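/- Let $\Lambda\subset J^1(\mathbb R)=\mathbb R^3_{x,y,z}$ (contact form $dz-y\,dx$) be an oriented Legendrian link in preferred plat position: all left cusps of its front lie over one value $x_L$ (at different heights), all right cusps over one value $x_R>x_L$ (at different heights), and the double points of the front are finitely many transverse crossings over distinct values of $x$ (so each strand of the front is a smooth graph over $(x_L,x_R)$). Let $\Lambda$ carry finitely many base points $*_\alpha$ (away from the crossings, possibly at cusps) and a Maslov potential $\mu$ on the strands with values in $\mathbb Z/2r$, $r\ge 0$, which is greater by $1$ on the upper than on the lower strand at each cusp, and such that two strands point in the same direction (left or right) if and only if their potentials agree mod 2. *The algebras.* Let $U\subset\mathbb R$ be open. The algebra $\mathcal A(U)$ is the unital noncommutative $\mathbb Z$-algebra generated by - the crossings $c$ over $U$, with $|c|=\mu(\mathrm{over})-\mu(\mathrm{under})$, where the overstrand is the one of lesser slope; - the right cusps over $U$, in degree $1$; - elements $t_\alpha^{\pm1}$ for the base points over $U$, in degree $0$; - for each $a\in[x_L,x_R)$ with $a\notin U$ and $(a,a+\varepsilon)\subset U$ for some $\varepsilon>0$, and all strands $i,j$ with $i$ above $j$ just to the right of $a$, an element $a_{ij}$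 ("pair of left endpoints") with $|a_{ij}|=\mu(i)-\mu(j)-1$; where the only relations are $t_\alpha t_\alpha^{-1}=t_\alpha^{-1}t_\alpha=1$. If $U$ is an interval this is the algebra of the bordered plat $\Lambda|_{J^1(U)}$. The differential satisfies $\partial(xy)=(\partial x)y+(-1)^{|x|}x\,\partial y$, $\partial t_\alpha=0$, and $$\partial a_{ij}=\sum_{l\text{ between } i\text{ and }j}(-1)^{|a_{il}|+1}a_{il}a_{lj},\qquad \partial c=\sum_u w(u),$$ with an additional term $1$ (or $t_\alpha^{\pm1}$ if there is a base point at the cusp, according to the orientation) if $c$ is a right cusp. Here $u$ runs over the embedded disks over $U$ with boundary on the front which start at $c$, have no other local maximum of $x$, end on the left at a left cusp or along the segment between two left endpoints $i,j$ of the component of $U$ in question, and otherwise have only convex corners, each filling the top or the bottom quadrant of a crossing. The word $w(u)$ is the product, along the boundary of $u$ traversed counterclockwise from $c$, of: $c'$ for a corner filling the top quadrant at a crossing $c'$, $(-1)^{|c'|+1}c'$ for one filling the bottom quadrant, $t_\alpha^{\pm1}$ for a base point (sign according to whether the boundary orientation agrees with the orientation of $\Lambda$), and $a_{ij}$ for the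 left end if that is the segment between $i$ and $j$. For $V\subset U$ let $\iota_{VU}:\mathcal A(V)\to\mathcal A(U)$ be the ring homomorphism which maps crossings, cusps and base points to themselves and a generator $b_{ij}$ for the left boundary point $a$ of (a component of) $V$ to the same generator if $a\notin U$, and to the sum of $w(u)$ over all disks $u$ over $U$ which extend to the left from the segment between $i$ and $j$ over $a$ if $a\in U$. *Copies.* The front projection $m$-copy $\Lambda^m$ consists of $m$ copies of $\Lambda$ shifted by small translations in the $z$-direction and numbered from top to bottom. Its algebras $\mathcal A^{(m)}(U)$, with differential and corestrictions, are defined by the same rules; the shifts are taken to be infinitesimally small, so that the $m^2$ crossings near a crossing of $\Lambda$ over $x$ and the $\binom m2$ crossings near a left or right cusp belong to $\mathcal A^{(m)}(U)$ if and only if $x\in U$, respectively $x_L\in U$ or $x_R\in U$. For a commutative ring $k$, the augmentation category $\mathcal Aug_+(\Lambda|_{J^1(U)},k)$ is the one defined by the sequence $(\mathcal A^{(m)}(U))_{m\ge1}$: its objects are the augmentations of $\mathcal A(U)$, that is, the DGA maps $\mathcal A(U)\to k$; $\mathrm{Hom}(\epsilon_1,\epsilon_2)$ is dual to the free $k$-module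 on the generators of $\mathcal A^{(2)}(U)$ whose upper end is on copy $1$ and whose lower end is on copy $2$, with degrees raised by $1$; and $m_n$, for objects $\epsilon_1,\dots,\epsilon_{n+1}$, is dual to the length $n$ part (on generators from copy $i$ to copy $i+1$, $1\le i\le n$) of the differential of $\mathcal A^{(n+1)}(U)$ twisted by the diagonal augmentation $(\epsilon_1,\dots,\epsilon_{n+1})$. The category $\mathcal Aug_+(\Lambda,k)$ is defined in the same way by the Chekanov–Eliashberg algebras of the $\Lambda^m$, which are generated by crossings, right cusps and base points of the whole front $\Lambda^m$. **Theorem.** 1. All $\mathcal A^{(m)}(U)$, in particular $\mathcal A(U)=\mathcal A^{(1)}(U)$, are DGAs: $\partial$ has degree $-1$ and $\partial^2=0$. The maps $\iota_{VU}$ are DGA maps, $\iota_{UU}=\mathrm{id}$, and $\iota_{VU}\iota_{WV}=\iota_{WU}$ for $W\subset V\subset U$. 2. $\underline{\mathcal A}(\Lambda):U\mapsto\mathcal A(U)$ is a cosheaf of DGAs over $\mathbb R$, and the underlying graded algebras already form a cosheaf of graded algebras. 3. It is constructible: there is a finite set $P\subset\mathbb R$ such that $\iota_{VU}$ is an isomorphism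 for all nonempty open intervals $V\subset U$ with $P\cap V=P\cap U$. 4. Its global sections $\mathcal A(\mathbb R)$ are isomorphic, as a DGA, to the Chekanov–Eliashberg DGA $\mathcal A(\Lambda)$. 5. All $\mathcal A(U)$ are semi-free, on the generators listed above, which are finite in number if $U$ is an interval. 6. For all open $L,R\subset\mathbb R$ with $V=L\cap R$ and $U=L\cup R$, in particular for overlapping intervals, the maps $\iota_{VL},\iota_{VR},\iota_{LU},\iota_{RU}$ form a pushout square in the category of DGAs. 7. For every commutative ring $k$, $U\mapsto\mathrm{Hom}_{\mathrm{DGA}}(\mathcal A(U),k)$ is a sheaf of sets on $\mathbb R$. 8. For every commutative ring $k$, $U\mapsto\mathcal Aug_+(\Lambda|_{J^1(U)},k)$ is a presheaf of $A_\infty$ categories with global sections $\mathcal Aug_+(\Lambda,k)$: all these are $A_\infty$ categories; the corestrictions of the $\mathcal A^{(m)}$ for all $m$ induce $A_\infty$ functors $\rho_{UV}:\mathcal Aug_+(\Lambda|_{J^1(U)},k)\to\mathcal Aug_+(\Lambda|_{J^1(V)},k)$ for $V\subset U$, which restrict augmentations on objects and satisfy $\rho_{UU}=\mathrm{id}$ and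 $\rho_{VW}\rho_{UV}=\rho_{UW}$; and for $U=\mathbb R$ the category is isomorphic to $\mathcal Aug_+(\Lambda,k)$ by mutually inverse $A_\infty$ functors. -/

import Mathlib

open CategoryTheory TopologicalSpace Topology
open scoped ContDiff

universe u v

noncomputable section

/-! ## Signs -/

/-- The parity `ℤ/2r → ℤ/2`, defined since the grading group has even order (`ℤ/0 = ℤ`). -/
def parity (r : ℕ) : ZMod (2 * r) →+* ZMod 2 := ZMod.castHom (dvd_mul_right 2 r) (ZMod 2)

/-- The sign `(-1)^d`. -/
def sgn {r : ℕ} (d : ZMod (2 * r)) : ℤ := if parity r d = 0 then 1 else -1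

/-! ## Differential graded algebras over `ℤ`, with a `ℤ/2r`-grading -/

/-- The ring `A` is graded by the subgroups `gr d`. -/
structure IsGradedRing {r : ℕ} {A : Type*} [Ring A] (gr : ZMod (2 * r) → AddSubgroup A) :
    Prop where
  internal : DirectSum.IsInternal gr
  one_mem : (1 : A) ∈ gr 0
  mul_mem : ∀ {i j : ZMod (2 * r)} {x y : A}, x ∈ gr i → y ∈ gr j → x * y ∈ gr (i + j)

/-- `A` with grading `gr` and differential `d` is a DGA: `d` has degree `-1`, is a derivation in
the graded sense, and squares to zero. -/
structure IsDGA {r : ℕ} {A : Type*} [Ring A] (gr : ZMod (2 * r) → AddSubgroup A) (d : A →+ A) :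
    Prop extends IsGradedRing gr where
  d_mem : ∀ {i : ZMod (2 * r)} {x : A}, x ∈ gr i → d x ∈ gr (i - 1)
  leibniz : ∀ {i : ZMod (2 * r)} {x : A} (y : A), x ∈ gr i →
    d (x * y) = d x * y + sgn i • (x * d y)
  d_d : ∀ x : A, d (d x) = 0

/-- A unital ring homomorphism preserving degrees. -/
def IsGradedHom {r : ℕ} {A B : Type*} [Ring A] [Ring B] (grA : ZMod (2 * r) → AddSubgroup A)
    (grB : ZMod (2 * r) → AddSubgroup B) (f : A →+* B) : Prop :=
  ∀ ⦃i : ZMod (2 * r)⦄ ⦃x : A⦄, x ∈ grA i → f x ∈ grB i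

/-- A DGA map: a unital ring homomorphism preserving degrees and commuting with differentials. -/
structure IsDGAHom {r : ℕ} {A B : Type*} [Ring A] [Ring B] (grA : ZMod (2 * r) → AddSubgroup A)
    (dA : A →+ A) (grB : ZMod (2 * r) → AddSubgroup B) (dB : B →+ B) (f : A →+* B) : Prop where
  graded : IsGradedHom grA grB f
  comm : ∀ x : A, f (dA x) = dB (f x)

/-- Bundled `ℤ/2r`-graded rings. -/
structure GrRing (r : ℕ) where
  carrier : Type
  [ring : Ring carrier]
  gr : ZMod (2 * r) → AddSubgroup carrier
  isGradedRing : IsGradedRing gr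

attribute [instance] GrRing.ring

/-- Bundled DGAs. -/
structure DGA (r : ℕ) where
  carrier : Type
  [ring : Ring carrier]
  gr : ZMod (2 * r) → AddSubgroup carrier
  d : carrier →+ carrier
  isDGA : IsDGA gr d

attribute [instance] DGA.ring

instance (r : ℕ) : Category (GrRing r) where
  Hom X Y := {f : X.carrier →+* Y.carrier // IsGradedHom X.gr Y.gr f}
  id X := ⟨RingHom.id _, fun _ _ h => h⟩
  comp f g := ⟨g.1.comp f.1, fun _ _ h => g.2 (f.2 h)⟩

instance (r : ℕ) : Category (DGA r) where
  Hom X Y := {f : X.carrier →+* Y.carrier // IsDGAHom X.gr X.d Y.gr Y.d f}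
  id X := ⟨RingHom.id _, ⟨fun _ _ h => h, fun _ => rfl⟩⟩
  comp f g := ⟨g.1.comp f.1, ⟨fun _ _ h => g.2.graded (f.2.graded h), fun x => by
    simp [f.2.comm, g.2.comm]⟩⟩

/-- The underlying graded ring of a DGA. -/
def DGA.toGrRing (r : ℕ) : DGA r ⥤ GrRing r where
  obj X := ⟨X.carrier, X.gr, X.isDGA.toIsGradedRing⟩
  map f := ⟨f.1, f.2.graded⟩

/-! ## Semi-free algebras -/

/-- Words in the letters `a ∈ R` and `t^{±1}`, `t ∈ T`. -/
abbrev SFMonoid (R T : Type) : Type := Monoid.Coprod (FreeMonoid R) (FreeGroup T)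

/-- The free noncommutative unital `ℤ`-algebra on generators `a ∈ R` and `t, t⁻¹` for `t ∈ T`,
with the relations `t t⁻¹ = t⁻¹ t = 1`. -/
abbrev SFAlg (R T : Type) : Type := MonoidAlgebra ℤ (SFMonoid R T)

namespace SFAlg

variable {R T : Type}

/-- The generator `a`. -/
def gen (a : R) : SFAlg R T := MonoidAlgebra.of ℤ _ (Monoid.Coprod.inl (FreeMonoid.of a))

/-- The invertible generator `t`. -/
def tgen (t : T) : (SFAlg R T)ˣ :=
  Units.map (MonoidAlgebra.of ℤ (SFMonoid R T))
    (Units.map (Monoid.Coprod.inr : FreeGroup T →* SFMonoid R T) (toUnits (FreeGroup.of t)))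

/-- The ring homomorphism with given values on the generators. -/
def lift {B : Type*} [Ring B] (f : R → B) (g : T → Bˣ) : SFAlg R T →+* B :=
  (MonoidAlgebra.lift ℤ B (SFMonoid R T)
    (Monoid.Coprod.lift (FreeMonoid.lift f) ((Units.coeHom B).comp (FreeGroup.lift g)))).toRingHom

/-- The degree of a word, when `a ∈ R` has degree `δ a` and the `t^{±1}` have degree `0`. -/
def wordDeg {N : ℕ} (δ : R → ZMod N) : SFMonoid R T →* Multiplicative (ZMod N) :=
  Monoid.Coprod.lift (FreeMonoid.lift fun a => Multiplicative.ofAdd (δ a)) 1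

/-- The homogeneous part of degree `d`: the `ℤ`-span of the words of degree `d`. -/
def grade {N : ℕ} (δ : R → ZMod N) (d : ZMod N) : AddSubgroup (SFAlg R T) :=
  AddSubgroup.closure
    {x | ∃ w : SFMonoid R T, wordDeg δ w = Multiplicative.ofAdd d ∧ x = MonoidAlgebra.of ℤ _ w}

/-- Auxiliary to `derivation`: the ring homomorphism `x ↦ !![(-1)^|x| x, ∂x; 0, x]`. The Leibniz
rule for `∂` says exactly that this map is multiplicative. -/
def derivationMatrix {r : ℕ} (δ : R → ZMod (2 * r)) (D : R → SFAlg R T) :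
    SFAlg R T →+* Matrix (Fin 2) (Fin 2) (SFAlg R T) :=
  lift (fun a => !![sgn (δ a) • gen a, D a; 0, gen a])
    (fun t => Units.map (Matrix.scalar (Fin 2) : SFAlg R T →+* _).toMonoidHom (tgen t))

/-- The extension of `∂ a = D a`, `∂ t = 0` to the whole algebra by the Leibniz rule
`∂(xy) = (∂x)y + (-1)^|x| x(∂y)`. -/
def derivation {r : ℕ} (δ : R → ZMod (2 * r)) (D : R → SFAlg R T) : SFAlg R T →+ SFAlg R T :=
  (Matrix.entryAddMonoidHom (SFAlg R T) 0 1).comp (derivationMatrix δ D).toAddMonoidHom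

end SFAlg

/-- `X` is semi-free with generating set `R ⊔ {t, t⁻¹ : t ∈ T}`: as an algebra it is freely
generated by these elements up to the relations `t t⁻¹ = t⁻¹ t = 1`, the generators are
homogeneous, and `|t| = 0`, `∂t = 0`. -/
def IsSemifreeOn {r : ℕ} (X : DGA r) (R T : Type) : Prop :=
  ∃ e : SFAlg R T ≃+* X.carrier,
    (∀ a, ∃ d, e (SFAlg.gen a) ∈ X.gr d) ∧
    (∀ t, e (SFAlg.tgen t : (SFAlg R T)ˣ).1 ∈ X.gr 0 ∧ X.d (e (SFAlg.tgen t).1) = 0)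

/-! ## Cosheaves on the line -/

/-- A precosheaf on `ℝ` is a cosheaf: for every object `E`, the presheaf `Hom(F(-), E)` is a sheaf
of sets. -/
def IsCosheaf {C : Type*} [Category C] (F : Opens ℝ ⥤ C) : Prop :=
  Presheaf.IsSheaf (Opens.grothendieckTopology ℝ) F.op

/-- A precosheaf on `ℝ` is constructible: for some finite set of points, the corestriction between
two nested intervals which contain the same ones of these points is an isomorphism. In particular
it is locally constant away from these points, and its sections over small intervals around a point
do not depend on the interval. -/
def IsConstructibleCosheaf {C : Type*} [Category C] (F : Opens ℝ ⥤ C) : Prop :=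
  ∃ P : Set ℝ, P.Finite ∧ ∀ (V U : Opens ℝ) (h : V ≤ U),
    _root_.IsConnected (V : Set ℝ) → _root_.IsConnected (U : Set ℝ) → P ∩ V = P ∩ U → IsIso (F.map (homOfLE h))

/-! ## `A∞` categories

An `A∞` category with operations `m_n`, of degree `2 - n`, is described through the maps `b_n` on
the shifted graded modules `Hom(X, Y)[1]`, which are related to `m_n` by `s ∘ m_n = b_n ∘ s^{⊗n}`.
The `A∞` relations for the `m_n` amount to the relation `b² = 0` for the coderivation `b` with
components `b_n`, and `A∞` functors amount to morphisms of differential graded coalgebras. An element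
of degree `d` has degree `d - 1` in the shifted module. -/

/-- Sequences of composable morphisms from `X` to `Y`. In `cons p f` the morphism `f` comes last; as
a tensor it is the leftmost factor, so that the sequence `f₁, …, fₙ` stands for `fₙ ⊗ … ⊗ f₁`. -/
inductive HomPath {Obj : Type u} (Hom : Obj → Obj → Type v) : Obj → Obj → Type (max u v)
  | nil (X : Obj) : HomPath Hom X X
  | cons {X Y Z : Obj} (p : HomPath Hom X Y) (f : Hom Y Z) : HomPath Hom X Z

namespace HomPath

variable {Obj : Type u} {Hom : Obj → Obj → Type v}

/-- Concatenation. -/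
def comp {X Y : Obj} (p : HomPath Hom X Y) : {Z : Obj} → HomPath Hom Y Z → HomPath Hom X Z
  | _, nil _ => p
  | _, cons q f => (p.comp q).cons f

/-- All ways of writing a sequence as a concatenation of two (possibly empty) sequences. -/
def splits {X : Obj} :
    {Z : Obj} → HomPath Hom X Z → List (Σ Y : Obj, HomPath Hom X Y × HomPath Hom Y Z)
  | _, nil _ => [⟨X, nil X, nil X⟩]
  | Z, cons p f => ⟨Z, p.cons f, nil Z⟩ :: p.splits.map fun c => ⟨c.1, c.2.1, c.2.2.cons f⟩

/-- The number of morphisms. -/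
def length {X : Obj} : {Y : Obj} → HomPath Hom X Y → ℕ
  | _, nil _ => 0
  | _, cons p _ => p.length + 1

/-- The objects `X₀, …, Xₙ` along a sequence of morphisms. -/
def objs {X : Obj} : {Y : Obj} → (p : HomPath Hom X Y) → Fin (p.length + 1) → Obj
  | _, nil _ => fun _ => X
  | Z, cons p _ => Fin.snoc (α := fun _ => Obj) p.objs Z

/-- The morphisms of a sequence, if all morphism sets are the same set `M`. -/
def homs {M : Type v} {X : Obj} :
    {Y : Obj} → (p : HomPath (fun _ _ : Obj => M) X Y) → Fin p.length → M
  | _, nil _ => Fin.elim0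
  | _, cons p f => Fin.snoc (α := fun _ => M) p.homs f

end HomPath

/-- The data of an `A∞` category over `k` with `ℤ/2r`-graded morphisms: `gr X Y d` is the submodule
of morphisms of degree `d`, and `b` is the collection of all the maps `b_n`, `n ≥ 1`. -/
structure AInfData (k : Type u) [CommRing k] (r : ℕ) where
  Obj : Type u
  Hom : Obj → Obj → Type u
  [addCommGroup : ∀ X Y, AddCommGroup (Hom X Y)]
  [module : ∀ X Y, Module k (Hom X Y)]
  gr : ∀ X Y, ZMod (2 * r) → Submodule k (Hom X Y)
  b : ∀ {X Y}, HomPath Hom X Y → Hom X Y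

namespace AInfData

attribute [instance] AInfData.addCommGroup AInfData.module

variable {k : Type u} [CommRing k] {r : ℕ} (C D E : AInfData k r)

/-- Sequences of composable homogeneous morphisms. -/
abbrev HPath : C.Obj → C.Obj → Type u := HomPath fun X Y => Σ d, C.gr X Y d

variable {C} in
/-- The underlying sequence of morphisms. -/
def HPath.forget {X : C.Obj} : {Y : C.Obj} → C.HPath X Y → HomPath C.Hom X Y
  | _, .nil _ => .nil X
  | _, .cons p f => .cons (HPath.forget p) f.2.1

variable {C} in
/-- The degree of a sequence as a tensor in the shifted modules. -/
def HPath.deg {X : C.Obj} : {Y : C.Obj} → C.HPath X Y → ZMod (2 * r)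
  | _, .nil _ => 0
  | _, .cons p f => HPath.deg p + (f.1 - 1)

variable {C} in
/-- For a map `G` on sequences of morphisms, the sum of the terms
`± G(f_n, …, b(f_j, …, f_{i+1}), …, f_1)`, where the Koszul sign is that of moving `b`, of degree
`1`, past the factors on its left. -/
def insertSum {M : Type*} [AddCommGroup M] {X Y : C.Obj} (G : HomPath C.Hom X Y → M)
    (p : C.HPath X Y) : M :=
  (p.splits.map fun c => (c.2.2.splits.map fun c' =>
    sgn (HPath.deg c'.2.2) •
      G ((HomPath.cons (HPath.forget c.2.1) (C.b (HPath.forget c'.2.1))).comp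
        (HPath.forget c'.2.2))).sum).sum

/-- The laws of an `A∞` category. -/
structure IsAInfCat : Prop where
  internal : ∀ X Y, DirectSum.IsInternal (C.gr X Y)
  b_nil : ∀ X, C.b (.nil X) = 0
  b_add : ∀ {X Y Z W} (p : HomPath C.Hom X Y) (f g : C.Hom Y Z) (q : HomPath C.Hom Z W),
    C.b ((p.cons (f + g)).comp q) = C.b ((p.cons f).comp q) + C.b ((p.cons g).comp q)
  b_smul : ∀ {X Y Z W} (p : HomPath C.Hom X Y) (a : k) (f : C.Hom Y Z) (q : HomPath C.Hom Z W),
    C.b ((p.cons (a • f)).comp q) = a • C.b ((p.cons f).comp q)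
  /-- `b` has degree `1` on the shifted modules -/
  b_mem : ∀ {X Y} (p : C.HPath X Y), C.b p.forget ∈ C.gr X Y (p.deg + 1 + 1)
  /-- `b² = 0` -/
  b_b : ∀ {X Y} (p : C.HPath X Y), insertSum C.b p = 0

/-- The data of an `A∞` functor: the map on objects and the collection of the maps
`F_n : Hom(X_{n-1}, X_n)[1] ⊗ … ⊗ Hom(X_0, X_1)[1] → Hom(F X_0, F X_n)[1]`, `n ≥ 1`. -/
structure Fun where
  obj : C.Obj → D.Obj
  map : ∀ {X Y}, HomPath C.Hom X Y → D.Hom (obj X) (obj Y)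

namespace Fun

variable {C D E}

/-- Auxiliary to `pieces`: the sequences `(F p₁, …, F p_s)` for all decompositions of the
concatenation of `p` and `q` into nonempty sequences `p₁, …, p_s` such that `p_s` ends with the
nonempty sequence `q`. -/
def blocks (F : Fun C D) {X : C.Obj} : {Y Z : C.Obj} → HomPath C.Hom X Y → HomPath C.Hom Y Z →
    List (HomPath D.Hom (F.obj X) (F.obj Z))
  | _, _, .nil _, q => [.cons (.nil _) (F.map q)]
  | _, _, .cons p f, q => F.blocks p ((HomPath.cons (.nil _) f).comp q) ++
      (F.blocks p (.cons (.nil _) f)).map fun w => w.cons (F.map q)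

/-- The sequences `(F p₁, …, F p_s)` for all decompositions of a sequence into nonempty sequences
`p₁, …, p_s`: the image of a tensor under the coalgebra morphism given by `F`. -/
def pieces (F : Fun C D) {X : C.Obj} :
    {Y : C.Obj} → HomPath C.Hom X Y → List (HomPath D.Hom (F.obj X) (F.obj Y))
  | _, .nil _ => [.nil _]
  | _, .cons p f => F.blocks p (.cons (.nil _) f)

/-- The laws of an `A∞` functor. -/
structure IsAInfFunctor (F : Fun C D) : Prop where
  map_nil : ∀ X, F.map (.nil X) = 0
  map_add : ∀ {X Y Z W} (p : HomPath C.Hom X Y) (f g : C.Hom Y Z) (q : HomPath C.Hom Z W),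
    F.map ((p.cons (f + g)).comp q) = F.map ((p.cons f).comp q) + F.map ((p.cons g).comp q)
  map_smul : ∀ {X Y Z W} (p : HomPath C.Hom X Y) (a : k) (f : C.Hom Y Z)
    (q : HomPath C.Hom Z W), F.map ((p.cons (a • f)).comp q) = a • F.map ((p.cons f).comp q)
  /-- `F` has degree `0` on the shifted modules -/
  map_mem : ∀ {X Y} (p : C.HPath X Y), F.map p.forget ∈ D.gr (F.obj X) (F.obj Y) (p.deg + 1)
  /-- `F` commutes with the codifferentials -/
  map_b : ∀ {X Y} (p : C.HPath X Y), ((F.pieces p.forget).map D.b).sum = insertSum F.map p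

/-- The identity functor. -/
protected def id (C : AInfData k r) : Fun C C where
  obj X := X
  map p := match p with
    | .cons (.nil _) f => f
    | _ => 0

/-- The composition of `A∞` functors, first `F` and then `G`. -/
def comp (F : Fun C D) (G : Fun D E) : Fun C E where
  obj X := G.obj (F.obj X)
  map p := ((F.pieces p).map G.map).sum

end Fun

end AInfData

/-! ## Augmentations and the augmentation category -/

/-- A `k`-augmentation of a DGA: a DGA map to `k`, where `k` has zero grading and differential. -/
def Aug {r : ℕ} {A : Type} [Ring A] (gr : ZMod (2 * r) → AddSubgroup A) (d : A →+ A) (k : Type u)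
    [CommRing k] : Type u :=
  {ε : A →+* k // (∀ i ≠ 0, ∀ x ∈ gr i, ε x = 0) ∧ ∀ x, ε (d x) = 0}

/-- Pullback of augmentations along a DGA map. -/
def Aug.pullback {r : ℕ} {A B : Type} [Ring A] [Ring B] {grA : ZMod (2 * r) → AddSubgroup A}
    {dA : A →+ A} {grB : ZMod (2 * r) → AddSubgroup B} {dB : B →+ B} {k : Type u} [CommRing k]
    {f : A →+* B} (hf : IsDGAHom grA dA grB dB f) (ε : Aug grB dB k) : Aug grA dA k :=
  ⟨ε.1.comp f, fun i hi x hx => ε.2.1 i hi _ (hf.graded hx), fun x => by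
    rw [RingHom.comp_apply, hf.comm, ε.2.2]⟩

/-- The presheaf `U ↦ Hom(F(U), k)` of augmentations of a precosheaf of DGAs. -/
def augPresheaf {r : ℕ} (F : Opens ℝ ⥤ DGA r) (k : Type u) [CommRing k] :
    (Opens ℝ)ᵒᵖ ⥤ Type u where
  obj U := Aug (F.obj U.unop).gr (F.obj U.unop).d k
  map f := ↾ (Aug.pullback (F.map f.unop).2)
  map_id U := by
    ext ε
    apply Subtype.ext
    change ε.1.comp (F.map (𝟙 U.unop)).1 = ε.1
    rw [F.map_id]
    rfl
  map_comp f g := by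
    ext ε
    apply Subtype.ext
    change ε.1.comp (F.map (g.unop ≫ f.unop)).1 = (ε.1.comp (F.map f.unop).1).comp (F.map g.unop).1
    rw [F.map_comp]
    rfl

/-- The data of a sequence of semi-free DGAs `A⁽¹⁾, A⁽²⁾, …` as needed for its augmentation
category: generators `R m` with degrees, invertible generators `T m`, differentials, a link grading
`R m → {0, …, m - 1}²` (also called rows and columns), and maps of generators for all order-preserving
inclusions. -/
structure DGASeq (r : ℕ) where
  R : ℕ → Type
  T : ℕ → Type
  deg : ∀ {m}, R m → ZMod (2 * r)
  diffGen : ∀ {m}, R m → SFAlg (R m) (T m)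
  row : ∀ {m}, R m → Fin m
  col : ∀ {m}, R m → Fin m
  mapR : ∀ {m n}, (Fin m ↪o Fin n) → R m → R n
  mapT : ∀ {m n}, (Fin m ↪o Fin n) → T m → T n

/-- The inclusion of `{i}`. -/
def oneEmb {m : ℕ} (i : Fin m) : Fin 1 ↪o Fin m :=
  OrderEmbedding.ofStrictMono (fun _ => i) (Subsingleton.strictMono _)

/-- The inclusion of `{i, j}`, where `i < j`. -/
def twoEmb {m : ℕ} {i j : Fin m} (h : i < j) : Fin 2 ↪o Fin m :=
  OrderEmbedding.ofStrictMono ![i, j] fun a b hab => by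
    fin_cases a <;> fin_cases b <;> simp_all

namespace DGASeq

open Classical

variable {r : ℕ} (S S' : DGASeq r)

/-- The differential. -/
def diff (m : ℕ) : SFAlg (S.R m) (S.T m) →+ SFAlg (S.R m) (S.T m) :=
  SFAlg.derivation S.deg S.diffGen

/-- The augmentations of `A⁽¹⁾`. -/
abbrev AugObj (k : Type u) [CommRing k] : Type u :=
  Aug (SFAlg.grade (T := S.T 1) (S.deg (m := 1))) (S.diff 1) k

/-- The generators in row `0` and column `1` of `A⁽²⁾`. -/
abbrev Mixed : Type := {a : S.R 2 // S.row a = 0 ∧ S.col a = 1}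

/-- The copy in row `i` and column `j` of such a generator. -/
def embed {m : ℕ} {i j : Fin m} (h : i < j) (a : S.Mixed) : S.R m := S.mapR (twoEmb h) a.1

variable {k : Type u} [CommRing k]

section

variable {S}

/-- The value on a generator in `R m` of the diagonal augmentation given by augmentations
`ε_0, …, ε_{m-1}` of `A⁽¹⁾`: it is `ε_i` on the `i`-th copy of the generators of `A⁽¹⁾`, and zero on
all other generators. -/
def diagR {m : ℕ} (ε : Fin m → S.AugObj k) (a : S.R m) : k :=
  ∑ i, Function.extend (S.mapR (oneEmb i)) (fun a' => (ε i).1 (SFAlg.gen a')) 0 a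

/-- The value of the diagonal augmentation on an invertible generator. -/
def diagT {m : ℕ} (ε : Fin m → S.AugObj k) (t : S.T m) : kˣ :=
  ∏ i, Function.extend (S.mapT (oneEmb i))
    (fun t' => Units.map (ε i).1.toMonoidHom (SFAlg.tgen t')) 1 t

/-- The homomorphism `A → A^ε = (A ⊗ k)/(t = ε(t)) → A^ε`, whose second map is `φ_ε`, given by
`a ↦ a + ε(a)`, for the diagonal augmentation `ε`. Here `A^ε` is the free `k`-algebra on the
generators in `R m`. -/
def twist {m : ℕ} (ε : Fin m → S.AugObj k) :
    SFAlg (S.R m) (S.T m) →+* MonoidAlgebra k (FreeMonoid (S.R m)) :=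
  SFAlg.lift
    (fun a => MonoidAlgebra.of k _ (FreeMonoid.of a) + algebraMap k _ (diagR ε a))
    (fun t => Units.map (algebraMap k (MonoidAlgebra k (FreeMonoid (S.R m)))).toMonoidHom
      (diagT ε t))

/-- The sign `(-1)^{∑_{p<q} |a_p||a_q|}` of a word `a_1 ⋯ a_n`. -/
def wordSign {m : ℕ} : List (S.R m) → ℤ
  | [] => 1
  | a :: w => sgn (S.deg a * (w.map S.deg).sum) * wordSign w

/-- The pairing of `f_n ⊗ … ⊗ f_1` with a word `a_1 ⋯ a_n`. It is zero unless `a_i` is in row `i - 1`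
and column `i` for all `i` (rows and columns being counted from `0`), and is then the product of the
values of `f_i` at `a_i` up to the sign above. -/
def pairWord {n : ℕ} (f : Fin n → S.Mixed → k) (w : List (S.R (n + 1))) : k :=
  if h : w.length = n then
    (wordSign w : k) * ∏ i : Fin n,
      Function.extend (S.embed (Fin.castSucc_lt_succ (i := i))) (f i) 0 (w.get (i.cast h.symm))
  else 0

/-- The linear extension of this pairing to the free algebra. -/
def pairAlg {n : ℕ} (f : Fin n → S.Mixed → k) (y : MonoidAlgebra k (FreeMonoid (S.R (n + 1)))) :
    k :=
  y.coeff.sum fun w c => c * pairWord f w.toList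

/-- The operation dual to a map `G : R' (n + 1) → A⁽ⁿ⁺¹⁾`: for a sequence `f_1, …, f_n` of morphisms
between augmentations `ε_0, …, ε_n`, its value on the generator `a` is the pairing of
`f_n ⊗ … ⊗ f_1` with `G` of the copy of `a` in row `0` and column `n`, twisted by
`(ε_0, …, ε_n)`. -/
def dualOp {S' : DGASeq r} (G : ∀ {m}, S'.R m → SFAlg (S.R m) (S.T m)) {X Y : S.AugObj k}
    (p : HomPath (fun _ _ : S.AugObj k => S.Mixed → k) X Y) (a : S'.Mixed) : k :=
  if h : 0 < Fin.last p.length then pairAlg p.homs (twist p.objs (G (S'.embed h a))) else 0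

end

/-- The augmentation category: its objects are the augmentations of `A⁽¹⁾`, the morphisms from `ε_1`
to `ε_2` form the dual of the free module on the generators in row `0` and column `1` of `A⁽²⁾`, with
the degree raised by `1`, and the operations are dual to the twisted differentials. -/
def augPlus (k : Type u) [CommRing k] : AInfData k r where
  Obj := S.AugObj k
  Hom _ _ := S.Mixed → k
  gr _ _ d :=
    { carrier := {f | ∀ a, f a ≠ 0 → S.deg a.1 + 1 = d}
      add_mem' := fun {f g} hf hg a ha => by
        by_cases h : f a = 0
        · exact hg a fun h' => ha (by simp [h, h'])
        · exact hf a h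
      zero_mem' := fun a ha => absurd rfl ha
      smul_mem' := fun c f hf a ha => hf a fun h => ha (by simp [h]) }
  b p := dualOp S.diffGen p

variable {S S'} in
/-- The functor from the augmentation category of `S` to that of `S'` which is induced by a sequence
of homomorphisms from the algebras of `S'` to those of `S`, the first of which is a DGA map. -/
def augPlusMap (k : Type u) [CommRing k]
    (f : ∀ m, SFAlg (S'.R m) (S'.T m) →+* SFAlg (S.R m) (S.T m))
    (hf : IsDGAHom (SFAlg.grade S'.deg) (S'.diff 1) (SFAlg.grade S.deg) (S.diff 1) (f 1)) :
    AInfData.Fun (S.augPlus k) (S'.augPlus k) where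
  obj ε := Aug.pullback hf ε
  map p := dualOp (fun {m} a => f m (SFAlg.gen a)) p

end DGASeq

/-! ## Legendrian links in preferred plat position -/

/-- The Legendrian lift to `J¹(ℝ) = ℝ³` (coordinates `x, y, z`, contact form `dz - y dx`) of the
point of the graph `z = f x` over `x`. -/
def jet (f : ℝ → ℝ) (x : ℝ) : ℝ × ℝ × ℝ := (x, deriv f x, f x)

/-- The Legendrian lifts of the graphs of `f` and `g` over `I` form, together with the point
`(c, 0, z)`, a smoothly embedded arc near that point, so that the two graphs form a horizontal cusp
of the front at `(c, z)`. -/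
def IsHorizontalCusp (f g : ℝ → ℝ) (I : Set ℝ) (c z : ℝ) : Prop :=
  ∃ ε > 0, ∃ γ : ℝ → ℝ × ℝ × ℝ, ContDiffOn ℝ ∞ γ (Set.Ioo (-ε) ε) ∧
    (∀ t ∈ Set.Ioo (-ε) ε, deriv γ t ≠ 0) ∧ γ 0 = (c, 0, z) ∧
    (∀ t ∈ Set.Ioo 0 ε, (γ t).1 ∈ I ∧ γ t = jet f (γ t).1) ∧
    (∀ t ∈ Set.Ioo (-ε) 0, (γ t).1 ∈ I ∧ γ t = jet g (γ t).1)

/-- The crossings of the front formed by the graphs of the functions `s i` over `I`: triples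
`(o, u, x)` such that the strands `o` and `u` meet over `x` and `o` has the lesser slope there (`o`
is the overstrand; it is the upper strand on the left of the crossing). -/
def crossingSet {S : Type} (s : S → ℝ → ℝ) (I : Set ℝ) : Set (S × S × ℝ) :=
  {c | c.2.2 ∈ I ∧ s c.1 c.2.2 = s c.2.1 c.2.2 ∧ deriv (s c.1) c.2.2 < deriv (s c.2.1) c.2.2}

/-- A Legendrian link `Λ ⊂ J¹(ℝ)` in preferred plat position, with an orientation, a
`ℤ/2r`-valued Maslov potential and base points. All left cusps of the front lie over `xL` and all
right cusps over `xR`, so each strand is the graph of a smooth function over the interval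
`(xL, xR)`; the strands are labelled `(k, true)` and `(k, false)`, the upper and lower strand at the
`k`-th left cusp. -/
structure PreferredPlat (r : ℕ) (Λ : Set (ℝ × ℝ × ℝ)) where
  /-- the number of left cusps, which is also the number of right cusps -/
  n : ℕ
  xL : ℝ
  xR : ℝ
  xL_lt_xR : xL < xR
  /-- the strands of the front, as functions of `x ∈ (xL, xR)` -/
  s : Fin n × Bool → ℝ → ℝ
  smooth : ∀ i, ContDiffOn ℝ ∞ (s i) (Set.Ioo xL xR)
  /-- heights of the left and right cusps -/
  zL : Fin n → ℝ
  zR : Fin n → ℝ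
  zL_injective : Function.Injective zL
  zR_injective : Function.Injective zR
  /-- upper and lower strand at the right cusps -/
  rup : Fin n → Fin n × Bool
  rlow : Fin n → Fin n × Bool
  bijective_right : Function.Bijective (Sum.elim rup rlow)
  left_cusp : ∀ k, IsHorizontalCusp (s (k, true)) (s (k, false)) (Set.Ioo xL xR) xL (zL k)
  right_cusp : ∀ k, IsHorizontalCusp (s (rup k)) (s (rlow k)) (Set.Ioo xL xR) xR (zR k)
  left_lt : ∀ k, ∀ᶠ x in 𝓝[>] xL, s (k, false) x < s (k, true) x
  right_lt : ∀ k, ∀ᶠ x in 𝓝[<] xR, s (rlow k) x < s (rup k) x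
  /-- the link consists of the Legendrian lifts of the strands and the cusp points -/
  link_eq : Λ = {p | ∃ i, p.1 ∈ Set.Ioo xL xR ∧ p = jet (s i) p.1} ∪
    Set.range (fun k => (xL, 0, zL k)) ∪ Set.range (fun k => (xR, 0, zR k))
  /-- all double points of the front are transverse -/
  transverse : ∀ i j, i ≠ j → ∀ x ∈ Set.Ioo xL xR, s i x = s j x → deriv (s i) x ≠ deriv (s j) x
  finite_crossings : (crossingSet s (Set.Ioo xL xR)).Finite
  /-- different crossings lie over different values of `x` -/
  distinct_crossings : Set.InjOn (fun c => c.2.2) (crossingSet s (Set.Ioo xL xR))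
  /-- the Maslov potential -/
  μ : Fin n × Bool → ZMod (2 * r)
  μ_left : ∀ k, μ (k, true) = μ (k, false) + 1
  μ_right : ∀ k, μ (rup k) = μ (rlow k) + 1
  /-- the orientation: whether a strand is oriented from left to right -/
  toRight : Fin n × Bool → Prop
  toRight_iff : ∀ i j, (toRight i ↔ toRight j) ↔ parity r (μ i) = parity r (μ j)
  /-- base points in the interior of strands, given by the strand and the value of `x` -/
  base : Finset ((Fin n × Bool) × ℝ)
  base_mem : ∀ b ∈ base, b.2 ∈ Set.Ioo xL xR
  base_not_double : ∀ b ∈ base, ∀ j, j ≠ b.1 → s j b.2 ≠ s b.1 b.2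
  /-- left cusps and right cusps at which there is a base point -/
  baseL : Finset (Fin n)
  baseR : Finset (Fin n)

namespace PreferredPlat

open Classical SFAlg

variable {r : ℕ} {Λ : Set (ℝ × ℝ × ℝ)} (P : PreferredPlat r Λ)

/-! ## The front projection `m`-copy

The `m`-copy `Λ^m` consists of `m` copies of `Λ`, numbered `0, …, m - 1` from top to bottom and
shifted from each other by infinitesimally small translations in the `z`-direction; the `1`-copy is
`Λ` itself. As the translations are infinitesimal, near a crossing of `Λ` over `x` there are `m²`
crossings of `Λ^m` lying over (infinitesimally close to) `x`, and near each left or right cusp there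
are `m(m-1)/2` of them. -/

/-- Strands of the `m`-copy. -/
abbrev Strand (m : ℕ) : Type := (Fin P.n × Bool) × Fin m

/-- Crossings of `Λ`. -/
abbrev Dbl : Type := crossingSet P.s (Set.Ioo P.xL P.xR)

/-- Crossings of the `m`-copy. -/
inductive Cross (m : ℕ) : Type
  /-- near a crossing of `Λ`, copy `i` of its overstrand with copy `j` of its understrand -/
  | dbl (c : P.Dbl) (i j : Fin m) : Cross m
  /-- near a left cusp, the lower strand of copy `i` with the upper strand of copy `j`, for
  `i < j` -/
  | left (k : Fin P.n) (i j : Fin m) (h : i < j) : Cross m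
  /-- near a right cusp, the lower strand of copy `i` with the upper strand of copy `j`, for
  `i < j` -/
  | right (k : Fin P.n) (i j : Fin m) (h : i < j) : Cross m

variable {m : ℕ}

namespace Cross

variable {P}

/-- The overstrand at a crossing, which is the upper strand on its left. -/
def overStrand : P.Cross m → P.Strand m
  | dbl c i _ => (c.1.1, i)
  | left k i _ _ => ((k, false), i)
  | right k _ j _ => (P.rup k, j)

/-- The understrand at a crossing, which is the lower strand on its left. -/
def underStrand : P.Cross m → P.Strand m
  | dbl c _ j => (c.1.2.1, j)
  | left k _ j _ => ((k, true), j)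
  | right k i _ _ => (P.rlow k, i)

/-- The value of `x` at a crossing. -/
def x : P.Cross m → ℝ
  | dbl c _ _ => c.1.2.2
  | left _ _ _ _ => P.xL
  | right _ _ _ _ => P.xR

/-- The degree of a crossing. -/
def deg (c : P.Cross m) : ZMod (2 * r) := P.μ c.overStrand.1 - P.μ c.underStrand.1

end Cross

/-- Base points of `Λ`: in the interior of strands, at left cusps, at right cusps. -/
abbrev Base₀ : Type := P.base ⊕ P.baseL ⊕ P.baseR

/-- Base points of the `m`-copy. -/
abbrev Base (m : ℕ) : Type := P.Base₀ × Fin m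

/-- The value of `x` at a base point. -/
def Base.x {P : PreferredPlat r Λ} (b : P.Base m) : ℝ :=
  match b.1 with
  | .inl b => b.1.2
  | .inr (.inl _) => P.xL
  | .inr (.inr _) => P.xR

/-- What a vertical line moving across the front meets: crossings, and base points in the interior
of strands. -/
abbrev Event (m : ℕ) : Type := P.Cross m ⊕ (P.base × Fin m)

/-- The crossings near a crossing of `Λ`, from left to right. -/
def dblList (m : ℕ) (c : P.Dbl) : List (P.Cross m) :=
  (List.finRange m).flatMap fun j => (List.finRange m).reverse.map fun i => .dbl c i j

/-- The crossings near a left cusp, from left to right. -/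
def leftList (m : ℕ) (k : Fin P.n) : List (P.Cross m) :=
  (List.finRange m).flatMap fun j => (List.finRange m).reverse.filterMap fun i =>
    if h : i < j then some (.left k i j h) else none

/-- The crossings near a right cusp, from left to right. -/
def rightList (m : ℕ) (k : Fin P.n) : List (P.Cross m) :=
  (List.finRange m).reverse.flatMap fun j => (List.finRange m).filterMap fun i =>
    if h : i < j then some (.right k i j h) else none

instance : Fintype P.Dbl := P.finite_crossings.fintype

/-- The events over (infinitesimally close to) `x`, from left to right. Over a given `x` there is at
most one crossing of `Λ`; events with disjoint strands may be listed in any order. -/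
def eventsAt (m : ℕ) (x : ℝ) : List (P.Event m) :=
  ((if x = P.xL then (List.finRange P.n).flatMap (P.leftList m) else []) ++
    ((Finset.univ.filter fun c : P.Dbl => c.1.2.2 = x).toList.flatMap (P.dblList m)) ++
    (if x = P.xR then (List.finRange P.n).flatMap (P.rightList m) else [])).map Sum.inl ++
  ((Finset.univ.filter fun b : P.base × Fin m => b.1.1.2 = x).toList.map Sum.inr)

/-- The values of `x` over which there are crossings, cusps or base points. -/
def positions : Finset ℝ :=
  Finset.univ.image (fun c : P.Dbl => c.1.2.2) ∪ P.base.image Prod.snd ∪ {P.xL, P.xR}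

/-- The events met when moving from `x` to the left as long as one stays in `U`, in the order in
which they are met (those over `x` included). -/
def sweep (m : ℕ) (U : Set ℝ) (x : ℝ) : List (P.Event m) :=
  ((P.positions.filter fun y => y ≤ x ∧ Set.Icc y x ⊆ U).sort (· ≥ ·)).flatMap
    fun y => (P.eventsAt m y).reverse

/-- Just to the right of `a`, the strand `i` of the `m`-copy lies above the strand `j`. -/
def Above (a : ℝ) (i j : P.Strand m) : Prop :=
  (i.1 ≠ j.1 ∧ ∀ᶠ x in 𝓝[>] a, P.s j.1 x < P.s i.1 x) ∨ (i.1 = j.1 ∧ i.2 < j.2)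

/-! ## Disks

A disk `u` whose `x`-coordinate has a unique local maximum at its right end and local minima only
at its left end is determined by the strands which carry its upper and lower boundary over each of
the intervals between consecutive events. Moving to the left past a crossing, the boundary continues
on the same strand or, if the disk then has a convex corner there, changes to the other strand. The
disk occupies the bottom quadrant at a corner on its upper boundary, and the top quadrant at a corner
on its lower boundary. -/

/-- The strands `p` carrying the upper and lower boundary on the right of an event may be followed
by the strands `q` on its left. (If the upper and lower boundary are the two strands of a crossing,
then there is no continuation.) -/
def Step (e : P.Event m) (p q : P.Strand m × P.Strand m) : Prop :=
  match e with
  | .inl c => ¬ (p.1 = c.underStrand ∧ p.2 = c.overStrand) ∧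
      (q = p ∨ (p.1 = c.overStrand ∧ q = (c.underStrand, p.2)) ∨ (p.2 = c.underStrand ∧ q = (p.1, c.overStrand)))
  | .inr _ => q = p

/-- A disk: the sequence of pairs of strands carrying the upper and lower boundary, from right to
left, where `L` is the list of events from right to left and `p` the pair of strands at the right
end. -/
structure Disk (L : List (P.Event m)) (p : P.Strand m × P.Strand m) : Type where
  slice : Fin (L.length + 1) → P.Strand m × P.Strand m
  start : slice 0 = p
  step : ∀ k : Fin L.length, P.Step (L.get k) (slice k.castSucc) (slice k.succ)

instance (L : List (P.Event m)) (p : P.Strand m × P.Strand m) : Fintype (P.Disk L p) :=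
  Fintype.ofInjective Disk.slice fun a b h => by cases a; cases b; congr

section Words

variable {P} {A : Type*} [Ring A] (x : P.Cross m → A) (t : P.Base m → Aˣ)

/-- `t` or `t⁻¹`, depending on whether the boundary orientation of the disk, which is given by `dir`,
agrees with the orientation of the link. -/
def signedBase (b : P.Base m) (agrees : Prop) : A := if agrees then (t b).1 else (t b)⁻¹.1

/-- The factor of an event on the upper boundary, which is traversed to the left. -/
def upperFactor (e : P.Event m) (p q : P.Strand m × P.Strand m) : A :=
  match e with
  | .inl c => if q.1 = p.1 then 1 else sgn (c.deg + 1) • x c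
  | .inr b => if p.1 = (b.1.1.1, b.2) then signedBase t (.inl b.1, b.2) (¬ P.toRight p.1.1) else 1

/-- The factor of an event on the lower boundary, which is traversed to the right. -/
def lowerFactor (e : P.Event m) (p q : P.Strand m × P.Strand m) : A :=
  match e with
  | .inl c => if q.2 = p.2 then 1 else x c
  | .inr b => if p.2 = (b.1.1.1, b.2) then signedBase t (.inl b.1, b.2) (P.toRight p.2.1) else 1

/-- The product `w(u)` of the terms along the boundary of a disk, counterclockwise from its right
end, where `e` gives the factor of the left end. -/
def Disk.word (e : P.Strand m × P.Strand m → A) {L : List (P.Event m)}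
    {p : P.Strand m × P.Strand m} (u : P.Disk L p) : A :=
  (List.ofFn fun k : Fin L.length =>
      upperFactor x t (L.get k) (u.slice k.castSucc) (u.slice k.succ)).prod *
    e (u.slice (Fin.last _)) *
    (List.ofFn fun k : Fin L.length =>
      lowerFactor x t (L.get k) (u.slice k.castSucc) (u.slice k.succ)).reverse.prod

/-- The sum of `w(u)` over all disks `u` with the right end `p`. -/
def diskSum (e : P.Strand m × P.Strand m → A) (L : List (P.Event m))
    (p : P.Strand m × P.Strand m) : A :=
  ∑ u : P.Disk L p, u.word x t e

/-- The factor of the left end of a disk ending over `xL`: it has to end at a left cusp (otherwise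
it does not count), where it may meet a base point. -/
def cuspEnd (p : P.Strand m × P.Strand m) : A :=
  let k := p.1.1.1
  let i := p.1.2
  if p = (((k, true), i), ((k, false), i)) then
    if h : k ∈ P.baseL then signedBase t (.inr (.inl ⟨k, h⟩), i) (¬ P.toRight (k, true)) else 1
  else 0

/-- The contribution `1` or `t^{±1}` of the invisible disk at a right cusp. -/
def invisible (k : Fin P.n) (i : Fin m) : A :=
  if h : k ∈ P.baseR then signedBase t (.inr (.inr ⟨k, h⟩), i) (P.toRight (P.rup k)) else 1

end Words

/-! ## The Chekanov–Eliashberg DGA of the front -/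

/-- Generators of the Chekanov–Eliashberg algebra: crossings and right cusps. -/
abbrev CEGen (m : ℕ) : Type := P.Cross m ⊕ (Fin P.n × Fin m)

/-- Degrees: `μ(over) - μ(under)` for crossings, `1` for right cusps. -/
def ceDeg : P.CEGen m → ZMod (2 * r)
  | .inl c => c.deg
  | .inr _ => 1

/-- The sum of `w(u)` over the disks `u` in the whole front. -/
def ceDiskSum (L : List (P.Event m)) (p : P.Strand m × P.Strand m) : SFAlg (P.CEGen m) (P.Base m) :=
  diskSum (fun c => gen (.inl c)) tgen (cuspEnd tgen) L p

/-- The events strictly on the left of a crossing `c`, if `L` is a list of events from right to left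
which contains `c`. -/
def after (c : P.Cross m) (L : List (P.Event m)) : List (P.Event m) :=
  (L.dropWhile fun e => decide (e ≠ .inl c)).tail

/-- The differential of the generators. -/
def ceDiffGen : P.CEGen m → SFAlg (P.CEGen m) (P.Base m)
  | .inl c => P.ceDiskSum (P.after c (P.sweep m Set.univ c.x)) (c.overStrand, c.underStrand)
  | .inr (k, i) => invisible tgen k i +
      P.ceDiskSum (P.sweep m Set.univ P.xR) ((P.rup k, i), (P.rlow k, i))

/-- The grading of the Chekanov–Eliashberg algebra. -/
def ceGr (m : ℕ) : ZMod (2 * r) → AddSubgroup (SFAlg (P.CEGen m) (P.Base m)) := SFAlg.grade P.ceDeg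

/-- The differential of the Chekanov–Eliashberg algebra. -/
def ceDiff (m : ℕ) : SFAlg (P.CEGen m) (P.Base m) →+ SFAlg (P.CEGen m) (P.Base m) :=
  SFAlg.derivation P.ceDeg P.ceDiffGen

/-! ## The DGA of the bordered front over an open set -/

/-- `a` is a left boundary point of `U` over which the front has strands. -/
def IsLeftEdge (U : Opens ℝ) (a : ℝ) : Prop :=
  a ∉ U ∧ (U : Set ℝ) ∈ 𝓝[>] a ∧ P.xL ≤ a ∧ a < P.xR

/-- Generators of the algebra of the front over `U`: crossings and right cusps over `U`, and pairs
of left endpoints, the first above the second (for each left boundary point of `U`; there is at most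
one if `U` is an interval). -/
inductive Gen (m : ℕ) (U : Opens ℝ) : Type
  | cross (c : P.Cross m) (h : c.x ∈ U) : Gen m U
  | cusp (k : Fin P.n) (i : Fin m) (h : P.xR ∈ U) : Gen m U
  | pair (a : ℝ) (i j : P.Strand m) (ha : P.IsLeftEdge U a) (h : P.Above a i j) : Gen m U

/-- Base points over `U`. -/
abbrev BaseOn (m : ℕ) (U : Opens ℝ) : Type := {b : P.Base m // b.x ∈ U}

/-- The algebra of the front over `U`. -/
abbrev Alg (m : ℕ) (U : Opens ℝ) : Type := SFAlg (P.Gen m U) (P.BaseOn m U)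

variable {P} in
/-- Degrees of the generators. -/
def Gen.deg {U : Opens ℝ} : P.Gen m U → ZMod (2 * r)
  | cross c _ => c.deg
  | cusp _ _ _ => 1
  | pair _ i j _ _ => P.μ i.1 - P.μ j.1 - 1

/-- The grading of the algebra. -/
def gr (m : ℕ) (U : Opens ℝ) : ZMod (2 * r) → AddSubgroup (P.Alg m U) := SFAlg.grade Gen.deg

/-- A crossing over `U` as an element of the algebra. -/
def crossElt (m : ℕ) (U : Opens ℝ) (c : P.Cross m) : P.Alg m U :=
  if h : c.x ∈ U then gen (.cross c h) else 0

/-- A base point over `U` as an element of the algebra. -/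
def baseElt (m : ℕ) (U : Opens ℝ) (b : P.Base m) : (P.Alg m U)ˣ :=
  if h : b.x ∈ U then tgen ⟨b, h⟩ else 1

/-- The generator of a pair of left endpoints as an element of the algebra. -/
def pairElt (m : ℕ) (U : Opens ℝ) (a : ℝ) (p : P.Strand m × P.Strand m) : P.Alg m U :=
  if h : P.IsLeftEdge U a ∧ P.Above a p.1 p.2 then gen (.pair a p.1 p.2 h.1 h.2) else 0

/-- The factor of the left end of a disk which starts over `x ∈ U`: if `U` contains everything
between the left cusps and `x`, then the disk has to end at a left cusp; otherwise it ends along the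
segment between two left endpoints, over the left boundary point of `U` next to `x`. -/
def endElt (m : ℕ) (U : Opens ℝ) (x : ℝ) (p : P.Strand m × P.Strand m) : P.Alg m U :=
  if Set.Icc P.xL x ⊆ U then cuspEnd (P.baseElt m U) p
  else P.pairElt m U (sSup {y | y ≤ x ∧ y ∉ U}) p

/-- The sum of `w(u)` over the disks `u` over `U` which start over `x` with the strands `p`. -/
def diskSumOn (m : ℕ) (U : Opens ℝ) (x : ℝ) (L : List (P.Event m))
    (p : P.Strand m × P.Strand m) : P.Alg m U :=
  diskSum (P.crossElt m U) (P.baseElt m U) (P.endElt m U x) L p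

/-- The differential of the generators. -/
def diffGen (m : ℕ) (U : Opens ℝ) : P.Gen m U → P.Alg m U
  | .cross c _ => P.diskSumOn m U c.x (P.after c (P.sweep m U c.x)) (c.overStrand, c.underStrand)
  | .cusp k i _ => invisible (P.baseElt m U) k i +
      P.diskSumOn m U P.xR (P.sweep m U P.xR) ((P.rup k, i), (P.rlow k, i))
  | .pair a i j ha _ =>
      ∑ l : {l : P.Strand m // P.Above a i l ∧ P.Above a l j},
        sgn ((Gen.pair a i l.1 ha l.2.1 : P.Gen m U).deg + 1) •
          (gen (.pair a i l.1 ha l.2.1) * gen (.pair a l.1 j ha l.2.2))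

/-- The differential. -/
def diff (m : ℕ) (U : Opens ℝ) : P.Alg m U →+ P.Alg m U := SFAlg.derivation Gen.deg (P.diffGen m U)

variable {P} in
theorem IsLeftEdge.mono {V U : Opens ℝ} (h : V ≤ U) {a : ℝ} (ha : P.IsLeftEdge V a) (haU : a ∉ U) :
    P.IsLeftEdge U a :=
  ⟨haU, Filter.mem_of_superset ha.2.1 h, ha.2.2⟩

/-- The corestriction map on generators, for `V ⊆ U`. A pair of left endpoints of `V` is sent to the
sum over the disks which extend from this segment of the left boundary of `V` to the left. -/
def coresGen (m : ℕ) {V U : Opens ℝ} (h : V ≤ U) : P.Gen m V → P.Alg m U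
  | .cross c hc => gen (.cross c (h hc))
  | .cusp k i hk => gen (.cusp k i (h hk))
  | .pair a i j ha hij =>
      if haU : a ∈ U then P.diskSumOn m U a (P.sweep m U a) (i, j)
      else gen (.pair a i j (ha.mono h haU) hij)

/-- The corestriction map `ι_{VU}`, for `V ⊆ U`. -/
def cores (m : ℕ) {V U : Opens ℝ} (h : V ≤ U) : P.Alg m V →+* P.Alg m U :=
  SFAlg.lift (P.coresGen m h) fun b => tgen ⟨b.1, h b.2⟩

/-- The algebras of the `m`-copy over open sets are DGAs and form a precosheaf. -/
structure IsDGAPrecosheaf (m : ℕ) : Prop where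
  isDGA : ∀ U, IsDGA (P.gr m U) (P.diff m U)
  isDGAHom : ∀ {V U : Opens ℝ} (h : V ≤ U),
    IsDGAHom (P.gr m V) (P.diff m V) (P.gr m U) (P.diff m U) (P.cores m h)
  cores_refl : ∀ U : Opens ℝ, P.cores m (le_refl U) = RingHom.id _
  cores_comp : ∀ {W V U : Opens ℝ} (h : W ≤ V) (h' : V ≤ U),
    (P.cores m h').comp (P.cores m h) = P.cores m (h.trans h')

variable {P} in
/-- The precosheaf of DGAs of the `m`-copy. -/
def IsDGAPrecosheaf.functor (H : P.IsDGAPrecosheaf m) : Opens ℝ ⥤ DGA r where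
  obj U := ⟨P.Alg m U, P.gr m U, P.diff m U, H.isDGA U⟩
  map f := ⟨P.cores m (leOfHom f), H.isDGAHom _⟩
  map_id U := Subtype.ext (H.cores_refl U)
  map_comp f g := Subtype.ext (H.cores_comp (leOfHom f) (leOfHom g)).symm

/-! ## The sequences of DGAs of the `m`-copies -/

namespace Cross

variable {P}

/-- The map of crossings for an order-preserving inclusion of indices of copies. -/
def map {n : ℕ} (σ : Fin m ↪o Fin n) : P.Cross m → P.Cross n
  | dbl c i j => dbl c (σ i) (σ j)
  | left k i j h => left k (σ i) (σ j) (σ.strictMono h)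
  | right k i j h => right k (σ i) (σ j) (σ.strictMono h)

theorem map_x {n : ℕ} (σ : Fin m ↪o Fin n) (c : P.Cross m) : (c.map σ).x = c.x := by
  cases c <;> rfl

end Cross

variable {P} in
theorem Above.map {n : ℕ} (σ : Fin m ↪o Fin n) {a : ℝ} {i j : P.Strand m} (h : P.Above a i j) :
    P.Above a (i.1, σ i.2) (j.1, σ j.2) :=
  h.imp id fun h => ⟨h.1, σ.strictMono h.2⟩

variable {P} in
/-- The map of generators for an order-preserving inclusion of indices of copies. -/
def Gen.map {n : ℕ} {U : Opens ℝ} (σ : Fin m ↪o Fin n) : P.Gen m U → P.Gen n U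
  | cross c h => cross (c.map σ) (by rwa [Cross.map_x])
  | cusp k i h => cusp k (σ i) h
  | pair a i j ha h => pair a (i.1, σ i.2) (j.1, σ j.2) ha (h.map σ)

/-- The sequence of the DGAs of the `m`-copies over `U`. The row of a generator is the copy at its
upper end, the column is the copy at its lower end. -/
def seq (U : Opens ℝ) : DGASeq r where
  R m := P.Gen m U
  T m := P.BaseOn m U
  deg := Gen.deg
  diffGen := P.diffGen _ U
  row a := match a with
    | .cross c _ => c.overStrand.2
    | .cusp _ i _ => i
    | .pair _ i _ _ _ => i.2
  col a := match a with
    | .cross c _ => c.underStrand.2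
    | .cusp _ i _ => i
    | .pair _ _ j _ _ => j.2
  mapR := Gen.map
  mapT σ b := ⟨(b.1.1, σ b.1.2), b.2⟩

/-- The sequence of the Chekanov–Eliashberg DGAs of the `m`-copies. -/
def ceSeq : DGASeq r where
  R m := P.CEGen m
  T m := P.Base m
  deg := P.ceDeg
  diffGen := P.ceDiffGen
  row a := match a with
    | .inl c => c.overStrand.2
    | .inr c => c.2
  col a := match a with
    | .inl c => c.underStrand.2
    | .inr c => c.2
  mapR σ a := match a with
    | .inl c => .inl (c.map σ)
    | .inr c => .inr (c.1, σ c.2)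
  mapT σ b := (b.1, σ b.2)

/-- The augmentation category of the restriction of `Λ` to `U`. -/
def augPlus (U : Opens ℝ) (k : Type u) [CommRing k] : AInfData k r := (P.seq U).augPlus k

/-- The augmentation category of `Λ`. -/
def ceAugPlus (k : Type u) [CommRing k] : AInfData k r := P.ceSeq.augPlus k

variable {P} in
/-- The restriction functor from `U` to `V`, for `V ⊆ U`. -/
def IsDGAPrecosheaf.res (H : P.IsDGAPrecosheaf 1) (k : Type u) [CommRing k] {V U : Opens ℝ}
    (h : V ≤ U) : AInfData.Fun (P.augPlus U k) (P.augPlus V k) :=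
  DGASeq.augPlusMap (S := P.seq U) (S' := P.seq V) k (fun m => P.cores m h) (H.isDGAHom h)

end PreferredPlat

end

noncomputable section

/-! ## Signs -/

section Signs

variable {r : ℕ}

theorem sgn_add (d e : ZMod (2 * r)) : sgn (d + e) = sgn d * sgn e := by
  unfold sgn
  rw [map_add]
  generalize parity r d = a
  generalize parity r e = b
  revert a b
  decide

@[simp]
theorem sgn_zero : sgn (0 : ZMod (2 * r)) = 1 := by simp [sgn]

@[simp]
theorem sgn_one : sgn (1 : ZMod (2 * r)) = -1 := by simp [sgn]

theorem sgn_mul_self (d : ZMod (2 * r)) : sgn d * sgn d = 1 := by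
  unfold sgn
  split_ifs <;> simp

theorem sgn_neg (d : ZMod (2 * r)) : sgn (-d) = sgn d := by
  unfold sgn
  rw [map_neg]
  generalize parity r d = a
  revert a
  decide

theorem sgn_sub (d e : ZMod (2 * r)) : sgn (d - e) = sgn d * sgn e := by
  rw [sub_eq_add_neg, sgn_add, sgn_neg]

end Signs

/-! ## Semi-free algebras -/

namespace SFAlg

variable {R T : Type}

/-- Induction on words. -/
theorem word_induction {p : SFMonoid R T → Prop} (one : p 1)
    (gen : ∀ a w, p w → p (Monoid.Coprod.inl (FreeMonoid.of a) * w))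
    (tgen : ∀ t w, p w → p (Monoid.Coprod.inr (FreeGroup.of t) * w))
    (tinv : ∀ t w, p w → p (Monoid.Coprod.inr (FreeGroup.of t)⁻¹ * w)) (w : SFMonoid R T) : p w := by
  have key : ∀ v w : SFMonoid R T, p w → p (v * w) := by
    intro v
    induction v using Monoid.Coprod.induction_on with
    | inl m =>
      induction m using FreeMonoid.recOn with
      | one => simp
      | of_mul a m ih =>
        intro w hw
        rw [map_mul, mul_assoc]
        exact gen _ _ (ih _ hw)
    | inr g =>
      induction g using FreeGroup.induction_on with
      | C1 => simp
      | of t => exact tgen t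
      | inv_of t _ => exact tinv t
      | mul a b ha hb =>
        intro w hw
        rw [map_mul, mul_assoc]
        exact ha _ (hb _ hw)
    | mul a b ha hb =>
      intro w hw
      rw [mul_assoc]
      exact ha _ (hb _ hw)
  simpa using key w 1 one

theorem of_inr (t : T) :
    MonoidAlgebra.of ℤ (SFMonoid R T) (Monoid.Coprod.inr (FreeGroup.of t)) = (tgen t).1 := rfl

theorem of_inr_inv (t : T) :
    MonoidAlgebra.of ℤ (SFMonoid R T) (Monoid.Coprod.inr (FreeGroup.of t)⁻¹) =
      ((tgen t)⁻¹ : (SFAlg R T)ˣ).1 := rfl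

theorem of_gen_mul (a : R) (w : SFMonoid R T) :
    MonoidAlgebra.of ℤ _ (Monoid.Coprod.inl (FreeMonoid.of a) * w) =
      gen a * MonoidAlgebra.of ℤ _ w := map_mul _ _ _

theorem of_tgen_mul (t : T) (w : SFMonoid R T) :
    MonoidAlgebra.of ℤ _ (Monoid.Coprod.inr (FreeGroup.of t) * w) =
      (tgen t).1 * MonoidAlgebra.of ℤ _ w := map_mul _ _ _

theorem of_tinv_mul (t : T) (w : SFMonoid R T) :
    MonoidAlgebra.of ℤ _ (Monoid.Coprod.inr (FreeGroup.of t)⁻¹ * w) =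
      ((tgen t)⁻¹ : (SFAlg R T)ˣ).1 * MonoidAlgebra.of ℤ _ w := map_mul _ _ _

theorem wordDeg_one {N : ℕ} (δ : R → ZMod N) : (wordDeg (T := T) δ 1).toAdd = 0 := by simp

theorem wordDeg_gen_mul {N : ℕ} (δ : R → ZMod N) (a : R) (w : SFMonoid R T) :
    (wordDeg δ (Monoid.Coprod.inl (FreeMonoid.of a) * w)).toAdd = δ a + (wordDeg δ w).toAdd := by
  rw [map_mul, toAdd_mul]
  simp [wordDeg]

theorem wordDeg_tgen_mul {N : ℕ} (δ : R → ZMod N) (t : T) (w : SFMonoid R T) :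
    (wordDeg δ (Monoid.Coprod.inr (FreeGroup.of t) * w)).toAdd = (wordDeg δ w).toAdd := by
  rw [map_mul, toAdd_mul]
  simp [wordDeg]

theorem wordDeg_tinv_mul {N : ℕ} (δ : R → ZMod N) (t : T) (w : SFMonoid R T) :
    (wordDeg δ (Monoid.Coprod.inr (FreeGroup.of t)⁻¹ * w)).toAdd = (wordDeg δ w).toAdd := by
  rw [map_mul, toAdd_mul]
  simp [wordDeg]

/-- Induction on elements of a semi-free algebra. -/
theorem induction {p : SFAlg R T → Prop} (one : p 1) (gen : ∀ a, p (gen a))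
    (tgen : ∀ t, p (tgen t).1) (tinv : ∀ t, p ((SFAlg.tgen t)⁻¹ : (SFAlg R T)ˣ).1)
    (mul : ∀ x y, p x → p y → p (x * y)) (add : ∀ x y, p x → p y → p (x + y))
    (neg : ∀ x, p x → p (-x)) (x : SFAlg R T) : p x := by
  have zero : p 0 := by simpa using add _ _ one (neg _ one)
  have hof : ∀ w, p (MonoidAlgebra.of ℤ _ w) := by
    intro w
    induction w using word_induction with
    | one => rw [map_one]; exact one
    | gen a w ih => rw [map_mul]; exact mul _ _ (gen a) ih
    | tgen a w ih => rw [map_mul]; exact mul _ _ (tgen a) ih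
    | tinv a w ih => rw [map_mul]; exact mul _ _ (tinv a) ih
  induction x using MonoidAlgebra.induction_on with
  | of w => exact hof w
  | add f g hf hg => exact add _ _ hf hg
  | smul z f hf =>
    induction z using Int.induction_on with
    | zero => simpa using zero
    | succ n ih => rw [add_smul, one_smul]; exact add _ _ ih hf
    | pred n ih => rw [sub_smul, one_smul, sub_eq_add_neg]; exact add _ _ ih (neg _ hf)

section Lift

variable {B : Type*} [Ring B]

@[simp]
theorem lift_gen (f : R → B) (g : T → Bˣ) (a : R) : lift f g (gen a : SFAlg R T) = f a := by
  simp [lift, gen, MonoidAlgebra.of]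

@[simp]
theorem lift_tgen (f : R → B) (g : T → Bˣ) (t : T) :
    lift f g (tgen t : (SFAlg R T)ˣ).1 = g t := by
  rw [← of_inr]
  simp [lift, MonoidAlgebra.of]

theorem map_unit_inv {A : Type*} [Ring A] (f : A →+* B) (x : Aˣ) {y : Bˣ} (h : f x.1 = y.1) :
    f (x⁻¹).1 = (y⁻¹).1 := by
  have : Units.map f.toMonoidHom x = y := Units.ext h
  rw [← this, ← map_inv]
  rfl

@[simp]
theorem lift_tgen_inv (f : R → B) (g : T → Bˣ) (t : T) :
    lift f g ((tgen t)⁻¹ : (SFAlg R T)ˣ).1 = (g t)⁻¹.1 :=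
  map_unit_inv _ _ (lift_tgen f g t)

theorem hom_ext {f g : SFAlg R T →+* B} (hgen : ∀ a, f (gen a) = g (gen a))
    (htgen : ∀ t, f (tgen t).1 = g (tgen t).1) : f = g := by
  refine RingHom.ext fun x => ?_
  induction x using induction with
  | one => simp
  | gen a => exact hgen a
  | tgen t => exact htgen t
  | tinv t =>
    rw [map_unit_inv f (tgen t) (y := Units.map g.toMonoidHom (tgen t)) (htgen t), ← map_inv]
    rfl
  | mul x y hx hy => rw [map_mul, map_mul, hx, hy]
  | add x y hx hy => rw [map_add, map_add, hx, hy]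
  | neg x hx => rw [map_neg, map_neg, hx]

end Lift

/-! ### Gradings -/

section Grade

variable {N : ℕ} (δ : R → ZMod N)

theorem of_mem_grade (w : SFMonoid R T) :
    MonoidAlgebra.of ℤ _ w ∈ grade δ (wordDeg δ w).toAdd :=
  AddSubgroup.subset_closure ⟨w, rfl, rfl⟩

theorem one_mem_grade : (1 : SFAlg R T) ∈ grade δ 0 :=
  AddSubgroup.subset_closure ⟨1, by simp, (map_one _).symm⟩

theorem gen_mem_grade (a : R) : (gen a : SFAlg R T) ∈ grade δ (δ a) :=
  AddSubgroup.subset_closure ⟨_, by simp [wordDeg], rfl⟩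

theorem tgen_mem_grade (t : T) : (tgen t : (SFAlg R T)ˣ).1 ∈ grade δ 0 :=
  AddSubgroup.subset_closure ⟨_, by simp [wordDeg], (of_inr t).symm⟩

theorem tgen_inv_mem_grade (t : T) : ((tgen t)⁻¹ : (SFAlg R T)ˣ).1 ∈ grade δ 0 :=
  AddSubgroup.subset_closure ⟨_, by simp [wordDeg], (of_inr_inv t).symm⟩

theorem mul_mem_grade {i j : ZMod N} {x y : SFAlg R T} (hx : x ∈ grade δ i) (hy : y ∈ grade δ j) :
    x * y ∈ grade δ (i + j) := by
  induction hx using AddSubgroup.closure_induction with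
  | mem x hx =>
    obtain ⟨w, hw, rfl⟩ := hx
    induction hy using AddSubgroup.closure_induction with
    | mem y hy =>
      obtain ⟨v, hv, rfl⟩ := hy
      refine AddSubgroup.subset_closure ⟨w * v, ?_, by rw [map_mul]⟩
      rw [map_mul, hw, hv, ofAdd_add]
    | zero => rw [mul_zero]; exact zero_mem _
    | add x y _ _ hx hy => rw [mul_add]; exact add_mem hx hy
    | neg x _ hx => rw [mul_neg]; exact neg_mem hx
  | zero => rw [zero_mul]; exact zero_mem _
  | add x y _ _ hx hy => rw [add_mul]; exact add_mem hx hy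
  | neg x _ hx => rw [neg_mul]; exact neg_mem hx

theorem addHom_ext {M : Type*} [AddCommGroup M] {f g : SFAlg R T →+ M}
    (h : ∀ w, f (MonoidAlgebra.of ℤ _ w) = g (MonoidAlgebra.of ℤ _ w)) : f = g := by
  refine MonoidAlgebra.addMonoidHom_ext fun w z => ?_
  have : (MonoidAlgebra.single w z : SFAlg R T) = z • MonoidAlgebra.of ℤ _ w := by
    simp [MonoidAlgebra.of]
  rw [this, map_zsmul, map_zsmul, h]

/-- The decomposition into homogeneous parts. -/
def decompose (δ : R → ZMod N) : SFAlg R T →+ DirectSum (ZMod N) fun i => grade (T := T) δ i :=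
  (Finsupp.liftAddHom fun w => (zmultiplesHom _
    (DirectSum.of (fun i => grade (T := T) δ i) _ ⟨_, of_mem_grade δ w⟩))).comp
    (MonoidAlgebra.coeffAddEquiv (R := ℤ) (M := SFMonoid R T)).toAddMonoidHom

theorem decompose_of (w : SFMonoid R T) : decompose δ (MonoidAlgebra.of ℤ _ w) =
    DirectSum.of (fun i => grade (T := T) δ i) _ ⟨_, of_mem_grade δ w⟩ := by
  simp [decompose, MonoidAlgebra.of]

theorem isInternal_grade : DirectSum.IsInternal (grade (T := T) δ) := by
  classical
  have h1 : (DirectSum.coeAddMonoidHom (grade (T := T) δ)).comp (decompose δ) = .id _ :=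
    addHom_ext fun w => by
      rw [AddMonoidHom.comp_apply, decompose_of, DirectSum.coeAddMonoidHom_of]
      rfl
  have h2 : (decompose δ).comp (DirectSum.coeAddMonoidHom (grade (T := T) δ)) = .id _ := by
    refine DirectSum.addHom_ext fun i x => ?_
    rw [AddMonoidHom.comp_apply, DirectSum.coeAddMonoidHom_of, AddMonoidHom.id_apply]
    obtain ⟨x, hx⟩ := x
    change decompose δ x = _
    induction hx using AddSubgroup.closure_induction with
    | mem x hx =>
      obtain ⟨w, hw, rfl⟩ := hx
      rw [decompose_of]
      refine DirectSum.of_eq_of_gradedMonoid_eq (Sigma.ext ?_ ?_)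
      · exact congrArg Multiplicative.toAdd hw
      · have hw' : (wordDeg δ w).toAdd = i := congrArg Multiplicative.toAdd hw
        subst hw'
        rfl
    | zero => exact (map_zero _).trans (map_zero _).symm
    | add x y hx hy ihx ihy =>
      rw [map_add, ihx, ihy, ← map_add]
      rfl
    | neg x hx ih =>
      rw [map_neg, ih, ← map_neg]
      rfl
  exact ⟨fun x y h => (DFunLike.congr_fun h2 x).symm.trans
      ((congrArg (decompose δ) h).trans (DFunLike.congr_fun h2 y)),
    fun x => ⟨decompose δ x, DFunLike.congr_fun h1 x⟩⟩

theorem isGradedRing_grade {r : ℕ} (δ : R → ZMod (2 * r)) : IsGradedRing (grade (T := T) δ) :=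
  ⟨isInternal_grade δ, one_mem_grade δ, mul_mem_grade δ⟩

end Grade

/-! ### Derivations -/

section Derivation

variable {r : ℕ} (δ : R → ZMod (2 * r)) (D : R → SFAlg R T)

theorem derivationMatrix_tgen (t : T) :
    derivationMatrix δ D (tgen t).1 = Matrix.scalar (Fin 2) (tgen t : (SFAlg R T)ˣ).1 := by
  rw [derivationMatrix, lift_tgen]
  rfl

theorem derivationMatrix_tgen_inv (t : T) :
    derivationMatrix δ D ((tgen t)⁻¹ : (SFAlg R T)ˣ).1 =
      Matrix.scalar (Fin 2) ((tgen t)⁻¹ : (SFAlg R T)ˣ).1 := by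
  rw [derivationMatrix, lift_tgen_inv, ← map_inv]
  rfl

theorem derivationMatrix_row_one (x : SFAlg R T) :
    derivationMatrix δ D x 1 0 = 0 ∧ derivationMatrix δ D x 1 1 = x := by
  induction x using induction with
  | one => simp
  | gen a => simp [derivationMatrix]
  | tgen t => simp [derivationMatrix_tgen]
  | tinv t => simp [derivationMatrix_tgen_inv]
  | mul x y hx hy => simp [Matrix.mul_apply, Fin.sum_univ_two, hx, hy]
  | add x y hx hy => simp [hx, hy]
  | neg x hx => simp [hx]

theorem derivationMatrix_zero_zero {i : ZMod (2 * r)} {x : SFAlg R T} (hx : x ∈ grade δ i) :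
    derivationMatrix δ D x 0 0 = sgn i • x := by
  have key : ∀ w : SFMonoid R T, derivationMatrix δ D (MonoidAlgebra.of ℤ _ w) 0 0 =
      sgn (wordDeg δ w).toAdd • MonoidAlgebra.of ℤ _ w := by
    intro w
    induction w using word_induction with
    | one => rw [wordDeg_one, map_one, map_one, sgn_zero, one_smul, Matrix.one_apply_eq]
    | gen a w ih =>
      rw [of_gen_mul, wordDeg_gen_mul, map_mul, Matrix.mul_apply, Fin.sum_univ_two, ih,
        (derivationMatrix_row_one δ D _).1, sgn_add, mul_smul, mul_zero, add_zero, mul_smul_comm]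
      conv_rhs => rw [smul_comm, ← smul_mul_assoc]
      rw [derivationMatrix, lift_gen]
      rfl
    | tgen t w ih =>
      rw [of_tgen_mul, wordDeg_tgen_mul, map_mul, Matrix.mul_apply, Fin.sum_univ_two, ih,
        (derivationMatrix_row_one δ D _).1, mul_zero, add_zero, mul_smul_comm,
        derivationMatrix_tgen, Matrix.scalar_apply, Matrix.diagonal_apply_eq]
    | tinv t w ih =>
      rw [of_tinv_mul, wordDeg_tinv_mul, map_mul, Matrix.mul_apply, Fin.sum_univ_two, ih,
        (derivationMatrix_row_one δ D _).1, mul_zero, add_zero, mul_smul_comm,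
        derivationMatrix_tgen_inv, Matrix.scalar_apply, Matrix.diagonal_apply_eq]
  induction hx using AddSubgroup.closure_induction with
  | mem x hx =>
    obtain ⟨w, hw, rfl⟩ := hx
    rw [key, hw]
    rfl
  | zero => simp
  | add x y _ _ hx hy => simp [hx, hy]
  | neg x _ hx => simp [hx]

@[simp]
theorem derivation_gen (a : R) : derivation δ D (gen a) = D a := by
  simp [derivation, derivationMatrix]

@[simp]
theorem derivation_tgen (t : T) : derivation δ D (tgen t).1 = 0 := by
  simp [derivation, derivationMatrix_tgen]

theorem derivation_mul {i : ZMod (2 * r)} {x : SFAlg R T} (y : SFAlg R T) (hx : x ∈ grade δ i) :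
    derivation δ D (x * y) = derivation δ D x * y + sgn i • (x * derivation δ D y) := by
  have h := derivationMatrix_zero_zero δ D hx
  have h' := (derivationMatrix_row_one δ D y).2
  simp only [derivation, AddMonoidHom.comp_apply, RingHom.toAddMonoidHom_eq_coe,
    AddMonoidHom.coe_coe, Matrix.entryAddMonoidHom_apply, map_mul, Matrix.mul_apply,
    Fin.sum_univ_two, h, h']
  rw [smul_mul_assoc, add_comm]

end Derivation

end SFAlg

/-! ## Recognising DGAs and DGA maps on generators -/

/-- The part of the axioms of a DGA which a target of a DGA map needs. -/
structure IsPreDGA {r : ℕ} {A : Type*} [Ring A] (gr : ZMod (2 * r) → AddSubgroup A) (d : A →+ A) :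
    Prop where
  one_mem : (1 : A) ∈ gr 0
  mul_mem : ∀ {i j : ZMod (2 * r)} {x y : A}, x ∈ gr i → y ∈ gr j → x * y ∈ gr (i + j)
  leibniz : ∀ {i : ZMod (2 * r)} {x : A} (y : A), x ∈ gr i →
    d (x * y) = d x * y + sgn i • (x * d y)

theorem IsDGA.isPreDGA {r : ℕ} {A : Type*} [Ring A] {gr : ZMod (2 * r) → AddSubgroup A}
    {d : A →+ A} (h : IsDGA gr d) : IsPreDGA gr d :=
  ⟨h.one_mem, h.mul_mem, h.leibniz⟩

namespace IsPreDGA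

variable {r : ℕ} {A : Type*} [Ring A] {gr : ZMod (2 * r) → AddSubgroup A} {d : A →+ A}

theorem d_one (h : IsPreDGA gr d) : d 1 = 0 := by
  have := h.leibniz 1 h.one_mem
  simpa using this

theorem d_inv (h : IsPreDGA gr d) {u : Aˣ} (hu : u.1 ∈ gr 0) (hd : d u.1 = 0) : d (u⁻¹).1 = 0 := by
  have := h.leibniz (u⁻¹).1 hu
  rw [Units.mul_inv, h.d_one, hd, zero_mul, zero_add, sgn_zero, one_smul] at this
  have h2 := congrArg ((u⁻¹).1 * ·) this
  simpa using h2.symm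

end IsPreDGA

/-- A commutative ring as a target of augmentations. -/
def trivialGr (r : ℕ) (k : Type*) [CommRing k] (d : ZMod (2 * r)) : AddSubgroup k where
  carrier := {x | d ≠ 0 → x = 0}
  add_mem' hx hy h := by rw [hx h, hy h, add_zero]
  zero_mem' _ := rfl
  neg_mem' hx h := by rw [hx h, neg_zero]

theorem isPreDGA_trivialGr (r : ℕ) (k : Type*) [CommRing k] :
    IsPreDGA (trivialGr r k) (0 : k →+ k) where
  one_mem h := absurd rfl h
  mul_mem {i j x y} hx hy h := by
    by_cases hi : i = 0
    · rw [hy (by rintro rfl; exact h (by rw [hi, add_zero])), mul_zero]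
    · rw [hx hi, zero_mul]
  leibniz := by simp

theorem isDGAHom_trivialGr_iff {r : ℕ} {A k : Type*} [Ring A] [CommRing k]
    {gr : ZMod (2 * r) → AddSubgroup A} {d : A →+ A} {ε : A →+* k} :
    IsDGAHom gr d (trivialGr r k) 0 ε ↔
      (∀ i ≠ 0, ∀ x ∈ gr i, ε x = 0) ∧ ∀ x, ε (d x) = 0 :=
  ⟨fun h => ⟨fun _ hi _ hx => h.graded hx hi, h.comm⟩,
    fun h => ⟨fun i x hx hi => h.1 i hi x hx, h.2⟩⟩

namespace SFAlg

variable {R T : Type} {r : ℕ} {δ : R → ZMod (2 * r)} {D : R → SFAlg R T} {B : Type*} [Ring B]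
  {grB : ZMod (2 * r) → AddSubgroup B} {dB : B →+ B} {φ : SFAlg R T →+* B}

theorem isPreDGA : IsPreDGA (grade δ) (derivation δ D) :=
  ⟨one_mem_grade δ, mul_mem_grade δ, derivation_mul δ D⟩

@[simp]
theorem derivation_tgen_inv (t : T) : derivation δ D ((tgen t)⁻¹ : (SFAlg R T)ˣ).1 = 0 :=
  (isPreDGA (δ := δ) (D := D)).d_inv (tgen_mem_grade δ t) (derivation_tgen δ D t)

/-- A ring homomorphism is graded if it preserves the degrees of generators. -/
theorem isGradedHom_of_gen (one : (1 : B) ∈ grB 0)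
    (mul : ∀ {i j : ZMod (2 * r)} {x y : B}, x ∈ grB i → y ∈ grB j → x * y ∈ grB (i + j))
    (hgen : ∀ a, φ (gen a) ∈ grB (δ a)) (ht : ∀ t, φ (tgen t).1 ∈ grB 0)
    (htinv : ∀ t, φ ((tgen t)⁻¹ : (SFAlg R T)ˣ).1 ∈ grB 0) : IsGradedHom (grade δ) grB φ := by
  have key : ∀ w : SFMonoid R T, φ (MonoidAlgebra.of ℤ _ w) ∈ grB (wordDeg δ w).toAdd := by
    intro w
    induction w using word_induction with
    | one => rw [wordDeg_one, map_one, map_one]; exact one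
    | gen a w ih => rw [of_gen_mul, wordDeg_gen_mul, map_mul]; exact mul (hgen a) ih
    | tgen t w ih =>
      rw [of_tgen_mul, wordDeg_tgen_mul, map_mul, ← zero_add (wordDeg δ w).toAdd]
      exact mul (ht t) ih
    | tinv t w ih =>
      rw [of_tinv_mul, wordDeg_tinv_mul, map_mul, ← zero_add (wordDeg δ w).toAdd]
      exact mul (htinv t) ih
  intro i x hx
  induction hx using AddSubgroup.closure_induction with
  | mem x hx =>
    obtain ⟨w, hw, rfl⟩ := hx
    have := key w
    rwa [hw] at this
  | zero => rw [map_zero]; exact zero_mem _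
  | add x y _ _ hx hy => rw [map_add]; exact add_mem hx hy
  | neg x _ hx => rw [map_neg]; exact neg_mem hx

/-- A ring homomorphism is a DGA map if it is compatible with degrees and differentials of
generators. -/
theorem isDGAHom_of_gen (hB : IsPreDGA grB dB)
    (hgen : ∀ a, φ (gen a) ∈ grB (δ a)) (ht : ∀ t, φ (tgen t).1 ∈ grB 0)
    (htinv : ∀ t, φ ((tgen t)⁻¹ : (SFAlg R T)ˣ).1 ∈ grB 0)
    (hD : ∀ a, φ (D a) = dB (φ (gen a))) (hDt : ∀ t, dB (φ (tgen t).1) = 0) :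
    IsDGAHom (grade δ) (derivation δ D) grB dB φ := by
  have hgr : IsGradedHom (grade δ) grB φ := isGradedHom_of_gen hB.one_mem hB.mul_mem hgen ht htinv
  have hDt' : ∀ t, dB (φ ((tgen t)⁻¹ : (SFAlg R T)ˣ).1) = 0 := by
    intro t
    have := hB.d_inv (u := Units.map φ.toMonoidHom (tgen t)) (ht t) (hDt t)
    rwa [← map_inv] at this
  refine ⟨hgr, fun x => ?_⟩
  suffices φ.toAddMonoidHom.comp (derivation δ D) = dB.comp φ.toAddMonoidHom from
    DFunLike.congr_fun this x
  refine addHom_ext fun w => ?_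
  change φ (derivation δ D _) = dB (φ _)
  induction w using word_induction with
  | one => rw [map_one (MonoidAlgebra.of ℤ _), map_one φ, hB.d_one, isPreDGA.d_one, map_zero]
  | gen a w ih =>
    rw [of_gen_mul, derivation_mul δ D _ (gen_mem_grade δ a), derivation_gen, map_mul φ,
      hB.leibniz _ (hgen a), map_add, map_mul, map_zsmul, map_mul, hD, ih]
  | tgen t w ih =>
    rw [of_tgen_mul, derivation_mul δ D _ (tgen_mem_grade δ t), derivation_tgen, map_mul φ,
      hB.leibniz _ (ht t), map_add, map_mul, map_zsmul, map_mul, hDt, ih, map_zero]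
  | tinv t w ih =>
    rw [of_tinv_mul, derivation_mul δ D _ (tgen_inv_mem_grade δ t), derivation_tgen_inv,
      map_mul φ, hB.leibniz _ (htinv t), map_add, map_mul, map_zsmul, map_mul, hDt', ih, map_zero]

/-- A derivation which is of degree `-1` and squares to zero on generators makes a semi-free algebra
into a DGA. -/
theorem isDGA_of_gen (hD : ∀ a, D a ∈ grade δ (δ a - 1)) (hDD : ∀ a, derivation δ D (D a) = 0) :
    IsDGA (grade δ) (derivation δ D) := by
  have hw : ∀ w : SFMonoid R T, derivation δ D (MonoidAlgebra.of ℤ _ w) ∈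
      grade δ ((wordDeg δ w).toAdd - 1) := by
    intro w
    induction w using word_induction with
    | one => rw [map_one (MonoidAlgebra.of ℤ _), isPreDGA.d_one]; exact zero_mem _
    | gen a w ih =>
      rw [of_gen_mul, wordDeg_gen_mul, derivation_mul δ D _ (gen_mem_grade δ a), derivation_gen]
      refine add_mem ?_ (zsmul_mem ?_ _)
      · rw [add_sub_right_comm]
        exact mul_mem_grade δ (hD a) (of_mem_grade δ w)
      · rw [add_sub_assoc]
        exact mul_mem_grade δ (gen_mem_grade δ a) ih
    | tgen t w ih =>
      rw [of_tgen_mul, wordDeg_tgen_mul, derivation_mul δ D _ (tgen_mem_grade δ t),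
        derivation_tgen, zero_mul, zero_add, ← zero_add (_ - 1)]
      exact zsmul_mem (mul_mem_grade δ (tgen_mem_grade δ t) ih) _
    | tinv t w ih =>
      rw [of_tinv_mul, wordDeg_tinv_mul, derivation_mul δ D _ (tgen_inv_mem_grade δ t),
        derivation_tgen_inv, zero_mul, zero_add, ← zero_add (_ - 1)]
      exact zsmul_mem (mul_mem_grade δ (tgen_inv_mem_grade δ t) ih) _
  have hmem : ∀ {i : ZMod (2 * r)} {x : SFAlg R T}, x ∈ grade δ i →
      derivation δ D x ∈ grade δ (i - 1) := by
    intro i x hx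
    induction hx using AddSubgroup.closure_induction with
    | mem x hx =>
      obtain ⟨w, h, rfl⟩ := hx
      have := hw w
      rwa [h] at this
    | zero => rw [map_zero]; exact zero_mem _
    | add x y _ _ hx hy => rw [map_add]; exact add_mem hx hy
    | neg x _ hx => rw [map_neg]; exact neg_mem hx
  refine ⟨isGradedRing_grade δ, hmem, derivation_mul δ D, fun x => ?_⟩
  suffices (derivation δ D).comp (derivation δ D) = 0 from DFunLike.congr_fun this x
  refine addHom_ext fun w => ?_
  change derivation δ D (derivation δ D _) = 0
  have step : ∀ (i : ZMod (2 * r)) (x y : SFAlg R T), x ∈ grade δ i →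
      derivation δ D (derivation δ D x) = 0 → derivation δ D (derivation δ D y) = 0 →
      derivation δ D (derivation δ D (x * y)) = 0 := by
    intro i x y hx h h'
    rw [derivation_mul δ D _ hx, map_add, map_zsmul, derivation_mul δ D _ hx,
      derivation_mul δ D _ (hmem hx), h, h', sgn_sub]
    simp
  induction w using word_induction with
  | one => rw [map_one (MonoidAlgebra.of ℤ _), isPreDGA.d_one, map_zero]
  | gen a w ih =>
    rw [of_gen_mul]
    exact step _ _ _ (gen_mem_grade δ a) (by rw [derivation_gen, hDD]) ih
  | tgen t w ih =>
    rw [of_tgen_mul]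
    exact step _ _ _ (tgen_mem_grade δ t) (by rw [derivation_tgen, map_zero]) ih
  | tinv t w ih =>
    rw [of_tinv_mul]
    exact step _ _ _ (tgen_inv_mem_grade δ t) (by rw [derivation_tgen_inv, map_zero]) ih

end SFAlg

end

noncomputable section

namespace PreferredPlat

open Classical SFAlg

variable {r : ℕ} {Λ : Set (ℝ × ℝ × ℝ)} {P : PreferredPlat r Λ} {m : ℕ}

theorem Cross.over_ne_under (c : P.Cross m) : c.overStrand ≠ c.underStrand := by
  intro h
  have h := congrArg Prod.fst h
  cases c with
  | dbl c i j =>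
    have h2 := c.2.2.2
    change c.1.1 = c.1.2.1 at h
    rw [h] at h2
    exact lt_irrefl _ h2
  | left k i j hij => simp [overStrand, underStrand] at h
  | right k i j hij =>
    have := P.bijective_right.1 (a₁ := Sum.inl k) (a₂ := Sum.inr k) h
    simp at this

/-! ## Sums over disks -/

section DiskSum

variable {A : Type*} [Ring A] (x : P.Cross m → A) (t : P.Base m → Aˣ)
  (e : P.Strand m × P.Strand m → A)

theorem Disk.ext {L : List (P.Event m)} {p : P.Strand m × P.Strand m} {u v : P.Disk L p}
    (h : u.slice = v.slice) : u = v := by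
  cases u
  cases v
  congr

/-- A disk is given by its first step and the rest. -/
def Disk.consEquiv (ev : P.Event m) (L : List (P.Event m)) (p : P.Strand m × P.Strand m) :
    P.Disk (ev :: L) p ≃ Σ q : {q // P.Step ev p q}, P.Disk L q.1 where
  toFun u := ⟨⟨u.slice 1, by
      have := u.step (0 : Fin (L.length + 1))
      rw [Fin.castSucc_zero, u.start] at this
      exact this⟩,
    ⟨fun k => u.slice k.succ, rfl, fun k => u.step k.succ⟩⟩
  invFun w := ⟨Fin.cons p w.2.slice, rfl, fun k => by
    refine Fin.cases ?_ (fun k => ?_) k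
    · have := w.1.2
      rw [← w.2.start] at this
      exact this
    · exact w.2.step k⟩
  left_inv u := by
    obtain ⟨s, rfl, hs⟩ := u
    exact Disk.ext (funext fun k => Fin.cases rfl (fun _ => rfl) k)
  right_inv w := by
    obtain ⟨⟨q, hq⟩, s, h, hs⟩ := w
    dsimp only at h
    subst h
    rfl

theorem Disk.word_cons (ev : P.Event m) (L : List (P.Event m)) (p : P.Strand m × P.Strand m)
    (u : P.Disk (ev :: L) p) : u.word x t e =
      upperFactor x t ev p (Disk.consEquiv ev L p u).1 *
        (Disk.consEquiv ev L p u).2.word x t e *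
        lowerFactor x t ev p (Disk.consEquiv ev L p u).1 := by
  obtain ⟨s, rfl, hs⟩ := u
  simp only [Disk.word, List.length_cons, List.ofFn_succ, List.prod_cons, List.reverse_cons,
    List.prod_append, List.prod_nil, mul_one, mul_assoc]
  rfl

theorem diskSum_nil (p : P.Strand m × P.Strand m) : diskSum x t e [] p = e p := by
  let u : P.Disk [] p := ⟨fun _ => p, rfl, fun k => k.elim0⟩
  have : Unique (P.Disk [] p) := ⟨⟨u⟩, fun v => by
    refine Disk.ext (funext fun k => ?_)
    have hk : k = 0 := Fin.ext (Nat.lt_one_iff.1 k.2)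
    subst hk
    exact v.start.trans u.start.symm⟩
  rw [diskSum, Fintype.sum_unique]
  rw [Subsingleton.elim default u]
  simp [Disk.word, u]

theorem diskSum_cons (ev : P.Event m) (L : List (P.Event m)) (p : P.Strand m × P.Strand m) :
    diskSum x t e (ev :: L) p = ∑ q : {q // P.Step ev p q},
      upperFactor x t ev p q * diskSum x t e L q * lowerFactor x t ev p q := by
  rw [diskSum, ← (Disk.consEquiv ev L p).symm.sum_comp, Fintype.sum_sigma]
  refine Finset.sum_congr rfl fun q _ => ?_
  rw [diskSum, Finset.mul_sum, Finset.sum_mul]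
  refine Finset.sum_congr rfl fun w _ => ?_
  rw [Disk.word_cons, Equiv.apply_symm_apply]

/-- The factor of a base point on the upper boundary. -/
def baseUpper (b : P.base × Fin m) (i : P.Strand m) : A :=
  if i = (b.1.1.1, b.2) then signedBase t (.inl b.1, b.2) (¬ P.toRight i.1) else 1

/-- The factor of a base point on the lower boundary. -/
def baseLower (b : P.base × Fin m) (i : P.Strand m) : A :=
  if i = (b.1.1.1, b.2) then signedBase t (.inl b.1, b.2) (P.toRight i.1) else 1

theorem diskSum_base (b : P.base × Fin m) (L : List (P.Event m)) (p : P.Strand m × P.Strand m) :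
    diskSum x t e (.inr b :: L) p = baseUpper t b p.1 * diskSum x t e L p * baseLower t b p.2 := by
  rw [diskSum_cons, Fintype.sum_eq_single (⟨p, rfl⟩ : {q // P.Step (.inr b) p q})
    fun v hv => absurd (Subtype.ext (show v.1 = p from v.2)) hv]
  rfl

theorem diskSum_cross (c : P.Cross m) (L : List (P.Event m)) (p : P.Strand m × P.Strand m) :
    diskSum x t e (.inl c :: L) p =
      if p = (c.underStrand, c.overStrand) then 0 else diskSum x t e L p +
        (if p.1 = c.overStrand then
          (sgn (c.deg + 1) • x c) * diskSum x t e L (c.underStrand, p.2) else 0) +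
        (if p.2 = c.underStrand then diskSum x t e L (p.1, c.overStrand) * x c else 0) := by
  have hne := c.over_ne_under
  obtain ⟨p1, p2⟩ := p
  rw [diskSum_cons]
  split_ifs with h0 h1 h2 h2
  · obtain ⟨rfl, rfl⟩ := Prod.mk.inj h0
    refine Fintype.sum_eq_zero _ fun q => ?_
    exact absurd q.2.1 (by simp)
  all_goals
    rw [Prod.mk.injEq] at h0
    dsimp only at *
  · rw [← Finset.sum_subtype {(p1, p2), (c.underStrand, p2), (p1, c.overStrand)}
      (p := P.Step (.inl c) (p1, p2)) (f := fun q => upperFactor x t (.inl c) (p1, p2) q *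
        diskSum x t e L q * lowerFactor x t (.inl c) (p1, p2) q),
      Finset.sum_insert, Finset.sum_pair]
    · subst h1 h2
      simp [upperFactor, lowerFactor, hne, hne.symm, add_assoc]
    · subst h1 h2
      simp [hne, hne.symm]
    · subst h1 h2
      simp [hne, hne.symm]
    · intro q
      have h3 : c.overStrand = c.underStrand ↔ False := iff_of_false hne not_false
      have h4 : c.underStrand = c.overStrand ↔ False := iff_of_false hne.symm not_false
      simp only [Finset.mem_insert, Finset.mem_singleton, Step, h0, h1, h2, h3, h4]
      tauto
  · rw [← Finset.sum_subtype {(p1, p2), (c.underStrand, p2)}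
      (p := P.Step (.inl c) (p1, p2)) (f := fun q => upperFactor x t (.inl c) (p1, p2) q *
        diskSum x t e L q * lowerFactor x t (.inl c) (p1, p2) q), Finset.sum_pair]
    · subst h1
      simp [upperFactor, lowerFactor, hne, hne.symm]
    · subst h1
      simp [hne]
    · intro q
      have h3 : c.overStrand = c.underStrand ↔ False := iff_of_false hne not_false
      have h4 : c.underStrand = c.overStrand ↔ False := iff_of_false hne.symm not_false
      simp only [Finset.mem_insert, Finset.mem_singleton, Step, h0, h1, h2, h3, h4]
      tauto
  · rw [← Finset.sum_subtype {(p1, p2), (p1, c.overStrand)}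
      (p := P.Step (.inl c) (p1, p2)) (f := fun q => upperFactor x t (.inl c) (p1, p2) q *
        diskSum x t e L q * lowerFactor x t (.inl c) (p1, p2) q), Finset.sum_pair]
    · subst h2
      simp [upperFactor, lowerFactor, hne, hne.symm]
    · subst h2
      simp [hne.symm]
    · intro q
      have h3 : c.overStrand = c.underStrand ↔ False := iff_of_false hne not_false
      have h4 : c.underStrand = c.overStrand ↔ False := iff_of_false hne.symm not_false
      simp only [Finset.mem_insert, Finset.mem_singleton, Step, h0, h1, h2, h3, h4]
      tauto
  · rw [← Finset.sum_subtype {(p1, p2)}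
      (p := P.Step (.inl c) (p1, p2)) (f := fun q => upperFactor x t (.inl c) (p1, p2) q *
        diskSum x t e L q * lowerFactor x t (.inl c) (p1, p2) q), Finset.sum_singleton]
    · simp [upperFactor, lowerFactor]
    · intro q
      have h3 : c.overStrand = c.underStrand ↔ False := iff_of_false hne not_false
      have h4 : c.underStrand = c.overStrand ↔ False := iff_of_false hne.symm not_false
      simp only [Finset.mem_insert, Finset.mem_singleton, Step, h0, h1, h2, h3, h4]
      tauto

theorem diskSum_append (L L' : List (P.Event m)) (p : P.Strand m × P.Strand m) :
    diskSum x t e (L ++ L') p = diskSum x t (diskSum x t e L') L p := by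
  induction L generalizing p with
  | nil => rw [List.nil_append, diskSum_nil]
  | cons ev L ih => simp only [List.cons_append, diskSum_cons, ih]

/-- Sums over disks are natural in the ring. -/
theorem map_diskSum {B : Type*} [Ring B] (φ : A →+* B) (x' : P.Cross m → B) (t' : P.Base m → Bˣ)
    (L : List (P.Event m)) (hx : ∀ c, Sum.inl c ∈ L → φ (x c) = x' c)
    (ht : ∀ b, Sum.inr b ∈ L → φ (t (.inl b.1, b.2)).1 = (t' (.inl b.1, b.2)).1)
    (p : P.Strand m × P.Strand m) :
    φ (diskSum x t e L p) = diskSum x' t' (fun q => φ (e q)) L p := by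
  induction L generalizing p with
  | nil => rw [diskSum_nil, diskSum_nil]
  | cons ev L ih =>
    have ih := ih (fun c hc => hx c (List.mem_cons_of_mem _ hc))
      (fun b hb => ht b (List.mem_cons_of_mem _ hb))
    rw [diskSum_cons, diskSum_cons, map_sum]
    refine Finset.sum_congr rfl fun q _ => ?_
    rw [map_mul, map_mul, ih]
    congr 1
    · congr 1
      cases ev with
      | inl c =>
        simp only [upperFactor]
        split_ifs
        · rw [map_one]
        · rw [map_zsmul, hx c (List.mem_cons_self ..)]
      | inr b =>
        have h := ht b (List.mem_cons_self ..)
        simp only [upperFactor, signedBase]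
        split_ifs
        · exact map_unit_inv φ _ h
        · exact h
        · exact map_one φ
    · cases ev with
      | inl c =>
        simp only [lowerFactor]
        split_ifs
        · rw [map_one]
        · rw [hx c (List.mem_cons_self ..)]
      | inr b =>
        have h := ht b (List.mem_cons_self ..)
        simp only [lowerFactor, signedBase]
        split_ifs
        · exact h
        · exact map_unit_inv φ _ h
        · exact map_one φ

end DiskSum

/-! ## Orders of the strands -/

/-- A strict total order. -/
structure IsOrder {S : Type*} (ab : S → S → Prop) : Prop where
  irrefl : ∀ i, ¬ ab i i
  trans : ∀ {i j k}, ab i j → ab j k → ab i k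
  total : ∀ {i j}, i ≠ j → ab i j ∨ ab j i

theorem IsOrder.asymm {S : Type*} {ab : S → S → Prop} (h : IsOrder ab) {i j : S} (hij : ab i j) :
    ¬ ab j i := fun hji => h.irrefl i (h.trans hij hji)

/-- The order `ab` on the left of the crossing `c`, whose strands are adjacent, becomes the order
`ab'` on its right. -/
structure CrossStep (c : P.Cross m) (ab ab' : P.Strand m → P.Strand m → Prop) : Prop where
  over_under : ab c.overStrand c.underStrand
  adjacent : ∀ l, ab c.overStrand l → ¬ ab l c.underStrand
  iff : ∀ i j, ab' i j ↔ (ab i j ∧ ¬ (i = c.overStrand ∧ j = c.underStrand)) ∨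
    (i = c.underStrand ∧ j = c.overStrand)

namespace CrossStep

variable {c : P.Cross m} {ab ab' : P.Strand m → P.Strand m → Prop}

theorem isOrder (h : CrossStep c ab ab') (hab : IsOrder ab) : IsOrder ab' where
  irrefl i hi := by
    rcases (h.iff i i).1 hi with h1 | h1
    · exact hab.irrefl i h1.1
    · exact c.over_ne_under (h1.2.symm.trans h1.1)
  trans {i j k} hij hjk := by
    have ho := h.over_under
    have hne := c.over_ne_under
    rw [h.iff] at hij hjk ⊢
    rcases hij with ⟨hij, hij'⟩ | ⟨rfl, rfl⟩ <;> rcases hjk with ⟨hjk, hjk'⟩ | ⟨hj, rfl⟩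
    · refine Or.inl ⟨hab.trans hij hjk, ?_⟩
      rintro ⟨rfl, rfl⟩
      exact h.adjacent j hij hjk
    · subst hj
      by_cases hi : i = c.overStrand
      · exact absurd ⟨hi, rfl⟩ hij'
      · refine Or.inl ⟨?_, fun h' => hi h'.1⟩
        rcases hab.total hi with h1 | h1
        · exact h1
        · exact absurd hij (h.adjacent i h1)
    · by_cases hk : k = c.underStrand
      · exact absurd ⟨rfl, hk⟩ hjk'
      · refine Or.inl ⟨?_, fun h' => hk h'.2⟩
        rcases hab.total (Ne.symm hk) with h1 | h1
        · exact h1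
        · exact absurd h1 (h.adjacent k hjk)
    · exact absurd hj hne
  total {i j} hij := by
    rw [h.iff, h.iff]
    rcases hab.total hij with h1 | h1
    · by_cases h2 : i = c.overStrand ∧ j = c.underStrand
      · exact Or.inr (Or.inr ⟨h2.2, h2.1⟩)
      · exact Or.inl (Or.inl ⟨h1, h2⟩)
    · by_cases h2 : j = c.overStrand ∧ i = c.underStrand
      · exact Or.inl (Or.inr ⟨h2.2, h2.1⟩)
      · exact Or.inr (Or.inl ⟨h1, h2⟩)

theorem above_of_step (h : CrossStep c ab ab') (hab : IsOrder ab) {p q : P.Strand m × P.Strand m}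
    (hp : ab' p.1 p.2) (hq : P.Step (.inl c) p q) : ab q.1 q.2 := by
  obtain ⟨hpc, hq⟩ := hq
  rcases (h.iff _ _).1 hp with ⟨h1, h2⟩ | h1
  · rcases hq with rfl | ⟨h3, rfl⟩ | ⟨h3, rfl⟩
    · exact h1
    · rw [h3] at h1 h2
      have : p.2 ≠ c.underStrand := fun h' => h2 ⟨rfl, h'⟩
      rcases hab.total this with h4 | h4
      · exact absurd h4 (h.adjacent _ h1)
      · exact h4
    · rw [h3] at h1 h2
      have : p.1 ≠ c.overStrand := fun h' => h2 ⟨h', rfl⟩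
      rcases hab.total this with h4 | h4
      · exact h4
      · exact absurd h1 (h.adjacent _ h4)
  · exact absurd h1 hpc

end CrossStep

/-- The events in `L`, listed from right to left, are crossings of adjacent strands (or base points)
and change the order `ab₀` on their left to the order on their right. -/
inductive Transit (ab₀ : P.Strand m → P.Strand m → Prop) :
    List (P.Event m) → (P.Strand m → P.Strand m → Prop) → Prop
  | nil : Transit ab₀ [] ab₀
  | cross {L ab ab'} (c : P.Cross m) : Transit ab₀ L ab → CrossStep c ab ab' →
      Transit ab₀ (.inl c :: L) ab'
  | base {L ab} (b : P.base × Fin m) : Transit ab₀ L ab → Transit ab₀ (.inr b :: L) ab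

namespace Transit

variable {ab₀ ab₁ ab₂ : P.Strand m → P.Strand m → Prop} {L L' : List (P.Event m)}

theorem isOrder (h : Transit ab₀ L ab₁) (h0 : IsOrder ab₀) : IsOrder ab₁ := by
  induction h with
  | nil => exact h0
  | cross c _ hc ih => exact hc.isOrder ih
  | base b _ ih => exact ih

theorem append (h : Transit ab₀ L ab₁) (h' : Transit ab₁ L' ab₂) : Transit ab₀ (L' ++ L) ab₂ := by
  induction h' with
  | nil => exact h
  | cross c _ hc ih => exact .cross c ih hc
  | base b _ ih => exact .base b ih

theorem split (h : Transit ab₀ (L' ++ L) ab₂) : ∃ ab₁, Transit ab₀ L ab₁ ∧ Transit ab₁ L' ab₂ := by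
  induction L' generalizing ab₂ with
  | nil => exact ⟨_, h, .nil⟩
  | cons ev L' ih =>
    cases h with
    | cross c h hc =>
      obtain ⟨ab₁, h1, h2⟩ := ih h
      exact ⟨ab₁, h1, .cross c h2 hc⟩
    | base b h =>
      obtain ⟨ab₁, h1, h2⟩ := ih h
      exact ⟨ab₁, h1, .base b h2⟩

/-- Only the values of `e` on pairs of strands in the right order matter. -/
theorem diskSum_congr {A : Type*} [Ring A] {x : P.Cross m → A} {t : P.Base m → Aˣ}
    {e e' : P.Strand m × P.Strand m → A} (h : Transit ab₀ L ab₁) (h0 : IsOrder ab₀)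
    (he : ∀ q, ab₀ q.1 q.2 → e q = e' q) {p : P.Strand m × P.Strand m} (hp : ab₁ p.1 p.2) :
    diskSum x t e L p = diskSum x t e' L p := by
  induction h generalizing p with
  | nil => rw [diskSum_nil, diskSum_nil, he p hp]
  | cross c hL hc ih =>
    rw [diskSum_cons, diskSum_cons]
    exact Finset.sum_congr rfl fun q _ => by rw [ih (hc.above_of_step (hL.isOrder h0) hp q.2)]
  | base b hL ih => rw [diskSum_base, diskSum_base, ih hp]

end Transit

/-! ## The Maurer-Cartan equation -/

section MaurerCartan

variable {A : Type*} [Ring A] {gr : ZMod (2 * r) → AddSubgroup A} {d : A →+ A}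

theorem sgn_smul_comm_mul (k l : ℤ) (a b : A) : (k • a) * (l • b) = (k * l) • (a * b) := by
  rw [smul_mul_assoc, mul_smul_comm, smul_smul]

/-- The matrix with entries `(-1)^{μ i - μ j} M i j`. -/
def bar (M : Matrix (P.Strand m) (P.Strand m) A) : Matrix (P.Strand m) (P.Strand m) A :=
  .of fun i j => sgn (P.μ i.1 - P.μ j.1) • M i j

theorem bar_add (M N : Matrix (P.Strand m) (P.Strand m) A) : bar (M + N) = bar M + bar N := by
  ext i j
  simp [bar]

theorem bar_sub (M N : Matrix (P.Strand m) (P.Strand m) A) : bar (M - N) = bar M - bar N := by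
  ext i j
  simp [bar, mul_sub]

theorem bar_smul (s : ℤ) (M : Matrix (P.Strand m) (P.Strand m) A) :
    bar (s • M) = s • bar M := by
  ext i j
  simp only [bar, Matrix.of_apply, Matrix.smul_apply]
  rw [smul_comm]

theorem bar_mul (M N : Matrix (P.Strand m) (P.Strand m) A) : bar (M * N) = bar M * bar N := by
  ext i j
  simp only [bar, Matrix.of_apply, Matrix.mul_apply, Finset.smul_sum]
  refine Finset.sum_congr rfl fun l _ => ?_
  rw [sgn_smul_comm_mul, ← sgn_add]
  congr 2
  ring

theorem bar_single (i j : P.Strand m) (a : A) :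
    bar (Matrix.single i j a) = sgn (P.μ i.1 - P.μ j.1) • Matrix.single i j a := by
  ext k l
  simp only [bar, Matrix.of_apply, Matrix.smul_apply, Matrix.single_apply]
  split_ifs with h
  · rw [h.1, h.2]
  · simp

/-- The Leibniz rule for products of matrices with homogeneous entries. -/
theorem map_d_mul (hA : IsPreDGA gr d) {M : Matrix (P.Strand m) (P.Strand m) A}
    (N : Matrix (P.Strand m) (P.Strand m) A) (e : ZMod (2 * r))
    (hM : ∀ i j, M i j ∈ gr (P.μ i.1 - P.μ j.1 + e)) :
    d.mapMatrix (M * N) = d.mapMatrix M * N + sgn e • (bar M * d.mapMatrix N) := by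
  ext i j
  simp only [AddMonoidHom.mapMatrix_apply, Matrix.map_apply, Matrix.mul_apply, Matrix.add_apply,
    Matrix.smul_apply, map_sum, bar, Matrix.of_apply, Finset.smul_sum, ← Finset.sum_add_distrib]
  refine Finset.sum_congr rfl fun l _ => ?_
  rw [hA.leibniz _ (hM i l), sgn_add, smul_mul_assoc, smul_smul, mul_comm (sgn e)]

/-- The values of a function on pairs of strands in the right order, as a matrix. -/
def upperMatrix (ab : P.Strand m → P.Strand m → Prop) (D : P.Strand m × P.Strand m → A) :
    Matrix (P.Strand m) (P.Strand m) A :=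
  .of fun i j => if ab i j then D (i, j) else 0

/-- The equation which the pairs of left endpoints satisfy. -/
def IsMaurerCartan (d : A →+ A) (ab : P.Strand m → P.Strand m → Prop)
    (D : P.Strand m × P.Strand m → A) : Prop :=
  d.mapMatrix (upperMatrix ab D) = bar (upperMatrix ab D) * upperMatrix ab D

theorem isMaurerCartan_iff {ab : P.Strand m → P.Strand m → Prop} (hab : IsOrder ab)
    {D : P.Strand m × P.Strand m → A} : IsMaurerCartan d ab D ↔
      ∀ i j, ab i j → d (D (i, j)) = ∑ l : {l : P.Strand m // ab i l ∧ ab l j},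
        sgn (P.μ i.1 - P.μ l.1.1) • (D (i, l) * D (l, j)) := by
  have key : ∀ i j, (bar (upperMatrix ab D) * upperMatrix ab D) i j =
      ∑ l : {l : P.Strand m // ab i l ∧ ab l j},
        sgn (P.μ i.1 - P.μ l.1.1) • (D (i, l) * D (l, j)) := by
    intro i j
    rw [← Finset.sum_subtype (Finset.univ.filter fun l => ab i l ∧ ab l j) (by simp)
      (f := fun l => sgn (P.μ i.1 - P.μ l.1) • (D (i, l) * D (l, j))), Finset.sum_filter,
      Matrix.mul_apply]
    refine Finset.sum_congr rfl fun l _ => ?_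
    simp only [bar, upperMatrix, Matrix.of_apply]
    by_cases h1 : ab i l <;> by_cases h2 : ab l j <;> simp [h1, h2, mul_assoc]
  constructor
  · intro h i j hij
    have := congrFun (congrFun h i) j
    rw [key] at this
    simpa [upperMatrix, hij] using this
  · intro h
    ext i j
    rw [key]
    by_cases hij : ab i j
    · rw [← h i j hij]
      simp [upperMatrix, hij]
    · rw [Fintype.sum_eq_zero]
      · simp [upperMatrix, hij]
      · intro l
        exact absurd (hab.trans l.2.1 l.2.2) hij

theorem d_d_eq_zero_of_isMaurerCartan (hA : IsPreDGA gr d)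
    {ab : P.Strand m → P.Strand m → Prop} {D : P.Strand m × P.Strand m → A}
    (hD : ∀ p, D p ∈ gr (P.μ p.1.1 - P.μ p.2.1 - 1)) (h : IsMaurerCartan d ab D)
    {i j : P.Strand m} (hij : ab i j) : d (d (D (i, j))) = 0 := by
  have hM : ∀ i j, bar (upperMatrix ab D) i j ∈ gr (P.μ i.1 - P.μ j.1 + (-1)) := by
    intro i j
    simp only [bar, upperMatrix, Matrix.of_apply]
    refine zsmul_mem ?_ _
    split_ifs
    · rw [← sub_eq_add_neg]
      exact hD (i, j)
    · exact zero_mem _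
  have hbar : ∀ M : Matrix (P.Strand m) (P.Strand m) A, d.mapMatrix (bar M) = bar (d.mapMatrix M) := by
    intro M
    ext i j
    exact map_zsmul d _ _
  have hbb : ∀ M : Matrix (P.Strand m) (P.Strand m) A, bar (bar M) = M := by
    intro M
    ext i j
    simp only [bar, Matrix.of_apply, smul_smul, sgn_mul_self, one_smul]
  have h2 : d.mapMatrix (d.mapMatrix (upperMatrix ab D)) = 0 := by
    rw [h, map_d_mul hA _ _ hM, hbar, h, bar_mul, hbb, mul_assoc, sgn_neg, sgn_one, neg_smul,
      one_smul, add_neg_cancel]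
  have := congrFun (congrFun h2 i) j
  simpa [upperMatrix, hij] using this

/-- The equation is preserved at a crossing. -/
theorem IsMaurerCartan.cross (hA : IsPreDGA gr d) {c : P.Cross m}
    {ab ab' : P.Strand m → P.Strand m → Prop} (hc : CrossStep c ab ab') (hab : IsOrder ab)
    {x : P.Cross m → A} {t : P.Base m → Aˣ} {e : P.Strand m × P.Strand m → A}
    {L : List (P.Event m)} (hx : x c ∈ gr c.deg)
    (hD : ∀ p, diskSum x t e L p ∈ gr (P.μ p.1.1 - P.μ p.2.1 - 1))
    (hdx : d (x c) = diskSum x t e L (c.overStrand, c.underStrand))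
    (h : IsMaurerCartan d ab (diskSum x t e L)) :
    IsMaurerCartan d ab' (diskSum x t e (.inl c :: L)) := by
  set M := upperMatrix ab (diskSum x t e L) with hM
  set E : Matrix (P.Strand m) (P.Strand m) A := .single c.overStrand c.underStrand (x c) with hE
  set E' : Matrix (P.Strand m) (P.Strand m) A :=
    .single c.overStrand c.underStrand (M c.overStrand c.underStrand) with hE'
  have hne := c.over_ne_under
  have ho := h
  have hno : ¬ ab c.underStrand c.overStrand := hab.asymm hc.over_under
  have hMno : M c.underStrand c.overStrand = 0 := by simp [hM, upperMatrix, hno]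
  have hdeg : ∀ i j, M i j ∈ gr (P.μ i.1 - P.μ j.1 + (-1)) := by
    intro i j
    simp only [hM, upperMatrix, Matrix.of_apply]
    split_ifs
    · rw [← sub_eq_add_neg]
      exact hD (i, j)
    · exact zero_mem _
  have hEdeg : ∀ i j, E i j ∈ gr (P.μ i.1 - P.μ j.1 + 0) := by
    intro i j
    rw [hE, Matrix.single_apply]
    split_ifs with hij
    · rw [← hij.1, ← hij.2, add_zero]
      exact hx
    · exact zero_mem _
  have hM' : upperMatrix ab' (diskSum x t e (.inl c :: L)) =
      M - sgn c.deg • (E * M) + M * E - E' := by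
    ext i j
    have e1 : (E * M) i j = if i = c.overStrand then x c * M c.underStrand j else 0 := by
      split_ifs with hi
      · rw [hi, hE, Matrix.single_mul_apply_same]
      · rw [hE, Matrix.single_mul_apply_of_ne _ _ _ _ _ hi]
    have e2 : (M * E) i j = if j = c.underStrand then M i c.overStrand * x c else 0 := by
      split_ifs with hj
      · rw [hj, hE, Matrix.mul_single_apply_same]
      · rw [hE, Matrix.mul_single_apply_of_ne _ _ _ _ _ hj]
    have e3 : E' i j = if i = c.overStrand ∧ j = c.underStrand then M i j else 0 := by
      rw [hE', Matrix.single_apply]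
      by_cases h3 : i = c.overStrand ∧ j = c.underStrand
      · rw [if_pos h3, if_pos ⟨h3.1.symm, h3.2.symm⟩, h3.1, h3.2]
      · rw [if_neg h3, if_neg fun h4 => h3 ⟨h4.1.symm, h4.2.symm⟩]
    simp only [Matrix.sub_apply, Matrix.add_apply, Matrix.smul_apply, e1, e2, e3]
    have hs : sgn (c.deg + 1) = - sgn c.deg := by rw [sgn_add, sgn_one, mul_neg_one]
    have hirr := hab.irrefl
    simp only [hM, upperMatrix, Matrix.of_apply, hc.iff, diskSum_cross, hs, Prod.mk.injEq]
    by_cases hi : i = c.overStrand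
    · have hiu : i ≠ c.underStrand := hi ▸ hne
      subst hi
      by_cases hj : j = c.underStrand
      · subst hj
        simp [hne, hirr]
      · have hj1 : ab c.overStrand j ↔ ab c.underStrand j := by
          constructor
          · intro h1
            rcases hab.total hj with h2 | h2
            · exact absurd h2 (hc.adjacent _ h1)
            · exact h2
          · exact fun h1 => hab.trans hc.over_under h1
        by_cases h1 : ab c.underStrand j
        · simp [hne, hj, h1, hj1, sub_eq_add_neg, mul_assoc]
        · simp [hne, hj, h1, hj1]
    · by_cases hj : j = c.underStrand
      · subst hj
        have hj1 : ab i c.underStrand ↔ ab i c.overStrand := by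
          constructor
          · intro h1
            rcases hab.total hi with h2 | h2
            · exact h2
            · exact absurd h1 (hc.adjacent _ h2)
          · exact fun h1 => hab.trans h1 hc.over_under
        by_cases h1 : ab i c.overStrand
        · simp [hi, hne.symm, h1, hj1]
        · simp [hi, hne.symm, h1, hj1]
      · by_cases h1 : i = c.underStrand ∧ j = c.overStrand
        · obtain ⟨rfl, rfl⟩ := h1
          simp [hno, hne, hne.symm]
        · have h2 : i = c.underStrand → j ≠ c.overStrand := fun h3 h4 => h1 ⟨h3, h4⟩
          by_cases h5 : ab i j
          · simp [hi, hj, h1, h5]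
          · simp [hi, hj, h1, h5]
  have hbM : ∀ l, bar M c.overStrand l * M l c.underStrand = 0 := by
    intro l
    simp only [bar, hM, upperMatrix, Matrix.of_apply]
    by_cases h1 : ab c.overStrand l
    · simp [hc.adjacent l h1]
    · simp [h1]
  have hbM' : (bar M * M) c.underStrand c.overStrand = 0 := by
    rw [Matrix.mul_apply]
    refine Finset.sum_eq_zero fun l _ => ?_
    simp only [bar, hM, upperMatrix, Matrix.of_apply]
    by_cases h1 : ab c.underStrand l
    · have : ¬ ab l c.overStrand := fun h2 => hno (hab.trans h1 h2)
      simp [this]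
    · simp [h1]
  have dE : d.mapMatrix E = E' := by
    have : d (x c) = M c.overStrand c.underStrand := by
      simp [hdx, hM, upperMatrix, hc.over_under]
    ext i j
    simp only [AddMonoidHom.mapMatrix_apply, Matrix.map_apply, hE, hE', Matrix.single_apply]
    split_ifs
    · exact this
    · exact map_zero d
  have dE' : d.mapMatrix E' = 0 := by
    have : d (M c.overStrand c.underStrand) = 0 := by
      have := congrFun (congrFun h c.overStrand) c.underStrand
      rw [Matrix.mul_apply, Finset.sum_eq_zero fun l _ => hbM l] at this
      exact this
    ext i j
    simp only [AddMonoidHom.mapMatrix_apply, Matrix.map_apply, hE', Matrix.single_apply]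
    split_ifs
    · exact this
    · exact map_zero d
  have sEM : ∀ X Y : A, ∀ N : Matrix (P.Strand m) (P.Strand m) A,
      N c.underStrand c.overStrand = 0 → Matrix.single c.overStrand c.underStrand X * (N *
        Matrix.single c.overStrand c.underStrand Y) = 0 := by
    intro X Y N hN
    rw [← mul_assoc, Matrix.single_mul_mul_single, hN]
    simp
  have sEM2 : ∀ X Y : A, ∀ N Z : Matrix (P.Strand m) (P.Strand m) A,
      N c.underStrand c.overStrand = 0 → Matrix.single c.overStrand c.underStrand X * (N *
        (Matrix.single c.overStrand c.underStrand Y * Z)) = 0 := by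
    intro X Y N Z hN
    rw [← mul_assoc N, ← mul_assoc, sEM X Y N hN, zero_mul]
  have ss : ∀ X Y : A, Matrix.single c.overStrand c.underStrand X *
      Matrix.single c.overStrand c.underStrand Y = 0 := by
    intro X Y
    rw [Matrix.single_mul_single_of_ne]
    exact hne.symm
  have ss2 : ∀ X Y : A, ∀ Z, Matrix.single c.overStrand c.underStrand X *
      (Matrix.single c.overStrand c.underStrand Y * Z) = 0 := by
    intro X Y Z
    rw [← mul_assoc, ss, zero_mul]
  have hbno : bar M c.underStrand c.overStrand = 0 := by simp [bar, hMno]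
  have hbE : bar E = sgn c.deg • E := bar_single _ _ _
  have hbE' : bar E' = sgn c.deg • E' := bar_single _ _ _
  unfold IsMaurerCartan at h ⊢
  rw [← hM] at h
  rw [hM', map_sub, map_add, map_sub, map_zsmul, dE', map_d_mul hA _ 0 hEdeg,
    map_d_mul hA _ (-1) hdeg, dE, h, bar_sub, bar_add, bar_sub, bar_smul, bar_mul, bar_mul,
    hbE, hbE', sgn_neg, sgn_one, sgn_zero]
  have hs : sgn c.deg = 1 ∨ sgn c.deg = -1 := by
    unfold sgn
    split_ifs <;> simp
  have f1 := sEM (x c) (x c) M hMno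
  have f2 := sEM (x c) (x c) (bar M) hbno
  have f3 := sEM (x c) (M c.overStrand c.underStrand) (bar M) hbno
  have f4 := sEM (M c.overStrand c.underStrand) (x c) M hMno
  have f5 := sEM (x c) (x c) _ hbM'
  have f6 := fun Z => sEM2 (x c) (x c) (bar M) Z hbno
  have g1 := ss (x c) (x c)
  have g2 := ss (x c) (M c.overStrand c.underStrand)
  have g3 := ss (M c.overStrand c.underStrand) (x c)
  have g4 := ss (M c.overStrand c.underStrand) (M c.overStrand c.underStrand)
  have k1 := ss2 (x c) (x c)
  have k2 := ss2 (x c) (M c.overStrand c.underStrand)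
  have k3 := ss2 (M c.overStrand c.underStrand) (x c)
  rw [mul_assoc] at f5
  simp only [← hE, ← hE'] at f1 f2 f3 f4 f5 f6 g1 g2 g3 g4 k1 k2 k3
  rcases hs with hs | hs <;> rw [hs] <;>
    simp only [one_smul, neg_smul, mul_add, add_mul, mul_sub, sub_mul, mul_assoc, neg_mul, mul_neg,
      neg_neg, f1, f2, f3, f4, f5, f6, g1, g2, g3, g4, k1, k2, k3, mul_zero, sub_zero, add_zero,
      zero_add, neg_zero, sub_neg_eq_add] <;> abel

end MaurerCartan

end PreferredPlat

end

noncomputable section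

namespace PreferredPlat

open Classical SFAlg

variable {r : ℕ} {Λ : Set (ℝ × ℝ × ℝ)} {P : PreferredPlat r Λ} {m : ℕ}

section MaurerCartan

variable {A : Type*} [Ring A] {gr : ZMod (2 * r) → AddSubgroup A} {d : A →+ A}

theorem signedBase_mem {B : AddSubgroup A} {t : P.Base m → Aˣ} {b : P.Base m}
    (h : (t b).1 ∈ B) (h' : (t b)⁻¹.1 ∈ B) (q : Prop) : signedBase t b q ∈ B := by
  unfold signedBase
  split_ifs
  exacts [h, h']

theorem baseUpper_mem {B : AddSubgroup A} (hB : 1 ∈ B) {t : P.Base m → Aˣ}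
    (ht : ∀ b, (t b).1 ∈ B ∧ (t b)⁻¹.1 ∈ B) (b : P.base × Fin m) (i : P.Strand m) :
    baseUpper t b i ∈ B := by
  unfold baseUpper
  split_ifs
  exacts [signedBase_mem (ht _).1 (ht _).2 _, hB]

theorem baseLower_mem {B : AddSubgroup A} (hB : 1 ∈ B) {t : P.Base m → Aˣ}
    (ht : ∀ b, (t b).1 ∈ B ∧ (t b)⁻¹.1 ∈ B) (b : P.base × Fin m) (i : P.Strand m) :
    baseLower t b i ∈ B := by
  unfold baseLower
  split_ifs
  exacts [signedBase_mem (ht _).1 (ht _).2 _, hB]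

theorem baseLower_mul_baseUpper (t : P.Base m → Aˣ) (b : P.base × Fin m) (i : P.Strand m) :
    baseLower t b i * baseUpper t b i = 1 := by
  unfold baseLower baseUpper signedBase
  split_ifs <;> simp

/-- The degree of a sum over disks. -/
theorem diskSum_mem (hA : IsPreDGA gr d) {x : P.Cross m → A} {t : P.Base m → Aˣ}
    {e : P.Strand m × P.Strand m → A} (hx : ∀ c, x c ∈ gr c.deg)
    (ht : ∀ b, (t b).1 ∈ gr 0 ∧ (t b)⁻¹.1 ∈ gr 0)
    (he : ∀ p, e p ∈ gr (P.μ p.1.1 - P.μ p.2.1 - 1)) (L : List (P.Event m))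
    (p : P.Strand m × P.Strand m) : diskSum x t e L p ∈ gr (P.μ p.1.1 - P.μ p.2.1 - 1) := by
  induction L generalizing p with
  | nil => rw [diskSum_nil]; exact he p
  | cons ev L ih =>
    cases ev with
    | inl c =>
      rw [diskSum_cross]
      split_ifs with h1 h2 h3 h3
      · exact zero_mem _
      all_goals try rw [add_zero]
      all_goals try rw [add_zero]
      all_goals try refine add_mem ?_ ?_
      all_goals try refine add_mem ?_ ?_
      all_goals first
        | exact ih _
        | skip
      all_goals first
        | (rw [smul_mul_assoc]
           refine zsmul_mem ?_ _
           have := hA.mul_mem (hx c) (ih (c.underStrand, p.2))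
           rw [h2]
           convert this using 2
           simp only [Cross.deg]
           ring)
        | (have := hA.mul_mem (ih (p.1, c.overStrand)) (hx c)
           rw [h3]
           convert this using 2
           simp only [Cross.deg]
           ring)
    | inr b =>
      rw [diskSum_base]
      have := hA.mul_mem (hA.mul_mem (baseUpper_mem hA.one_mem ht b p.1) (ih p))
        (baseLower_mem hA.one_mem ht b p.2)
      rwa [zero_add, add_zero] at this

theorem IsMaurerCartan.base (hA : IsPreDGA gr d) {ab : P.Strand m → P.Strand m → Prop}
    (hab : IsOrder ab) (b : P.base × Fin m) {x : P.Cross m → A} {t : P.Base m → Aˣ}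
    {e : P.Strand m × P.Strand m → A} {L : List (P.Event m)}
    (ht : ∀ b, (t b).1 ∈ gr 0 ∧ (t b)⁻¹.1 ∈ gr 0) (hdt : ∀ b, d (t b).1 = 0)
    (hD : ∀ p, diskSum x t e L p ∈ gr (P.μ p.1.1 - P.μ p.2.1 - 1))
    (h : IsMaurerCartan d ab (diskSum x t e L)) :
    IsMaurerCartan d ab (diskSum x t e (.inr b :: L)) := by
  rw [isMaurerCartan_iff hab] at h ⊢
  have hdt' : ∀ b, (t b).1 ∈ d.ker ∧ (t b)⁻¹.1 ∈ d.ker := fun b =>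
    ⟨hdt b, hA.d_inv (ht b).1 (hdt b)⟩
  have du : ∀ i, d (baseUpper t b i) = 0 := baseUpper_mem (B := d.ker) hA.d_one hdt' b
  have dl : ∀ i, d (baseLower t b i) = 0 := baseLower_mem (B := d.ker) hA.d_one hdt' b
  intro i j hij
  rw [diskSum_base, mul_assoc, hA.leibniz _ (baseUpper_mem hA.one_mem ht b _), du, zero_mul,
    zero_add, sgn_zero, one_smul, hA.leibniz _ (hD _), dl, mul_zero, smul_zero, add_zero, h i j hij,
    Finset.sum_mul, Finset.mul_sum]
  refine Finset.sum_congr rfl fun l _ => ?_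
  rw [diskSum_base, diskSum_base, smul_mul_assoc, mul_smul_comm]
  congr 1
  simp only [mul_assoc]
  rw [← mul_assoc (baseLower t b _) (baseUpper t b _), baseLower_mul_baseUpper, one_mul]

/-- Sums over disks satisfy the Maurer-Cartan equation if their left ends do. -/
theorem Transit.isMaurerCartan (hA : IsPreDGA gr d) {ab₀ ab₁ : P.Strand m → P.Strand m → Prop}
    {x : P.Cross m → A} {t : P.Base m → Aˣ} {e : P.Strand m × P.Strand m → A}
    {L : List (P.Event m)} (h : Transit ab₀ L ab₁) (h0 : IsOrder ab₀) (hx : ∀ c, x c ∈ gr c.deg)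
    (ht : ∀ b, (t b).1 ∈ gr 0 ∧ (t b)⁻¹.1 ∈ gr 0) (hdt : ∀ b, d (t b).1 = 0)
    (he : ∀ p, e p ∈ gr (P.μ p.1.1 - P.μ p.2.1 - 1)) (hMC : IsMaurerCartan d ab₀ e)
    (hdx : ∀ L₁ c L₂, L = L₁ ++ .inl c :: L₂ →
      d (x c) = diskSum x t e L₂ (c.overStrand, c.underStrand)) :
    IsMaurerCartan d ab₁ (diskSum x t e L) := by
  induction h with
  | nil =>
    have : diskSum x t e ([] : List (P.Event m)) = e := funext fun p => diskSum_nil x t e p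
    rwa [this]
  | cross c hL hc ih =>
    exact IsMaurerCartan.cross hA hc (hL.isOrder h0) (hx c) (diskSum_mem hA hx ht he _)
      (hdx [] c _ rfl) (ih fun L₁ c' L₂ h' => hdx (_ :: L₁) c' L₂ (by rw [h']; rfl))
  | base b hL ih =>
    exact IsMaurerCartan.base hA (hL.isOrder h0) b ht hdt (diskSum_mem hA hx ht he _)
      (ih fun L₁ c' L₂ h' => hdx (_ :: L₁) c' L₂ (by rw [h']; rfl))

end MaurerCartan

/-! ## Lists of crossings which reverse a set of pairs -/

/-- The relation `ab`, reversed on the pairs in `K`. -/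
def flipOn {S : Type*} (ab : S → S → Prop) (K : Set (S × S)) (i j : S) : Prop :=
  (ab i j ∧ (i, j) ∉ K) ∨ (j, i) ∈ K

/-- The pairs of over- and understrands of the crossings with a property. -/
def crossPairs (q : P.Cross m → Prop) : Set (P.Strand m × P.Strand m) :=
  {p | ∃ c, q c ∧ p = (c.overStrand, c.underStrand)}

theorem transit_of_pairwise {ab : P.Strand m → P.Strand m → Prop} (hab : IsOrder ab)
    {R : P.Cross m → P.Cross m → Prop} (hR : ∀ c c', R c c' → ¬ R c' c)
    (hne : ∀ c c', R c c' →
      (c.overStrand, c.underStrand) ≠ (c'.overStrand, c'.underStrand))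
    (l : List (P.Cross m)) (hl : l.Pairwise R) (hou : ∀ c ∈ l, ab c.overStrand c.underStrand)
    (hadj : ∀ c ∈ l, ∀ w, flipOn ab (crossPairs fun c' => c' ∈ l ∧ R c' c) c.overStrand w →
      ¬ flipOn ab (crossPairs fun c' => c' ∈ l ∧ R c' c) w c.underStrand) :
    Transit ab (l.map Sum.inl).reverse (flipOn ab (crossPairs (· ∈ l))) := by
  induction l using List.reverseRecOn with
  | nil =>
    have : flipOn ab (crossPairs (· ∈ ([] : List (P.Cross m)))) = ab := by
      ext i j
      simp [flipOn, crossPairs]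
    rw [this]
    exact .nil
  | append_singleton l c ih =>
    rw [List.pairwise_append] at hl
    obtain ⟨hl, -, hlc⟩ := hl
    have hlc : ∀ a ∈ l, R a c := fun a ha => hlc a ha c (by simp)
    have hK : (crossPairs fun c' => c' ∈ l ++ [c] ∧ R c' c) = crossPairs (· ∈ l) := by
      ext p
      simp only [crossPairs, Set.mem_ofPred_eq, List.mem_append, List.mem_singleton]
      refine exists_congr fun c' => and_congr_left fun _ => ⟨?_, fun h => ⟨Or.inl h, hlc c' h⟩⟩
      rintro ⟨h | rfl, h'⟩
      · exact h
      · exact absurd h' (hR _ _ h')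
    have ih := ih hl (fun c' hc' => hou c' (by simp [hc'])) (by
      intro c' hc'
      have : (crossPairs fun c'' => c'' ∈ l ++ [c] ∧ R c'' c') =
          crossPairs fun c'' => c'' ∈ l ∧ R c'' c' := by
        ext p
        simp only [crossPairs, Set.mem_ofPred_eq, List.mem_append, List.mem_singleton]
        refine exists_congr fun c'' => and_congr_left fun _ =>
          ⟨?_, fun h => ⟨Or.inl h.1, h.2⟩⟩
        rintro ⟨h | rfl, h'⟩
        · exact ⟨h, h'⟩
        · exact absurd h' (hR _ _ (hlc c' hc'))
      rw [← this]
      exact hadj c' (by simp [hc']))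
    rw [List.map_append, List.reverse_append]
    have hcou := hou c (by simp)
    refine .cross c ih ⟨Or.inl ⟨hcou, ?_⟩, ?_, ?_⟩
    · rintro ⟨c', hc', h⟩
      exact hne _ _ (hlc c' hc') h.symm
    · have := hadj c (by simp)
      rwa [hK] at this
    · intro i j
      have hK' : ∀ p, p ∈ crossPairs (· ∈ l ++ [c]) ↔
          p ∈ crossPairs (· ∈ l) ∨ p = (c.overStrand, c.underStrand) := by
        intro p
        simp only [crossPairs, Set.mem_ofPred_eq, List.mem_append, List.mem_singleton]
        constructor
        · rintro ⟨c', h | rfl, h'⟩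
          · exact Or.inl ⟨c', h, h'⟩
          · exact Or.inr h'
        · rintro (⟨c', h, h'⟩ | h)
          · exact ⟨c', Or.inl h, h'⟩
          · exact ⟨c, Or.inr rfl, h⟩
      have hno : (c.underStrand, c.overStrand) ∉ crossPairs (· ∈ l) := by
        rintro ⟨c', hc', h⟩
        obtain ⟨h1, h2⟩ := Prod.mk.inj h
        have := hou c' (by simp [hc'])
        rw [← h1, ← h2] at this
        exact hab.asymm this hcou
      simp only [flipOn, hK', Prod.mk.injEq, not_or]
      constructor
      · rintro (⟨h1, h2, h3⟩ | h | ⟨rfl, rfl⟩)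
        · exact Or.inl ⟨Or.inl ⟨h1, h2⟩, h3⟩
        · refine Or.inl ⟨Or.inr h, ?_⟩
          rintro ⟨rfl, rfl⟩
          exact hno h
        · exact Or.inr ⟨rfl, rfl⟩
      · rintro (⟨⟨h1, h2⟩ | h, h3⟩ | ⟨rfl, rfl⟩)
        · exact Or.inl ⟨h1, h2, h3⟩
        · exact Or.inr (Or.inl h)
        · exact Or.inr (Or.inr ⟨rfl, rfl⟩)

/-! ## Orders of the strands of the copies -/

/-- The order of the strands of the copies given by an order of the strands of `Λ`. -/
def copyOrder {S : Type*} (m : ℕ) (ab : S → S → Prop) (i j : S × Fin m) : Prop :=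
  (i.1 ≠ j.1 ∧ ab i.1 j.1) ∨ (i.1 = j.1 ∧ i.2 < j.2)

theorem copyOrder_isOrder {S : Type*} {ab : S → S → Prop} (h : IsOrder ab) :
    IsOrder (copyOrder m ab) where
  irrefl i hi := by
    rcases hi with hi | hi
    · exact hi.1 rfl
    · exact lt_irrefl _ hi.2
  trans {i j k} hij hjk := by
    rcases hij with ⟨h1, h2⟩ | ⟨h1, h2⟩ <;> rcases hjk with ⟨h3, h4⟩ | ⟨h3, h4⟩
    · have := h.trans h2 h4
      refine Or.inl ⟨fun h5 => ?_, this⟩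
      rw [h5] at this
      exact h.irrefl _ this
    · rw [h3] at h1 h2
      exact Or.inl ⟨h1, h2⟩
    · rw [← h1] at h3 h4
      exact Or.inl ⟨h3, h4⟩
    · exact Or.inr ⟨h1.trans h3, h2.trans h4⟩
  total {i j} hij := by
    by_cases h1 : i.1 = j.1
    · have : i.2 ≠ j.2 := fun h2 => hij (Prod.ext h1 h2)
      rcases this.lt_or_gt with h2 | h2
      · exact Or.inl (Or.inr ⟨h1, h2⟩)
      · exact Or.inr (Or.inr ⟨h1.symm, h2⟩)
    · rcases h.total h1 with h2 | h2
      · exact Or.inl (Or.inl ⟨h1, h2⟩)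
      · exact Or.inr (Or.inl ⟨fun h3 => h1 h3.symm, h2⟩)

/-- The order of the strands next to cusps with heights `z`, if `e` gives the upper and lower
strands at the cusps. -/
def nearCuspOrder {S : Type*} {n : ℕ} (e : Fin n × Bool ≃ S) (z : Fin n → ℝ) (i j : S) : Prop :=
  z (e.symm j).1 < z (e.symm i).1 ∨
    ((e.symm i).1 = (e.symm j).1 ∧ (e.symm i).2 = true ∧ (e.symm j).2 = false)

/-- The order of the strands of the copies next to cusps, where nothing has been crossed yet. -/
def cuspOrder {S : Type*} {n : ℕ} (m : ℕ) (e : Fin n × Bool ≃ S) (z : Fin n → ℝ)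
    (i j : S × Fin m) : Prop :=
  z (e.symm j.1).1 < z (e.symm i.1).1 ∨ ((e.symm i.1).1 = (e.symm j.1).1 ∧
    (i.2 < j.2 ∨ (i.2 = j.2 ∧ (e.symm i.1).2 = true ∧ (e.symm j.1).2 = false)))

theorem nearCuspOrder_isOrder {S : Type*} {n : ℕ} (e : Fin n × Bool ≃ S) {z : Fin n → ℝ}
    (hz : Function.Injective z) : IsOrder (nearCuspOrder e z) where
  irrefl i hi := by
    rcases hi with hi | ⟨_, hi, hi'⟩
    · exact lt_irrefl _ hi
    · rw [hi] at hi'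
      exact Bool.noConfusion hi'
  trans {i j k} hij hjk := by
    unfold nearCuspOrder at *
    rcases hij with h1 | ⟨h1, h2, h3⟩ <;> rcases hjk with h4 | ⟨h4, h5, h6⟩
    · exact Or.inl (h4.trans h1)
    · rw [← h4]
      exact Or.inl h1
    · rw [h1]
      exact Or.inl h4
    · rw [h3] at h5
      exact Bool.noConfusion h5
  total {i j} hij := by
    unfold nearCuspOrder
    by_cases h : (e.symm i).1 = (e.symm j).1
    · have : (e.symm i).2 ≠ (e.symm j).2 := fun h2 => hij (e.symm.injective (Prod.ext h h2))
      cases hi : (e.symm i).2 <;> cases hj : (e.symm j).2 <;> simp_all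
    · rcases lt_or_gt_of_ne (hz.ne h) with h1 | h1
      · exact Or.inr (Or.inl h1)
      · exact Or.inl (Or.inl h1)

theorem cuspOrder_isOrder {S : Type*} {n : ℕ} (e : Fin n × Bool ≃ S) {z : Fin n → ℝ}
    (hz : Function.Injective z) : IsOrder (cuspOrder m e z) where
  irrefl i hi := by
    rcases hi with hi | ⟨_, hi | ⟨_, hi, hi'⟩⟩
    · exact lt_irrefl _ hi
    · exact lt_irrefl _ hi
    · rw [hi] at hi'
      exact Bool.noConfusion hi'
  trans {i j k} hij hjk := by
    unfold cuspOrder at *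
    rcases hij with h1 | ⟨h1, h2⟩ <;> rcases hjk with h4 | ⟨h4, h5⟩
    · exact Or.inl (h4.trans h1)
    · rw [← h4]
      exact Or.inl h1
    · rw [h1]
      exact Or.inl h4
    · refine Or.inr ⟨h1.trans h4, ?_⟩
      rcases h2 with h2 | ⟨h2, h2', h2''⟩ <;> rcases h5 with h5 | ⟨h5, h5', h5''⟩
      · exact Or.inl (h2.trans h5)
      · rw [← h5]
        exact Or.inl h2
      · rw [h2]
        exact Or.inl h5
      · rw [h2''] at h5'
        exact Bool.noConfusion h5'
  total {i j} hij := by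
    unfold cuspOrder
    by_cases h : (e.symm i.1).1 = (e.symm j.1).1
    · rcases lt_trichotomy i.2 j.2 with h1 | h1 | h1
      · exact Or.inl (Or.inr ⟨h, Or.inl h1⟩)
      · have : (e.symm i.1).2 ≠ (e.symm j.1).2 := fun h2 =>
          hij (Prod.ext (e.symm.injective (Prod.ext h h2)) h1)
        cases hi : (e.symm i.1).2 <;> cases hj : (e.symm j.1).2 <;> simp_all
      · exact Or.inr (Or.inr ⟨h.symm, Or.inl h1⟩)
    · rcases lt_or_gt_of_ne (hz.ne h) with h1 | h1
      · exact Or.inr (Or.inl h1)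
      · exact Or.inl (Or.inl h1)

end PreferredPlat

end

noncomputable section

namespace PreferredPlat

open Classical SFAlg

variable {r : ℕ} {Λ : Set (ℝ × ℝ × ℝ)} {P : PreferredPlat r Λ} {m : ℕ}

/-! ## The crossings of the copies near a crossing or near the cusps -/

/-- The order from left to right of the crossings near a crossing of `Λ` and near the cusps. -/
def Precedes : P.Cross m → P.Cross m → Prop
  | .dbl c i j, .dbl c' i' j' => c = c' ∧ (j < j' ∨ (j = j' ∧ i' < i))
  | .left k i j _, .left k' i' j' _ => k < k' ∨ (k = k' ∧ (j < j' ∨ (j = j' ∧ i' < i)))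
  | .right k i j _, .right k' i' j' _ => k < k' ∨ (k = k' ∧ (j' < j ∨ (j = j' ∧ i < i')))
  | _, _ => False

theorem Precedes.asymm (c c' : P.Cross m) (h : Precedes c c') : ¬ Precedes c' c := by
  intro h'
  cases c <;> cases c' <;> simp only [Precedes] at h h' <;> grind

theorem Precedes.ne (c c' : P.Cross m) (h : Precedes c c') :
    (c.overStrand, c.underStrand) ≠ (c'.overStrand, c'.underStrand) := by
  have hup : Function.Injective P.rup := fun k k' hk => by
    simpa using P.bijective_right.1 (a₁ := Sum.inl k) (a₂ := Sum.inl k') hk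
  intro h'
  cases c <;> cases c' <;> simp only [Precedes] at h <;>
    simp only [Cross.overStrand, Cross.underStrand, Prod.mk.injEq] at h'
  · grind
  · grind
  · have := @hup _ _ h'.1.1
    grind

theorem mem_dblList {c : P.Dbl} {c' : P.Cross m} :
    c' ∈ P.dblList m c ↔ ∃ i j, c' = .dbl c i j := by
  simp only [dblList, List.mem_flatMap, List.mem_finRange, true_and, List.mem_map,
    List.mem_reverse]
  grind

theorem mem_leftList {k : Fin P.n} {c' : P.Cross m} :
    c' ∈ P.leftList m k ↔ ∃ i j h, c' = .left k i j h := by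
  simp only [leftList, List.mem_flatMap, List.mem_finRange, true_and, List.mem_filterMap,
    List.mem_reverse]
  constructor
  · rintro ⟨j, i, h⟩
    split_ifs at h with hij
    exact ⟨i, j, hij, (Option.some.inj h).symm⟩
  · rintro ⟨i, j, hij, rfl⟩
    exact ⟨j, i, dif_pos hij⟩

theorem mem_rightList {k : Fin P.n} {c' : P.Cross m} :
    c' ∈ P.rightList m k ↔ ∃ i j h, c' = .right k i j h := by
  simp only [rightList, List.mem_flatMap, List.mem_finRange, true_and, List.mem_filterMap,
    List.mem_reverse]
  constructor
  · rintro ⟨j, i, h⟩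
    split_ifs at h with hij
    exact ⟨i, j, hij, (Option.some.inj h).symm⟩
  · rintro ⟨i, j, hij, rfl⟩
    exact ⟨j, i, dif_pos hij⟩

theorem pairwise_dblList (c : P.Dbl) : (P.dblList m c).Pairwise Precedes := by
  unfold dblList
  rw [List.pairwise_flatMap]
  refine ⟨fun j _ => ?_, (List.pairwise_lt_finRange m).imp ?_⟩
  · rw [List.pairwise_map, List.pairwise_reverse]
    exact (List.pairwise_lt_finRange m).imp fun h => ⟨rfl, Or.inr ⟨rfl, h⟩⟩
  · intro j j' hj x hx y hy
    simp only [List.mem_map] at hx hy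
    obtain ⟨i, -, rfl⟩ := hx
    obtain ⟨i', -, rfl⟩ := hy
    exact ⟨rfl, Or.inl hj⟩

theorem pairwise_leftList :
    ((List.finRange P.n).flatMap (P.leftList m)).Pairwise Precedes := by
  rw [List.pairwise_flatMap]
  refine ⟨fun k _ => ?_, (List.pairwise_lt_finRange _).imp ?_⟩
  · unfold leftList
    rw [List.pairwise_flatMap]
    refine ⟨fun j _ => ?_, (List.pairwise_lt_finRange m).imp ?_⟩
    · rw [List.pairwise_filterMap, List.pairwise_reverse]
      refine (List.pairwise_lt_finRange m).imp fun {i i'} h x hx y hy => ?_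
      split_ifs at hx hy with h1 h2
      obtain rfl := Option.some.inj hx
      obtain rfl := Option.some.inj hy
      exact Or.inr ⟨rfl, Or.inr ⟨rfl, h⟩⟩
    · intro j j' hj x hx y hy
      simp only [List.mem_filterMap] at hx hy
      obtain ⟨i, -, hx⟩ := hx
      obtain ⟨i', -, hy⟩ := hy
      split_ifs at hx hy with h1 h2
      obtain rfl := Option.some.inj hx
      obtain rfl := Option.some.inj hy
      exact Or.inr ⟨rfl, Or.inl hj⟩
  · intro k k' hk x hx y hy
    obtain ⟨_, _, _, rfl⟩ := mem_leftList.1 hx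
    obtain ⟨_, _, _, rfl⟩ := mem_leftList.1 hy
    exact Or.inl hk

theorem pairwise_rightList :
    ((List.finRange P.n).flatMap (P.rightList m)).Pairwise Precedes := by
  rw [List.pairwise_flatMap]
  refine ⟨fun k _ => ?_, (List.pairwise_lt_finRange _).imp ?_⟩
  · unfold rightList
    rw [List.pairwise_flatMap, List.pairwise_reverse]
    refine ⟨fun j _ => ?_, (List.pairwise_lt_finRange m).imp ?_⟩
    · rw [List.pairwise_filterMap]
      refine (List.pairwise_lt_finRange m).imp fun {i i'} h x hx y hy => ?_
      split_ifs at hx hy with h1 h2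
      obtain rfl := Option.some.inj hx
      obtain rfl := Option.some.inj hy
      exact Or.inr ⟨rfl, Or.inr ⟨rfl, h⟩⟩
    · intro j j' hj x hx y hy
      simp only [List.mem_filterMap] at hx hy
      obtain ⟨i, -, hx⟩ := hx
      obtain ⟨i', -, hy⟩ := hy
      split_ifs at hx hy with h1 h2
      obtain rfl := Option.some.inj hx
      obtain rfl := Option.some.inj hy
      exact Or.inr ⟨rfl, Or.inl hj⟩
  · intro k k' hk x hx y hy
    obtain ⟨_, _, _, rfl⟩ := mem_rightList.1 hx
    obtain ⟨_, _, _, rfl⟩ := mem_rightList.1 hy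
    exact Or.inl hk

theorem transit_dblList (c : P.Dbl) {ab ab' : Fin P.n × Bool → Fin P.n × Bool → Prop}
    (hab : IsOrder ab) (hou : ab c.1.1 c.1.2.1) (hadj : ∀ w, ab c.1.1 w → ¬ ab w c.1.2.1)
    (hiff : ∀ i j, ab' i j ↔ (ab i j ∧ ¬ (i = c.1.1 ∧ j = c.1.2.1)) ∨
      (i = c.1.2.1 ∧ j = c.1.1)) :
    Transit (copyOrder m ab) ((P.dblList m c).map Sum.inl).reverse (copyOrder m ab') := by
  have hne : c.1.1 ≠ c.1.2.1 := fun h => hab.irrefl _ (h ▸ hou)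
  have hirr := hab.irrefl
  convert transit_of_pairwise (copyOrder_isOrder hab) Precedes.asymm Precedes.ne _
    (pairwise_dblList c) ?_ ?_ using 1
  · ext ⟨i, a⟩ ⟨j, b⟩
    have hK : ∀ p : P.Strand m × P.Strand m, p ∈ crossPairs (· ∈ P.dblList m c) ↔
        p.1.1 = c.1.1 ∧ p.2.1 = c.1.2.1 := by
      intro p
      simp only [crossPairs, Set.mem_ofPred_eq, mem_dblList]
      constructor
      · rintro ⟨_, ⟨i, j, rfl⟩, rfl⟩
        exact ⟨rfl, rfl⟩
      · intro h
        exact ⟨_, ⟨p.1.2, p.2.2, rfl⟩, Prod.ext (Prod.ext h.1 rfl) (Prod.ext h.2 rfl)⟩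
    simp only [flipOn, hK, copyOrder, hiff]
    grind
  · intro c' hc'
    obtain ⟨i, j, rfl⟩ := mem_dblList.1 hc'
    exact Or.inl ⟨hne, hou⟩
  · intro c' hc'
    obtain ⟨i, j, rfl⟩ := mem_dblList.1 hc'
    have hK : ∀ p : P.Strand m × P.Strand m,
        p ∈ crossPairs (fun c' => c' ∈ P.dblList m c ∧ Precedes c' (.dbl c i j)) ↔
        p.1.1 = c.1.1 ∧ p.2.1 = c.1.2.1 ∧ (p.2.2 < j ∨ (p.2.2 = j ∧ i < p.1.2)) := by
      intro p
      simp only [crossPairs, Set.mem_ofPred_eq, mem_dblList]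
      constructor
      · rintro ⟨_, ⟨⟨i, j, rfl⟩, h⟩, rfl⟩
        exact ⟨rfl, rfl, h.2⟩
      · intro h
        exact ⟨_, ⟨⟨p.1.2, p.2.2, rfl⟩, rfl, h.2.2⟩,
          Prod.ext (Prod.ext h.1 rfl) (Prod.ext h.2.1 rfl)⟩
    rintro ⟨w, l⟩ h1 h2
    simp only [flipOn, hK, copyOrder, Cross.overStrand, Cross.underStrand] at h1 h2
    have := hadj w
    grind

theorem transit_leftList {z : Fin P.n → ℝ} (hz : Function.Injective z) :
    Transit (cuspOrder m (Equiv.refl _) z)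
      (((List.finRange P.n).flatMap (P.leftList m)).map Sum.inl).reverse
      (copyOrder m (nearCuspOrder (Equiv.refl _) z)) := by
  convert transit_of_pairwise (cuspOrder_isOrder (Equiv.refl _) hz) Precedes.asymm Precedes.ne _
    pairwise_leftList ?_ ?_ using 1
  · ext ⟨⟨k, s⟩, a⟩ ⟨⟨k', s'⟩, b⟩
    have hK : ∀ p : P.Strand m × P.Strand m,
        p ∈ crossPairs (· ∈ (List.finRange P.n).flatMap (P.leftList m)) ↔
        p.1.1.1 = p.2.1.1 ∧ p.1.1.2 = false ∧ p.2.1.2 = true ∧ p.1.2 < p.2.2 := by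
      intro p
      simp only [crossPairs, Set.mem_ofPred_eq, List.mem_flatMap, mem_leftList]
      constructor
      · rintro ⟨_, ⟨k, -, i, j, h, rfl⟩, rfl⟩
        exact ⟨rfl, rfl, rfl, h⟩
      · intro h
        exact ⟨_, ⟨p.1.1.1, List.mem_finRange _, p.1.2, p.2.2, h.2.2.2, rfl⟩,
          Prod.ext (Prod.ext (Prod.ext rfl h.2.1) rfl)
            (Prod.ext (Prod.ext h.1.symm h.2.2.1) rfl)⟩
    simp only [flipOn, hK, copyOrder, cuspOrder, nearCuspOrder, Equiv.refl_symm,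
      Equiv.refl_apply]
    cases s <;> cases s' <;> grind
  · intro c' hc'
    obtain ⟨k, -, hc'⟩ := List.mem_flatMap.1 hc'
    obtain ⟨i, j, h, rfl⟩ := mem_leftList.1 hc'
    exact Or.inr ⟨rfl, Or.inl h⟩
  · intro c' hc'
    obtain ⟨k, -, hc'⟩ := List.mem_flatMap.1 hc'
    obtain ⟨i, j, hij, rfl⟩ := mem_leftList.1 hc'
    have hK : ∀ p : P.Strand m × P.Strand m, p ∈ crossPairs (fun c' =>
          c' ∈ (List.finRange P.n).flatMap (P.leftList m) ∧ Precedes c' (.left k i j hij)) ↔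
        p.1.1.1 = p.2.1.1 ∧ p.1.1.2 = false ∧ p.2.1.2 = true ∧ p.1.2 < p.2.2 ∧
        (p.1.1.1 < k ∨ (p.1.1.1 = k ∧ (p.2.2 < j ∨ (p.2.2 = j ∧ i < p.1.2)))) := by
      intro p
      simp only [crossPairs, Set.mem_ofPred_eq, List.mem_flatMap, mem_leftList]
      constructor
      · rintro ⟨_, ⟨⟨k, -, i, j, h, rfl⟩, h'⟩, rfl⟩
        exact ⟨rfl, rfl, rfl, h, h'⟩
      · intro h
        exact ⟨_, ⟨⟨p.1.1.1, List.mem_finRange _, p.1.2, p.2.2, h.2.2.2.1, rfl⟩, h.2.2.2.2⟩,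
          Prod.ext (Prod.ext (Prod.ext rfl h.2.1) rfl)
            (Prod.ext (Prod.ext h.1.symm h.2.2.1) rfl)⟩
    rintro ⟨⟨k', s⟩, l⟩ h1 h2
    have hz' := @hz k k'
    simp only [flipOn, hK, cuspOrder, Cross.overStrand, Cross.underStrand, Equiv.refl_symm,
      Equiv.refl_apply] at h1 h2
    cases s <;> grind

variable (P) in
/-- The upper and lower strands at the right cusps. -/
def rightEquiv : Fin P.n × Bool ≃ Fin P.n × Bool :=
  ((Equiv.prodComm _ _).trans (Equiv.boolProdEquivSum _)).trans
    ((Equiv.sumComm _ _).trans (Equiv.ofBijective _ P.bijective_right))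

theorem rightEquiv_true (k : Fin P.n) : P.rightEquiv (k, true) = P.rup k := rfl

theorem rightEquiv_false (k : Fin P.n) : P.rightEquiv (k, false) = P.rlow k := rfl

theorem eq_rup {i : Fin P.n × Bool} (h : (P.rightEquiv.symm i).2 = true) :
    i = P.rup (P.rightEquiv.symm i).1 := by
  have h' : P.rightEquiv.symm i = ((P.rightEquiv.symm i).1, true) := Prod.ext rfl h
  rw [← rightEquiv_true, ← h', Equiv.apply_symm_apply]

theorem eq_rlow {i : Fin P.n × Bool} (h : (P.rightEquiv.symm i).2 = false) :
    i = P.rlow (P.rightEquiv.symm i).1 := by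
  have h' : P.rightEquiv.symm i = ((P.rightEquiv.symm i).1, false) := Prod.ext rfl h
  rw [← rightEquiv_false, ← h', Equiv.apply_symm_apply]

theorem transit_rightList {z : Fin P.n → ℝ} (hz : Function.Injective z) :
    Transit (copyOrder m (nearCuspOrder P.rightEquiv z))
      (((List.finRange P.n).flatMap (P.rightList m)).map Sum.inl).reverse
      (cuspOrder m P.rightEquiv z) := by
  have hup : ∀ k, P.rightEquiv.symm (P.rup k) = (k, true) := fun k =>
    P.rightEquiv.symm_apply_eq.2 rfl
  have hlow : ∀ k, P.rightEquiv.symm (P.rlow k) = (k, false) := fun k =>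
    P.rightEquiv.symm_apply_eq.2 rfl
  convert transit_of_pairwise (copyOrder_isOrder (nearCuspOrder_isOrder P.rightEquiv hz))
    Precedes.asymm Precedes.ne _ pairwise_rightList ?_ ?_ using 1
  · ext ⟨i, a⟩ ⟨j, b⟩
    have hK : ∀ p : P.Strand m × P.Strand m,
        p ∈ crossPairs (· ∈ (List.finRange P.n).flatMap (P.rightList m)) ↔
        (P.rightEquiv.symm p.1.1).1 = (P.rightEquiv.symm p.2.1).1 ∧
        (P.rightEquiv.symm p.1.1).2 = true ∧ (P.rightEquiv.symm p.2.1).2 = false ∧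
        p.2.2 < p.1.2 := by
      intro p
      simp only [crossPairs, Set.mem_ofPred_eq, List.mem_flatMap, mem_rightList]
      constructor
      · rintro ⟨_, ⟨k, -, i, j, h, rfl⟩, rfl⟩
        simp only [Cross.overStrand, Cross.underStrand, hup, hlow]
        exact ⟨trivial, trivial, trivial, h⟩
      · intro h
        refine ⟨_, ⟨(P.rightEquiv.symm p.1.1).1, List.mem_finRange _, p.2.2, p.1.2, h.2.2.2, rfl⟩,
          Prod.ext (Prod.ext ?_ rfl) (Prod.ext ?_ rfl)⟩
        · simp only [Cross.overStrand]
          exact eq_rup h.2.1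
        · simp only [Cross.underStrand]
          rw [h.1]
          exact eq_rlow h.2.2.1
    simp only [flipOn, hK, copyOrder, cuspOrder, nearCuspOrder]
    have hi : i = j ↔ P.rightEquiv.symm i = P.rightEquiv.symm j :=
      P.rightEquiv.symm.injective.eq_iff.symm
    simp only [ne_eq, hi]
    generalize P.rightEquiv.symm i = i'
    generalize P.rightEquiv.symm j = j'
    obtain ⟨k, s⟩ := i'
    obtain ⟨k', s'⟩ := j'
    cases s <;> cases s' <;> grind
  · intro c' hc'
    obtain ⟨k, -, hc'⟩ := List.mem_flatMap.1 hc'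
    obtain ⟨i, j, h, rfl⟩ := mem_rightList.1 hc'
    refine Or.inl ⟨fun h' => ?_, Or.inr ?_⟩
    · have h' : P.rup k = P.rlow k := h'
      have := (hup k).symm.trans ((congrArg _ h').trans (hlow k))
      simp at this
    · simp only [Cross.overStrand, Cross.underStrand, hup, hlow]
      exact ⟨trivial, trivial, trivial⟩
  · intro c' hc'
    obtain ⟨k, -, hc'⟩ := List.mem_flatMap.1 hc'
    obtain ⟨i, j, hij, rfl⟩ := mem_rightList.1 hc'
    have hK : ∀ p : P.Strand m × P.Strand m, p ∈ crossPairs (fun c' =>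
          c' ∈ (List.finRange P.n).flatMap (P.rightList m) ∧ Precedes c' (.right k i j hij)) ↔
        (P.rightEquiv.symm p.1.1).1 = (P.rightEquiv.symm p.2.1).1 ∧
        (P.rightEquiv.symm p.1.1).2 = true ∧ (P.rightEquiv.symm p.2.1).2 = false ∧
        p.2.2 < p.1.2 ∧ ((P.rightEquiv.symm p.1.1).1 < k ∨ ((P.rightEquiv.symm p.1.1).1 = k ∧
          (j < p.1.2 ∨ (p.1.2 = j ∧ p.2.2 < i)))) := by
      intro p
      simp only [crossPairs, Set.mem_ofPred_eq, List.mem_flatMap, mem_rightList]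
      constructor
      · rintro ⟨_, ⟨⟨k, -, i, j, h, rfl⟩, h'⟩, rfl⟩
        simp only [Cross.overStrand, Cross.underStrand, hup, hlow]
        exact ⟨trivial, trivial, trivial, h, h'⟩
      · intro h
        refine ⟨_, ⟨⟨(P.rightEquiv.symm p.1.1).1, List.mem_finRange _, p.2.2, p.1.2, h.2.2.2.1,
          rfl⟩, h.2.2.2.2⟩, Prod.ext (Prod.ext ?_ rfl) (Prod.ext ?_ rfl)⟩
        · simp only [Cross.overStrand]
          exact eq_rup h.2.1
        · simp only [Cross.underStrand]
          rw [h.1]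
          exact eq_rlow h.2.2.1
    rintro ⟨w, l⟩ h1 h2
    simp only [flipOn, hK, copyOrder, nearCuspOrder, Cross.overStrand, Cross.underStrand, hup,
      hlow] at h1 h2
    have e1 : w = P.rup k ↔ P.rightEquiv.symm w = (k, true) := by
      rw [← hup k, P.rightEquiv.symm.injective.eq_iff]
    have e2 : w = P.rlow k ↔ P.rightEquiv.symm w = (k, false) := by
      rw [← hlow k, P.rightEquiv.symm.injective.eq_iff]
    have e3 : P.rup k = w ↔ P.rightEquiv.symm w = (k, true) := by rw [eq_comm, e1]
    simp only [ne_eq, e2, e3] at h1 h2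
    generalize P.rightEquiv.symm w = w' at *
    obtain ⟨k', s⟩ := w'
    have hz' := @hz k k'
    cases s <;> grind

end PreferredPlat

end

noncomputable section

/-! ## Horizontal cusps -/

/-- A function has a limit at `c` if its graph is near `c` parametrised by a curve which starts at
`c`. -/
theorem tendsto_of_curve {f : ℝ → ℝ} {I : Set ℝ} {F : Filter ℝ} {c z ε : ℝ} (hε : 0 < ε)
    {γ : ℝ → ℝ × ℝ × ℝ} (hγ : ContinuousOn γ (Set.Ico 0 ε)) (h0 : γ 0 = (c, 0, z))
    (hI : ∀ t ∈ Set.Ioo 0 ε, (γ t).1 ∈ I ∧ (γ t).2.2 = f (γ t).1)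
    (hF : ∀ p ∈ I, Set.uIcc c p \ {c} ∈ F) : Filter.Tendsto f F (𝓝 z) := by
  rw [Metric.tendsto_nhds]
  intro η hη
  have hcont : ContinuousWithinAt (fun t => (γ t).2.2) (Set.Ico 0 ε) 0 :=
    (continuous_snd.comp continuous_snd).continuousAt.comp_continuousWithinAt
      (hγ 0 ⟨le_rfl, hε⟩)
  have h1 : ∀ᶠ t in 𝓝[Set.Ico 0 ε] 0, dist (γ t).2.2 z < η := by
    have := (Metric.tendsto_nhds.1 hcont) η hη
    simp only [h0] at this
    exact this
  rw [nhdsWithin_Ico_eq_nhdsGE hε] at h1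
  obtain ⟨δ, hδ, hδ'⟩ := (mem_nhdsGE_iff_exists_Icc_subset).1 h1
  set δ' := min δ (ε / 2) with hδdef
  have hδ'pos : 0 < δ' := lt_min hδ (by linarith)
  have hδ'ε : δ' < ε := (min_le_right _ _).trans_lt (by linarith)
  have hmem := hI δ' ⟨hδ'pos, hδ'ε⟩
  filter_upwards [hF _ hmem.1] with x hx
  have hγ1 : ContinuousOn (fun t => (γ t).1) (Set.uIcc 0 δ') := by
    rw [Set.uIcc_of_le hδ'pos.le]
    exact (continuous_fst.comp_continuousOn hγ).mono fun t ht => ⟨ht.1, ht.2.trans_lt hδ'ε⟩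
  have := intermediate_value_uIcc hγ1
  simp only [h0] at this
  obtain ⟨t, ht, rfl⟩ := this hx.1
  rw [Set.uIcc_of_le hδ'pos.le] at ht
  have ht0 : t ≠ 0 := by
    rintro rfl
    exact hx.2 (by simp [h0])
  have ht' : t ∈ Set.Ioo 0 ε := ⟨lt_of_le_of_ne ht.1 ht0.symm, ht.2.trans_lt hδ'ε⟩
  rw [← (hI t ht').2]
  exact hδ' ⟨ht.1, ht.2.trans (min_le_left _ _)⟩

theorem IsHorizontalCusp.tendsto {f g : ℝ → ℝ} {I : Set ℝ} {c z : ℝ} {F : Filter ℝ}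
    (h : IsHorizontalCusp f g I c z) (hF : ∀ p ∈ I, Set.uIcc c p \ {c} ∈ F) :
    Filter.Tendsto f F (𝓝 z) ∧ Filter.Tendsto g F (𝓝 z) := by
  obtain ⟨ε, hε, γ, hγ, -, h0, hf, hg⟩ := h
  have hγ := hγ.continuousOn
  constructor
  · refine tendsto_of_curve hε (hγ.mono fun t ht => ⟨by linarith [ht.1], ht.2⟩) h0 ?_ hF
    intro t ht
    exact ⟨(hf t ht).1, congrArg (fun p => p.2.2) (hf t ht).2⟩
  · refine tendsto_of_curve (γ := fun t => γ (-t)) hε ?_ (by simpa using h0) ?_ hF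
    · exact hγ.comp continuous_neg.continuousOn fun t ht => ⟨by linarith [ht.2], by linarith [ht.1]⟩
    · intro t ht
      have ht' : -t ∈ Set.Ioo (-ε) 0 := ⟨by linarith [ht.2], by linarith [ht.1]⟩
      exact ⟨(hg _ ht').1, congrArg (fun p => p.2.2) (hg _ ht').2⟩

namespace PreferredPlat

open Classical SFAlg

variable {r : ℕ} {Λ : Set (ℝ × ℝ × ℝ)} {P : PreferredPlat r Λ} {m : ℕ}

/-! ## The order of the strands -/

variable (P) in
/-- The strand `i` lies above the strand `j` along the filter `F`. -/
def AboveAlong (F : Filter ℝ) (i j : Fin P.n × Bool) : Prop := ∀ᶠ x in F, P.s j x < P.s i x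

theorem above_eq (a : ℝ) : P.Above (m := m) a = copyOrder m (P.AboveAlong (𝓝[>] a)) := rfl

theorem continuousAt_strand (i : Fin P.n × Bool) {x : ℝ} (hx : x ∈ Set.Ioo P.xL P.xR) :
    ContinuousAt (P.s i) x :=
  ((P.smooth i).continuousOn x hx).continuousAt (isOpen_Ioo.mem_nhds hx)

theorem differentiableAt_strand (i : Fin P.n × Bool) {x : ℝ} (hx : x ∈ Set.Ioo P.xL P.xR) :
    DifferentiableAt ℝ (P.s i) x :=
  ((P.smooth i).contDiffAt (isOpen_Ioo.mem_nhds hx)).differentiableAt (by simp)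

theorem aboveAlong_of_lt {i j : Fin P.n × Bool} {x : ℝ} (hx : x ∈ Set.Ioo P.xL P.xR)
    (h : P.s j x < P.s i x) {F : Filter ℝ} (hF : F ≤ 𝓝 x) : P.AboveAlong F i j :=
  hF ((continuousAt_strand j hx).eventually_lt (continuousAt_strand i hx) h)

theorem aboveAlong_of_crossing {i j : Fin P.n × Bool} {x : ℝ} (hx : x ∈ Set.Ioo P.xL P.xR)
    (h : P.s i x = P.s j x) (h' : deriv (P.s i) x < deriv (P.s j) x) :
    P.AboveAlong (𝓝[<] x) i j ∧ P.AboveAlong (𝓝[>] x) j i := by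
  have hi := differentiableAt_strand i hx
  have hj := differentiableAt_strand j hx
  have hd : deriv (P.s j - P.s i) x > 0 := by
    rw [deriv_sub hj hi]
    linarith
  have key := eventually_nhdsWithin_sign_eq_of_deriv_pos hd (by simp [h])
  constructor
  · filter_upwards [nhdsWithin_le_nhds key, self_mem_nhdsWithin]
      with y hy hyx
    rw [sign_neg (sub_neg.2 hyx), sign_eq_neg_one_iff] at hy
    exact sub_neg.1 hy
  · filter_upwards [nhdsWithin_le_nhds key, self_mem_nhdsWithin]
      with y hy hyx
    rw [sign_pos (sub_pos.2 hyx), sign_eq_one_iff] at hy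
    exact sub_pos.1 hy

theorem aboveAlong_isOrder_of_total {F : Filter ℝ} [F.NeBot]
    (h : ∀ i j, i ≠ j → P.AboveAlong F i j ∨ P.AboveAlong F j i) : IsOrder (P.AboveAlong F) where
  irrefl i hi := by
    obtain ⟨x, hx⟩ := hi.exists
    exact lt_irrefl _ hx
  trans hij hjk := by
    filter_upwards [hij, hjk] with x h1 h2
    exact h2.trans h1
  total hij := h _ _ hij

theorem aboveAlong_trichotomy {i j : Fin P.n × Bool} (hij : i ≠ j) {x : ℝ}
    (hx : x ∈ Set.Ioo P.xL P.xR) :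
    P.s j x < P.s i x ∨ P.s i x < P.s j x ∨
      (i, j, x) ∈ crossingSet P.s (Set.Ioo P.xL P.xR) ∨
      (j, i, x) ∈ crossingSet P.s (Set.Ioo P.xL P.xR) := by
  rcases lt_trichotomy (P.s i x) (P.s j x) with h | h | h
  · exact Or.inr (Or.inl h)
  · rcases lt_or_gt_of_ne (P.transverse i j hij x hx h) with h' | h'
    · exact Or.inr (Or.inr (Or.inl ⟨hx, h, h'⟩))
    · exact Or.inr (Or.inr (Or.inr ⟨hx, h.symm, h'⟩))
  · exact Or.inl h

theorem aboveAlong_isOrder {x : ℝ} (hx : x ∈ Set.Ioo P.xL P.xR) :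
    IsOrder (P.AboveAlong (𝓝[<] x)) ∧ IsOrder (P.AboveAlong (𝓝[>] x)) := by
  constructor <;> refine aboveAlong_isOrder_of_total fun i j hij => ?_ <;>
    rcases aboveAlong_trichotomy hij hx with h | h | h | h
  · exact Or.inl (aboveAlong_of_lt hx h nhdsWithin_le_nhds)
  · exact Or.inr (aboveAlong_of_lt hx h nhdsWithin_le_nhds)
  · exact Or.inl (aboveAlong_of_crossing hx h.2.1 h.2.2).1
  · exact Or.inr (aboveAlong_of_crossing hx h.2.1 h.2.2).1
  · exact Or.inl (aboveAlong_of_lt hx h nhdsWithin_le_nhds)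
  · exact Or.inr (aboveAlong_of_lt hx h nhdsWithin_le_nhds)
  · exact Or.inr (aboveAlong_of_crossing hx h.2.1 h.2.2).2
  · exact Or.inl (aboveAlong_of_crossing hx h.2.1 h.2.2).2

/-- Two strict total orders are equal if one implies the other. -/
theorem IsOrder.eq_of_imp {S : Type*} {ab ab' : S → S → Prop} (h : IsOrder ab) (h' : IsOrder ab')
    (himp : ∀ i j, ab i j → ab' i j) : ab = ab' := by
  ext i j
  refine ⟨himp i j, fun hij => ?_⟩
  have hne : i ≠ j := by
    rintro rfl
    exact h'.irrefl _ hij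
  rcases h.total hne with h1 | h1
  · exact h1
  · exact absurd (himp _ _ h1) (h'.asymm hij)

theorem aboveAlong_left_eq_right {x : ℝ} (hx : x ∈ Set.Ioo P.xL P.xR)
    (hc : ∀ c ∈ crossingSet P.s (Set.Ioo P.xL P.xR), c.2.2 ≠ x) :
    P.AboveAlong (𝓝[<] x) = P.AboveAlong (𝓝[>] x) := by
  refine (aboveAlong_isOrder hx).1.eq_of_imp (aboveAlong_isOrder hx).2 fun i j hij => ?_
  have hne : i ≠ j := by
    rintro rfl
    exact (aboveAlong_isOrder hx).1.irrefl _ hij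
  rcases aboveAlong_trichotomy hne hx with h | h | h | h
  · exact aboveAlong_of_lt hx h nhdsWithin_le_nhds
  · exact absurd (aboveAlong_of_lt hx h nhdsWithin_le_nhds) ((aboveAlong_isOrder hx).1.asymm hij)
  · exact absurd rfl (hc _ h)
  · exact absurd rfl (hc _ h)

/-- At a crossing, its two strands are adjacent and change places. -/
theorem aboveAlong_crossing (c : P.Dbl) :
    P.AboveAlong (𝓝[<] c.1.2.2) c.1.1 c.1.2.1 ∧
    (∀ w, P.AboveAlong (𝓝[<] c.1.2.2) c.1.1 w → ¬ P.AboveAlong (𝓝[<] c.1.2.2) w c.1.2.1) ∧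
    ∀ i j, P.AboveAlong (𝓝[>] c.1.2.2) i j ↔
      (P.AboveAlong (𝓝[<] c.1.2.2) i j ∧ ¬ (i = c.1.1 ∧ j = c.1.2.1)) ∨
      (i = c.1.2.1 ∧ j = c.1.1) := by
  obtain ⟨⟨o, w, x⟩, hx, heq, hd⟩ := c
  dsimp only at hx heq hd ⊢
  obtain ⟨h1, h2⟩ := aboveAlong_of_crossing hx heq hd
  have hO := aboveAlong_isOrder hx
  have huniq : ∀ i j, (i, j, x) ∈ crossingSet P.s (Set.Ioo P.xL P.xR) → i = o ∧ j = w := by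
    intro i j h
    have := P.distinct_crossings h
      (show ((o, w, x) : (Fin P.n × Bool) × (Fin P.n × Bool) × ℝ) ∈
        crossingSet P.s (Set.Ioo P.xL P.xR) from ⟨hx, heq, hd⟩) rfl
    simp only [Prod.mk.injEq] at this
    exact ⟨this.1, this.2.1⟩
  have hne : o ≠ w := by
    rintro rfl
    exact lt_irrefl _ hd
  refine ⟨h1, fun l hl hl' => ?_, fun i j => ?_⟩
  · have hlo : l ≠ o := by
      rintro rfl
      exact hO.1.irrefl _ hl
    have hlw : l ≠ w := by
      rintro rfl
      exact hO.1.irrefl _ hl'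
    rcases aboveAlong_trichotomy hlo hx with h | h | h | h
    · exact hO.1.asymm hl (aboveAlong_of_lt hx h nhdsWithin_le_nhds)
    · rw [heq] at h
      exact hO.1.asymm hl' (aboveAlong_of_lt hx h nhdsWithin_le_nhds)
    · exact hlo (huniq _ _ h).1
    · exact hlw (huniq _ _ h).2
  · by_cases hij : i = j
    · subst hij
      refine iff_of_false (hO.2.irrefl i) ?_
      rintro (h | h)
      · exact hO.1.irrefl i h.1
      · exact hne (h.2.symm.trans h.1)
    · rcases aboveAlong_trichotomy hij hx with h | h | h | h
      · refine iff_of_true (aboveAlong_of_lt hx h nhdsWithin_le_nhds)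
          (Or.inl ⟨aboveAlong_of_lt hx h nhdsWithin_le_nhds, ?_⟩)
        rintro ⟨rfl, rfl⟩
        exact h.ne' heq
      · refine iff_of_false (hO.2.asymm (aboveAlong_of_lt hx h nhdsWithin_le_nhds)) ?_
        rintro (h' | ⟨rfl, rfl⟩)
        · exact hO.1.asymm h'.1 (aboveAlong_of_lt hx h nhdsWithin_le_nhds)
        · exact h.ne' heq
      · obtain ⟨rfl, rfl⟩ := huniq _ _ h
        refine iff_of_false (hO.2.asymm h2) ?_
        rintro (h' | ⟨h', -⟩)
        · exact h'.2 ⟨rfl, rfl⟩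
        · exact hne h'
      · obtain ⟨rfl, rfl⟩ := huniq _ _ h
        exact iff_of_true h2 (Or.inr ⟨rfl, rfl⟩)

/-- The order does not change where there are no crossings. -/
theorem aboveAlong_eq_of_no_crossing {a b : ℝ} (hab : a < b) (ha : P.xL ≤ a) (hb : b ≤ P.xR)
    (hc : ∀ c ∈ crossingSet P.s (Set.Ioo P.xL P.xR), c.2.2 ∉ Set.Ioo a b) :
    P.AboveAlong (𝓝[>] a) = P.AboveAlong (𝓝[<] b) ∧
      ∀ x ∈ Set.Ioo a b, P.AboveAlong (𝓝[>] a) = P.AboveAlong (𝓝[>] x) := by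
  have hsub : Set.Ioo a b ⊆ Set.Ioo P.xL P.xR := Set.Ioo_subset_Ioo ha hb
  have key : ∀ i j, i ≠ j → (∀ x ∈ Set.Ioo a b, P.s j x < P.s i x) ∨
      ∀ x ∈ Set.Ioo a b, P.s i x < P.s j x := by
    intro i j hij
    have hne : ∀ x ∈ Set.Ioo a b, P.s i x ≠ P.s j x := by
      intro x hx heq
      rcases aboveAlong_trichotomy hij (hsub hx) with h | h | h | h
      · exact h.ne' heq
      · exact h.ne heq
      · exact hc _ h hx
      · exact hc _ h hx
    by_contra! hcon
    obtain ⟨⟨x, hx, hx'⟩, y, hy, hy'⟩ := hcon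
    obtain ⟨w, hw, hw'⟩ := isPreconnected_Ioo.intermediate_value₂ hx hy
      ((P.smooth i).continuousOn.mono hsub) ((P.smooth j).continuousOn.mono hsub) hx' hy'
    exact hne w hw hw'
  have hF : ∀ (F : Filter ℝ) [F.NeBot], Set.Ioo a b ∈ F → IsOrder (P.AboveAlong F) ∧
      ∀ i j, P.AboveAlong F i j → ∀ x ∈ Set.Ioo a b, P.s j x < P.s i x := by
    intro F hF hmem
    have h1 : ∀ i j, P.AboveAlong F i j → ∀ x ∈ Set.Ioo a b, P.s j x < P.s i x := by
      intro i j hij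
      have hne : i ≠ j := by
        rintro rfl
        obtain ⟨x, hx⟩ := hij.exists
        exact lt_irrefl _ hx
      rcases key i j hne with h | h
      · exact h
      · obtain ⟨x, hx, hx'⟩ := (hij.and hmem).exists
        exact absurd hx (h x hx').not_gt
    refine ⟨aboveAlong_isOrder_of_total fun i j hij => ?_, h1⟩
    rcases key i j hij with h | h
    · exact Or.inl (Filter.mem_of_superset hmem h)
    · exact Or.inr (Filter.mem_of_superset hmem h)
  have hA := hF (𝓝[>] a) (Ioo_mem_nhdsGT hab)
  have heq : ∀ (F : Filter ℝ) [F.NeBot], Set.Ioo a b ∈ F →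
      P.AboveAlong (𝓝[>] a) = P.AboveAlong F := by
    intro F hF' hmem
    refine hA.1.eq_of_imp (hF F hmem).1 fun i j hij => ?_
    exact Filter.mem_of_superset hmem (hA.2 i j hij)
  exact ⟨heq _ (Ioo_mem_nhdsLT hab), fun x hx => heq _
    (nhdsWithin_le_nhds (isOpen_Ioo.mem_nhds hx))⟩

theorem aboveAlong_xL : P.AboveAlong (𝓝[>] P.xL) = nearCuspOrder (Equiv.refl _) P.zL := by
  have hF : ∀ p ∈ Set.Ioo P.xL P.xR, Set.uIcc P.xL p \ {P.xL} ∈ 𝓝[>] P.xL := by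
    intro p hp
    refine Filter.mem_of_superset (Ioc_mem_nhdsGT hp.1) fun x hx => ?_
    rw [Set.uIcc_of_le hp.1.le]
    exact ⟨⟨hx.1.le, hx.2⟩, hx.1.ne'⟩
  have hlim : ∀ i : Fin P.n × Bool, Filter.Tendsto (P.s i) (𝓝[>] P.xL) (𝓝 (P.zL i.1)) := by
    rintro ⟨k, s⟩
    cases s
    · exact ((P.left_cusp k).tendsto hF).2
    · exact ((P.left_cusp k).tendsto hF).1
  have himp : ∀ i j, nearCuspOrder (Equiv.refl _) P.zL i j → P.AboveAlong (𝓝[>] P.xL) i j := by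
    rintro ⟨k, s⟩ ⟨k', s'⟩ (h | ⟨rfl, rfl, rfl⟩)
    · exact (hlim (k', s')).eventually_lt (hlim (k, s)) h
    · exact P.left_lt k
  have hO := nearCuspOrder_isOrder (Equiv.refl (Fin P.n × Bool)) P.zL_injective
  refine (hO.eq_of_imp (aboveAlong_isOrder_of_total fun i j hij => ?_) himp).symm
  exact (hO.total hij).imp (himp _ _) (himp _ _)

theorem aboveAlong_xR : P.AboveAlong (𝓝[<] P.xR) = nearCuspOrder P.rightEquiv P.zR := by
  have hF : ∀ p ∈ Set.Ioo P.xL P.xR, Set.uIcc P.xR p \ {P.xR} ∈ 𝓝[<] P.xR := by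
    intro p hp
    refine Filter.mem_of_superset (Ico_mem_nhdsLT hp.2) fun x hx => ?_
    rw [Set.uIcc_of_ge hp.2.le]
    exact ⟨⟨hx.1, hx.2.le⟩, hx.2.ne⟩
  have hlim : ∀ i : Fin P.n × Bool,
      Filter.Tendsto (P.s (P.rightEquiv i)) (𝓝[<] P.xR) (𝓝 (P.zR i.1)) := by
    rintro ⟨k, s⟩
    cases s
    · exact ((P.right_cusp k).tendsto hF).2
    · exact ((P.right_cusp k).tendsto hF).1
  have himp : ∀ i j, nearCuspOrder P.rightEquiv P.zR i j → P.AboveAlong (𝓝[<] P.xR) i j := by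
    intro i j
    obtain ⟨i, rfl⟩ := P.rightEquiv.surjective i
    obtain ⟨j, rfl⟩ := P.rightEquiv.surjective j
    unfold nearCuspOrder
    rw [Equiv.symm_apply_apply, Equiv.symm_apply_apply]
    obtain ⟨k, s⟩ := i
    obtain ⟨k', s'⟩ := j
    rintro (h | ⟨rfl, rfl, rfl⟩)
    · exact (hlim (k', s')).eventually_lt (hlim (k, s)) h
    · exact P.right_lt k
  have hO := nearCuspOrder_isOrder P.rightEquiv P.zR_injective
  refine (hO.eq_of_imp (aboveAlong_isOrder_of_total fun i j hij => ?_) himp).symm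
  exact (hO.total hij).imp (himp _ _) (himp _ _)

theorem aboveAlong_right_isOrder {a : ℝ} (ha : P.xL ≤ a) (ha' : a < P.xR) :
    IsOrder (P.AboveAlong (𝓝[>] a)) := by
  rcases ha.eq_or_lt with rfl | h
  · rw [aboveAlong_xL]
    exact nearCuspOrder_isOrder _ P.zL_injective
  · exact (aboveAlong_isOrder ⟨h, ha'⟩).2

theorem above_isOrder {a : ℝ} (ha : P.xL ≤ a) (ha' : a < P.xR) : IsOrder (P.Above (m := m) a) :=
  copyOrder_isOrder (aboveAlong_right_isOrder ha ha')

/-! ## Passing the events over a point -/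

theorem transit_bases {ab : P.Strand m → P.Strand m → Prop} (l : List (P.base × Fin m)) :
    Transit ab (l.map Sum.inr) ab := by
  induction l with
  | nil => exact .nil
  | cons b l ih => exact .base b ih

theorem transit_eventsAt {x : ℝ} (hx : x ∈ Set.Ioo P.xL P.xR) :
    Transit (copyOrder m (P.AboveAlong (𝓝[<] x))) (P.eventsAt m x).reverse (P.Above x) := by
  have h1 : x ≠ P.xL := hx.1.ne'
  have h2 : x ≠ P.xR := hx.2.ne
  simp only [eventsAt, if_neg h1, if_neg h2, List.nil_append, List.append_nil,
    List.reverse_append, ← List.map_reverse]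
  refine Transit.append ?_ (transit_bases _)
  rw [List.map_reverse, above_eq]
  by_cases hc : ∃ c : P.Dbl, c.1.2.2 = x
  · obtain ⟨c, rfl⟩ := hc
    have hl : (Finset.univ.filter fun c' : P.Dbl => c'.1.2.2 = c.1.2.2) = {c} := by
      ext c'
      simp only [Finset.mem_filter, Finset.mem_univ, true_and, Finset.mem_singleton]
      exact ⟨fun h => Subtype.ext (P.distinct_crossings c'.2 c.2 h), fun h => by rw [h]⟩
    rw [hl, Finset.toList_singleton]
    simp only [List.flatMap_cons, List.flatMap_nil, List.append_nil]
    obtain ⟨h3, h4, h5⟩ := aboveAlong_crossing c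
    exact transit_dblList c (aboveAlong_isOrder hx).1 h3 h4 h5
  · have hl : (Finset.univ.filter fun c' : P.Dbl => c'.1.2.2 = x) = ∅ := by
      rw [Finset.filter_eq_empty_iff]
      intro c _ h
      exact hc ⟨c, h⟩
    rw [hl, Finset.toList_empty]
    have : P.AboveAlong (𝓝[<] x) = P.AboveAlong (𝓝[>] x) :=
      aboveAlong_left_eq_right hx fun c hc' h => hc ⟨⟨c, hc'⟩, h⟩
    rw [this]
    exact .nil

theorem eventsAt_xL : P.eventsAt m P.xL =
    ((List.finRange P.n).flatMap (P.leftList m)).map Sum.inl := by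
  have h1 : P.xL ≠ P.xR := P.xL_lt_xR.ne
  have h2 : (Finset.univ.filter fun c : P.Dbl => c.1.2.2 = P.xL) = ∅ := by
    rw [Finset.filter_eq_empty_iff]
    intro c _ h
    exact c.2.1.1.ne' h
  have h3 : (Finset.univ.filter fun b : P.base × Fin m => b.1.1.2 = P.xL) = ∅ := by
    rw [Finset.filter_eq_empty_iff]
    intro c _ h
    exact (P.base_mem _ c.1.2).1.ne' h
  simp [eventsAt, h1, h2, h3]

theorem eventsAt_xR : P.eventsAt m P.xR =
    ((List.finRange P.n).flatMap (P.rightList m)).map Sum.inl := by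
  have h1 : P.xR ≠ P.xL := P.xL_lt_xR.ne'
  have h2 : (Finset.univ.filter fun c : P.Dbl => c.1.2.2 = P.xR) = ∅ := by
    rw [Finset.filter_eq_empty_iff]
    intro c _ h
    exact c.2.1.2.ne h
  have h3 : (Finset.univ.filter fun b : P.base × Fin m => b.1.1.2 = P.xR) = ∅ := by
    rw [Finset.filter_eq_empty_iff]
    intro c _ h
    exact (P.base_mem _ c.1.2).2.ne h
  simp [eventsAt, h1, h2, h3]

theorem transit_eventsAt_xL :
    Transit (cuspOrder m (Equiv.refl _) P.zL) (P.eventsAt m P.xL).reverse (P.Above P.xL) := by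
  rw [eventsAt_xL, above_eq, aboveAlong_xL]
  exact transit_leftList P.zL_injective

theorem transit_eventsAt_xR :
    Transit (copyOrder m (P.AboveAlong (𝓝[<] P.xR))) (P.eventsAt m P.xR).reverse
      (cuspOrder m P.rightEquiv P.zR) := by
  rw [eventsAt_xR, aboveAlong_xR]
  exact transit_rightList P.zR_injective

theorem eventsAt_eq_nil {x : ℝ} (hx : x ∉ P.positions) : P.eventsAt m x = [] := by
  simp only [positions, Finset.mem_union, Finset.mem_image, Finset.mem_univ, true_and,
    Finset.mem_insert, Finset.mem_singleton, not_or, not_exists] at hx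
  have h2 : (Finset.univ.filter fun c : P.Dbl => c.1.2.2 = x) = ∅ := by
    rw [Finset.filter_eq_empty_iff]
    exact fun c _ h => hx.1.1 c h
  have h3 : (Finset.univ.filter fun b : P.base × Fin m => b.1.1.2 = x) = ∅ := by
    rw [Finset.filter_eq_empty_iff]
    exact fun b _ h => hx.1.2 b.1.1 ⟨b.1.2, h⟩
  simp [eventsAt, hx.2.1, hx.2.2, h2, h3]

end PreferredPlat

end

noncomputable section

namespace PreferredPlat

open Classical SFAlg

variable {r : ℕ} {Λ : Set (ℝ × ℝ × ℝ)} {P : PreferredPlat r Λ} {m : ℕ}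

/-! ## Lists of events over subsets of the line -/

/-- The value of `x` at an event. -/
def Event.x : P.Event m → ℝ := Sum.elim Cross.x fun b => b.1.1.2

theorem mem_eventsAt {x : ℝ} {ev : P.Event m} : ev ∈ P.eventsAt m x ↔ Event.x ev = x := by
  cases ev with
  | inr b => simp [eventsAt, Event.x]
  | inl c =>
    have h1 : P.xL ≠ P.xR := P.xL_lt_xR.ne
    have : (Sum.inl c ∈ P.eventsAt m x) ↔
        (x = P.xL ∧ ∃ k, c ∈ P.leftList m k) ∨ (∃ d : P.Dbl, d.1.2.2 = x ∧ c ∈ P.dblList m d) ∨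
        (x = P.xR ∧ ∃ k, c ∈ P.rightList m k) := by
      by_cases hL : x = P.xL <;> by_cases hR : x = P.xR <;>
        simp [eventsAt, hL, hR, or_assoc]
    rw [this]
    simp only [mem_leftList, mem_rightList, mem_dblList, Event.x, Sum.elim_inl]
    cases c with
    | dbl c i j =>
      simp only [Cross.x, reduceCtorEq, exists_false, and_false, false_or, or_false,
        Cross.dbl.injEq]
      constructor
      · rintro ⟨d, h, _, _, rfl, rfl, rfl⟩
        exact h
      · intro h
        exact ⟨c, h, i, j, rfl, rfl, rfl⟩
    | left k i j h =>
      simp only [Cross.x, reduceCtorEq, exists_false, and_false, or_false,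
        Cross.left.injEq]
      constructor
      · rintro ⟨h, -⟩
        exact h.symm
      · intro h'
        exact ⟨h'.symm, k, i, j, h, rfl, rfl, rfl⟩
    | right k i j h =>
      simp only [Cross.x, reduceCtorEq, exists_false, and_false, false_or,
        Cross.right.injEq]
      constructor
      · rintro ⟨h, -⟩
        exact h.symm
      · intro h'
        exact ⟨h'.symm, k, i, j, h, rfl, rfl, rfl⟩

theorem nodup_of_precedes {l : List (P.Cross m)} (h : l.Pairwise Precedes) : l.Nodup :=
  h.imp (S := (· ≠ ·)) fun {a b} hab he => Precedes.asymm a b hab (by rw [he] at hab ⊢; exact hab)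

theorem nodup_eventsAt (x : ℝ) : (P.eventsAt m x).Nodup := by
  by_cases hL : x = P.xL
  · rw [hL, eventsAt_xL]
    exact (nodup_of_precedes pairwise_leftList).map Sum.inl_injective
  by_cases hR : x = P.xR
  · rw [hR, eventsAt_xR]
    exact (nodup_of_precedes pairwise_rightList).map Sum.inl_injective
  simp only [eventsAt, if_neg hL, if_neg hR, List.nil_append, List.append_nil]
  refine List.Nodup.append (List.Nodup.map Sum.inl_injective ?_)
    ((Finset.nodup_toList _).map Sum.inr_injective) ?_
  · rw [List.nodup_flatMap]
    refine ⟨fun c _ => nodup_of_precedes (pairwise_dblList c),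
      (Finset.nodup_toList _).imp fun {c d} hcd => ?_⟩
    intro e hc hd
    obtain ⟨i, j, rfl⟩ := mem_dblList.1 hc
    obtain ⟨i', j', h⟩ := mem_dblList.1 hd
    simp only [Cross.dbl.injEq] at h
    exact hcd h.1
  · intro e h1 h2
    obtain ⟨c, -, rfl⟩ := List.mem_map.1 h1
    obtain ⟨b, -, h⟩ := List.mem_map.1 h2
    exact Sum.inr_ne_inl h

variable (P) in
/-- The events over `S`, from right to left. -/
def eventList (m : ℕ) (S : Set ℝ) : List (P.Event m) :=
  ((P.positions.filter fun y => y ∈ S).sort (· ≥ ·)).flatMap fun y => (P.eventsAt m y).reverse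

theorem eventList_eq_flatMap {S : Set ℝ} {F : Finset ℝ}
    (h : ∀ y, y ∈ F ↔ y ∈ P.positions ∧ y ∈ S) :
    P.eventList m S = (F.sort (· ≥ ·)).flatMap fun y => (P.eventsAt m y).reverse := by
  unfold eventList
  congr 2
  ext y
  rw [h, Finset.mem_filter]

theorem sweep_eq (U : Set ℝ) (x : ℝ) :
    P.sweep m U x = P.eventList m {y | y ≤ x ∧ Set.Icc y x ⊆ U} := by
  symm
  refine eventList_eq_flatMap fun y => ?_
  rw [Finset.mem_filter]
  rfl

theorem mem_eventList {S : Set ℝ} {ev : P.Event m} :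
    ev ∈ P.eventList m S ↔ Event.x ev ∈ S := by
  simp only [eventList, List.mem_flatMap, Finset.mem_sort, Finset.mem_filter, List.mem_reverse,
    mem_eventsAt]
  constructor
  · rintro ⟨y, ⟨-, hy⟩, rfl⟩
    exact hy
  · intro h
    refine ⟨_, ⟨?_, h⟩, rfl⟩
    by_contra hcon
    have h1 : ev ∈ P.eventsAt m (Event.x ev) := mem_eventsAt.2 rfl
    rw [eventsAt_eq_nil hcon] at h1
    exact List.not_mem_nil h1

theorem nodup_eventList (S : Set ℝ) : (P.eventList m S).Nodup := by
  unfold eventList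
  rw [List.nodup_flatMap]
  refine ⟨fun y _ => List.nodup_reverse.2 (nodup_eventsAt y),
    (Finset.sort_nodup _ _).imp fun {y z} hyz e hy hz => hyz ?_⟩
  rw [List.mem_reverse, mem_eventsAt] at hy hz
  exact hy.symm.trans hz

theorem eventList_congr {S T : Set ℝ} (h : ∀ y ∈ P.positions, y ∈ S ↔ y ∈ T) :
    P.eventList m S = P.eventList m T := by
  unfold eventList
  rw [Finset.filter_congr h]

theorem eventList_eq_append {S T T' : Set ℝ} (h : ∀ y ∈ P.positions, y ∈ S ↔ y ∈ T ∨ y ∈ T')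
    (hlt : ∀ y ∈ T, ∀ z ∈ T', y < z) :
    P.eventList m S = P.eventList m T' ++ P.eventList m T := by
  unfold eventList
  rw [← List.flatMap_append]
  congr 1
  set l := (P.positions.filter fun y => y ∈ T').sort (· ≥ ·) ++
    (P.positions.filter fun y => y ∈ T).sort (· ≥ ·) with hl
  have hnd : l.Nodup := by
    refine List.Nodup.append (Finset.sort_nodup _ _) (Finset.sort_nodup _ _) ?_
    intro y h1 h2
    simp only [Finset.mem_sort, Finset.mem_filter] at h1 h2
    exact lt_irrefl _ (hlt _ h2.2 _ h1.2)
  have hpw : l.Pairwise (· ≥ ·) := by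
    rw [hl, List.pairwise_append]
    refine ⟨Finset.pairwise_sort _ _, Finset.pairwise_sort _ _, fun y h1 z h2 => ?_⟩
    simp only [Finset.mem_sort, Finset.mem_filter] at h1 h2
    exact (hlt _ h2.2 _ h1.2).le
  rw [← (List.toFinset_sort (r := fun a b : ℝ => a ≥ b) hnd).2 hpw]
  congr 1
  ext y
  simp only [hl, Finset.mem_filter, List.mem_toFinset, List.mem_append, Finset.mem_sort]
  constructor
  · rintro ⟨h1, h2⟩
    rcases (h y h1).1 h2 with h3 | h3
    · exact Or.inr ⟨h1, h3⟩
    · exact Or.inl ⟨h1, h3⟩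
  · rintro (⟨h1, h2⟩ | ⟨h1, h2⟩)
    · exact ⟨h1, (h y h1).2 (Or.inr h2)⟩
    · exact ⟨h1, (h y h1).2 (Or.inl h2)⟩

theorem eventList_eq_nil {S : Set ℝ} (h : ∀ y ∈ P.positions, y ∉ S) : P.eventList m S = [] := by
  unfold eventList
  rw [Finset.filter_eq_empty_iff.2 fun y hy => h y hy, Finset.sort_empty]
  rfl

theorem eventList_singleton (y : ℝ) : P.eventList m {y} = (P.eventsAt m y).reverse := by
  by_cases hy : y ∈ P.positions
  · rw [eventList_eq_flatMap (F := {y}) fun z => ?_, Finset.sort_singleton]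
    · simp
    · rw [Finset.mem_singleton, Set.mem_singleton_iff]
      exact ⟨fun h => ⟨h ▸ hy, h⟩, fun h => h.2⟩
  · rw [eventsAt_eq_nil hy, eventList_eq_nil fun z hz h => hy (by rwa [Set.mem_singleton_iff.1 h] at hz)]
    rfl

theorem crossing_mem_positions {c : (Fin P.n × Bool) × (Fin P.n × Bool) × ℝ}
    (hc : c ∈ crossingSet P.s (Set.Ioo P.xL P.xR)) : c.2.2 ∈ P.positions := by
  simp only [positions, Finset.mem_union, Finset.mem_image, Finset.mem_univ, true_and]
  exact Or.inl (Or.inl ⟨⟨c, hc⟩, rfl⟩)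

theorem mem_Icc_of_mem_positions {y : ℝ} (hy : y ∈ P.positions) : y ∈ Set.Icc P.xL P.xR := by
  simp only [positions, Finset.mem_union, Finset.mem_image, Finset.mem_univ, true_and,
    Finset.mem_insert, Finset.mem_singleton] at hy
  rcases hy with (⟨c, rfl⟩ | ⟨b, hb, rfl⟩) | rfl | rfl
  · exact Set.Ioo_subset_Icc_self c.2.1
  · exact Set.Ioo_subset_Icc_self (P.base_mem b hb)
  · exact ⟨le_rfl, P.xL_lt_xR.le⟩
  · exact ⟨P.xL_lt_xR.le, le_rfl⟩

theorem transit_eventList_Ioo {a b : ℝ} (ha : P.xL ≤ a) (hab : a < b) (hb : b ≤ P.xR) :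
    Transit (P.Above a) (P.eventList m (Set.Ioo a b)) (copyOrder m (P.AboveAlong (𝓝[<] b))) := by
  induction hn : (P.positions.filter fun y => y ∈ Set.Ioo a b).card using Nat.strong_induction_on
    generalizing b with
  | _ n ih =>
    by_cases hne : (P.positions.filter fun y => y ∈ Set.Ioo a b).Nonempty
    · obtain ⟨p, hp, hmax⟩ := Finset.exists_max_image _ id hne
      simp only [Finset.mem_filter, id] at hp hmax
      obtain ⟨hp, hap, hpb⟩ := hp
      have hlt : (P.positions.filter fun y => y ∈ Set.Ioo a p).card < n := by
        rw [← hn]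
        refine Finset.card_lt_card (Finset.ssubset_iff_of_subset ?_ |>.2 ⟨p, ?_, ?_⟩)
        · exact fun y hy => Finset.mem_filter.2 ⟨(Finset.mem_filter.1 hy).1,
            (Finset.mem_filter.1 hy).2.1, (Finset.mem_filter.1 hy).2.2.trans hpb⟩
        · exact Finset.mem_filter.2 ⟨hp, hap, hpb⟩
        · exact fun h => lt_irrefl _ (Finset.mem_filter.1 h).2.2
      have h1 := ih _ hlt hap (hpb.le.trans hb) rfl
      have h2 := transit_eventsAt (P := P) (m := m) ⟨ha.trans_lt hap, hpb.trans_le hb⟩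
      have h3 : P.AboveAlong (𝓝[>] p) = P.AboveAlong (𝓝[<] b) := by
        refine (aboveAlong_eq_of_no_crossing hpb (ha.trans hap.le) hb fun c hc hc' => ?_).1
        exact (hmax _ ⟨crossing_mem_positions hc, hap.trans hc'.1, hc'.2⟩).not_gt hc'.1
      rw [← h3, ← above_eq]
      have h4 := h1.append h2
      rw [← eventList_singleton] at h4
      rwa [eventList_eq_append (T := Set.Ioo a p) (T' := {p})]
      · intro y hy
        constructor
        · rintro ⟨h5, h6⟩
          rcases (hmax y ⟨hy, h5, h6⟩).lt_or_eq with h7 | h7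
          · exact Or.inl ⟨h5, h7⟩
          · exact Or.inr h7
        · rintro (h5 | rfl)
          · exact ⟨h5.1, h5.2.trans hpb⟩
          · exact ⟨hap, hpb⟩
      · rintro y hy z rfl
        exact hy.2
    · rw [Finset.not_nonempty_iff_eq_empty, Finset.filter_eq_empty_iff] at hne
      rw [eventList_eq_nil fun y hy => hne hy, above_eq, (aboveAlong_eq_of_no_crossing hab ha hb
        fun c hc => hne (crossing_mem_positions hc)).1]
      exact .nil

variable (P) in
/-- The order of the strands at the right end of the events over `x`. -/
def orderAt (m : ℕ) (x : ℝ) : P.Strand m → P.Strand m → Prop :=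
  if x = P.xR then cuspOrder m P.rightEquiv P.zR else P.Above x

theorem transit_eventList_Ioc {a b : ℝ} (ha : P.xL ≤ a) (haR : a < P.xR) (hab : a ≤ b)
    (hb : b ≤ P.xR) : Transit (P.Above a) (P.eventList m (Set.Ioc a b)) (P.orderAt m b) := by
  rcases hab.eq_or_lt with rfl | hab
  · rw [Set.Ioc_self, eventList_eq_nil (by simp), orderAt, if_neg haR.ne]
    exact .nil
  · have h1 := transit_eventList_Ioo (m := m) ha hab hb
    rw [eventList_eq_append (T := Set.Ioo a b) (T' := {b})
      (fun y _ => by rw [← Set.Ioo_union_right hab]; exact Iff.rfl)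
      (by rintro y hy z rfl; exact hy.2), eventList_singleton]
    refine h1.append ?_
    unfold orderAt
    split_ifs with h
    · subst h
      exact transit_eventsAt_xR
    · exact transit_eventsAt ⟨ha.trans_lt hab, lt_of_le_of_ne hb h⟩

theorem transit_eventList_Iic {b : ℝ} (ha : P.xL ≤ b) (hb : b ≤ P.xR) :
    Transit (cuspOrder m (Equiv.refl _) P.zL) (P.eventList m (Set.Iic b)) (P.orderAt m b) := by
  rw [eventList_eq_append (T := {P.xL}) (T' := Set.Ioc P.xL b), eventList_singleton]
  · exact transit_eventsAt_xL.append (transit_eventList_Ioc le_rfl P.xL_lt_xR ha hb)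
  · intro y hy
    constructor
    · intro h
      rcases (mem_Icc_of_mem_positions hy).1.eq_or_lt with h' | h'
      · exact Or.inl h'.symm
      · exact Or.inr ⟨h', h⟩
    · rintro (rfl | h)
      · exact ha
      · exact h.2
  · rintro y rfl z hz
    exact hz.1

/-! ## The left end of a sweep -/

variable (P) in
/-- The left boundary point of `U` next to `x`. -/
def leftEnd (U : Set ℝ) (x : ℝ) : ℝ := sSup {y | y ≤ x ∧ y ∉ U}

theorem leftEnd_spec {U : Opens ℝ} {x : ℝ} (hx : x ∈ U) (hU : ¬ Set.Icc P.xL x ⊆ U) :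
    P.xL ≤ leftEnd U x ∧ leftEnd U x < x ∧ leftEnd U x ∉ U ∧ Set.Ioc (leftEnd U x) x ⊆ U := by
  obtain ⟨y, hy, hyU⟩ := Set.not_subset.1 hU
  have hne : {y | y ≤ x ∧ y ∉ U}.Nonempty := ⟨y, hy.2, hyU⟩
  have hbdd : BddAbove {y | y ≤ x ∧ y ∉ U} := ⟨x, fun z hz => hz.1⟩
  have hcl : IsClosed {y | y ≤ x ∧ y ∉ U} := isClosed_Iic.inter U.isOpen.isClosed_compl
  have hmem : leftEnd U x ≤ x ∧ leftEnd U x ∉ U := hcl.csSup_mem hne hbdd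
  refine ⟨hy.1.trans (le_csSup hbdd ⟨hy.2, hyU⟩), lt_of_le_of_ne hmem.1 fun h => ?_, hmem.2,
    fun z hz => ?_⟩
  · rw [h] at hmem
    exact hmem.2 hx
  · by_contra hzU
    exact hz.1.not_ge (le_csSup hbdd ⟨hz.2, hzU⟩)

theorem leftEnd_eq {U : Set ℝ} {a x : ℝ} (hax : a ≤ x) (ha : a ∉ U) (hU : Set.Ioc a x ⊆ U) :
    leftEnd U x = a := by
  refine IsLUB.csSup_eq ⟨fun y hy => ?_, fun b hb => hb ⟨hax, ha⟩⟩ ⟨a, hax, ha⟩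
  by_contra h
  exact hy.2 (hU ⟨not_le.1 h, hy.1⟩)

theorem isLeftEdge_leftEnd {U : Opens ℝ} {x : ℝ} (hx : x ∈ U) (hU : ¬ Set.Icc P.xL x ⊆ U)
    (hxR : x ≤ P.xR) : P.IsLeftEdge U (leftEnd U x) := by
  obtain ⟨h1, h2, h3, h4⟩ := leftEnd_spec hx hU
  exact ⟨h3, Filter.mem_of_superset (Ioc_mem_nhdsGT h2) h4, h1, h2.trans_le hxR⟩

theorem sweep_of_Icc_subset {U : Set ℝ} {x : ℝ} (hU : Set.Icc P.xL x ⊆ U) :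
    P.sweep m U x = P.eventList m (Set.Iic x) := by
  rw [sweep_eq]
  refine eventList_congr fun y hy => ⟨fun h => h.1, fun h => ⟨h, ?_⟩⟩
  exact (Set.Icc_subset_Icc_left (mem_Icc_of_mem_positions hy).1).trans hU

theorem sweep_of_notMem {U : Set ℝ} {a x : ℝ} (ha : a ∉ U) (hax : a ≤ x) (hU : Set.Ioc a x ⊆ U) :
    P.sweep m U x = P.eventList m (Set.Ioc a x) := by
  rw [sweep_eq]
  refine eventList_congr fun y hy => ⟨fun h => ⟨?_, h.1⟩, fun h => ⟨h.2, ?_⟩⟩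
  · by_contra hya
    exact ha (h.2 ⟨not_lt.1 hya, hax⟩)
  · exact (Set.Icc_subset_Ioc_iff h.2).2 ⟨h.1, le_rfl⟩ |>.trans hU

theorem sweep_eq_append {U : Set ℝ} {a x : ℝ} (hax : a ≤ x) (hU : Set.Icc a x ⊆ U) :
    P.sweep m U x = P.eventList m (Set.Ioc a x) ++ P.sweep m U a := by
  rw [sweep_eq, sweep_eq]
  refine eventList_eq_append (fun y hy => ?_) fun y hy z hz => hy.1.trans_lt hz.1
  constructor
  · intro h
    rcases le_or_gt y a with hya | hya
    · exact Or.inl ⟨hya, (Set.Icc_subset_Icc_right hax).trans h.2⟩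
    · exact Or.inr ⟨hya, h.1⟩
  · rintro (h | h)
    · refine ⟨h.1.trans hax, fun z hz => ?_⟩
      rcases le_total z a with hza | hza
      · exact h.2 ⟨hz.1, hza⟩
      · exact hU ⟨hza, hz.2⟩
    · exact ⟨h.2, (Set.Icc_subset_Icc_left h.1.le).trans hU⟩

variable (P) in
/-- The order of the strands at the left end of a sweep over `U` starting over `x`. -/
def startOrder (m : ℕ) (U : Opens ℝ) (x : ℝ) : P.Strand m → P.Strand m → Prop :=
  if Set.Icc P.xL x ⊆ U then cuspOrder m (Equiv.refl _) P.zL else P.Above (leftEnd U x)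

theorem startOrder_isOrder {U : Opens ℝ} {x : ℝ} (hx : x ∈ U) (hxR : x ≤ P.xR) :
    IsOrder (P.startOrder m U x) := by
  unfold startOrder
  split_ifs with h
  · exact cuspOrder_isOrder _ P.zL_injective
  · exact above_isOrder (leftEnd_spec hx h).1 ((leftEnd_spec hx h).2.1.trans_le hxR)

theorem transit_sweep {U : Opens ℝ} {x : ℝ} (hx : x ∈ U) (hxL : P.xL ≤ x) (hxR : x ≤ P.xR) :
    Transit (P.startOrder m U x) (P.sweep m U x) (P.orderAt m x) := by
  unfold startOrder
  split_ifs with h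
  · rw [sweep_of_Icc_subset h]
    exact transit_eventList_Iic hxL hxR
  · obtain ⟨h1, h2, h3, h4⟩ := leftEnd_spec hx h
    rw [sweep_of_notMem h3 h2.le h4]
    exact transit_eventList_Ioc h1 (h2.trans_le hxR) h2.le hxR

theorem endElt_eq (m : ℕ) (U : Opens ℝ) (x : ℝ) : P.endElt m U x =
    if Set.Icc P.xL x ⊆ U then cuspEnd (P.baseElt m U) else P.pairElt m U (leftEnd U x) := by
  ext p
  unfold endElt
  split_ifs <;> rfl

theorem Icc_subset_iff {U : Set ℝ} {a x : ℝ} (hax : a ≤ x) (hU : Set.Icc a x ⊆ U) :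
    Set.Icc P.xL a ⊆ U ↔ Set.Icc P.xL x ⊆ U := by
  refine ⟨fun h z hz => ?_, fun h => (Set.Icc_subset_Icc_right hax).trans h⟩
  rcases le_total z a with hza | hza
  · exact h ⟨hz.1, hza⟩
  · exact hU ⟨hza, hz.2⟩

theorem leftEnd_eq_leftEnd {U : Set ℝ} {a x : ℝ} (hax : a ≤ x) (hU : Set.Icc a x ⊆ U) :
    leftEnd U a = leftEnd U x := by
  unfold leftEnd
  congr 1
  ext y
  refine ⟨fun h => ⟨h.1.trans hax, h.2⟩, fun h => ⟨?_, h.2⟩⟩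
  by_contra hya
  exact h.2 (hU ⟨(not_le.1 hya).le, h.1⟩)

theorem endElt_eq_endElt {U : Opens ℝ} {a x : ℝ} (hax : a ≤ x) (hU : Set.Icc a x ⊆ U) :
    P.endElt m U a = P.endElt m U x := by
  rw [endElt_eq, endElt_eq, leftEnd_eq_leftEnd hax hU]
  simp only [Icc_subset_iff (P := P) hax hU]

theorem Icc_subset_of_mem_sweep {U : Set ℝ} {x : ℝ} {ev : P.Event m} (h : ev ∈ P.sweep m U x) :
    Event.x ev ≤ x ∧ Set.Icc (Event.x ev) x ⊆ U := by
  rw [sweep_eq] at h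
  exact mem_eventList.1 h

theorem event_x_mem (ev : P.Event m) : Event.x ev ∈ Set.Icc P.xL P.xR := by
  by_contra h
  have h1 : ev ∈ P.eventList m {Event.x ev} := mem_eventList.2 rfl
  rw [eventList_eq_nil fun y hy h' => h (by
    rw [Set.mem_singleton_iff.1 h'] at hy
    exact mem_Icc_of_mem_positions hy)] at h1
  exact List.not_mem_nil h1

theorem after_append_cons {c : P.Cross m} {L₁ L₂ : List (P.Event m)} (h : Sum.inl c ∉ L₁) :
    P.after c (L₁ ++ .inl c :: L₂) = L₂ := by
  induction L₁ with
  | nil => simp [after]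
  | cons ev L₁ ih =>
    rw [List.mem_cons, not_or] at h
    have := ih h.2
    unfold after at this ⊢
    rw [List.cons_append, List.dropWhile_cons_of_pos (by simpa using fun h' => h.1 h'.symm)]
    exact this

/-- The events on the left of a crossing in a sweep which passes it. -/
theorem after_sweep {U : Set ℝ} {x : ℝ} {c : P.Cross m} {L₁ L₂ : List (P.Event m)}
    (h : P.sweep m U x = L₁ ++ .inl c :: L₂) : P.after c (P.sweep m U c.x) = L₂ := by
  have hmem : Sum.inl c ∈ P.sweep m U x := by rw [h]; simp
  obtain ⟨h1, h2⟩ := Icc_subset_of_mem_sweep hmem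
  change c.x ≤ x at h1
  change Set.Icc c.x x ⊆ U at h2
  have hmem' : Sum.inl c ∈ P.sweep m U c.x :=
    by
      rw [sweep_eq]
      refine mem_eventList.2 ⟨le_refl c.x, ?_⟩
      change Set.Icc c.x c.x ⊆ U
      exact (Set.Icc_subset_Icc_right h1).trans h2
  obtain ⟨M₁, M₂, hM⟩ := List.append_of_mem hmem'
  have hnd : (P.sweep m U x).Nodup := by rw [sweep_eq]; exact nodup_eventList _
  have hnd' : (P.sweep m U c.x).Nodup := by rw [sweep_eq]; exact nodup_eventList _
  have e : P.sweep m U x = (P.eventList m (Set.Ioc c.x x) ++ M₁) ++ .inl c :: M₂ := by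
    rw [sweep_eq_append h1 h2, hM, List.append_assoc]
  have key : ∀ {K₁ K₂ : List (P.Event m)}, P.sweep m U x = K₁ ++ .inl c :: K₂ →
      P.after c (P.sweep m U x) = K₂ := by
    intro K₁ K₂ hK
    rw [hK] at hnd ⊢
    refine after_append_cons fun hc => ?_
    exact List.disjoint_of_nodup_append hnd hc (by simp)
  have e1 : M₂ = L₂ := (key e).symm.trans (key h)
  rw [← e1, hM]
  rw [hM] at hnd'
  exact after_append_cons fun hc => List.disjoint_of_nodup_append hnd' hc (by simp)

end PreferredPlat

end

noncomputable section

namespace PreferredPlat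

open Classical SFAlg

variable {r : ℕ} {Λ : Set (ℝ × ℝ × ℝ)} {P : PreferredPlat r Λ} {m : ℕ}

/-! ## The algebras over open sets are DGAs -/

section Elements

variable (U : Opens ℝ)

theorem isPreDGA : IsPreDGA (P.gr m U) (P.diff m U) := SFAlg.isPreDGA

theorem gen_mem_gr (a : P.Gen m U) : gen a ∈ P.gr m U a.deg := gen_mem_grade _ a

theorem diff_gen (a : P.Gen m U) : P.diff m U (gen a) = P.diffGen m U a := derivation_gen _ _ a

theorem crossElt_mem (c : P.Cross m) : P.crossElt m U c ∈ P.gr m U c.deg := by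
  unfold crossElt
  split_ifs with h
  · exact gen_mem_gr U (.cross c h)
  · exact zero_mem _

theorem baseElt_mem (b : P.Base m) :
    (P.baseElt m U b).1 ∈ P.gr m U 0 ∧ ((P.baseElt m U b)⁻¹).1 ∈ P.gr m U 0 := by
  unfold baseElt
  split_ifs with h
  · exact ⟨tgen_mem_grade _ _, tgen_inv_mem_grade _ _⟩
  · rw [inv_one]
    exact ⟨one_mem_grade _, one_mem_grade _⟩

theorem diff_baseElt (b : P.Base m) :
    P.diff m U (P.baseElt m U b).1 = 0 ∧ P.diff m U ((P.baseElt m U b)⁻¹).1 = 0 := by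
  have h : P.diff m U (P.baseElt m U b).1 = 0 := by
    unfold baseElt
    split_ifs with h
    · exact derivation_tgen _ _ _
    · exact (isPreDGA U).d_one
  exact ⟨h, (isPreDGA U).d_inv (baseElt_mem U b).1 h⟩

theorem pairElt_mem (a : ℝ) (p : P.Strand m × P.Strand m) :
    P.pairElt m U a p ∈ P.gr m U (P.μ p.1.1 - P.μ p.2.1 - 1) := by
  unfold pairElt
  split_ifs with h
  · exact gen_mem_gr U (.pair a p.1 p.2 h.1 h.2)
  · exact zero_mem _

variable {U} in
theorem cuspEnd_mem {A : Type*} [Ring A] {gr : ZMod (2 * r) → AddSubgroup A}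
    (h1 : 1 ∈ gr 0) {t : P.Base m → Aˣ} (ht : ∀ b, (t b).1 ∈ gr 0 ∧ (t b)⁻¹.1 ∈ gr 0)
    (p : P.Strand m × P.Strand m) : cuspEnd t p ∈ gr (P.μ p.1.1 - P.μ p.2.1 - 1) := by
  simp only [cuspEnd]
  split_ifs with h h'
  all_goals try exact zero_mem _
  all_goals
    have e : P.μ p.1.1 - P.μ p.2.1 - 1 = 0 := by
      rw [h]
      simp only [P.μ_left]
      ring
    rw [e]
  exacts [signedBase_mem (ht _).1 (ht _).2 _, h1]

theorem endElt_mem (x : ℝ) (p : P.Strand m × P.Strand m) :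
    P.endElt m U x p ∈ P.gr m U (P.μ p.1.1 - P.μ p.2.1 - 1) := by
  rw [endElt_eq]
  split_ifs with h
  · exact cuspEnd_mem (isPreDGA U).one_mem (baseElt_mem U) p
  · exact pairElt_mem U _ p

theorem diskSumOn_mem (x : ℝ) (L : List (P.Event m)) (p : P.Strand m × P.Strand m) :
    P.diskSumOn m U x L p ∈ P.gr m U (P.μ p.1.1 - P.μ p.2.1 - 1) :=
  diskSum_mem (isPreDGA U) (crossElt_mem U) (baseElt_mem U) (endElt_mem U x) L p

theorem invisible_mem {A : Type*} [Ring A] {B : AddSubgroup A}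
    (h1 : 1 ∈ B) {t : P.Base m → Aˣ} (ht : ∀ b, (t b).1 ∈ B ∧ (t b)⁻¹.1 ∈ B)
    (k : Fin P.n) (i : Fin m) : invisible t k i ∈ B := by
  unfold invisible
  split_ifs with h
  · exact signedBase_mem (ht _).1 (ht _).2 _
  · exact h1

end Elements

theorem isMaurerCartan_pairElt {U : Opens ℝ} {a : ℝ} (ha : P.IsLeftEdge U a) :
    IsMaurerCartan (P.diff m U) (P.Above a) (P.pairElt m U a) := by
  rw [isMaurerCartan_iff (above_isOrder ha.2.2.1 ha.2.2.2)]
  intro i j hij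
  have hp : ∀ i j (h : P.Above a i j), P.pairElt m U a (i, j) = gen (.pair a i j ha h) :=
    fun i j h => dif_pos ⟨ha, h⟩
  rw [hp i j hij, diff_gen]
  simp only [diffGen]
  refine Finset.sum_congr rfl fun l _ => ?_
  rw [hp _ _ l.2.1, hp _ _ l.2.2]
  congr 2
  simp only [Gen.deg]
  ring

theorem cuspEnd_mul_cuspEnd {A : Type*} [Ring A] (t : P.Base m → Aˣ) (i l j : P.Strand m) :
    cuspEnd t (i, l) * cuspEnd t (l, j) = 0 := by
  simp only [cuspEnd]
  by_cases h1 : l = ((i.1.1, false), i.2)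
  · have h2 : ¬ ((l, j) = (((l.1.1, true), l.2), ((l.1.1, false), l.2))) := by
      intro h
      have := congrArg (fun p => p.1.1.2) h
      rw [h1] at this
      exact Bool.noConfusion this
    rw [if_neg h2, mul_zero]
  · have h2 : ¬ ((i, l) = (((i.1.1, true), i.2), ((i.1.1, false), i.2))) := fun h =>
      h1 (Prod.mk.inj h).2
    rw [if_neg h2, zero_mul]

theorem isMaurerCartan_cuspEnd (U : Opens ℝ) :
    IsMaurerCartan (P.diff m U) (cuspOrder m (Equiv.refl _) P.zL)
      (cuspEnd (P.baseElt m U)) := by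
  rw [isMaurerCartan_iff (cuspOrder_isOrder _ P.zL_injective)]
  intro i j _
  simp only [cuspEnd_mul_cuspEnd, smul_zero, Finset.sum_const_zero]
  simp only [cuspEnd]
  have hb : ∀ b, (P.baseElt m U b).1 ∈ (P.diff m U).ker ∧
      ((P.baseElt m U b)⁻¹).1 ∈ (P.diff m U).ker := diff_baseElt U
  split_ifs
  · exact signedBase_mem (B := (P.diff m U).ker) (hb _).1 (hb _).2 _
  · exact (isPreDGA U).d_one
  · exact map_zero _

theorem isMaurerCartan_endElt {U : Opens ℝ} {x : ℝ} (hx : x ∈ U) (hxR : x ≤ P.xR) :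
    IsMaurerCartan (P.diff m U) (P.startOrder m U x) (P.endElt m U x) := by
  rw [endElt_eq]
  unfold startOrder
  split_ifs with h
  · exact isMaurerCartan_cuspEnd U
  · exact isMaurerCartan_pairElt (isLeftEdge_leftEnd hx h hxR)

/-- The differential of a crossing in terms of the events on its left in any sweep passing it. -/
theorem diff_crossElt {U : Opens ℝ} {x : ℝ} {c : P.Cross m}
    {L₁ L₂ : List (P.Event m)} (h : P.sweep m U x = L₁ ++ .inl c :: L₂) :
    P.diff m U (P.crossElt m U c) = P.diskSumOn m U x L₂ (c.overStrand, c.underStrand) := by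
  have hmem : Sum.inl c ∈ P.sweep m U x := by rw [h]; simp
  obtain ⟨h1, h2⟩ := Icc_subset_of_mem_sweep hmem
  change c.x ≤ x at h1
  change Set.Icc c.x x ⊆ U at h2
  have hc : c.x ∈ U := h2 ⟨le_rfl, h1⟩
  rw [crossElt, dif_pos hc, diff_gen, diffGen, after_sweep h]
  unfold diskSumOn
  rw [endElt_eq_endElt h1 h2]

theorem isMaurerCartan_diskSumOn {U : Opens ℝ} {x : ℝ} (hx : x ∈ U) (hxR : x ≤ P.xR)
    {L₁ L₂ : List (P.Event m)} (h : P.sweep m U x = L₁ ++ L₂)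
    {ab : P.Strand m → P.Strand m → Prop} (hL : Transit (P.startOrder m U x) L₂ ab) :
    IsMaurerCartan (P.diff m U) ab (P.diskSumOn m U x L₂) := by
  refine hL.isMaurerCartan (isPreDGA U) (startOrder_isOrder hx hxR)
    (crossElt_mem U) (baseElt_mem U) (fun b => (diff_baseElt U b).1) (endElt_mem U x)
    (isMaurerCartan_endElt hx hxR) ?_
  rintro M₁ c M₂ rfl
  exact diff_crossElt (L₁ := L₁ ++ M₁) (by rw [h, List.append_assoc])

/-- If the strands of `p` are adjacent, then the sum over the disks starting with `p` is closed. -/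
theorem diff_diskSumOn_of_adjacent {U : Opens ℝ} {x : ℝ} (hx : x ∈ U) (hxR : x ≤ P.xR)
    {L₁ L₂ : List (P.Event m)} (h : P.sweep m U x = L₁ ++ L₂)
    {ab : P.Strand m → P.Strand m → Prop} (hL : Transit (P.startOrder m U x) L₂ ab)
    {i j : P.Strand m} (hij : ab i j) (hadj : ∀ l, ab i l → ¬ ab l j) :
    P.diff m U (P.diskSumOn m U x L₂ (i, j)) = 0 := by
  have hab := hL.isOrder (startOrder_isOrder hx hxR)
  rw [(isMaurerCartan_iff hab).1 (isMaurerCartan_diskSumOn hx hxR h hL) i j hij]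
  refine Finset.sum_eq_zero fun l _ => absurd l.2.2 (hadj _ l.2.1)

/-- The events on the left of a crossing, and the order of the strands there. -/
theorem exists_sweep_eq {U : Opens ℝ} {c : P.Cross m} (hc : c.x ∈ U) :
    ∃ L₁ L₂ ab ab', P.sweep m U c.x = L₁ ++ .inl c :: L₂ ∧ P.after c (P.sweep m U c.x) = L₂ ∧
      Transit (P.startOrder m U c.x) L₂ ab ∧ CrossStep c ab ab' := by
  have hI : c.x ∈ Set.Icc P.xL P.xR := event_x_mem (.inl c)
  have hmem : Sum.inl c ∈ P.sweep m U c.x := by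
    rw [sweep_eq, mem_eventList]
    refine ⟨le_refl c.x, ?_⟩
    change Set.Icc c.x c.x ⊆ U
    rw [Set.Icc_self, Set.singleton_subset_iff]
    exact hc
  obtain ⟨L₁, L₂, h⟩ := List.append_of_mem hmem
  have ht := transit_sweep (m := m) hc hI.1 hI.2
  rw [h] at ht
  obtain ⟨ab', h1, -⟩ := ht.split
  cases h1 with
  | cross _ hL hcs => exact ⟨L₁, L₂, _, _, h, after_sweep h, hL, hcs⟩

theorem cuspOrder_adjacent (k : Fin P.n) (i : Fin m) :
    cuspOrder m P.rightEquiv P.zR (P.rup k, i) (P.rlow k, i) ∧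
    ∀ l, cuspOrder m P.rightEquiv P.zR (P.rup k, i) l →
      ¬ cuspOrder m P.rightEquiv P.zR l (P.rlow k, i) := by
  have hup : P.rightEquiv.symm (P.rup k) = (k, true) := P.rightEquiv.symm_apply_eq.2 rfl
  have hlow : P.rightEquiv.symm (P.rlow k) = (k, false) := P.rightEquiv.symm_apply_eq.2 rfl
  simp only [cuspOrder, hup, hlow]
  refine ⟨Or.inr ⟨trivial, Or.inr ⟨trivial, trivial, trivial⟩⟩, ?_⟩
  rintro ⟨w, l⟩
  generalize P.rightEquiv.symm w = w'
  obtain ⟨k', s⟩ := w'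
  dsimp only
  cases s <;> grind

theorem rup_rlow_adjacent {k : Fin P.n} {i : Fin m} :
    P.orderAt m P.xR (P.rup k, i) (P.rlow k, i) ∧
    ∀ l, P.orderAt m P.xR (P.rup k, i) l → ¬ P.orderAt m P.xR l (P.rlow k, i) := by
  rw [orderAt, if_pos rfl]
  exact cuspOrder_adjacent k i

theorem diffGen_cross {U : Opens ℝ} (c : P.Cross m) (h : c.x ∈ U) :
    P.diffGen m U (.cross c h) =
      P.diskSumOn m U c.x (P.after c (P.sweep m U c.x)) (c.overStrand, c.underStrand) := rfl

theorem diffGen_cusp {U : Opens ℝ} (k : Fin P.n) (i : Fin m) (h : P.xR ∈ U) :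
    P.diffGen m U (.cusp k i h) = invisible (P.baseElt m U) k i +
      P.diskSumOn m U P.xR (P.sweep m U P.xR) ((P.rup k, i), (P.rlow k, i)) := rfl

theorem diffGen_pair {U : Opens ℝ} (a : ℝ) (i j : P.Strand m) (ha : P.IsLeftEdge U a)
    (h : P.Above a i j) : P.diffGen m U (.pair a i j ha h) =
      ∑ l : {l : P.Strand m // P.Above a i l ∧ P.Above a l j},
        sgn ((Gen.pair a i l.1 ha l.2.1 : P.Gen m U).deg + 1) •
          (gen (.pair a i l.1 ha l.2.1) * gen (.pair a l.1 j ha l.2.2)) := rfl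

theorem diffGen_mem {U : Opens ℝ} (a : P.Gen m U) : P.diffGen m U a ∈ P.gr m U (a.deg - 1) := by
  cases a with
  | cross c h =>
    rw [diffGen_cross]
    exact diskSumOn_mem U c.x _ (c.overStrand, c.underStrand)
  | cusp k i h =>
    have h1 := invisible_mem (B := P.gr m U 0) (isPreDGA U).one_mem (baseElt_mem U) k i
    have h2 := diskSumOn_mem U P.xR (P.sweep m U P.xR) ((P.rup k, i), (P.rlow k, i))
    have e1 : (Gen.cusp k i h : P.Gen m U).deg - 1 = 0 := sub_self (1 : ZMod (2 * r))
    have e2 : P.μ (P.rup k) - P.μ (P.rlow k) - 1 = 0 := by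
      rw [P.μ_right]
      ring
    rw [e2] at h2
    rw [e1, diffGen_cusp]
    exact AddSubgroup.add_mem _ h1 h2
  | pair a i j ha h =>
    rw [diffGen_pair]
    refine sum_mem fun l _ => zsmul_mem ?_ _
    have := (isPreDGA U).mul_mem (gen_mem_gr U (.pair a i l.1 ha l.2.1))
      (gen_mem_gr U (.pair a l.1 j ha l.2.2))
    convert this using 2
    simp only [Gen.deg]
    ring

theorem diff_diffGen {U : Opens ℝ} (a : P.Gen m U) : P.diff m U (P.diffGen m U a) = 0 := by
  cases a with
  | cross c h =>
    obtain ⟨L₁, L₂, ab, ab', h1, h2, h3, h4⟩ := exists_sweep_eq h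
    rw [diffGen_cross, h2]
    exact diff_diskSumOn_of_adjacent (L₁ := L₁ ++ [.inl c]) h (event_x_mem (.inl c)).2
      (by simpa using h1) h3 h4.over_under h4.adjacent
  | cusp k i h =>
    have hb : ∀ b, (P.baseElt m U b).1 ∈ (P.diff m U).ker ∧
      ((P.baseElt m U b)⁻¹).1 ∈ (P.diff m U).ker := diff_baseElt U
    have h1 : P.diff m U (invisible (P.baseElt m U) k i) = 0 :=
      invisible_mem (B := (P.diff m U).ker) (isPreDGA U).d_one hb k i
    have h2 := diff_diskSumOn_of_adjacent (L₁ := []) (L₂ := P.sweep m U P.xR) h le_rfl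
      (List.nil_append _).symm (transit_sweep (m := m) h P.xL_lt_xR.le le_rfl)
      (rup_rlow_adjacent (k := k) (i := i)).1 rup_rlow_adjacent.2
    rw [diffGen_cusp, map_add, h1, h2, add_zero]
  | pair a i j ha h =>
    have := d_d_eq_zero_of_isMaurerCartan (isPreDGA U) (pairElt_mem U a)
      (isMaurerCartan_pairElt ha) h
    have hp : P.pairElt m U a (i, j) = gen (.pair a i j ha h) := dif_pos ⟨ha, h⟩
    rwa [hp, diff_gen] at this

theorem isDGA (m : ℕ) (U : Opens ℝ) : IsDGA (P.gr m U) (P.diff m U) :=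
  isDGA_of_gen diffGen_mem diff_diffGen

/-! ## Corestrictions -/

section Cores

variable {V U W : Opens ℝ} (hVU : V ≤ U)

theorem cores_gen (a : P.Gen m V) : P.cores m hVU (gen a) = P.coresGen m hVU a := lift_gen _ _ a

theorem cores_tgen (b : P.BaseOn m V) :
    P.cores m hVU (tgen b).1 = (tgen (⟨b.1, hVU b.2⟩ : P.BaseOn m U)).1 := lift_tgen _ _ b

theorem cores_crossElt {c : P.Cross m} (hc : c.x ∈ V) :
    P.cores m hVU (P.crossElt m V c) = P.crossElt m U c := by
  rw [crossElt, dif_pos hc, crossElt, dif_pos (hVU hc), cores_gen]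
  rfl

theorem cores_baseElt {b : P.Base m} (hb : b.x ∈ V) :
    P.cores m hVU (P.baseElt m V b).1 = (P.baseElt m U b).1 := by
  rw [baseElt, dif_pos hb, baseElt, dif_pos (hVU hb), cores_tgen]

theorem map_signedBase {A B : Type*} [Ring A] [Ring B] (φ : A →+* B) {t : P.Base m → Aˣ}
    {t' : P.Base m → Bˣ} {b : P.Base m} (h : φ (t b).1 = (t' b).1) (q : Prop) :
    φ (signedBase t b q) = signedBase t' b q := by
  unfold signedBase
  split_ifs
  · exact h
  · exact map_unit_inv φ _ h

theorem map_cuspEnd {A B : Type*} [Ring A] [Ring B] (φ : A →+* B) {t : P.Base m → Aˣ}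
    {t' : P.Base m → Bˣ} (h : ∀ b : P.Base m, b.x = P.xL → φ (t b).1 = (t' b).1)
    (p : P.Strand m × P.Strand m) : φ (cuspEnd t p) = cuspEnd t' p := by
  simp only [cuspEnd]
  split_ifs
  · exact map_signedBase φ (h _ rfl) _
  · exact map_one φ
  · exact map_zero φ

theorem map_invisible {A B : Type*} [Ring A] [Ring B] (φ : A →+* B) {t : P.Base m → Aˣ}
    {t' : P.Base m → Bˣ} (h : ∀ b : P.Base m, b.x = P.xR → φ (t b).1 = (t' b).1)
    (k : Fin P.n) (i : Fin m) : φ (invisible t k i) = invisible t' k i := by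
  unfold invisible
  split_ifs
  · exact map_signedBase φ (h _ rfl) _
  · exact map_one φ

theorem cores_pairElt_of_notMem {a : ℝ} (ha : P.IsLeftEdge V a) (haU : a ∉ U)
    (p : P.Strand m × P.Strand m) :
    P.cores m hVU (P.pairElt m V a p) = P.pairElt m U a p := by
  unfold pairElt
  by_cases h : P.Above a p.1 p.2
  · rw [dif_pos ⟨ha, h⟩, dif_pos ⟨ha.mono hVU haU, h⟩, cores_gen, coresGen, dif_neg haU]
  · rw [dif_neg fun h' => h h'.2, dif_neg fun h' => h h'.2, map_zero]

theorem cores_pairElt_of_mem {a : ℝ} (ha : P.IsLeftEdge V a) (haU : a ∈ U)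
    {p : P.Strand m × P.Strand m} (hp : P.Above a p.1 p.2) :
    P.cores m hVU (P.pairElt m V a p) = P.diskSumOn m U a (P.sweep m U a) p := by
  rw [pairElt, dif_pos ⟨ha, hp⟩, cores_gen, coresGen, dif_pos haU]

/-- The corestriction of a sum over disks. -/
theorem cores_diskSumOn {x : ℝ} (hx : x ∈ V) (hxL : P.xL ≤ x) (hxR : x ≤ P.xR) :
    ∃ R, P.sweep m U x = P.sweep m V x ++ R ∧
      ∀ L₁ L₂ ab (p : P.Strand m × P.Strand m), P.sweep m V x = L₁ ++ L₂ →
        Transit (P.startOrder m V x) L₂ ab → ab p.1 p.2 →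
        P.cores m hVU (P.diskSumOn m V x L₂ p) = P.diskSumOn m U x (L₂ ++ R) p := by
  obtain ⟨R, hR, hend⟩ : ∃ R, P.sweep m U x = P.sweep m V x ++ R ∧
      ∀ q : P.Strand m × P.Strand m, P.startOrder m V x q.1 q.2 →
        P.cores m hVU (P.endElt m V x q) =
          diskSum (P.crossElt m U) (P.baseElt m U) (P.endElt m U x) R q := by
    by_cases h : Set.Icc P.xL x ⊆ V
    · have h' : Set.Icc P.xL x ⊆ U := h.trans hVU
      refine ⟨[], by rw [sweep_of_Icc_subset h, sweep_of_Icc_subset h', List.append_nil], ?_⟩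
      intro q _
      rw [diskSum_nil, endElt_eq, endElt_eq, if_pos h, if_pos h']
      exact map_cuspEnd _ (fun b hb => cores_baseElt hVU (by rw [hb]; exact h ⟨le_rfl, hxL⟩)) q
    · obtain ⟨h1, h2, h3, h4⟩ := leftEnd_spec hx h
      have hed := isLeftEdge_leftEnd hx h hxR
      set a := leftEnd V x with ha
      by_cases haU : a ∈ U
      · have hI : Set.Icc a x ⊆ U := by
          intro z hz
          rcases hz.1.eq_or_lt with rfl | hz'
          · exact haU
          · exact hVU (h4 ⟨hz', hz.2⟩)
        refine ⟨P.sweep m U a, by rw [sweep_of_notMem h3 h2.le h4, sweep_eq_append h2.le hI], ?_⟩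
        intro q hq
        rw [startOrder, if_neg h] at hq
        rw [endElt_eq, if_neg h, cores_pairElt_of_mem hVU hed haU hq, diskSumOn,
          endElt_eq_endElt h2.le hI]
      · have h' : ¬ Set.Icc P.xL x ⊆ U := fun h' => haU (h' ⟨h1, h2.le⟩)
        refine ⟨[], ?_, ?_⟩
        · rw [sweep_of_notMem h3 h2.le h4, sweep_of_notMem haU h2.le (h4.trans hVU),
            List.append_nil]
        · intro q _
          rw [diskSum_nil, endElt_eq, endElt_eq, if_neg h, if_neg h', ← ha,
            leftEnd_eq h2.le haU (h4.trans hVU)]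
          exact cores_pairElt_of_notMem hVU hed haU q
  refine ⟨R, hR, fun L₁ L₂ ab p hL hT hp => ?_⟩
  have hmem : ∀ ev ∈ L₂, Event.x ev ∈ V := by
    intro ev hev
    have h := Icc_subset_of_mem_sweep (show ev ∈ P.sweep m V x by rw [hL]; simp [hev])
    exact h.2 ⟨le_rfl, h.1⟩
  unfold diskSumOn
  rw [diskSum_append, map_diskSum _ _ _ (P.cores m hVU) (P.crossElt m U) (P.baseElt m U) L₂
    (fun c hc => cores_crossElt hVU (hmem (.inl c) hc))
    (fun b hb => cores_baseElt hVU (hmem (.inr b) hb))]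
  exact hT.diskSum_congr (startOrder_isOrder hx hxR) hend hp

/-- The corestriction of the sum over all disks starting with given strands over a point. -/
theorem cores_diskSumOn_sweep {x : ℝ} (hx : x ∈ V) (hxL : P.xL ≤ x) (hxR : x ≤ P.xR)
    {p : P.Strand m × P.Strand m} (hp : P.orderAt m x p.1 p.2) :
    P.cores m hVU (P.diskSumOn m V x (P.sweep m V x) p) =
      P.diskSumOn m U x (P.sweep m U x) p := by
  obtain ⟨R, hR, h⟩ := cores_diskSumOn (m := m) hVU hx hxL hxR
  rw [h [] (P.sweep m V x) _ p (List.nil_append _).symm (transit_sweep hx hxL hxR) hp, hR]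

theorem cores_diffGen (a : P.Gen m V) :
    P.cores m hVU (P.diffGen m V a) = P.diff m U (P.coresGen m hVU a) := by
  cases a with
  | cross c hc =>
    obtain ⟨R, hR, h⟩ :=
      cores_diskSumOn (m := m) hVU hc (event_x_mem (.inl c)).1 (event_x_mem (.inl c)).2
    obtain ⟨L₁, L₂, ab, ab', h1, h2, h3, h4⟩ := exists_sweep_eq hc
    rw [diffGen_cross, h2, h (L₁ ++ [.inl c]) L₂ ab (c.overStrand, c.underStrand)
      (by simpa using h1) h3 h4.over_under, coresGen, diff_gen, diffGen_cross,
      after_sweep (x := c.x) (L₁ := L₁) (L₂ := L₂ ++ R)]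
    change P.sweep m U c.x = _ at hR
    rw [hR]
    rw [h1, List.append_assoc]
    rfl
  | cusp k i hk =>
    rw [diffGen_cusp, map_add, cores_diskSumOn_sweep hVU hk P.xL_lt_xR.le le_rfl
      rup_rlow_adjacent.1, map_invisible (P.cores m hVU)
      (fun b hb => cores_baseElt hVU (by rwa [hb])), coresGen, diff_gen, diffGen_cusp]
  | pair a i j ha hij =>
    rw [diffGen_pair]
    simp only [map_sum, map_zsmul, map_mul, cores_gen]
    by_cases haU : a ∈ U
    · have h := (isMaurerCartan_iff (above_isOrder ha.2.2.1 ha.2.2.2)).1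
        (isMaurerCartan_diskSumOn (L₁ := []) (L₂ := P.sweep m U a) haU ha.2.2.2.le
          (List.nil_append _).symm
          (by
            have := transit_sweep (m := m) haU ha.2.2.1 ha.2.2.2.le
            rwa [orderAt, if_neg ha.2.2.2.ne] at this)) i j hij
      simp only [coresGen, dif_pos haU]
      rw [h]
      refine Finset.sum_congr rfl fun l _ => ?_
      congr 2
      simp only [Gen.deg]
      ring
    · simp only [coresGen, dif_neg haU]
      rw [diff_gen, diffGen_pair]
      rfl

theorem isDGAHom_cores :
    IsDGAHom (P.gr m V) (P.diff m V) (P.gr m U) (P.diff m U) (P.cores m hVU) := by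
  refine isDGAHom_of_gen (isPreDGA U) (fun a => ?_) (fun t => ?_) (fun t => ?_) (fun a => ?_)
    fun t => ?_
  · rw [cores_gen]
    cases a with
    | cross c hc => exact gen_mem_gr U (.cross c (hVU hc))
    | cusp k i hk => exact gen_mem_gr U (.cusp k i (hVU hk))
    | pair a i j ha hij =>
      simp only [coresGen]
      split_ifs with haU
      · exact diskSumOn_mem U a (P.sweep m U a) (i, j)
      · exact gen_mem_gr U (.pair a i j (ha.mono hVU haU) hij)
  · rw [cores_tgen]
    exact tgen_mem_grade _ _
  · rw [map_unit_inv _ _ (cores_tgen hVU t)]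
    exact tgen_inv_mem_grade _ _
  · rw [cores_gen]
    exact cores_diffGen hVU a
  · rw [cores_tgen]
    exact derivation_tgen _ _ _

theorem cores_refl (U : Opens ℝ) : P.cores m (le_refl U) = RingHom.id _ := by
  refine hom_ext (fun a => ?_) fun t => ?_
  · rw [cores_gen]
    cases a with
    | cross c hc => rfl
    | cusp k i hk => rfl
    | pair a i j ha hij =>
      rw [coresGen, dif_neg ha.1]
      rfl
  · rw [cores_tgen]
    rfl

theorem cores_comp (hWV : W ≤ V) (hVU : V ≤ U) :
    (P.cores m hVU).comp (P.cores m hWV) = P.cores m (hWV.trans hVU) := by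
  refine hom_ext (fun a => ?_) fun t => ?_
  · rw [RingHom.comp_apply, cores_gen, cores_gen]
    cases a with
    | cross c hc => exact cores_gen _ _
    | cusp k i hk => exact cores_gen _ _
    | pair a i j ha hij =>
      simp only [coresGen]
      by_cases haV : a ∈ V
      · rw [dif_pos haV, dif_pos (hVU haV)]
        refine cores_diskSumOn_sweep hVU haV ha.2.2.1 ha.2.2.2.le ?_
        rw [orderAt, if_neg ha.2.2.2.ne]
        exact hij
      · rw [dif_neg haV, cores_gen]
        rfl
  · rw [RingHom.comp_apply, cores_tgen, cores_tgen, cores_tgen]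

end Cores

variable (P) in
theorem isDGAPrecosheaf (m : ℕ) : P.IsDGAPrecosheaf m where
  isDGA := isDGA m
  isDGAHom := isDGAHom_cores
  cores_refl := cores_refl
  cores_comp := cores_comp

end PreferredPlat

end

noncomputable section

namespace PreferredPlat

open Classical SFAlg

variable {r : ℕ} {Λ : Set (ℝ × ℝ × ℝ)} {P : PreferredPlat r Λ} {m : ℕ}

theorem pairElt_eq {U : Opens ℝ} {a : ℝ} (ha : P.IsLeftEdge U a) {i j : P.Strand m}
    (h : P.Above a i j) : P.pairElt m U a (i, j) = gen (.pair a i j ha h) := dif_pos ⟨ha, h⟩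

/-! ## Restricting an open set to the right of a point -/

/-- The part of `V` on the right of `y`. -/
def rightOf (V : Opens ℝ) (y : ℝ) : Opens ℝ := V ⊓ ⟨Set.Ioi y, isOpen_Ioi⟩

theorem rightOf_le (V : Opens ℝ) (y : ℝ) : rightOf V y ≤ V := inf_le_left

theorem isLeftEdge_rightOf {V : Opens ℝ} {y : ℝ} (hy : y ∈ V) (hyL : P.xL ≤ y) (hyR : y < P.xR) :
    P.IsLeftEdge (rightOf V y) y :=
  ⟨fun h => lt_irrefl y h.2, Filter.inter_mem (nhdsWithin_le_nhds (V.isOpen.mem_nhds hy))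
    self_mem_nhdsWithin, hyL, hyR⟩

theorem IsLeftEdge.inf {V W : Opens ℝ} {a : ℝ} (hV : P.IsLeftEdge V a) (hW : P.IsLeftEdge W a) :
    P.IsLeftEdge (V ⊓ W) a :=
  ⟨fun h => hV.1 h.1, Filter.inter_mem hV.2.1 hW.2.1, hV.2.2.1, hV.2.2.2⟩

theorem not_Icc_subset_of_leftEnd {U : Set ℝ} {a x : ℝ} (ha : a ∉ U) (haL : P.xL ≤ a)
    (hax : a ≤ x) : ¬ Set.Icc P.xL x ⊆ U := fun h => ha (h ⟨haL, hax⟩)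

theorem diskSumOn_of_leftEnd {U : Opens ℝ} {a x : ℝ} (haL : P.xL ≤ a) (ha : a ∉ U) (hax : a ≤ x)
    (hU : Set.Ioc a x ⊆ U) (p : P.Strand m × P.Strand m) :
    P.diskSumOn m U x (P.sweep m U x) p = diskSum (P.crossElt m U) (P.baseElt m U)
      (P.pairElt m U a) (P.eventList m (Set.Ioc a x)) p := by
  rw [diskSumOn, sweep_of_notMem ha hax hU, endElt_eq,
    if_neg (not_Icc_subset_of_leftEnd ha haL hax), leftEnd_eq hax ha hU]

/-- The corestriction of a pair of left endpoints along an interval without events. -/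
theorem cores_pairElt_of_no_events {V U : Opens ℝ} (hVU : V ≤ U) {a y : ℝ}
    (hV : P.IsLeftEdge V y) (haL : P.xL ≤ a) (ha : a ∉ U) (hay : a ≤ y)
    (hU : Set.Ioc a y ⊆ U) (hpos : ∀ z ∈ P.positions, z ∉ Set.Ioc a y)
    {p : P.Strand m × P.Strand m} (hp : P.Above y p.1 p.2) :
    P.cores m hVU (P.pairElt m V y p) = P.pairElt m U a p := by
  rcases hay.eq_or_lt with rfl | hay'
  · exact cores_pairElt_of_notMem hVU hV ha p
  · rw [cores_pairElt_of_mem hVU hV (hU ⟨hay', le_rfl⟩) hp, diskSumOn_of_leftEnd haL ha hay hU,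
      eventList_eq_nil hpos, diskSum_nil]

theorem above_eq_of_no_events {a y : ℝ} (haL : P.xL ≤ a) (hay : a ≤ y) (hy : y < P.xR)
    (hpos : ∀ z ∈ P.positions, z ∉ Set.Ioc a y) : P.Above (m := m) a = P.Above y := by
  have h := transit_eventList_Ioc (P := P) (m := m) haL (hay.trans_lt hy) hay hy.le
  rw [eventList_eq_nil hpos, orderAt, if_neg hy.ne] at h
  generalize hA : P.Above (m := m) y = ab at h
  cases h
  rfl

/-- Close to a left boundary point there are no events. -/
theorem IsLeftEdge.exists_no_events {U : Opens ℝ} {a b : ℝ} (ha : P.IsLeftEdge U a) (hab : a < b) :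
    ∃ y, a < y ∧ y < b ∧ y < P.xR ∧ Set.Ioc a y ⊆ U ∧ ∀ z ∈ P.positions, z ∉ Set.Ioc a y := by
  have h1 : (P.positions.filter fun z => a < z : Set ℝ)ᶜ ∈ 𝓝[>] a := by
    refine nhdsWithin_le_nhds ((Finset.finite_toSet _).isClosed.isOpen_compl.mem_nhds ?_)
    simp
  obtain ⟨c, hc, hc'⟩ := (mem_nhdsGT_iff_exists_Ioo_subset).1 (Filter.inter_mem ha.2.1 h1)
  obtain ⟨y, hy1, hy2⟩ := exists_between (lt_min (lt_min hc hab) ha.2.2.2)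
  rw [lt_min_iff, lt_min_iff] at hy2
  refine ⟨y, hy1, hy2.1.2, hy2.2, fun z hz => (hc' ⟨hz.1, hz.2.trans_lt hy2.1.1⟩).1,
    fun z hzP hz => (hc' ⟨hz.1, hz.2.trans_lt hy2.1.1⟩).2 ?_⟩
  simp [hzP, hz.1]

/-! ## Gluing ring homomorphisms -/

/-- A compatible family of ring homomorphisms on the algebras over the members of a covering
sieve. -/
structure GlueData (P : PreferredPlat r Λ) (m : ℕ) (U : Opens ℝ) (E : Type*) [Ring E] where
  mem : Opens ℝ → Prop
  le : ∀ {V}, mem V → V ≤ U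
  down : ∀ {W V}, W ≤ V → mem V → mem W
  cover : ∀ x ∈ U, ∃ V, mem V ∧ x ∈ V
  f : ∀ V, mem V → P.Alg m V →+* E
  compat : ∀ {W V} (h : W ≤ V) (hV : mem V), (f V hV).comp (P.cores m h) = f W (down h hV)

namespace GlueData

variable {U : Opens ℝ} {E : Type*} [Ring E] (D : GlueData P m U E)

theorem compat_apply {W V : Opens ℝ} (h : W ≤ V) (hV : D.mem V) (x : P.Alg m W) :
    D.f V hV (P.cores m h x) = D.f W (D.down h hV) x := by
  rw [← D.compat h hV]
  rfl

/-- A member of the cover which contains `x`. -/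
def nbhd (x : ℝ) (hx : x ∈ U) : Opens ℝ := (D.cover x hx).choose

theorem mem_nbhd (x : ℝ) (hx : x ∈ U) : D.mem (D.nbhd x hx) := (D.cover x hx).choose_spec.1

theorem self_mem_nbhd (x : ℝ) (hx : x ∈ U) : x ∈ D.nbhd x hx := (D.cover x hx).choose_spec.2

/-- The glued value of a crossing. -/
def cross (c : P.Cross m) : E :=
  if h : c.x ∈ U then D.f _ (D.mem_nbhd _ h) (P.crossElt m _ c) else 0

theorem f_crossElt {V : Opens ℝ} (hV : D.mem V) {c : P.Cross m} (hc : c.x ∈ V) :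
    D.f V hV (P.crossElt m V c) = D.cross c := by
  have hcU := D.le hV hc
  rw [cross, dif_pos hcU]
  have hW : c.x ∈ V ⊓ D.nbhd _ hcU := ⟨hc, D.self_mem_nbhd _ hcU⟩
  rw [← cores_crossElt inf_le_left hW, ← cores_crossElt inf_le_right hW, D.compat_apply,
    D.compat_apply]

/-- The glued value of a base point. -/
def base (b : P.Base m) : Eˣ :=
  if h : b.x ∈ U then Units.map (D.f _ (D.mem_nbhd _ h)).toMonoidHom (P.baseElt m _ b) else 1

theorem f_baseElt {V : Opens ℝ} (hV : D.mem V) {b : P.Base m} (hb : b.x ∈ V) :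
    D.f V hV (P.baseElt m V b).1 = (D.base b).1 := by
  have hbU := D.le hV hb
  rw [base, dif_pos hbU]
  have hW : b.x ∈ V ⊓ D.nbhd _ hbU := ⟨hb, D.self_mem_nbhd _ hbU⟩
  change _ = D.f _ _ (P.baseElt m _ b).1
  rw [← cores_baseElt inf_le_left hW, ← cores_baseElt inf_le_right hW, D.compat_apply,
    D.compat_apply]

/-- The glued value of a right cusp. -/
def cusp (k : Fin P.n) (i : Fin m) : E :=
  if h : P.xR ∈ U then D.f _ (D.mem_nbhd _ h) (gen (.cusp k i (D.self_mem_nbhd _ h))) else 0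

theorem f_cusp {V : Opens ℝ} (hV : D.mem V) (k : Fin P.n) (i : Fin m) (h : P.xR ∈ V) :
    D.f V hV (gen (.cusp k i h)) = D.cusp k i := by
  have hU := D.le hV h
  rw [cusp, dif_pos hU]
  have hW : P.xR ∈ V ⊓ D.nbhd _ hU := ⟨h, D.self_mem_nbhd _ hU⟩
  have h1 := cores_gen (inf_le_left : V ⊓ D.nbhd _ hU ≤ V) (.cusp k i hW)
  have h2 := cores_gen (inf_le_right : V ⊓ D.nbhd _ hU ≤ D.nbhd _ hU) (.cusp k i hW)
  simp only [coresGen] at h1 h2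
  rw [← h1, ← h2, D.compat_apply, D.compat_apply]

/-- The value of a pair of left endpoints over `y ∈ U`. -/
def pair (y : ℝ) (p : P.Strand m × P.Strand m) : E :=
  if h : y ∈ U then
    D.f _ (D.down (rightOf_le _ y) (D.mem_nbhd _ h)) (P.pairElt m (rightOf (D.nbhd y h) y) y p)
  else 0

theorem f_pairElt {V : Opens ℝ} (hV : D.mem V) {y : ℝ} (hyU : y ∈ U) (hy : P.IsLeftEdge V y)
    (p : P.Strand m × P.Strand m) : D.f V hV (P.pairElt m V y p) = D.pair y p := by
  rw [pair, dif_pos hyU]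
  have hy' := isLeftEdge_rightOf (P := P) (D.self_mem_nbhd y hyU) hy.2.2.1 hy.2.2.2
  have hW := hy.inf hy'
  rw [← cores_pairElt_of_notMem inf_le_left hW hy.1, D.compat_apply,
    ← cores_pairElt_of_notMem inf_le_right hW hy'.1, D.compat_apply]

/-- The values of pairs of left endpoints in terms of a sum over disks over a member of the cover. -/
theorem pair_eq {V : Opens ℝ} (hV : D.mem V) {y : ℝ} (hy : y ∈ V) (hyL : P.xL ≤ y)
    (hyR : y < P.xR) {p : P.Strand m × P.Strand m} (hp : P.Above y p.1 p.2) :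
    D.pair y p = D.f V hV (P.diskSumOn m V y (P.sweep m V y) p) := by
  have he := isLeftEdge_rightOf (P := P) hy hyL hyR
  rw [← D.f_pairElt (D.down (rightOf_le V y) hV) (D.le hV hy) he, ← D.compat_apply (rightOf_le V y),
    cores_pairElt_of_mem _ he hy hp]

theorem map_diskSum {V : Opens ℝ} (hV : D.mem V) (e : P.Strand m × P.Strand m → P.Alg m V)
    (L : List (P.Event m)) (hL : ∀ ev ∈ L, Event.x ev ∈ V) (p : P.Strand m × P.Strand m) :
    D.f V hV (diskSum (P.crossElt m V) (P.baseElt m V) e L p) =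
      diskSum D.cross D.base (fun q => D.f V hV (e q)) L p :=
  PreferredPlat.map_diskSum _ _ _ (D.f V hV) D.cross D.base L
    (fun c hc => D.f_crossElt hV (hL (.inl c) hc)) (fun b hb => D.f_baseElt hV (hL (.inr b) hb)) p

/-- Moving the values of pairs of left endpoints past the events over an interval in a member of the
cover. -/
theorem pair_transport_of_mem {V : Opens ℝ} (hV : D.mem V) {y z : ℝ} (hyL : P.xL ≤ y)
    (hyz : y ≤ z) (hzR : z < P.xR) (hI : Set.Icc y z ⊆ V) {p : P.Strand m × P.Strand m}
    (hp : P.Above z p.1 p.2) :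
    D.pair z p = diskSum D.cross D.base (D.pair y) (P.eventList m (Set.Ioc y z)) p := by
  rcases hyz.eq_or_lt with rfl | hyz'
  · rw [Set.Ioc_self, eventList_eq_nil (by simp), diskSum_nil]
  have hyV : y ∈ V := hI ⟨le_rfl, hyz⟩
  have he := isLeftEdge_rightOf (P := P) hyV hyL (hyz.trans_lt hzR)
  have hsub : Set.Ioc y z ⊆ rightOf V y := fun w hw => ⟨hI ⟨hw.1.le, hw.2⟩, hw.1⟩
  have hW := D.down (rightOf_le V y) hV
  rw [D.pair_eq hW (hsub ⟨hyz', le_rfl⟩) (hyL.trans hyz) hzR hp,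
    diskSumOn_of_leftEnd hyL he.1 hyz hsub, D.map_diskSum hW _ _
      fun ev hev => hsub (mem_eventList.1 hev)]
  congr 1
  funext q
  exact D.f_pairElt hW (D.le hV hyV) he q

theorem eventList_Ioc_append {x y z : ℝ} (hxy : x ≤ y) (hyz : y ≤ z) :
    P.eventList m (Set.Ioc x z) = P.eventList m (Set.Ioc y z) ++ P.eventList m (Set.Ioc x y) :=
  eventList_eq_append (fun w _ => by rw [← Set.Ioc_union_Ioc_eq_Ioc hxy hyz]; exact Iff.rfl)
    fun w hw v hv => hw.2.trans_lt hv.1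

theorem pair_transport {y z : ℝ} (hyL : P.xL ≤ y) (hyz : y ≤ z) (hzR : z < P.xR)
    (hI : Set.Icc y z ⊆ U) {p : P.Strand m × P.Strand m} (hp : P.Above z p.1 p.2) :
    D.pair z p = diskSum D.cross D.base (D.pair y) (P.eventList m (Set.Ioc y z)) p := by
  obtain ⟨t, ht0, htm, ⟨N, hN⟩, ht⟩ := exists_monotone_Icc_subset_open_cover_Icc hyz
    (c := fun V : {V // D.mem V} => ((↑) : Set.Icc y z → ℝ) ⁻¹' (V.1 : Set ℝ))
    (fun V => V.1.isOpen.preimage continuous_subtype_val) (by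
      intro w _
      obtain ⟨V, hV, hw⟩ := D.cover w.1 (hI w.2)
      exact Set.mem_iUnion.2 ⟨⟨V, hV⟩, hw⟩)
  have key : ∀ n, ∀ p : P.Strand m × P.Strand m, P.Above (t n).1 p.1 p.2 →
      D.pair (t n) p = diskSum D.cross D.base (D.pair y) (P.eventList m (Set.Ioc y (t n))) p := by
    intro n
    induction n with
    | zero =>
      intro p _
      rw [ht0, Set.Ioc_self, eventList_eq_nil (by simp), diskSum_nil]
    | succ n ih =>
      intro p hp
      obtain ⟨⟨V, hV⟩, hVt⟩ := ht n
      have h1 : y ≤ (t n).1 := (t n).2.1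
      have h2 : (t n).1 ≤ (t (n + 1)).1 := htm (Nat.le_succ n)
      have h3 : (t (n + 1)).1 < P.xR := (t (n + 1)).2.2.trans_lt hzR
      rw [D.pair_transport_of_mem hV (hyL.trans h1) h2 h3 (fun w hw => hVt
        (show (⟨w, h1.trans hw.1, hw.2.trans (t (n + 1)).2.2⟩ : Set.Icc y z) ∈ _ from hw)) hp,
        eventList_Ioc_append h1 h2, diskSum_append]
      have hT := transit_eventList_Ioc (m := m) (hyL.trans h1) (h2.trans_lt h3) h2 h3.le
      rw [orderAt, if_neg h3.ne] at hT
      exact hT.diskSum_congr (above_isOrder (hyL.trans h1) (h2.trans_lt h3)) (fun q hq => ih q hq) hp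
  have := key N p (by rw [hN N le_rfl]; exact hp)
  rwa [hN N le_rfl] at this

theorem pair_xL (hU : P.xL ∈ U) {p : P.Strand m × P.Strand m} (hp : P.Above P.xL p.1 p.2) :
    D.pair P.xL p = diskSum D.cross D.base (cuspEnd D.base) (P.eventList m (Set.Iic P.xL)) p := by
  obtain ⟨V, hV, hx⟩ := D.cover _ hU
  have hI : Set.Icc P.xL P.xL ⊆ V := by
    rw [Set.Icc_self, Set.singleton_subset_iff]
    exact hx
  rw [D.pair_eq hV hx le_rfl P.xL_lt_xR hp, diskSumOn, sweep_of_Icc_subset hI, endElt_eq,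
    if_pos hI, D.map_diskSum hV]
  · congr 1
    funext q
    exact map_cuspEnd _ (fun b hb => D.f_baseElt hV (by rwa [hb])) q
  · intro ev hev
    have h1 : Event.x ev ≤ P.xL := mem_eventList.1 hev
    rwa [le_antisymm h1 (event_x_mem ev).1]

/-- The values of pairs of left endpoints over a left boundary point `a` of `U`. -/
def edge (a : ℝ) (ha : P.IsLeftEdge U a) : P.Strand m × P.Strand m → E :=
  D.pair (ha.exists_no_events ha.2.2.2).choose

theorem edge_eq {a : ℝ} (ha : P.IsLeftEdge U a) {y : ℝ} (hay : a < y) (hyR : y < P.xR)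
    (hU : Set.Ioc a y ⊆ U) (hpos : ∀ z ∈ P.positions, z ∉ Set.Ioc a y)
    {p : P.Strand m × P.Strand m} (hp : P.Above a p.1 p.2) : D.edge a ha p = D.pair y p := by
  obtain ⟨h1, h2, h3, h4, h5⟩ := (ha.exists_no_events ha.2.2.2).choose_spec
  rw [edge]
  generalize (ha.exists_no_events ha.2.2.2).choose = y' at *
  have key : ∀ w z, a < w → w ≤ z → z < P.xR → Set.Ioc a z ⊆ U →
      (∀ v ∈ P.positions, v ∉ Set.Ioc a z) → D.pair z p = D.pair w p := by
    intro w z haw hwz hzR hU hpos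
    rw [D.pair_transport (ha.2.2.1.trans haw.le) hwz hzR
      (fun v hv => hU ⟨haw.trans_le hv.1, hv.2⟩), eventList_eq_nil, diskSum_nil]
    · exact fun v hv hv' => hpos v hv ⟨haw.trans hv'.1, hv'.2⟩
    · rwa [← above_eq_of_no_events ha.2.2.1 (haw.trans_le hwz).le hzR hpos]
  rcases le_total y y' with h | h
  · exact key y y' hay h h3 h4 h5
  · exact (key y' y h1 h hyR hU hpos).symm

/-- The glued homomorphism. -/
def glue : P.Alg m U →+* E :=
  lift (fun a => match a with
    | .cross c _ => D.cross c
    | .cusp k i _ => D.cusp k i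
    | .pair a i j ha _ => D.edge a ha (i, j)) fun b => D.base b.1

theorem glue_crossElt {c : P.Cross m} (hc : c.x ∈ U) : D.glue (P.crossElt m U c) = D.cross c := by
  rw [crossElt, dif_pos hc, glue, lift_gen]

theorem glue_baseElt {b : P.Base m} (hb : b.x ∈ U) : D.glue (P.baseElt m U b).1 = (D.base b).1 := by
  rw [baseElt, dif_pos hb, glue, lift_tgen]

theorem glue_pairElt {a : ℝ} (ha : P.IsLeftEdge U a) {p : P.Strand m × P.Strand m}
    (hp : P.Above a p.1 p.2) : D.glue (P.pairElt m U a p) = D.edge a ha p := by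
  rw [pairElt, dif_pos ⟨ha, hp⟩, glue, lift_gen]

theorem glue_diskSum (e : P.Strand m × P.Strand m → P.Alg m U)
    (L : List (P.Event m)) (hL : ∀ ev ∈ L, Event.x ev ∈ U) (p : P.Strand m × P.Strand m) :
    D.glue (diskSum (P.crossElt m U) (P.baseElt m U) e L p) =
      diskSum D.cross D.base (fun q => D.glue (e q)) L p :=
  PreferredPlat.map_diskSum _ _ _ D.glue D.cross D.base L
    (fun c hc => D.glue_crossElt (hL (.inl c) hc)) (fun b hb => D.glue_baseElt (hL (.inr b) hb)) p

/-- The glued value of a sum over disks. -/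
theorem glue_diskSumOn {y : ℝ} (hy : y ∈ U) (hyL : P.xL ≤ y) (hyR : y < P.xR)
    {p : P.Strand m × P.Strand m} (hp : P.Above y p.1 p.2) :
    D.glue (P.diskSumOn m U y (P.sweep m U y) p) = D.pair y p := by
  by_cases h : Set.Icc P.xL y ⊆ U
  · have hxL : P.xL ∈ U := h ⟨le_rfl, hyL⟩
    rw [D.pair_transport le_rfl hyL hyR h hp, diskSumOn, sweep_of_Icc_subset h, endElt_eq,
      if_pos h, D.glue_diskSum]
    · rw [eventList_eq_append (T := Set.Iic P.xL) (T' := Set.Ioc P.xL y), diskSum_append]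
      · have hT := transit_eventList_Ioc (m := m) le_rfl P.xL_lt_xR hyL hyR.le
        rw [orderAt, if_neg hyR.ne] at hT
        refine hT.diskSum_congr (above_isOrder le_rfl P.xL_lt_xR) (fun q hq => ?_) hp
        rw [D.pair_xL hxL hq]
        congr 1
        funext q'
        exact map_cuspEnd _ (fun b hb => D.glue_baseElt (by rwa [hb])) q'
      · intro z _
        rw [← Set.mem_union, Set.Iic_union_Ioc_eq_Iic hyL]
      · exact fun z hz w hw => (Set.mem_Iic.1 hz).trans_lt hw.1
    · intro ev hev
      exact h ⟨(event_x_mem ev).1, mem_eventList.1 hev⟩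
  · obtain ⟨h1, h2, h3, h4⟩ := leftEnd_spec hy h
    have he := isLeftEdge_leftEnd hy h hyR.le
    rw [diskSumOn_of_leftEnd h1 h3 h2.le h4]
    generalize leftEnd U y = a at *
    obtain ⟨w, haw, hwy, hwR, hU, hpos⟩ := he.exists_no_events h2
    rw [D.glue_diskSum _ _ fun ev hev => h4 (mem_eventList.1 hev),
      D.pair_transport (h1.trans haw.le) hwy.le hyR (show Set.Icc w y ⊆ U from
        fun z hz => h4 ⟨haw.trans_le hz.1, hz.2⟩) hp,
      eventList_Ioc_append haw.le hwy.le, eventList_eq_nil hpos, List.append_nil]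
    have hT := transit_eventList_Ioc (m := m) (h1.trans haw.le) hwR hwy.le hyR.le
    rw [orderAt, if_neg hyR.ne] at hT
    refine hT.diskSum_congr (above_isOrder (h1.trans haw.le) hwR) (fun q hq => ?_) hp
    have hq' : P.Above a q.1 q.2 := by rwa [above_eq_of_no_events h1 haw.le hwR hpos]
    rw [D.glue_pairElt he hq', D.edge_eq he haw hwR hU hpos hq']

/-- The glued homomorphism extends the given ones. -/
theorem glue_comp {V : Opens ℝ} (hV : D.mem V) : D.glue.comp (P.cores m (D.le hV)) = D.f V hV := by
  refine hom_ext (fun a => ?_) fun b => ?_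
  · rw [RingHom.comp_apply, cores_gen]
    cases a with
    | cross c hc =>
      have h1 := D.f_crossElt hV hc
      have h2 := D.glue_crossElt (D.le hV hc)
      rw [crossElt, dif_pos hc] at h1
      rw [crossElt, dif_pos (D.le hV hc)] at h2
      rw [h1]
      exact h2
    | cusp k i hk =>
      rw [D.f_cusp hV k i hk, coresGen, glue, lift_gen]
    | pair a i j ha hij =>
      have hp : gen (.pair a i j ha hij) = P.pairElt m V a (i, j) := (pairElt_eq ha hij).symm
      rw [hp]
      simp only [coresGen]
      by_cases haU : a ∈ U
      · rw [dif_pos haU, D.f_pairElt hV haU ha, D.glue_diskSumOn haU ha.2.2.1 ha.2.2.2 hij]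
      · have he := ha.mono (D.le hV) haU
        have hp' : gen (.pair a i j he hij) = P.pairElt m U a (i, j) := (pairElt_eq he hij).symm
        obtain ⟨y, h1, h2, h3, h4, h5⟩ := ha.exists_no_events ha.2.2.2
        have hij' : P.Above y i j := by rwa [← above_eq_of_no_events ha.2.2.1 h1.le h3 h5]
        rw [dif_neg haU, hp', D.glue_pairElt he hij,
          D.edge_eq he h1 h3 (h4.trans (D.le hV)) h5 hij,
          D.pair_eq hV (h4 ⟨h1, le_rfl⟩) (ha.2.2.1.trans h1.le) h3 hij',
          diskSumOn_of_leftEnd ha.2.2.1 ha.1 h1.le h4, eventList_eq_nil h5, diskSum_nil]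
  · have h1 := D.f_baseElt hV b.2
    have h2 := D.glue_baseElt (D.le hV b.2)
    rw [baseElt, dif_pos b.2] at h1
    rw [baseElt, dif_pos (D.le hV b.2)] at h2
    rw [RingHom.comp_apply, cores_tgen, h1]
    exact h2

end GlueData

/-! ## Generators come from the members of a cover -/

theorem exists_cores_gen {U : Opens ℝ} {mem : Opens ℝ → Prop}
    (down : ∀ {W V : Opens ℝ}, W ≤ V → mem V → mem W) (le : ∀ {V}, mem V → V ≤ U)
    (cover : ∀ x ∈ U, ∃ V, mem V ∧ x ∈ V) (a : P.Gen m U) :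
    ∃ (V : Opens ℝ) (hV : mem V) (b : P.Gen m V),
      b.deg = a.deg ∧ P.cores m (le hV) (gen b) = gen a := by
  cases a with
  | cross c h =>
    obtain ⟨V, hV, hx⟩ := cover _ h
    exact ⟨V, hV, .cross c hx, rfl, cores_gen _ _⟩
  | cusp k i h =>
    obtain ⟨V, hV, hx⟩ := cover _ h
    exact ⟨V, hV, .cusp k i hx, rfl, cores_gen _ _⟩
  | pair a i j ha hij =>
    obtain ⟨y, h1, h2, h3, h4, h5⟩ := ha.exists_no_events ha.2.2.2
    obtain ⟨V, hV, hy⟩ := cover y (h4 ⟨h1, le_rfl⟩)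
    have he := isLeftEdge_rightOf (P := P) hy (ha.2.2.1.trans h1.le) h3
    have hij' : P.Above y i j := by rwa [← above_eq_of_no_events ha.2.2.1 h1.le h3 h5]
    have key := cores_pairElt_of_no_events (m := m) (le (down (rightOf_le V y) hV)) he ha.2.2.1
      ha.1 h1.le h4 h5 (p := (i, j)) hij'
    rw [pairElt, pairElt, dif_pos ⟨he, hij'⟩, dif_pos ⟨ha, hij⟩] at key
    exact ⟨_, down (rightOf_le V y) hV, .pair y i j he hij', rfl, key⟩

theorem exists_cores_tgen {U : Opens ℝ} {mem : Opens ℝ → Prop} (le : ∀ {V}, mem V → V ≤ U)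
    (cover : ∀ x ∈ U, ∃ V, mem V ∧ x ∈ V) (b : P.BaseOn m U) :
    ∃ (V : Opens ℝ) (hV : mem V) (b' : P.BaseOn m V),
      P.cores m (le hV) (tgen b').1 = (tgen b).1 := by
  obtain ⟨V, hV, hx⟩ := cover _ b.2
  exact ⟨V, hV, ⟨b.1, hx⟩, cores_tgen _ _⟩

end PreferredPlat

end

noncomputable section

namespace PreferredPlat

open Classical SFAlg

variable {r : ℕ} {Λ : Set (ℝ × ℝ × ℝ)} {P : PreferredPlat r Λ} {m : ℕ}

/-! ## The cosheaf property -/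

namespace GlueData

variable {U : Opens ℝ} {E : Type*} [Ring E] (D : GlueData P m U E)

theorem glue_unique {g g' : P.Alg m U →+* E}
    (h : ∀ V (hV : D.mem V), g.comp (P.cores m (D.le hV)) = g'.comp (P.cores m (D.le hV))) :
    g = g' := by
  have h' : ∀ V (hV : D.mem V) (x : P.Alg m V),
      g (P.cores m (D.le hV) x) = g' (P.cores m (D.le hV) x) :=
    fun V hV x => RingHom.congr_fun (h V hV) x
  refine hom_ext (fun a => ?_) fun t => ?_
  · obtain ⟨V, hV, b, -, hb⟩ := exists_cores_gen D.down D.le D.cover a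
    rw [← hb, h' V hV]
  · obtain ⟨V, hV, b, hb⟩ := exists_cores_tgen D.le D.cover t
    rw [← hb, h' V hV]

theorem glue_cores {V : Opens ℝ} (hV : D.mem V) (x : P.Alg m V) :
    D.glue (P.cores m (D.le hV) x) = D.f V hV x := RingHom.congr_fun (D.glue_comp hV) x

variable {grE : ZMod (2 * r) → AddSubgroup E} {dE : E →+ E}

theorem glue_gen_mem (hf : ∀ V hV, IsGradedHom (P.gr m V) grE (D.f V hV)) (a : P.Gen m U) :
    D.glue (gen a) ∈ grE a.deg := by
  obtain ⟨V, hV, b, hdeg, hb⟩ := exists_cores_gen D.down D.le D.cover a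
  rw [← hb, D.glue_cores hV, ← hdeg]
  exact hf V hV (gen_mem_gr V b)

theorem glue_tgen_mem (hf : ∀ V hV, IsGradedHom (P.gr m V) grE (D.f V hV)) (t : P.BaseOn m U) :
    D.glue (tgen t).1 ∈ grE 0 := by
  obtain ⟨V, hV, b, hb⟩ := exists_cores_tgen D.le D.cover t
  rw [← hb, D.glue_cores hV]
  exact hf V hV (tgen_mem_grade _ b)

theorem glue_tgen_inv_mem (hf : ∀ V hV, IsGradedHom (P.gr m V) grE (D.f V hV))
    (t : P.BaseOn m U) : D.glue ((tgen t)⁻¹ : (P.Alg m U)ˣ).1 ∈ grE 0 := by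
  obtain ⟨V, hV, b, hb⟩ := exists_cores_tgen D.le D.cover t
  rw [← map_unit_inv _ _ hb, D.glue_cores hV]
  exact hf V hV (tgen_inv_mem_grade _ b)

theorem glue_isGradedHom (one : (1 : E) ∈ grE 0)
    (mul : ∀ {i j : ZMod (2 * r)} {x y : E}, x ∈ grE i → y ∈ grE j → x * y ∈ grE (i + j))
    (hf : ∀ V hV, IsGradedHom (P.gr m V) grE (D.f V hV)) :
    IsGradedHom (P.gr m U) grE D.glue :=
  isGradedHom_of_gen one mul (D.glue_gen_mem hf) (D.glue_tgen_mem hf) (D.glue_tgen_inv_mem hf)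

theorem glue_isDGAHom (hE : IsPreDGA grE dE)
    (hf : ∀ V hV, IsDGAHom (P.gr m V) (P.diff m V) grE dE (D.f V hV)) :
    IsDGAHom (P.gr m U) (P.diff m U) grE dE D.glue := by
  have hf' : ∀ V hV, IsGradedHom (P.gr m V) grE (D.f V hV) := fun V hV => (hf V hV).graded
  refine isDGAHom_of_gen hE (D.glue_gen_mem hf') (D.glue_tgen_mem hf') (D.glue_tgen_inv_mem hf')
    (fun a => ?_) fun t => ?_
  · obtain ⟨V, hV, b, -, hb⟩ := exists_cores_gen D.down D.le D.cover a
    rw [← diff_gen, ← hb, ← (isDGAHom_cores (D.le hV)).comm, D.glue_cores hV, D.glue_cores hV,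
      (hf V hV).comm]
  · obtain ⟨V, hV, b, hb⟩ := exists_cores_tgen D.le D.cover t
    have hz : P.diff m V (tgen b).1 = 0 := derivation_tgen _ _ b
    rw [← hb, D.glue_cores hV, ← (hf V hV).comm, hz, map_zero]

/-- A compatible family on a covering sieve. -/
def ofSieve {S : Sieve U} (hS : S ∈ Opens.grothendieckTopology ℝ U)
    (f : ∀ ⦃V⦄ (i : V ⟶ U), S i → P.Alg m V →+* E)
    (compat : ∀ ⦃W V⦄ (j : W ⟶ V) (i : V ⟶ U) (h : S i),
      (f i h).comp (P.cores m (leOfHom j)) = f (j ≫ i) (S.downward_closed h j)) :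
    GlueData P m U E where
  mem V := ∃ h : V ≤ U, S (homOfLE h)
  le h := h.1
  down hWV h := ⟨hWV.trans h.1, S.downward_closed h.2 (homOfLE hWV)⟩
  cover x hx := by
    obtain ⟨V, i, hV, hxV⟩ := hS x hx
    exact ⟨V, ⟨leOfHom i, hV⟩, hxV⟩
  f V hV := f (homOfLE hV.1) hV.2
  compat hWV hV := compat (homOfLE hWV) _ hV.2

end GlueData

theorem isCosheaf (H : P.IsDGAPrecosheaf m) : IsCosheaf H.functor := by
  intro E U S hS x hx
  rw [Presieve.compatible_iff_sieveCompatible] at hx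
  let D : GlueData P m U E.unop.carrier := GlueData.ofSieve hS (fun V i h => (x i h).unop.1)
    fun W V j i h => (congrArg (fun g => g.unop.1) (hx i j h)).symm
  refine ⟨Quiver.Hom.op (⟨D.glue, D.glue_isDGAHom E.unop.isDGA.isPreDGA
    fun V hV => (x _ hV.2).unop.2⟩ : H.functor.obj U ⟶ E.unop), ?_, ?_⟩
  · intro V i hi
    exact Quiver.Hom.unop_inj (Subtype.ext (D.glue_comp ⟨leOfHom i, hi⟩))
  · intro g hg
    exact Quiver.Hom.unop_inj (Subtype.ext (D.glue_unique fun V hV =>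
      (congrArg (fun g => g.unop.1) (hg _ hV.2)).trans (D.glue_comp hV).symm))

theorem isCosheaf_grRing (H : P.IsDGAPrecosheaf m) : IsCosheaf (H.functor ⋙ DGA.toGrRing r) := by
  intro E U S hS x hx
  rw [Presieve.compatible_iff_sieveCompatible] at hx
  let D : GlueData P m U E.unop.carrier := GlueData.ofSieve hS (fun V i h => (x i h).unop.1)
    fun W V j i h => (congrArg (fun g => g.unop.1) (hx i j h)).symm
  refine ⟨Quiver.Hom.op (⟨D.glue, D.glue_isGradedHom E.unop.isGradedRing.one_mem
    E.unop.isGradedRing.mul_mem fun V hV => (x _ hV.2).unop.2⟩ :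
      (H.functor ⋙ DGA.toGrRing r).obj U ⟶ E.unop), ?_, ?_⟩
  · intro V i hi
    exact Quiver.Hom.unop_inj (Subtype.ext (D.glue_comp ⟨leOfHom i, hi⟩))
  · intro g hg
    exact Quiver.Hom.unop_inj (Subtype.ext (D.glue_unique fun V hV =>
      (congrArg (fun g => g.unop.1) (hg _ hV.2)).trans (D.glue_comp hV).symm))

theorem isSheaf_augPresheaf (H : P.IsDGAPrecosheaf m) (k : Type u) [CommRing k] :
    Presheaf.IsSheaf (Opens.grothendieckTopology ℝ) (augPresheaf H.functor k) := by
  rw [isSheaf_iff_isSheaf_of_type]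
  intro U S hS x hx
  rw [Presieve.compatible_iff_sieveCompatible] at hx
  let D : GlueData P m U k := GlueData.ofSieve hS (fun V i h => (x i h).1)
    fun W V j i h => (congrArg Subtype.val (hx i j h)).symm
  refine ⟨⟨D.glue, isDGAHom_trivialGr_iff.1 (D.glue_isDGAHom (isPreDGA_trivialGr r k)
    fun V hV => isDGAHom_trivialGr_iff.2 (x _ hV.2).2)⟩, ?_, ?_⟩
  · intro V i hi
    exact Subtype.ext (D.glue_comp ⟨leOfHom i, hi⟩)
  · intro g hg
    exact Subtype.ext (D.glue_unique fun V hV =>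
      (congrArg Subtype.val (hg _ hV.2)).trans (D.glue_comp hV).symm)

/-! ## Pushouts -/

/-- Compatible homomorphisms on the algebras over `L` and `R`. -/
def GlueData.ofPair {L R : Opens ℝ} {E : Type*} [Ring E] (f : P.Alg m L →+* E)
    (g : P.Alg m R →+* E) (h : f.comp (P.cores m inf_le_left) =
      g.comp (P.cores m (inf_le_right : L ⊓ R ≤ R))) : GlueData P m (L ⊔ R) E where
  mem V := V ≤ L ∨ V ≤ R
  le h := h.elim (fun h => h.trans le_sup_left) fun h => h.trans le_sup_right
  down hWV h := h.imp hWV.trans hWV.trans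
  cover x hx := hx.elim (fun h => ⟨L, Or.inl le_rfl, h⟩) fun h => ⟨R, Or.inr le_rfl, h⟩
  f V hV := if hL : V ≤ L then f.comp (P.cores m hL)
    else g.comp (P.cores m (hV.resolve_left hL))
  compat {W V} hWV hV := by
    by_cases hL : V ≤ L
    · rw [dif_pos hL, dif_pos (hWV.trans hL), RingHom.comp_assoc, cores_comp]
    · have hR := hV.resolve_left hL
      rw [dif_neg hL, RingHom.comp_assoc, cores_comp]
      split_ifs with hWL
      · rw [← cores_comp (le_inf hWL (hWV.trans hR)) inf_le_left,
          ← cores_comp (le_inf hWL (hWV.trans hR)) inf_le_right, ← RingHom.comp_assoc,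
          ← RingHom.comp_assoc, h]
      · rfl

section Pair

variable {L R : Opens ℝ} {E : Type*} [Ring E] (f : P.Alg m L →+* E) (g : P.Alg m R →+* E)
  (h : f.comp (P.cores m inf_le_left) = g.comp (P.cores m (inf_le_right : L ⊓ R ≤ R)))

theorem GlueData.ofPair_left : (ofPair f g h).f L (Or.inl le_rfl) = f := by
  change dite _ _ _ = _
  rw [dif_pos le_rfl, cores_refl, RingHom.comp_id]

theorem GlueData.ofPair_right : (ofPair f g h).f R (Or.inr le_rfl) = g := by
  change dite _ _ _ = _
  split_ifs with h'
  · rw [← cores_comp (le_inf h' le_rfl) inf_le_left, ← RingHom.comp_assoc, h,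
      RingHom.comp_assoc, cores_comp, cores_refl, RingHom.comp_id]
  · rw [cores_refl, RingHom.comp_id]

theorem GlueData.ofPair_glue_left :
    (ofPair f g h).glue.comp (P.cores m le_sup_left) = f :=
  (glue_comp _ (Or.inl le_rfl)).trans (ofPair_left f g h)

theorem GlueData.ofPair_glue_right :
    (ofPair f g h).glue.comp (P.cores m le_sup_right) = g :=
  (glue_comp _ (Or.inr le_rfl)).trans (ofPair_right f g h)

theorem GlueData.ofPair_glue_unique {φ : P.Alg m (L ⊔ R) →+* E}
    (hL : φ.comp (P.cores m le_sup_left) = f) (hR : φ.comp (P.cores m le_sup_right) = g) :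
    φ = (ofPair f g h).glue := by
  refine glue_unique (ofPair f g h) fun V hV => ?_
  rcases hV with h' | h'
  · rw [← cores_comp h' le_sup_left, ← RingHom.comp_assoc, ← RingHom.comp_assoc, hL,
      ofPair_glue_left]
  · rw [← cores_comp h' le_sup_right, ← RingHom.comp_assoc, ← RingHom.comp_assoc, hR,
      ofPair_glue_right]

theorem GlueData.ofPair_isDGAHom {grE : ZMod (2 * r) → AddSubgroup E} {dE : E →+ E}
    (hE : IsPreDGA grE dE) (hf : IsDGAHom (P.gr m L) (P.diff m L) grE dE f)
    (hg : IsDGAHom (P.gr m R) (P.diff m R) grE dE g) :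
    IsDGAHom (P.gr m (L ⊔ R)) (P.diff m (L ⊔ R)) grE dE (ofPair f g h).glue := by
  have comp : ∀ {W V : Opens ℝ} (hWV : W ≤ V) {φ : P.Alg m V →+* E},
      IsDGAHom (P.gr m V) (P.diff m V) grE dE φ →
      IsDGAHom (P.gr m W) (P.diff m W) grE dE (φ.comp (P.cores m hWV)) := fun hWV φ hφ =>
    ⟨fun _ _ hx => hφ.graded ((isDGAHom_cores hWV).graded hx), fun x => by
      rw [RingHom.comp_apply, (isDGAHom_cores hWV).comm, hφ.comm]
      rfl⟩
  refine glue_isDGAHom _ hE fun V hV => ?_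
  rcases hV with h' | h'
  · rw [← (ofPair f g h).compat h' (Or.inl le_rfl), ofPair_left]
    exact comp h' hf
  · rw [← (ofPair f g h).compat h' (Or.inr le_rfl), ofPair_right]
    exact comp h' hg

end Pair

theorem isPushout (H : P.IsDGAPrecosheaf m) (L R : Opens ℝ) :
    IsPushout (H.functor.map (homOfLE (inf_le_left : L ⊓ R ≤ L)))
      (H.functor.map (homOfLE (inf_le_right : L ⊓ R ≤ R)))
      (H.functor.map (homOfLE (le_sup_left : L ≤ L ⊔ R)))
      (H.functor.map (homOfLE (le_sup_right : R ≤ L ⊔ R))) := by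
  have hw : H.functor.map (homOfLE (inf_le_left : L ⊓ R ≤ L)) ≫
      H.functor.map (homOfLE (le_sup_left : L ≤ L ⊔ R)) =
      H.functor.map (homOfLE (inf_le_right : L ⊓ R ≤ R)) ≫
      H.functor.map (homOfLE (le_sup_right : R ≤ L ⊔ R)) := by
    rw [← H.functor.map_comp, ← H.functor.map_comp]
    rfl
  have hs : ∀ s : Limits.PushoutCocone (H.functor.map (homOfLE (inf_le_left : L ⊓ R ≤ L)))
      (H.functor.map (homOfLE (inf_le_right : L ⊓ R ≤ R))),
      RingHom.comp (α := P.Alg m (L ⊓ R)) (β := P.Alg m L) s.inl.1 (P.cores m inf_le_left) =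
        RingHom.comp (β := P.Alg m R) s.inr.1 (P.cores m inf_le_right) :=
    fun s => congrArg Subtype.val s.condition
  exact ⟨⟨hw⟩, ⟨Limits.PushoutCocone.IsColimit.mk hw
    (fun s => ⟨(GlueData.ofPair _ _ (hs s)).glue,
      GlueData.ofPair_isDGAHom _ _ (hs s) s.pt.isDGA.isPreDGA s.inl.2 s.inr.2⟩)
    (fun s => Subtype.ext (GlueData.ofPair_glue_left _ _ (hs s)))
    (fun s => Subtype.ext (GlueData.ofPair_glue_right _ _ (hs s)))
    (fun s g hL hR => Subtype.ext (GlueData.ofPair_glue_unique _ _ (hs s)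
      (congrArg Subtype.val hL) (congrArg Subtype.val hR)))⟩⟩

end PreferredPlat

end

noncomputable section

/-- The inverse of a DGA map is a DGA map if it preserves degrees. -/
theorem IsDGAHom.of_inverse {r : ℕ} {A B : Type*} [Ring A] [Ring B]
    {grA : ZMod (2 * r) → AddSubgroup A} {dA : A →+ A} {grB : ZMod (2 * r) → AddSubgroup B}
    {dB : B →+ B} {f : A →+* B} {g : B →+* A} (hf : IsDGAHom grA dA grB dB f)
    (hg : IsGradedHom grB grA g) (hgf : g.comp f = RingHom.id A) (hfg : f.comp g = RingHom.id B) :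
    IsDGAHom grB dB grA dA g where
  graded := hg
  comm x := by
    have h1 : ∀ y, g (f y) = y := RingHom.congr_fun hgf
    have h2 : ∀ y, f (g y) = y := RingHom.congr_fun hfg
    rw [← h1 (dA (g x)), hf.comm, h2]

namespace PreferredPlat

open Classical SFAlg

variable {r : ℕ} {Λ : Set (ℝ × ℝ × ℝ)} {P : PreferredPlat r Λ} {m : ℕ}

/-! ## Left boundary points of connected sets -/

theorem IsLeftEdge.exists_mem {U : Opens ℝ} {a b : ℝ} (ha : P.IsLeftEdge U a) (hab : a < b) :
    ∃ y ∈ U, a < y ∧ y < b := by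
  obtain ⟨y, h1, h2, -, h3, -⟩ := ha.exists_no_events hab
  exact ⟨y, h3 ⟨h1, le_rfl⟩, h1, h2⟩

theorem IsLeftEdge.lt_of_mem {U : Opens ℝ} (hU : _root_.IsPreconnected (U : Set ℝ)) {a y : ℝ}
    (ha : P.IsLeftEdge U a) (hy : y ∈ U) : a < y := by
  by_contra h
  obtain ⟨z, hz, haz, -⟩ := ha.exists_mem ha.2.2.2
  exact ha.1 (hU.ordConnected.out hy hz ⟨not_lt.1 h, haz.le⟩)

theorem IsLeftEdge.eq_sInf {U : Opens ℝ} (hU : _root_.IsPreconnected (U : Set ℝ)) {a : ℝ}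
    (ha : P.IsLeftEdge U a) : a = sInf (U : Set ℝ) := by
  obtain ⟨y, hy, -, -⟩ := ha.exists_mem ha.2.2.2
  have hlb : a ∈ lowerBounds (U : Set ℝ) := fun y hy => (ha.lt_of_mem hU hy).le
  refine (IsGLB.csInf_eq ⟨hlb, fun b hb => ?_⟩ ⟨y, hy⟩).symm
  by_contra h
  obtain ⟨z, hz, -, hzb⟩ := ha.exists_mem (not_le.1 h)
  exact (hb hz).not_gt hzb

section Constructible

variable {V U : Opens ℝ} (hVU : V ≤ U) (hV : _root_.IsConnected (V : Set ℝ))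
  (hU : _root_.IsConnected (U : Set ℝ)) (hP : ∀ y ∈ P.positions, y ∈ U → y ∈ V)

theorem xL_mem_positions : P.xL ∈ P.positions := by simp [positions]

theorem xR_mem_positions : P.xR ∈ P.positions := by simp [positions]

theorem cross_mem_positions (c : P.Cross m) : c.x ∈ P.positions := by
  by_contra h
  have h1 : Sum.inl c ∈ P.eventsAt m c.x := mem_eventsAt.2 rfl
  rw [eventsAt_eq_nil h] at h1
  exact List.not_mem_nil h1

theorem base_mem_positions (b : P.Base m) : b.x ∈ P.positions := by
  obtain ⟨b | b | b, i⟩ := b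
  · simp only [positions, Base.x, Finset.mem_union, Finset.mem_image]
    exact Or.inl (Or.inr ⟨b.1, b.2, rfl⟩)
  · exact xL_mem_positions
  · exact xR_mem_positions

theorem IsLeftEdge.exists_of_subset (hVU : V ≤ U) (hV : _root_.IsConnected (V : Set ℝ))
    (hU : _root_.IsConnected (U : Set ℝ)) (hP : ∀ y ∈ P.positions, y ∈ U → y ∈ V)
    {a : ℝ} (ha : P.IsLeftEdge V a) :
    P.IsLeftEdge U (sInf (U : Set ℝ)) ∧ P.Above (m := m) a = P.Above (sInf (U : Set ℝ)) ∧
      ∀ p : P.Strand m × P.Strand m, P.Above a p.1 p.2 →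
        P.cores m hVU (P.pairElt m V a p) = P.pairElt m U (sInf (U : Set ℝ)) p := by
  obtain ⟨b, hb, hab, -⟩ := ha.exists_mem ha.2.2.2
  by_cases haU : a ∈ U
  · have hn : ¬ Set.Icc P.xL a ⊆ U := fun h => ha.1 (hV.isPreconnected.ordConnected.out
      (hP _ xL_mem_positions (h ⟨le_rfl, ha.2.2.1⟩)) hb ⟨ha.2.2.1, hab.le⟩)
    have he := isLeftEdge_leftEnd haU hn ha.2.2.2.le
    obtain ⟨h1, h2, h3, h4⟩ := leftEnd_spec haU hn
    rw [← he.eq_sInf hU.isPreconnected]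
    have hpos : ∀ z ∈ P.positions, z ∉ Set.Ioc (leftEnd (U : Set ℝ) a) a := fun z hz hz' =>
      ha.1 (hV.isPreconnected.ordConnected.out (hP z hz (h4 hz')) hb ⟨hz'.2, hab.le⟩)
    exact ⟨he, (above_eq_of_no_events h1 h2.le ha.2.2.2 hpos).symm, fun p hp =>
      cores_pairElt_of_no_events hVU ha h1 h3 h2.le h4 hpos hp⟩
  · have he := ha.mono hVU haU
    rw [← he.eq_sInf hU.isPreconnected]
    exact ⟨he, rfl, fun p _ => cores_pairElt_of_notMem hVU ha haU p⟩

theorem IsLeftEdge.exists_of_superset (hVU : V ≤ U) (hV : _root_.IsConnected (V : Set ℝ))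
    (hU : _root_.IsConnected (U : Set ℝ)) (hP : ∀ y ∈ P.positions, y ∈ U → y ∈ V)
    {a : ℝ} (ha : P.IsLeftEdge U a) : P.IsLeftEdge V (sInf (V : Set ℝ)) := by
  obtain ⟨v, hv⟩ := hV.nonempty
  have hlb : a ∈ lowerBounds (V : Set ℝ) := fun y hy =>
    (ha.lt_of_mem hU.isPreconnected (hVU hy)).le
  have hbdd : BddBelow (V : Set ℝ) := ⟨a, hlb⟩
  set b := sInf (V : Set ℝ) with hb
  have hab : a ≤ b := le_csInf ⟨v, hv⟩ hlb
  have hbV : b ∉ V := by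
    intro h
    obtain ⟨c, hc, hc'⟩ := exists_Ioc_subset_of_mem_nhds (V.isOpen.mem_nhds h) ⟨b - 1, by linarith⟩
    obtain ⟨z, hz1, hz2⟩ := exists_between hc
    exact (csInf_le hbdd (hc' ⟨hz1, hz2.le⟩)).not_gt hz2
  have hbv : ∀ w ∈ V, b < w := fun w hw =>
    lt_of_le_of_ne (csInf_le hbdd hw) fun h => hbV (by rwa [h])
  refine ⟨hbV, Filter.mem_of_superset (Ioc_mem_nhdsGT (hbv v hv)) fun z hz => ?_,
    ha.2.2.1.trans hab, ?_⟩
  · obtain ⟨w, hw, hwz⟩ := exists_lt_of_csInf_lt ⟨v, hv⟩ hz.1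
    exact hV.isPreconnected.ordConnected.out hw hv ⟨hwz.le, hz.2⟩
  · by_contra h
    obtain ⟨y, hy, -, hyR⟩ := ha.exists_mem ha.2.2.2
    have hxR : P.xR ∈ U := hU.isPreconnected.ordConnected.out hy (hVU hv)
      ⟨hyR.le, (not_lt.1 h).trans (hbv v hv).le⟩
    exact h (hbv _ (hP _ xR_mem_positions hxR))

/-- The inverse of the corestriction between intervals with the same events. -/
def coresInv (V U : Opens ℝ) : P.Alg m U →+* P.Alg m V :=
  lift (fun a => match a with
    | .cross c _ => P.crossElt m V c
    | .cusp k i _ => if h : P.xR ∈ V then gen (.cusp k i h) else 0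
    | .pair _ i j _ _ => P.pairElt m V (sInf (V : Set ℝ)) (i, j)) fun b => P.baseElt m V b.1

theorem coresInv_isGradedHom : IsGradedHom (P.gr m U) (P.gr m V) (coresInv V U) := by
  refine isGradedHom_of_gen (isPreDGA V).one_mem (isPreDGA V).mul_mem (fun a => ?_) (fun t => ?_)
    fun t => ?_
  · rw [coresInv, lift_gen]
    cases a with
    | cross c h => exact crossElt_mem V c
    | cusp k i h =>
      dsimp only
      split_ifs with hV
      · exact gen_mem_gr V (.cusp k i hV)
      · exact zero_mem _
    | pair a i j ha h => exact pairElt_mem V _ (i, j)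
  · rw [coresInv, lift_tgen]
    exact (baseElt_mem V t.1).1
  · rw [coresInv, lift_tgen_inv]
    exact (baseElt_mem V t.1).2

theorem coresInv_comp_cores (hVU : V ≤ U) (hV : _root_.IsConnected (V : Set ℝ))
    (hU : _root_.IsConnected (U : Set ℝ)) (hP : ∀ y ∈ P.positions, y ∈ U → y ∈ V) :
    (coresInv V U).comp (P.cores m hVU) = RingHom.id _ := by
  refine hom_ext (fun a => ?_) fun t => ?_
  · rw [RingHom.comp_apply]
    cases a with
    | cross c h =>
      rw [cores_gen, coresGen, coresInv, lift_gen]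
      exact dif_pos h
    | cusp k i h =>
      rw [cores_gen, coresGen, coresInv, lift_gen]
      exact dif_pos h
    | pair a i j ha h =>
      obtain ⟨h1, h2, h3⟩ := ha.exists_of_subset (m := m) hVU hV hU hP
      have h' : P.Above (sInf (U : Set ℝ)) i j := by rwa [← h2]
      rw [← pairElt_eq ha h, h3 (i, j) h, pairElt_eq h1 h', coresInv, lift_gen,
        ← ha.eq_sInf hV.isPreconnected]
      rfl
  · rw [RingHom.comp_apply, cores_tgen, coresInv, lift_tgen, baseElt, dif_pos t.2]
    rfl

theorem cores_comp_coresInv (hVU : V ≤ U) (hV : _root_.IsConnected (V : Set ℝ))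
    (hU : _root_.IsConnected (U : Set ℝ)) (hP : ∀ y ∈ P.positions, y ∈ U → y ∈ V) :
    (P.cores m hVU).comp (coresInv V U) = RingHom.id _ := by
  refine hom_ext (fun a => ?_) fun t => ?_
  · rw [RingHom.comp_apply, coresInv, lift_gen]
    cases a with
    | cross c h =>
      dsimp only
      rw [cores_crossElt hVU (hP _ (cross_mem_positions c) h)]
      exact dif_pos h
    | cusp k i h =>
      dsimp only
      rw [dif_pos (hP _ xR_mem_positions h), cores_gen]
      rfl
    | pair a i j ha h =>
      dsimp only
      have hb := ha.exists_of_superset hVU hV hU hP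
      obtain ⟨h1, h2, h3⟩ := hb.exists_of_subset (m := m) hVU hV hU hP
      rw [← ha.eq_sInf hU.isPreconnected] at h2 h3
      rw [h3 (i, j) (by rwa [h2]), pairElt_eq ha h]
      rfl
  · rw [RingHom.comp_apply, coresInv, lift_tgen,
      cores_baseElt hVU (hP _ (base_mem_positions t.1) t.2), baseElt, dif_pos t.2]
    rfl

end Constructible

theorem isConstructibleCosheaf (H : P.IsDGAPrecosheaf m) :
    IsConstructibleCosheaf H.functor := by
  refine ⟨P.positions, Finset.finite_toSet _, fun V U h hV hU hPVU => ?_⟩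
  have hP : ∀ y ∈ P.positions, y ∈ U → y ∈ V := fun y hy hyU =>
    (show y ∈ (P.positions : Set ℝ) ∩ V from hPVU ▸ ⟨hy, hyU⟩).2
  have h1 := coresInv_comp_cores (P := P) (m := m) h hV hU hP
  have h2 := cores_comp_coresInv (P := P) (m := m) h hV hU hP
  exact ⟨⟨coresInv V U, (isDGAHom_cores h).of_inverse coresInv_isGradedHom h1 h2⟩,
    Subtype.ext h1, Subtype.ext h2⟩

/-! ## Generators -/

instance : Finite (P.Cross m) := by
  let f : P.Cross m → (P.Dbl × Fin m × Fin m) ⊕ (Fin P.n × Fin m × Fin m) ⊕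
      (Fin P.n × Fin m × Fin m) := fun c => match c with
    | .dbl c i j => .inl (c, i, j)
    | .left k i j _ => .inr (.inl (k, i, j))
    | .right k i j _ => .inr (.inr (k, i, j))
  refine Finite.of_injective f fun c c' h => ?_
  cases c <;> cases c' <;> simp only [f, Sum.inl.injEq, Sum.inr.injEq, Prod.mk.injEq,
    reduceCtorEq] at h <;> simp [h]

theorem finite_gen {U : Opens ℝ} (hU : _root_.IsPreconnected (U : Set ℝ)) : Finite (P.Gen m U) := by
  let f : P.Gen m U → P.Cross m ⊕ (Fin P.n × Fin m) ⊕ (P.Strand m × P.Strand m) :=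
    fun a => match a with
    | .cross c _ => .inl c
    | .cusp k i _ => .inr (.inl (k, i))
    | .pair _ i j _ _ => .inr (.inr (i, j))
  refine Finite.of_injective f fun a a' h => ?_
  cases a <;> cases a' <;> simp only [f, Sum.inl.injEq, Sum.inr.injEq, Prod.mk.injEq,
    reduceCtorEq] at h
  · simp [h]
  · simp [h]
  · next a i j ha _ a' i' j' ha' _ =>
    have : a = a' := (ha.eq_sInf hU).trans (ha'.eq_sInf hU).symm
    simp [h, this]

theorem isSemifreeOn (H : P.IsDGAPrecosheaf m) (U : Opens ℝ) :
    IsSemifreeOn (H.functor.obj U) (P.Gen m U) (P.BaseOn m U) :=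
  ⟨RingEquiv.refl _, fun a => ⟨a.deg, gen_mem_gr U a⟩,
    fun t => ⟨tgen_mem_grade _ t, derivation_tgen _ _ t⟩⟩

/-! ## Global sections -/

/-- The comparison of the Chekanov-Eliashberg algebra with the global sections, on generators. -/
def topGen : P.CEGen m → P.Gen m ⊤
  | .inl c => .cross c (Opens.mem_top _)
  | .inr c => .cusp c.1 c.2 (Opens.mem_top _)

theorem topGen_bijective : Function.Bijective (topGen : P.CEGen m → P.Gen m ⊤) := by
  constructor
  · rintro (c | ⟨k, i⟩) (c' | ⟨k', i'⟩) h <;> simp only [topGen, Gen.cross.injEq, Gen.cusp.injEq,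
      reduceCtorEq] at h <;> simp [h]
  · rintro (⟨c, h⟩ | ⟨k, i, h⟩ | ⟨a, i, j, ha, h⟩)
    · exact ⟨.inl c, rfl⟩
    · exact ⟨.inr (k, i), rfl⟩
    · exact absurd (Opens.mem_top a) ha.1

theorem topGen_deg (a : P.CEGen m) : (topGen a).deg = P.ceDeg a := by
  cases a <;> rfl

variable (P m) in
/-- The comparison of the generators of the Chekanov-Eliashberg algebra with those of the global
sections. -/
def topEquiv : P.CEGen m ≃ P.Gen m ⊤ := Equiv.ofBijective _ topGen_bijective

variable (P m) in
/-- The map from the Chekanov-Eliashberg algebra to the global sections. -/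
def ceToTop : SFAlg (P.CEGen m) (P.Base m) →+* P.Alg m ⊤ :=
  lift (fun a => gen (topGen a)) fun b => tgen ⟨b, Opens.mem_top _⟩

variable (P m) in
/-- The map from the global sections to the Chekanov-Eliashberg algebra. -/
def topToCE : P.Alg m ⊤ →+* SFAlg (P.CEGen m) (P.Base m) :=
  lift (fun a => gen ((topEquiv P m).symm a)) fun b => tgen b.1

theorem ceToTop_gen (a : P.CEGen m) : ceToTop P m (gen a) = gen (topGen a) := lift_gen _ _ a

theorem ceToTop_tgen (b : P.Base m) : ceToTop P m (tgen b).1 = (P.baseElt m ⊤ b).1 := by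
  rw [ceToTop, lift_tgen, baseElt, dif_pos (Opens.mem_top _)]

theorem topToCE_gen (a : P.CEGen m) : topToCE P m (gen (topGen a)) = gen a := by
  rw [topToCE, lift_gen]
  exact congrArg gen ((topEquiv P m).symm_apply_apply a)

theorem topToCE_comp_ceToTop : (topToCE P m).comp (ceToTop P m) = RingHom.id _ := by
  refine hom_ext (fun a => ?_) fun t => ?_
  · rw [RingHom.comp_apply, ceToTop_gen, topToCE_gen]
    rfl
  · rw [RingHom.comp_apply, ceToTop, lift_tgen, topToCE, lift_tgen]
    rfl

theorem ceToTop_comp_topToCE : (ceToTop P m).comp (topToCE P m) = RingHom.id _ := by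
  refine hom_ext (fun a => ?_) fun t => ?_
  · obtain ⟨a, rfl⟩ := topGen_bijective.2 a
    rw [RingHom.comp_apply, topToCE_gen, ceToTop_gen]
    rfl
  · rw [RingHom.comp_apply, topToCE, lift_tgen, ceToTop, lift_tgen]
    rfl

theorem ceToTop_isGradedHom : IsGradedHom (P.ceGr m) (P.gr m ⊤) (ceToTop P m) := by
  refine isGradedHom_of_gen (isPreDGA _).one_mem (isPreDGA _).mul_mem (fun a => ?_) (fun t => ?_)
    fun t => ?_
  · rw [ceToTop_gen, ← topGen_deg]
    exact gen_mem_gr _ _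
  · rw [ceToTop_tgen]
    exact (baseElt_mem _ _).1
  · rw [map_unit_inv _ _ (ceToTop_tgen t)]
    exact (baseElt_mem _ _).2

theorem topToCE_isGradedHom : IsGradedHom (P.gr m ⊤) (P.ceGr m) (topToCE P m) := by
  refine isGradedHom_of_gen (one_mem_grade _) (mul_mem_grade _) (fun a => ?_) (fun t => ?_)
    fun t => ?_
  · obtain ⟨a, rfl⟩ := topGen_bijective.2 a
    rw [topToCE_gen, topGen_deg]
    exact gen_mem_grade _ a
  · rw [topToCE, lift_tgen]
    exact tgen_mem_grade _ _
  · rw [topToCE, lift_tgen_inv]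
    exact tgen_inv_mem_grade _ _

theorem ceToTop_ceDiskSum (x : ℝ) (L : List (P.Event m)) (p : P.Strand m × P.Strand m) :
    ceToTop P m (P.ceDiskSum L p) = P.diskSumOn m ⊤ x L p := by
  rw [ceDiskSum, diskSumOn, endElt_eq, if_pos (show Set.Icc P.xL x ⊆ ((⊤ : Opens ℝ) : Set ℝ) from fun y _ => Opens.mem_top y),
    map_diskSum _ _ _ (ceToTop P m) (P.crossElt m ⊤) (P.baseElt m ⊤) L
      (fun c _ => by rw [ceToTop_gen, crossElt, dif_pos (Opens.mem_top _)]; rfl) (fun b _ => ceToTop_tgen _)]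
  congr 1
  funext q
  exact map_cuspEnd _ (fun b _ => ceToTop_tgen b) q

theorem ceToTop_ceDiffGen (a : P.CEGen m) :
    ceToTop P m (P.ceDiffGen a) = P.diffGen m ⊤ (topGen a) := by
  rcases a with c | ⟨k, i⟩
  · simp only [ceDiffGen, topGen]
    rw [diffGen_cross, ceToTop_ceDiskSum c.x]
    rfl
  · simp only [ceDiffGen, topGen]
    rw [diffGen_cusp, map_add, ceToTop_ceDiskSum P.xR,
      map_invisible (ceToTop P m) (fun b _ => ceToTop_tgen b)]
    rfl

theorem ceToTop_isDGAHom :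
    IsDGAHom (P.ceGr m) (P.ceDiff m) (P.gr m ⊤) (P.diff m ⊤) (ceToTop P m) := by
  refine isDGAHom_of_gen (isPreDGA _) (fun a => ceToTop_isGradedHom (gen_mem_grade _ a))
    (fun t => ceToTop_isGradedHom (tgen_mem_grade _ t))
    (fun t => ceToTop_isGradedHom (tgen_inv_mem_grade _ t)) (fun a => ?_) fun t => ?_
  · rw [ceToTop_ceDiffGen, ceToTop_gen, diff_gen]
  · rw [ceToTop_tgen]
    exact (diff_baseElt _ _).1

theorem topToCE_isDGAHom :
    IsDGAHom (P.gr m ⊤) (P.diff m ⊤) (P.ceGr m) (P.ceDiff m) (topToCE P m) :=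
  ceToTop_isDGAHom.of_inverse topToCE_isGradedHom topToCE_comp_ceToTop ceToTop_comp_topToCE

theorem topToCE_diffGen (a : P.CEGen m) :
    topToCE P m (P.diffGen m ⊤ (topGen a)) = P.ceDiffGen a := by
  rw [← ceToTop_ceDiffGen]
  exact RingHom.congr_fun topToCE_comp_ceToTop _

variable (P m) in
theorem ce_isDGA : IsDGA (P.ceGr m) (P.ceDiff m) := by
  refine isDGA_of_gen (fun a => ?_) fun a => ?_
  · rw [← topToCE_diffGen, ← topGen_deg]
    exact topToCE_isGradedHom (diffGen_mem _)
  · rw [← topToCE_diffGen]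
    have := topToCE_isDGAHom.comm (P.diffGen m ⊤ (topGen a))
    rw [diff_diffGen, map_zero] at this
    exact this.symm

theorem nonempty_iso (H : P.IsDGAPrecosheaf m) (hΛ : IsDGA (P.ceGr m) (P.ceDiff m)) :
    Nonempty (H.functor.obj ⊤ ≅ DGA.mk _ (P.ceGr m) (P.ceDiff m) hΛ) :=
  ⟨⟨⟨topToCE P m, topToCE_isDGAHom⟩, ⟨ceToTop P m, ceToTop_isDGAHom⟩,
    Subtype.ext ceToTop_comp_topToCE, Subtype.ext topToCE_comp_ceToTop⟩⟩

end PreferredPlat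

end

noncomputable section

/-! ## Pairing words with sequences of labelled functionals -/

section Splits

variable {α : Type*}

/-- All ways of writing a list as `c.2 ++ c.1`. -/
def lsplits : List α → List (List α × List α)
  | [] => [([], [])]
  | x :: s => (x :: s, []) :: (lsplits s).map fun c => (c.1, x :: c.2)

theorem append_of_mem_lsplits {s : List α} {c : List α × List α} (h : c ∈ lsplits s) :
    c.2 ++ c.1 = s := by
  induction s generalizing c with
  | nil => simp_all [lsplits]
  | cons x s ih =>
    simp only [lsplits, List.mem_cons, List.mem_map] at h
    rcases h with rfl | ⟨c', hc', rfl⟩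
    · simp
    · simp [ih hc']

theorem sum_lsplits_nil {A : Type*} [AddCommMonoid A] (φ : List α × List α → A) :
    ((lsplits []).map φ).sum = φ ([], []) := by simp [lsplits]

theorem sum_lsplits_cons {A : Type*} [AddCommMonoid A] (φ : List α × List α → A) (x : α)
    (s : List α) : ((lsplits (x :: s)).map φ).sum =
      φ (x :: s, []) + ((lsplits s).map fun c => φ (c.1, x :: c.2)).sum := by
  simp [lsplits, Function.comp_def]

theorem sum_map_congr {A : Type*} [AddCommMonoid A] {l : List α} {φ ψ : α → A}
    (h : ∀ c ∈ l, φ c = ψ c) : (l.map φ).sum = (l.map ψ).sum := by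
  rw [List.map_congr_left h]

end Splits

section Pairing

variable {k : Type u} [CommRing k] {r : ℕ} {R I : Type} {M : Type u} [AddCommGroup M] [Module k M]

/-- The label at the end of a sequence of steps starting at `i`, the last step coming first. -/
def endLabel (i : I) : List (M × I) → I
  | [] => i
  | x :: _ => x.2

theorem endLabel_append (i : I) (s t : List (M × I)) :
    endLabel i (t ++ s) = endLabel (endLabel i s) t := by
  cases t <;> rfl

theorem endLabel_cons (i l : I) (f : M) (s : List (M × I)) : endLabel i ((f, l) :: s) = l := rfl

/-- The words satisfying `p` span this submodule of the free algebra. -/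
def wordSpan (k : Type u) [CommRing k] {R : Type} (p : List R → Prop) :
    Submodule k (MonoidAlgebra k (FreeMonoid R)) :=
  Submodule.span k {x | ∃ w : FreeMonoid R, p w.toList ∧ x = MonoidAlgebra.of k _ w}

theorem of_mem_wordSpan {p : List R → Prop} {w : FreeMonoid R} (h : p w.toList) :
    MonoidAlgebra.of k _ w ∈ wordSpan k p := Submodule.subset_span ⟨w, h, rfl⟩

theorem mul_mem_wordSpan {p q t : List R → Prop} (h : ∀ v w, p v → q w → t (v ++ w))
    {x y : MonoidAlgebra k (FreeMonoid R)} (hx : x ∈ wordSpan k p) (hy : y ∈ wordSpan k q) :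
    x * y ∈ wordSpan k t := by
  induction hx using Submodule.span_induction with
  | mem x hx =>
    obtain ⟨v, hv, rfl⟩ := hx
    induction hy using Submodule.span_induction with
    | mem y hy =>
      obtain ⟨w, hw, rfl⟩ := hy
      rw [← map_mul]
      exact of_mem_wordSpan (h _ _ hv hw)
    | zero => rw [mul_zero]; exact zero_mem _
    | add y z _ _ hy hz => rw [mul_add]; exact add_mem hy hz
    | smul c y _ hy => rw [mul_smul_comm]; exact Submodule.smul_mem _ _ hy
  | zero => rw [zero_mul]; exact zero_mem _
  | add y z _ _ hy hz => rw [add_mul]; exact add_mem hy hz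
  | smul c y _ hy => rw [smul_mul_assoc]; exact Submodule.smul_mem _ _ hy

theorem wordSpan_top (x : MonoidAlgebra k (FreeMonoid R)) : x ∈ wordSpan k fun _ => True := by
  induction x using MonoidAlgebra.induction_on with
  | of w => exact of_mem_wordSpan trivial
  | add x y hx hy => exact add_mem hx hy
  | smul c x hx => exact Submodule.smul_mem _ _ hx

theorem map_eq_of_mem_wordSpan {p : List R → Prop} {N : Type*} [AddCommMonoid N] [Module k N]
    {f g : MonoidAlgebra k (FreeMonoid R) →ₗ[k] N}
    (h : ∀ w : FreeMonoid R, p w.toList → f (MonoidAlgebra.of k _ w) = g (MonoidAlgebra.of k _ w))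
    {x : MonoidAlgebra k (FreeMonoid R)} (hx : x ∈ wordSpan k p) : f x = g x := by
  induction hx using Submodule.span_induction with
  | mem x hx =>
    obtain ⟨v, hv, rfl⟩ := hx
    exact h v hv
  | zero => simp
  | add y z _ _ hy hz => rw [map_add, map_add, hy, hz]
  | smul c y _ hy => rw [map_smul, map_smul, hy]

section Defs

variable (δ : R → ZMod (2 * r)) (ev : I → I → M →ₗ[k] (R → k))

/-- The degree of a word. -/
def listDeg (w : List R) : ZMod (2 * r) := (w.map δ).sum

/-- The Koszul sign of a word. -/
def listSign : List R → ℤ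
  | [] => 1
  | a :: w => sgn (δ a * listDeg δ w) * listSign w

/-- The homogeneous elements of degree `d`. -/
def homogeneous (k : Type u) [CommRing k] (d : ZMod (2 * r)) :
    Submodule k (MonoidAlgebra k (FreeMonoid R)) := wordSpan k fun w => listDeg δ w = d

/-- The pairing of a sequence of steps with a word, both in reverse order. -/
def listPair (i : I) : List (M × I) → List R → k
  | [], [] => 1
  | x :: s, a :: w => ev (endLabel i s) x.2 x.1 a * listPair i s w
  | _, _ => 0

/-- The pairing with a sequence of steps, with signs, on the free algebra. -/
def pathPair (i : I) (s : List (M × I)) : MonoidAlgebra k (FreeMonoid R) →ₗ[k] k :=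
  (Finsupp.linearCombination k fun w : FreeMonoid R =>
    (listSign δ w.toList : k) * listPair ev i s w.toList.reverse).comp
    (MonoidAlgebra.coeffLinearEquiv k).toLinearMap

end Defs

variable {δ : R → ZMod (2 * r)} {ev : I → I → M →ₗ[k] (R → k)}

theorem listDeg_append (v w : List R) : listDeg δ (v ++ w) = listDeg δ v + listDeg δ w := by
  simp [listDeg]

theorem listSign_append (v w : List R) :
    listSign δ (v ++ w) = listSign δ v * listSign δ w * sgn (listDeg δ v * listDeg δ w) := by
  induction v with
  | nil => simp [listSign, listDeg]
  | cons a v ih =>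
    have h : listDeg δ (a :: v) = δ a + listDeg δ v := by simp [listDeg]
    rw [List.cons_append, listSign, ih, listSign, listDeg_append, h, mul_add, add_mul, sgn_add,
      sgn_add]
    ring

theorem listPair_nil_left (i : I) (a : R) (w : List R) :
    listPair ev i [] (a :: w) = 0 := rfl

theorem listPair_nil_right (i : I) (x : M × I) (s : List (M × I)) :
    listPair ev i (x :: s) [] = 0 := rfl

theorem listPair_append (i : I) (s : List (M × I)) (v w : List R) :
    listPair ev i s (v ++ w) = ((lsplits s).map fun c =>
      listPair ev i c.1 w * listPair ev (endLabel i c.1) c.2 v).sum := by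
  induction v generalizing s with
  | nil =>
    cases s with
    | nil => simp [lsplits, listPair]
    | cons x s => simp [sum_lsplits_cons, listPair_nil_right, listPair]
  | cons a v ih =>
    cases s with
    | nil => simp [lsplits, listPair_nil_left]
    | cons x s =>
      rw [sum_lsplits_cons]
      simp only [List.cons_append, listPair_nil_left, mul_zero, zero_add]
      rw [listPair, ih, ← List.sum_map_mul_left]
      refine sum_map_congr fun c hc => ?_
      rw [listPair, ← endLabel_append, append_of_mem_lsplits hc]
      ring

@[simp]
theorem pathPair_of (i : I) (s : List (M × I)) (w : FreeMonoid R) :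
    pathPair δ ev i s (MonoidAlgebra.of k _ w) =
      (listSign δ w.toList : k) * listPair ev i s w.toList.reverse := by
  simp [pathPair, MonoidAlgebra.of, MonoidAlgebra.coeffLinearEquiv]

theorem pathPair_one (i : I) (s : List (M × I)) :
    pathPair δ ev i s 1 = if s = [] then 1 else 0 := by
  rw [← map_one (MonoidAlgebra.of k (FreeMonoid R)), pathPair_of]
  cases s with
  | nil => simp [listSign, listPair]
  | cons x s => simp [listPair_nil_right]

theorem pathPair_algebraMap (i : I) (s : List (M × I)) (c : k) :
    pathPair δ ev i s (algebraMap k _ c) = if s = [] then c else 0 := by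
  rw [Algebra.algebraMap_eq_smul_one, map_smul, pathPair_one]
  simp

/-- Reduction of a bilinear identity to words. -/
theorem pathPair_mul {d e : ZMod (2 * r)} (i : I) (s : List (M × I))
    {x y : MonoidAlgebra k (FreeMonoid R)} (hx : x ∈ homogeneous δ k d)
    (hy : y ∈ homogeneous δ k e) :
    pathPair δ ev i s (x * y) = (sgn (d * e) : k) * ((lsplits s).map fun c =>
      pathPair δ ev i c.1 x * pathPair δ ev (endLabel i c.1) c.2 y).sum := by
  induction hx using Submodule.span_induction with
  | mem x hx =>
    obtain ⟨v, hv, rfl⟩ := hx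
    induction hy using Submodule.span_induction with
    | mem y hy =>
      obtain ⟨w, hw, rfl⟩ := hy
      rw [← map_mul, pathPair_of, FreeMonoid.toList_mul, List.reverse_append, listPair_append,
        listSign_append, hv, hw, ← List.sum_map_mul_left, ← List.sum_map_mul_left]
      refine sum_map_congr fun c _ => ?_
      rw [pathPair_of, pathPair_of]
      push_cast
      ring
    | zero => simp
    | add y z _ _ hy hz =>
      rw [mul_add, map_add, hy, hz, ← mul_add, ← List.sum_map_add]
      simp only [map_add, mul_add]
    | smul c y _ hy =>
      rw [mul_smul_comm, map_smul, hy, smul_eq_mul, mul_left_comm, ← List.sum_map_mul_left]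
      simp only [map_smul, smul_eq_mul, mul_left_comm]
  | zero => simp
  | add y z _ _ hy hz =>
    rw [add_mul, map_add, hy, hz, ← mul_add, ← List.sum_map_add]
    simp only [map_add, add_mul]
  | smul c y _ hy =>
    rw [smul_mul_assoc, map_smul, hy, smul_eq_mul, mul_left_comm, ← List.sum_map_mul_left]
    simp only [map_smul, smul_eq_mul, mul_assoc]

theorem pathPair_nil_mul_of (i : I) (x : MonoidAlgebra k (FreeMonoid R)) (a : R) :
    pathPair δ ev i [] (x * MonoidAlgebra.of k _ (FreeMonoid.of a)) = 0 := by
  refine map_eq_of_mem_wordSpan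
    (f := (pathPair δ ev i []).comp (LinearMap.mulRight k (MonoidAlgebra.of k _ (FreeMonoid.of a))))
    (g := 0) (fun w _ => ?_) (wordSpan_top x)
  rw [LinearMap.comp_apply, LinearMap.mulRight_apply, ← map_mul, pathPair_of]
  simp [listPair_nil_left]

theorem pathPair_cons_mul_of {d : ZMod (2 * r)} (i : I) (f : M) (l : I) (s : List (M × I))
    {x : MonoidAlgebra k (FreeMonoid R)} (hx : x ∈ homogeneous δ k d) (a : R) :
    pathPair δ ev i ((f, l) :: s) (x * MonoidAlgebra.of k _ (FreeMonoid.of a)) =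
      (sgn (d * δ a) : k) * (ev (endLabel i s) l f a * pathPair δ ev i s x) := by
  refine map_eq_of_mem_wordSpan (f := (pathPair δ ev i ((f, l) :: s)).comp
      (LinearMap.mulRight k (MonoidAlgebra.of k _ (FreeMonoid.of a))))
    (g := ((sgn (d * δ a) : k) * ev (endLabel i s) l f a) • pathPair δ ev i s) (fun w hw => ?_) hx
    |>.trans (by simp [mul_assoc])
  rw [LinearMap.comp_apply, LinearMap.mulRight_apply, ← map_mul, pathPair_of, LinearMap.smul_apply,
    pathPair_of, FreeMonoid.toList_mul, listSign_append, hw]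
  simp only [FreeMonoid.toList_of, List.reverse_append, List.reverse_singleton,
    List.singleton_append, listPair, listSign, listDeg, List.map_cons, List.map_nil, List.sum_cons,
    List.sum_nil, mul_zero, sgn_zero, add_zero, smul_eq_mul]
  push_cast
  ring

theorem pathPair_mem {d : ZMod (2 * r)} {i : I} {s : List (M × I)}
    {x : MonoidAlgebra k (FreeMonoid R)} (hx : x ∈ homogeneous δ k d)
    (h : pathPair δ ev i s x ≠ 0) : ∃ w : List R, listDeg δ w = d ∧ listPair ev i s w.reverse ≠ 0 := by
  by_contra! hc
  exact h (map_eq_of_mem_wordSpan (f := pathPair δ ev i s) (g := 0) (fun w hw => by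
    rw [pathPair_of, hc _ hw, mul_zero, LinearMap.zero_apply]) hx)

/-- The pairing is linear in each step. -/
theorem listPair_add (i l : I) (s t : List (M × I)) (f g : M) (w : List R) :
    listPair ev i (t ++ (f + g, l) :: s) w =
      listPair ev i (t ++ (f, l) :: s) w + listPair ev i (t ++ (g, l) :: s) w := by
  induction t generalizing w with
  | nil =>
    cases w with
    | nil => simp [listPair_nil_right]
    | cons a w => simp [listPair, add_mul]
  | cons x t ih =>
    cases w with
    | nil => simp [listPair_nil_right]
    | cons a w => simp only [List.cons_append, listPair, ih, mul_add, endLabel_append, endLabel_cons]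

theorem listPair_smul (i l : I) (s t : List (M × I)) (c : k) (f : M) (w : List R) :
    listPair ev i (t ++ (c • f, l) :: s) w = c * listPair ev i (t ++ (f, l) :: s) w := by
  induction t generalizing w with
  | nil =>
    cases w with
    | nil => simp [listPair_nil_right]
    | cons a w => simp [listPair, mul_assoc]
  | cons x t ih =>
    cases w with
    | nil => simp [listPair_nil_right]
    | cons a w => simp only [List.cons_append, listPair, ih, mul_left_comm, endLabel_append, endLabel_cons]

theorem pathPair_add (i l : I) (s t : List (M × I)) (f g : M) :
    pathPair δ ev i (t ++ (f + g, l) :: s) =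
      pathPair δ ev i (t ++ (f, l) :: s) + pathPair δ ev i (t ++ (g, l) :: s) :=
  LinearMap.ext fun x => map_eq_of_mem_wordSpan (fun w _ => by
    rw [LinearMap.add_apply, pathPair_of, pathPair_of, pathPair_of, listPair_add, mul_add]) (wordSpan_top x)

theorem pathPair_smul (i l : I) (s t : List (M × I)) (c : k) (f : M) :
    pathPair δ ev i (t ++ (c • f, l) :: s) = c • pathPair δ ev i (t ++ (f, l) :: s) :=
  LinearMap.ext fun x => map_eq_of_mem_wordSpan (fun w _ => by
    rw [LinearMap.smul_apply, pathPair_of, pathPair_of, listPair_smul, smul_eq_mul,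
      mul_left_comm]) (wordSpan_top x)

/-! ### Twisting by scalars -/

section Twist

variable {T : Type}

/-- The homomorphism to the free `k`-algebra which maps `a` to `a + c a` and `t` to a scalar. -/
def shiftHom (c : R → k) (ct : T → kˣ) : SFAlg R T →+* MonoidAlgebra k (FreeMonoid R) :=
  SFAlg.lift (fun a => MonoidAlgebra.of k _ (FreeMonoid.of a) + algebraMap k _ (c a))
    (fun t => Units.map (algebraMap k (MonoidAlgebra k (FreeMonoid R))).toMonoidHom (ct t))

variable {c : R → k} {ct : T → kˣ}

@[simp]
theorem shiftHom_gen (a : R) : shiftHom c ct (SFAlg.gen a) =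
    MonoidAlgebra.of k _ (FreeMonoid.of a) + algebraMap k _ (c a) := SFAlg.lift_gen ..

@[simp]
theorem shiftHom_tgen (t : T) :
    shiftHom c ct (SFAlg.tgen t).1 = algebraMap k _ (ct t).1 := SFAlg.lift_tgen ..

@[simp]
theorem shiftHom_tgen_inv (t : T) :
    shiftHom c ct ((SFAlg.tgen t)⁻¹ : (SFAlg R T)ˣ).1 = algebraMap k _ ((ct t)⁻¹).1 := by
  rw [shiftHom, SFAlg.lift_tgen_inv, ← map_inv]
  rfl

theorem one_mem_homogeneous : (1 : MonoidAlgebra k (FreeMonoid R)) ∈ homogeneous δ k 0 := by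
  rw [← map_one (MonoidAlgebra.of k (FreeMonoid R))]
  exact of_mem_wordSpan (by simp [listDeg])

theorem algebraMap_mem_homogeneous (x : k) :
    algebraMap k (MonoidAlgebra k (FreeMonoid R)) x ∈ homogeneous δ k 0 := by
  rw [Algebra.algebraMap_eq_smul_one]
  exact Submodule.smul_mem _ _ one_mem_homogeneous

theorem mul_mem_homogeneous {d e : ZMod (2 * r)} {x y : MonoidAlgebra k (FreeMonoid R)}
    (hx : x ∈ homogeneous δ k d) (hy : y ∈ homogeneous δ k e) : x * y ∈ homogeneous δ k (d + e) :=
  mul_mem_wordSpan (fun v w hv hw => by rw [listDeg_append, hv, hw]) hx hy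

theorem shiftHom_mem (hc : ∀ a, c a ≠ 0 → δ a = 0) {d : ZMod (2 * r)} {x : SFAlg R T}
    (hx : x ∈ SFAlg.grade δ d) : shiftHom c ct x ∈ homogeneous δ k d := by
  have hw : ∀ w : SFMonoid R T, shiftHom c ct (MonoidAlgebra.of ℤ _ w) ∈
      homogeneous δ k (SFAlg.wordDeg δ w).toAdd := by
    intro w
    induction w using SFAlg.word_induction with
    | one =>
      rw [SFAlg.wordDeg_one, map_one (MonoidAlgebra.of ℤ _), map_one]
      exact one_mem_homogeneous
    | gen a w ih =>
      rw [SFAlg.of_gen_mul, SFAlg.wordDeg_gen_mul, map_mul, shiftHom_gen]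
      refine mul_mem_homogeneous (add_mem (of_mem_wordSpan (by simp [listDeg])) ?_) ih
      by_cases h : c a = 0
      · rw [h, map_zero]
        exact zero_mem _
      · rw [hc a h]
        exact algebraMap_mem_homogeneous _
    | tgen t w ih =>
      rw [SFAlg.of_tgen_mul, SFAlg.wordDeg_tgen_mul, map_mul, shiftHom_tgen, ← zero_add (Multiplicative.toAdd _)]
      exact mul_mem_homogeneous (algebraMap_mem_homogeneous _) ih
    | tinv t w ih =>
      rw [SFAlg.of_tinv_mul, SFAlg.wordDeg_tinv_mul, map_mul, shiftHom_tgen_inv, ← zero_add (Multiplicative.toAdd _)]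
      exact mul_mem_homogeneous (algebraMap_mem_homogeneous _) ih
  induction hx using AddSubgroup.closure_induction with
  | mem x hx =>
    obtain ⟨w, h, rfl⟩ := hx
    have := hw w
    rwa [h] at this
  | zero => rw [map_zero]; exact zero_mem _
  | add x y _ _ hx hy => rw [map_add]; exact add_mem hx hy
  | neg x _ hx => rw [map_neg]; exact neg_mem hx

end Twist

end Pairing

namespace SFAlg

variable {R T : Type}

/-- Two additive maps agree if their agreement on homogeneous elements is preserved by
multiplication by generators from the right. -/
theorem addHom_ext_right {r : ℕ} {δ : R → ZMod (2 * r)} {A : Type*} [AddCommGroup A]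
    {ι : Type*} {f g : ι → SFAlg R T →+ A} (one : ∀ i, f i 1 = g i 1)
    (gen : ∀ (a : R) (d) (x : SFAlg R T), x ∈ grade δ d → (∀ i, f i x = g i x) →
      ∀ i, f i (x * gen a) = g i (x * gen a))
    (tgen : ∀ (t : T) (d) (x : SFAlg R T), x ∈ grade δ d → (∀ i, f i x = g i x) →
      ∀ i, f i (x * (tgen t).1) = g i (x * (tgen t).1))
    (tinv : ∀ (t : T) (d) (x : SFAlg R T), x ∈ grade δ d → (∀ i, f i x = g i x) →
      ∀ i, f i (x * ((SFAlg.tgen t)⁻¹ : (SFAlg R T)ˣ).1) =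
        g i (x * ((SFAlg.tgen t)⁻¹ : (SFAlg R T)ˣ).1)) (i : ι) (x : SFAlg R T) : f i x = g i x := by
  refine DFunLike.congr_fun (addHom_ext fun w => ?_) x
  have key : ∀ (w : SFMonoid R T) (d) (x : SFAlg R T), x ∈ grade δ d → (∀ i, f i x = g i x) →
      ∀ i, f i (x * MonoidAlgebra.of ℤ _ w) = g i (x * MonoidAlgebra.of ℤ _ w) := by
    intro w
    induction w using word_induction with
    | one =>
      intro d x _ h i
      rw [map_one, mul_one]
      exact h i
    | gen a w ih =>
      intro d x hx h
      rw [of_gen_mul, ← mul_assoc]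
      exact ih _ _ (mul_mem_grade δ hx (gen_mem_grade δ a)) (gen a d x hx h)
    | tgen t w ih =>
      intro d x hx h
      rw [of_tgen_mul, ← mul_assoc]
      exact ih _ _ (mul_mem_grade δ hx (tgen_mem_grade δ t)) (tgen t d x hx h)
    | tinv t w ih =>
      intro d x hx h
      rw [of_tinv_mul, ← mul_assoc]
      exact ih _ _ (mul_mem_grade δ hx (tgen_inv_mem_grade δ t)) (tinv t d x hx h)
  have := key w 0 1 (one_mem_grade δ) one i
  rwa [one_mul] at this

end SFAlg

end

noncomputable section

section Insertion

variable {k : Type u} [CommRing k] {r : ℕ} {R T R' T' I : Type} {M M' : Type u} [AddCommGroup M]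
  [Module k M] [AddCommGroup M'] [Module k M']

/-- The labels along a sequence of steps are increasing. -/
def IncSteps [LT I] (i : I) : List (M × I) → Prop
  | [] => True
  | x :: s => endLabel i s < x.2 ∧ IncSteps i s

theorem incSteps_append [LT I] (i : I) (s t : List (M × I)) :
    IncSteps i (t ++ s) ↔ IncSteps i s ∧ IncSteps (endLabel i s) t := by
  induction t with
  | nil => simp [IncSteps]
  | cons x t ih => simp only [List.cons_append, IncSteps, ih, endLabel_append]; tauto

theorem IncSteps.le [Preorder I] {i : I} {s : List (M × I)} (h : IncSteps i s) :
    i ≤ endLabel i s := by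
  induction s with
  | nil => exact le_refl i
  | cons x s ih => exact (ih h.2).trans h.1.le

theorem IncSteps.lt [Preorder I] {i : I} {s : List (M × I)} (h : IncSteps i s) (hs : s ≠ []) :
    i < endLabel i s := by
  cases s with
  | nil => exact absurd rfl hs
  | cons x s => exact h.2.le.trans_lt h.1

theorem incSteps_of_mem_lsplits [LT I] {i : I} {s : List (M × I)} (h : IncSteps i s)
    {c : List (M × I) × List (M × I)} (hc : c ∈ lsplits s) :
    IncSteps i c.1 ∧ IncSteps (endLabel i c.1) c.2 := by
  rwa [← append_of_mem_lsplits hc, incSteps_append] at h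

/-- The sum of the values of `ψ` at all sequences obtained by contracting a part of a sequence with
`B` and by applying `ν` to the steps which come later. -/
def insertLabelled {A : Type*} [AddCommMonoid A] (B : I → List (M × I) → M) (ν : M → M) (i : I) :
    List (M × I) → (List (M × I) → A) → A
  | [], ψ => ψ [(B i [], i)]
  | x :: s, ψ => ((lsplits (x :: s)).map fun c => ψ ((B (endLabel i c.1) c.2, x.2) :: c.1)).sum +
      insertLabelled B ν i s fun q => ψ ((ν x.1, x.2) :: q)

section

variable {A : Type*} [AddCommMonoid A] {B : I → List (M × I) → M} {ν : M → M} {i : I}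

theorem insertLabelled_congr {s : List (M × I)} {φ ψ : List (M × I) → A}
    (h : ∀ q, endLabel i q = endLabel i s → φ q = ψ q) :
    insertLabelled B ν i s φ = insertLabelled B ν i s ψ := by
  induction s generalizing φ ψ with
  | nil => exact h _ rfl
  | cons x s ih =>
    rw [insertLabelled, insertLabelled, ih fun q _ => h ((ν x.1, x.2) :: q) rfl]
    congr 2
    exact List.map_congr_left fun c _ => h _ rfl

theorem insertLabelled_add (s : List (M × I)) (φ ψ : List (M × I) → A) :
    insertLabelled B ν i s (fun q => φ q + ψ q) =
      insertLabelled B ν i s φ + insertLabelled B ν i s ψ := by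
  induction s generalizing φ ψ with
  | nil => rfl
  | cons x s ih =>
    rw [insertLabelled, insertLabelled, insertLabelled, ih, List.sum_map_add]
    exact add_add_add_comm _ _ _ _

theorem insertLabelled_mul (s : List (M × I)) (c : k) (φ : List (M × I) → k) :
    insertLabelled B ν i s (fun q => c * φ q) = c * insertLabelled B ν i s φ := by
  induction s generalizing φ with
  | nil => rfl
  | cons x s ih => rw [insertLabelled, insertLabelled, ih, List.sum_map_mul_left, mul_add]

end

variable {δ : R → ZMod (2 * r)} {ev : I → I → M →ₗ[k] (R → k)} {c : R → k} {ct : T → kˣ}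
  {D : R → SFAlg R T} {B : I → List (M × I) → M} {ν : M → M} [LinearOrder I]

/-- The contraction of parts of a sequence is dual to the twisted differential. -/
theorem insertLabelled_pathPair (hc : ∀ a, c a ≠ 0 → δ a = 0)
    (hD : ∀ {d : ZMod (2 * r)} {x : SFAlg R T}, x ∈ SFAlg.grade δ d →
      SFAlg.derivation δ D x ∈ SFAlg.grade δ (d - 1))
    (hν : ∀ i l f a, ev i l (ν f) a = (sgn (δ a) : k) * ev i l f a)
    (hB : ∀ i s, IncSteps i s → ∀ a,
      ev i (endLabel i s) (B i s) a = pathPair δ ev i s (shiftHom c ct (D a)))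
    (i : I) {s : List (M × I)} (hs : IncSteps i s) (x : SFAlg R T) :
    insertLabelled B ν i s (fun q => pathPair δ ev i q (shiftHom c ct x)) =
      pathPair δ ev i s (shiftHom c ct (SFAlg.derivation δ D x)) := by
  have hdeg : ∀ a, SFAlg.derivation δ D (SFAlg.gen a) ∈ SFAlg.grade δ (δ a - 1) :=
    fun a => hD (SFAlg.gen_mem_grade δ a)
  have hunit : ∀ (t : SFAlg R T) (y : k), shiftHom c ct t = algebraMap k _ y →
      SFAlg.derivation δ D t = 0 → ∀ (d : ZMod (2 * r)) (x : SFAlg R T), x ∈ SFAlg.grade δ d →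
      (∀ s : {s : List (M × I) // IncSteps i s},
        insertLabelled B ν i s.1 (fun q => pathPair δ ev i q (shiftHom c ct x)) =
          pathPair δ ev i s.1 (shiftHom c ct (SFAlg.derivation δ D x))) →
      ∀ s : {s : List (M × I) // IncSteps i s},
        insertLabelled B ν i s.1 (fun q => pathPair δ ev i q (shiftHom c ct (x * t))) =
          pathPair δ ev i s.1 (shiftHom c ct (SFAlg.derivation δ D (x * t))) := by
    intro t y ht hdt d x hx ih s
    rw [SFAlg.derivation_mul δ D t hx, hdt, mul_zero, smul_zero, add_zero, map_mul, map_mul, ht,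
      ← Algebra.commutes, ← Algebra.smul_def, ← Algebra.commutes, ← Algebra.smul_def, map_smul,
      ← ih s]
    simp only [map_smul, smul_eq_mul, insertLabelled_mul]
  refine SFAlg.addHom_ext_right (δ := δ) (ι := {s : List (M × I) // IncSteps i s})
    (f := fun s => AddMonoidHom.mk' (fun x => insertLabelled B ν i s.1 fun q =>
      pathPair δ ev i q (shiftHom c ct x)) fun x y => by
        simp only [map_add, insertLabelled_add])
    (g := fun s => (pathPair δ ev i s.1).toAddMonoidHom.comp
      ((shiftHom c ct).toAddMonoidHom.comp (SFAlg.derivation δ D))) (fun s => ?_) ?_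
    (fun t => hunit _ _ (shiftHom_tgen t) (SFAlg.derivation_tgen δ D t))
    (fun t => hunit _ _ (shiftHom_tgen_inv t) (SFAlg.derivation_tgen_inv t)) ⟨s, hs⟩ x
  · have h1 : SFAlg.derivation δ D 1 = 0 := SFAlg.isPreDGA.d_one
    have : ∀ s : List (M × I), insertLabelled B ν i s (fun q => if q = [] then (1 : k) else 0) = 0 := by
      intro s
      cases s with
      | nil => rfl
      | cons x s =>
        rw [insertLabelled, insertLabelled_congr (ψ := fun _ => 0 * 0) (by simp),
          insertLabelled_mul]
        simp
    simpa [h1, pathPair_one] using this s.1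
  · rintro a d x hx ih ⟨s, hs⟩
    have hx' := shiftHom_mem (ct := ct) hc hx
    change insertLabelled B ν i s (fun q => pathPair δ ev i q (shiftHom c ct (x * SFAlg.gen a))) =
      pathPair δ ev i s (shiftHom c ct (SFAlg.derivation δ D (x * SFAlg.gen a)))
    replace ih : ∀ s, IncSteps i s →
        insertLabelled B ν i s (fun q => pathPair δ ev i q (shiftHom c ct x)) =
        pathPair δ ev i s (shiftHom c ct (SFAlg.derivation δ D x)) := fun s hs => ih ⟨s, hs⟩
    have e1 : ∀ q : List (M × I), pathPair δ ev i q (shiftHom c ct (x * SFAlg.gen a)) =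
        pathPair δ ev i q (shiftHom c ct x * MonoidAlgebra.of k _ (FreeMonoid.of a)) +
          c a * pathPair δ ev i q (shiftHom c ct x) := by
      intro q
      rw [map_mul, shiftHom_gen, mul_add, map_add, ← Algebra.commutes, ← Algebra.smul_def, map_smul,
        smul_eq_mul]
    simp only [e1]
    rw [insertLabelled_add, insertLabelled_mul, ih s hs, SFAlg.derivation_mul δ D _ hx,
      SFAlg.derivation_gen, map_add, map_mul, shiftHom_gen, map_zsmul, map_mul, mul_add, map_add,
      map_add, ← Algebra.commutes, ← Algebra.smul_def, map_smul, smul_eq_mul, add_right_comm,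
      map_zsmul, pathPair_mul i s hx' (shiftHom_mem hc (by
        rw [← SFAlg.derivation_gen δ D a]; exact hdeg a))]
    congr 1
    have hdx := shiftHom_mem (ct := ct) hc (hD hx)
    cases s with
    | nil =>
      have h0 := hB i [] trivial a
      rw [insertLabelled, pathPair_cons_mul_of _ _ _ _ hx', pathPair_nil_mul_of, sum_lsplits_nil]
      simp only [endLabel] at h0 ⊢
      rw [h0, zero_add, zsmul_eq_mul, ← mul_assoc (sgn d : k), mul_comm (pathPair δ ev i [] _), mul_sub, mul_one,
        sgn_sub]
      push_cast
      have := sgn_mul_self d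
      have h' : (sgn d : k) * (sgn d : k) = 1 := by exact_mod_cast congrArg (Int.cast (R := k)) this
      linear_combination (-(sgn (d * δ a) : k) * (pathPair δ ev i []) ((shiftHom c ct) (D a)) *
        (pathPair δ ev i []) ((shiftHom c ct) x)) * h'
    | cons y s =>
      obtain ⟨f, l⟩ := y
      have h' : (sgn d : k) * (sgn d : k) = 1 := by
        exact_mod_cast congrArg (Int.cast (R := k)) (sgn_mul_self d)
      rw [insertLabelled, pathPair_cons_mul_of _ _ _ _ hdx, insertLabelled_congr
        (ψ := fun q => ((sgn (d * δ a) : k) * ((sgn (δ a) : k) * ev (endLabel i s) l f a)) *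
          pathPair δ ev i q (shiftHom c ct x)), insertLabelled_mul, ih s hs.2, add_comm,
        sub_mul, sgn_sub, mul_sub, sgn_sub, zsmul_eq_mul, ← mul_assoc (sgn d : k)]
      · push_cast
        congr 1
        · rw [one_mul]
          ring
        · rw [mul_one, mul_comm (sgn (d * δ a) : k), ← mul_assoc, h', one_mul,
            ← List.sum_map_mul_left]
          refine sum_map_congr fun c hc => ?_
          have hl : l = endLabel (endLabel i c.1) c.2 := by
            rw [← endLabel_append, append_of_mem_lsplits hc, endLabel_cons]
          rw [pathPair_cons_mul_of _ _ _ _ hx', hl, hB _ _ (incSteps_of_mem_lsplits hs hc).2]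
          ring
      · intro q hq
        rw [pathPair_cons_mul_of _ _ _ _ hx', hq, hν]
        ring

/-! ### Decompositions -/

/-- Auxiliary to `labelledPieces`. -/
def labelledBlocks (B : I → List (M × I) → M') (i : I) :
    List (M × I) → List (M × I) → List (List (M' × I))
  | [], q => [[(B i q, endLabel i q)]]
  | x :: p, q => labelledBlocks B i p (q ++ [x]) ++
      (labelledBlocks B i p [x]).map fun w => (B x.2 q, endLabel x.2 q) :: w

/-- The sequences obtained by contracting all parts of a decomposition with `B`. -/
def labelledPieces (B : I → List (M × I) → M') (i : I) :
    List (M × I) → List (List (M' × I))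
  | [] => [[]]
  | x :: p => labelledBlocks B i p [x]

theorem sum_labelledBlocks {A : Type*} [AddCommMonoid A] (B : I → List (M × I) → M') (i : I)
    (p q : List (M × I)) (ψ : List (M' × I) → A) :
    ((labelledBlocks B i p q).map ψ).sum = ((lsplits p).map fun c =>
      ((labelledPieces B i c.1).map fun w => ψ ((B (endLabel i c.1) (q ++ c.2),
        endLabel (endLabel i p) q) :: w)).sum).sum := by
  induction p generalizing q with
  | nil => simp [labelledBlocks, labelledPieces, lsplits, endLabel]
  | cons x p ih =>
    rw [sum_lsplits_cons, labelledBlocks, List.map_append, List.sum_append, ih, add_comm]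
    congr 1
    · simp [labelledPieces, Function.comp_def, endLabel]
    · refine sum_map_congr fun c _ => ?_
      cases q <;> simp [endLabel]

theorem endLabel_of_mem_labelledBlocks {B : I → List (M × I) → M'} {i : I}
    {p q : List (M × I)} {w : List (M' × I)} (h : w ∈ labelledBlocks B i p q) :
    endLabel i w = endLabel i (q ++ p) := by
  induction p generalizing q w with
  | nil =>
    rw [labelledBlocks, List.mem_singleton] at h
    rw [h, List.append_nil]
    rfl
  | cons x p ih =>
    rw [labelledBlocks, List.mem_append, List.mem_map] at h
    rcases h with h | ⟨w, -, rfl⟩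
    · rw [ih h, List.append_assoc, List.singleton_append]
    · rw [endLabel_append]
      rfl

theorem endLabel_of_mem_labelledPieces {B : I → List (M × I) → M'} {i : I}
    {s : List (M × I)} {w : List (M' × I)} (h : w ∈ labelledPieces B i s) :
    endLabel i w = endLabel i s := by
  cases s with
  | nil =>
    rw [labelledPieces, List.mem_singleton] at h
    rw [h]
    rfl
  | cons x p => exact endLabel_of_mem_labelledBlocks h

variable {δ' : R' → ZMod (2 * r)} {ev' : I → I → M' →ₗ[k] (R' → k)} {c' : R' → k} {ct' : T' → kˣ}
  {B' : I → List (M × I) → M'} {f : SFAlg R' T' →+* SFAlg R T}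

/-- The decompositions of a sequence are dual to a homomorphism. -/
theorem sum_labelledPieces_pathPair (hc : ∀ a, c a ≠ 0 → δ a = 0) (hc' : ∀ a, c' a ≠ 0 → δ' a = 0)
    (hf : IsGradedHom (SFAlg.grade δ') (SFAlg.grade δ) f)
    (hB : ∀ i s, IncSteps i s → s ≠ [] → ∀ a,
      ev' i (endLabel i s) (B' i s) a = pathPair δ ev i s (shiftHom c ct (f (SFAlg.gen a))))
    (hnil : ∀ i a, pathPair δ ev i [] (shiftHom c ct (f (SFAlg.gen a))) = c' a)
    (ht : ∀ t, shiftHom c ct (f (SFAlg.tgen t).1) = algebraMap k _ (ct' t).1)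
    (i : I) {s : List (M × I)} (hs : IncSteps i s) (x : SFAlg R' T') :
    ((labelledPieces B' i s).map fun w => pathPair δ' ev' i w (shiftHom c' ct' x)).sum =
      pathPair δ ev i s (shiftHom c ct (f x)) := by
  have hti : ∀ t, shiftHom c ct (f ((SFAlg.tgen t)⁻¹ : (SFAlg R' T')ˣ).1) =
      algebraMap k _ ((ct' t)⁻¹).1 := by
    intro t
    have := SFAlg.map_unit_inv ((shiftHom c ct).comp f) (SFAlg.tgen t)
      (y := Units.map (algebraMap k (MonoidAlgebra k (FreeMonoid R))).toMonoidHom (ct' t)) (ht t)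
    rw [← map_inv] at this
    exact this
  have hunit : ∀ (t : SFAlg R' T') (y : k), shiftHom c' ct' t = algebraMap k _ y →
      shiftHom c ct (f t) = algebraMap k _ y → ∀ (d : ZMod (2 * r)) (x : SFAlg R' T'),
      x ∈ SFAlg.grade δ' d → (∀ s : {s : List (M × I) // IncSteps i s},
        ((labelledPieces B' i s.1).map fun w => pathPair δ' ev' i w (shiftHom c' ct' x)).sum =
          pathPair δ ev i s.1 (shiftHom c ct (f x))) →
      ∀ s : {s : List (M × I) // IncSteps i s},
        ((labelledPieces B' i s.1).map fun w =>
          pathPair δ' ev' i w (shiftHom c' ct' (x * t))).sum =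
          pathPair δ ev i s.1 (shiftHom c ct (f (x * t))) := by
    intro t y h h' d x _ ih s
    rw [map_mul f, map_mul (shiftHom c ct), h', ← Algebra.commutes, ← Algebra.smul_def, map_smul,
      smul_eq_mul, ← ih s, ← List.sum_map_mul_left]
    refine sum_map_congr fun w _ => ?_
    rw [map_mul, h, ← Algebra.commutes, ← Algebra.smul_def, map_smul, smul_eq_mul]
  refine SFAlg.addHom_ext_right (δ := δ') (ι := {s : List (M × I) // IncSteps i s})
    (f := fun s => AddMonoidHom.mk' (fun x => ((labelledPieces B' i s.1).map fun w =>
      pathPair δ' ev' i w (shiftHom c' ct' x)).sum) fun x y => by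
        simp only [map_add, List.sum_map_add])
    (g := fun s => (pathPair δ ev i s.1).toAddMonoidHom.comp
      ((shiftHom c ct).comp f).toAddMonoidHom) (fun s => ?_) ?_
    (fun t => hunit _ _ (shiftHom_tgen t) (ht t))
    (fun t => hunit _ _ (shiftHom_tgen_inv t) (hti t)) ⟨s, hs⟩ x
  · obtain ⟨s, hs⟩ := s
    change ((labelledPieces B' i s).map fun w => pathPair δ' ev' i w (shiftHom c' ct' 1)).sum =
      pathPair δ ev i s (shiftHom c ct (f 1))
    simp only [map_one, pathPair_one]
    cases s with
    | nil => simp [labelledPieces]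
    | cons x s => simp [labelledPieces, sum_labelledBlocks]
  · rintro a d x hx ih ⟨s, hs⟩
    have hx' := shiftHom_mem (ct := ct') hc' hx
    have hfx := shiftHom_mem (ct := ct) hc (hf hx)
    have hfa := shiftHom_mem (ct := ct) hc (hf (SFAlg.gen_mem_grade δ' a))
    replace ih : ∀ s, IncSteps i s →
        ((labelledPieces B' i s).map fun w => pathPair δ' ev' i w (shiftHom c' ct' x)).sum =
          pathPair δ ev i s (shiftHom c ct (f x)) := fun s hs => ih ⟨s, hs⟩
    change ((labelledPieces B' i s).map fun w =>
        pathPair δ' ev' i w (shiftHom c' ct' (x * SFAlg.gen a))).sum =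
      pathPair δ ev i s (shiftHom c ct (f (x * SFAlg.gen a)))
    have e1 : ∀ q : List (M' × I), pathPair δ' ev' i q (shiftHom c' ct' (x * SFAlg.gen a)) =
        pathPair δ' ev' i q (shiftHom c' ct' x * MonoidAlgebra.of k _ (FreeMonoid.of a)) +
          c' a * pathPair δ' ev' i q (shiftHom c' ct' x) := by
      intro q
      rw [map_mul, shiftHom_gen, mul_add, map_add, ← Algebra.commutes, ← Algebra.smul_def, map_smul,
        smul_eq_mul]
    simp only [e1]
    have hsgn : c' a ≠ 0 → sgn (d * δ' a) = 1 := fun h => by rw [hc' a h, mul_zero, sgn_zero]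
    have hmul : (sgn (d * δ' a) : k) * c' a = c' a := by
      by_cases h : c' a = 0
      · rw [h, mul_zero]
      · rw [hsgn h, Int.cast_one, one_mul]
    rw [List.sum_map_add, List.sum_map_mul_left, ih s hs, map_mul, map_mul,
      pathPair_mul i s hfx hfa]
    cases s with
    | nil =>
      rw [sum_lsplits_nil, hnil]
      simp only [labelledPieces, List.map_cons, List.map_nil, List.sum_cons, List.sum_nil,
        pathPair_nil_mul_of]
      linear_combination -(pathPair δ ev i [] (shiftHom c ct (f x))) * hmul
    | cons y s =>
      obtain ⟨g, l⟩ := y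
      rw [sum_lsplits_cons, mul_add, add_comm, hnil]
      congr 1
      · linear_combination -(pathPair δ ev i ((g, l) :: s) (shiftHom c ct (f x))) * hmul
      · rw [labelledPieces, sum_labelledBlocks, ← List.sum_map_mul_left]
        refine sum_map_congr fun c hcs => ?_
        have hcs' := incSteps_of_mem_lsplits (i := i) hs
          (c := (c.1, (g, l) :: c.2)) (by
            rw [lsplits]; exact List.mem_cons_of_mem _ (List.mem_map_of_mem hcs))
        rw [← ih c.1 hcs'.1, ← List.sum_map_mul_right, ← List.sum_map_mul_left]
        refine sum_map_congr fun w hw => ?_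
        have hwl : endLabel i w = endLabel i c.1 := by
          exact endLabel_of_mem_labelledPieces hw
        rw [pathPair_cons_mul_of _ _ _ _ hx', hwl, ← hB _ _ hcs'.2 (by simp)]
        simp only [endLabel, List.singleton_append]
        ring

end Insertion

end

noncomputable section

/-! ## Consistent sequences of DGAs -/

theorem Function.extend_comp_injective {α β γ M : Type*} [Zero M] {g : β → γ}
    (hg : Function.Injective g) (e : α → β) (f : α → M) (x : β) :
    Function.extend (g ∘ e) f 0 (g x) = Function.extend e f 0 x := by
  by_cases h : ∃ a, e a = x
  · have h' : ∃ a, (g ∘ e) a = g x := h.imp fun a ha => congrArg g ha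
    classical
    rw [Function.extend_def, Function.extend_def, dif_pos h', dif_pos h]
    congr 2
    funext a
    exact propext hg.eq_iff
  · rw [Function.extend_apply' (f := e) _ _ _ h, Function.extend_apply' (f := g ∘ e) _ _ _ fun ⟨a, ha⟩ => h ⟨a, hg ha⟩]
    rfl

namespace DGASeq

open Classical

variable {r : ℕ} {S S' : DGASeq r} {k : Type u} [CommRing k]

/-- Composable products of generators, from row `u` to column `v`, and their sums. -/
inductive IsLink (S : DGASeq r) (cp : ∀ {m}, S.T m → Fin m) {m : ℕ} :
    Fin m → Fin m → SFAlg (S.R m) (S.T m) → Prop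
  | zero (u v) : IsLink S cp u v 0
  | one (u) : IsLink S cp u u 1
  | gen (a) : IsLink S cp (S.row a) (S.col a) (SFAlg.gen a)
  | tgen (t) : IsLink S cp (cp t) (cp t) (SFAlg.tgen t).1
  | tinv (t) : IsLink S cp (cp t) (cp t) ((SFAlg.tgen t)⁻¹ : (SFAlg (S.R m) (S.T m))ˣ).1
  | mul {u v w x y} : IsLink S cp u v x → IsLink S cp v w y → IsLink S cp u w (x * y)
  | add {u v x y} : IsLink S cp u v x → IsLink S cp u v y → IsLink S cp u v (x + y)
  | neg {u v x} : IsLink S cp u v x → IsLink S cp u v (-x)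

/-- The projection which kills the generators that are not in the image of `σ`. -/
def restrict (S : DGASeq r) {m n : ℕ} (σ : Fin m ↪o Fin n) :
    SFAlg (S.R n) (S.T n) →+* SFAlg (S.R m) (S.T m) :=
  SFAlg.lift (Function.extend (S.mapR σ) SFAlg.gen 0) (Function.extend (S.mapT σ) SFAlg.tgen 1)

/-- The inclusions of indices act compatibly with degrees and the link grading; the images of
generators are characterized by their rows and columns, and those of invertible generators by the
number `cp` of the copy on which they lie. -/
structure IsIndexed (S : DGASeq r) (cp : ∀ {m}, S.T m → Fin m) : Prop where
  mapR_refl : ∀ {m} (a : S.R m), S.mapR (RelEmbedding.refl _) a = a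
  mapR_trans : ∀ {l m n} (σ : Fin l ↪o Fin m) (τ : Fin m ↪o Fin n) (a : S.R l),
    S.mapR τ (S.mapR σ a) = S.mapR (σ.trans τ) a
  mapR_injective : ∀ {m n} (σ : Fin m ↪o Fin n), Function.Injective (S.mapR σ)
  row_mapR : ∀ {m n} (σ : Fin m ↪o Fin n) (a : S.R m), S.row (S.mapR σ a) = σ (S.row a)
  col_mapR : ∀ {m n} (σ : Fin m ↪o Fin n) (a : S.R m), S.col (S.mapR σ a) = σ (S.col a)
  deg_mapR : ∀ {m n} (σ : Fin m ↪o Fin n) (a : S.R m), S.deg (S.mapR σ a) = S.deg a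
  mem_range_mapR : ∀ {m n} (σ : Fin m ↪o Fin n) (a : S.R n), S.row a ∈ Set.range σ →
    S.col a ∈ Set.range σ → a ∈ Set.range (S.mapR σ)
  mapT_refl : ∀ {m} (t : S.T m), S.mapT (RelEmbedding.refl _) t = t
  mapT_trans : ∀ {l m n} (σ : Fin l ↪o Fin m) (τ : Fin m ↪o Fin n) (t : S.T l),
    S.mapT τ (S.mapT σ t) = S.mapT (σ.trans τ) t
  mapT_injective : ∀ {m n} (σ : Fin m ↪o Fin n), Function.Injective (S.mapT σ)
  cp_mapT : ∀ {m n} (σ : Fin m ↪o Fin n) (t : S.T m), cp (S.mapT σ t) = σ (cp t)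
  mem_range_mapT : ∀ {m n} (σ : Fin m ↪o Fin n) (t : S.T n), cp t ∈ Set.range σ →
    t ∈ Set.range (S.mapT σ)

/-- The values `G` respect the link grading and the restrictions to fewer indices. -/
structure IsCompatible (S : DGASeq r) (cp : ∀ {m}, S.T m → Fin m) (S' : DGASeq r)
    (G : ∀ {m}, S'.R m → SFAlg (S.R m) (S.T m)) : Prop where
  link : ∀ {m} (a : S'.R m), IsLink S cp (S'.row a) (S'.col a) (G a)
  restrict : ∀ {m n} (σ : Fin m ↪o Fin n) (a : S'.R m), S.restrict σ (G (S'.mapR σ a)) = G a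

/-- The projection of free `k`-algebras which kills the letters that are not in the image of `σ`. -/
def restrictFree (k : Type u) [CommRing k] (S : DGASeq r) {m n : ℕ} (σ : Fin m ↪o Fin n) :
    MonoidAlgebra k (FreeMonoid (S.R n)) →ₐ[k] MonoidAlgebra k (FreeMonoid (S.R m)) :=
  MonoidAlgebra.lift k _ _ (FreeMonoid.lift
    (Function.extend (S.mapR σ) (fun a => MonoidAlgebra.of k _ (FreeMonoid.of a)) 0))

theorem restrictFree_of_of {m n : ℕ} (σ : Fin m ↪o Fin n) (a : S.R n) :
    S.restrictFree k σ (MonoidAlgebra.of k _ (FreeMonoid.of a)) =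
      Function.extend (S.mapR σ) (fun a => MonoidAlgebra.of k _ (FreeMonoid.of a)) 0 a := by
  simp [restrictFree, MonoidAlgebra.of]

/-- The constant term. -/
def constTerm (k : Type u) [CommRing k] (R : Type) : MonoidAlgebra k (FreeMonoid R) →ₐ[k] k :=
  MonoidAlgebra.lift k _ _ (FreeMonoid.lift 0)

theorem constTerm_of_of {R : Type} (a : R) :
    constTerm k R (MonoidAlgebra.of k _ (FreeMonoid.of a)) = 0 := by
  simp [constTerm, MonoidAlgebra.of]

theorem pathPair_nil {R I : Type} {M : Type u} [AddCommGroup M] [Module k M]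
    {δ : R → ZMod (2 * r)} {ev : I → I → M →ₗ[k] (R → k)} (i : I)
    (x : MonoidAlgebra k (FreeMonoid R)) : pathPair δ ev i [] x = constTerm k R x := by
  refine map_eq_of_mem_wordSpan (f := pathPair δ ev i []) (g := (constTerm k R).toLinearMap)
    (fun w _ => ?_) (wordSpan_top x)
  rw [pathPair_of]
  induction w using FreeMonoid.recOn with
  | one =>
    rw [map_one (MonoidAlgebra.of k (FreeMonoid R)), AlgHom.toLinearMap_apply,
      map_one (constTerm k R)]
    simp [listSign, listPair]
  | of_mul a w _ =>
    rw [map_mul (MonoidAlgebra.of k (FreeMonoid R)), AlgHom.toLinearMap_apply,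
      map_mul (constTerm k R), constTerm_of_of, zero_mul,
      FreeMonoid.toList_of_mul]
    have : ∀ l : List R, l ≠ [] → listPair ev i [] l = 0 := fun l hl => by
      cases l with
      | nil => exact absurd rfl hl
      | cons => rfl
    rw [this _ (by simp), mul_zero]

theorem constTerm_restrictFree {m n : ℕ} (σ : Fin m ↪o Fin n)
    (x : MonoidAlgebra k (FreeMonoid (S.R n))) :
    constTerm k _ (S.restrictFree k σ x) = constTerm k _ x := by
  suffices (constTerm k _).comp (S.restrictFree k σ) = constTerm k (S.R n) from
    DFunLike.congr_fun this x
  refine MonoidAlgebra.algHom_ext' (R := k) (M := FreeMonoid (S.R n))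
    (FreeMonoid.hom_eq fun a => ?_) (Subsingleton.elim _ _)
  change constTerm k _ (S.restrictFree k σ (MonoidAlgebra.of k (FreeMonoid (S.R n))
    (FreeMonoid.of a))) = constTerm k _ (MonoidAlgebra.of k (FreeMonoid (S.R n)) (FreeMonoid.of a))
  rw [restrictFree_of_of, constTerm_of_of, Function.extend_def]
  split_ifs
  · rw [constTerm_of_of]
  · rw [Pi.zero_apply, map_zero]

theorem oneEmb_trans {m n : ℕ} (i : Fin m) (σ : Fin m ↪o Fin n) :
    (oneEmb i).trans σ = oneEmb (σ i) := by
  ext; rfl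

theorem twoEmb_trans {m n : ℕ} {i j : Fin m} (h : i < j) (σ : Fin m ↪o Fin n) :
    (twoEmb h).trans σ = twoEmb (σ.strictMono h) := by
  ext x; fin_cases x <;> rfl

theorem mem_range_oneEmb {m : ℕ} {i j : Fin m} : j ∈ Set.range (oneEmb i) ↔ j = i :=
  ⟨fun ⟨_, h⟩ => h ▸ rfl, fun h => ⟨0, h.symm ▸ rfl⟩⟩

namespace IsIndexed

variable {cp : ∀ {m}, S.T m → Fin m}

theorem restrict_gen (H : S.IsIndexed cp) {m n : ℕ} (σ : Fin m ↪o Fin n) (a : S.R m) :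
    S.restrict σ (SFAlg.gen (S.mapR σ a)) = SFAlg.gen a := by
  rw [restrict, SFAlg.lift_gen, (H.mapR_injective σ).extend_apply]

theorem restrict_tgen (H : S.IsIndexed cp) {m n : ℕ} (σ : Fin m ↪o Fin n) (t : S.T m) :
    S.restrict σ (SFAlg.tgen (S.mapT σ t)).1 = (SFAlg.tgen t).1 := by
  rw [restrict, SFAlg.lift_tgen, (H.mapT_injective σ).extend_apply]

theorem diagR_mapR_oneEmb (H : S.IsIndexed cp) {m : ℕ} (ε : Fin m → S.AugObj k) (i : Fin m) (b : S.R 1) :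
    diagR ε (S.mapR (oneEmb i) b) = (ε i).1 (SFAlg.gen b) := by
  rw [diagR, Finset.sum_eq_single i]
  · rw [(H.mapR_injective _).extend_apply]
  · intro j _ hj
    rw [Function.extend_apply', Pi.zero_apply]
    rintro ⟨b', hb'⟩
    have := congrArg S.row hb'
    rw [H.row_mapR, H.row_mapR] at this
    exact hj this
  · simp

theorem diagR_of_ne (H : S.IsIndexed cp) {m : ℕ} (ε : Fin m → S.AugObj k) {a : S.R m} (h : S.row a ≠ S.col a) :
    diagR ε a = 0 := by
  refine Finset.sum_eq_zero fun j _ => ?_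
  rw [Function.extend_apply', Pi.zero_apply]
  rintro ⟨b, rfl⟩
  rw [H.row_mapR, H.col_mapR] at h
  exact h rfl

theorem exists_of_row_eq_col (H : S.IsIndexed cp) {m : ℕ} {a : S.R m} (h : S.row a = S.col a) :
    ∃ b, S.mapR (oneEmb (S.row a)) b = a :=
  H.mem_range_mapR _ a (mem_range_oneEmb.2 rfl) (mem_range_oneEmb.2 h.symm)

theorem diagR_mapR (H : S.IsIndexed cp) {m n : ℕ} (σ : Fin m ↪o Fin n) (ε : Fin n → S.AugObj k) (a : S.R m) :
    diagR ε (S.mapR σ a) = diagR (ε ∘ σ) a := by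
  by_cases h : S.row a = S.col a
  · obtain ⟨b, hb⟩ := H.exists_of_row_eq_col h
    rw [← hb, H.mapR_trans, oneEmb_trans, H.diagR_mapR_oneEmb, H.diagR_mapR_oneEmb]
    rfl
  · rw [H.diagR_of_ne _ h, H.diagR_of_ne]
    rw [H.row_mapR, H.col_mapR]
    exact fun h' => h (σ.injective h')

theorem exists_mapT (H : S.IsIndexed cp) {m : ℕ} (t : S.T m) : ∃ b, S.mapT (oneEmb (cp t)) b = t :=
  H.mem_range_mapT _ t (mem_range_oneEmb.2 rfl)

theorem diagT_mapT_oneEmb (H : S.IsIndexed cp) {m : ℕ} (ε : Fin m → S.AugObj k) (i : Fin m) (b : S.T 1) :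
    diagT ε (S.mapT (oneEmb i) b) = Units.map (ε i).1.toMonoidHom (SFAlg.tgen b) := by
  rw [diagT, Finset.prod_eq_single i]
  · rw [(H.mapT_injective _).extend_apply]
  · intro j _ hj
    rw [Function.extend_apply', Pi.one_apply]
    rintro ⟨b', hb'⟩
    have := congrArg cp hb'
    rw [H.cp_mapT, H.cp_mapT] at this
    exact hj this
  · simp

theorem diagT_mapT (H : S.IsIndexed cp) {m n : ℕ} (σ : Fin m ↪o Fin n) (ε : Fin n → S.AugObj k) (t : S.T m) :
    diagT ε (S.mapT σ t) = diagT (ε ∘ σ) t := by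
  obtain ⟨b, hb⟩ := H.exists_mapT t
  rw [← hb, H.mapT_trans, oneEmb_trans, H.diagT_mapT_oneEmb, H.diagT_mapT_oneEmb]
  rfl

theorem deg_eq_zero_of_diagR_ne_zero (H : S.IsIndexed cp) {m : ℕ} (ε : Fin m → S.AugObj k) (a : S.R m)
    (h : diagR ε a ≠ 0) : S.deg a = 0 := by
  by_contra hd
  by_cases ha : S.row a = S.col a
  · obtain ⟨b, hb⟩ := H.exists_of_row_eq_col ha
    rw [← hb, H.deg_mapR] at hd
    rw [← hb, H.diagR_mapR_oneEmb] at h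
    exact h ((ε _).2.1 _ hd _ (SFAlg.gen_mem_grade S.deg b))
  · exact h (H.diagR_of_ne ε ha)

theorem constTerm_twist (H : S.IsIndexed cp) (ε : Fin 1 → S.AugObj k) (x : SFAlg (S.R 1) (S.T 1)) :
    constTerm k _ (twist ε x) = (ε 0).1 x := by
  have h0 : oneEmb (0 : Fin 1) = RelEmbedding.refl _ := by
    ext x; fin_cases x; rfl
  suffices (constTerm k _).toRingHom.comp (twist ε) = (ε 0).1 from DFunLike.congr_fun this x
  refine SFAlg.hom_ext (fun a => ?_) fun t => ?_
  · change constTerm k _ (shiftHom (diagR ε) (diagT ε) _) = _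
    rw [shiftHom_gen, map_add, constTerm_of_of, AlgHom.commutes]
    conv_lhs => rw [← H.mapR_refl a, ← h0, H.diagR_mapR_oneEmb]
    simp
  · change constTerm k _ (shiftHom (diagR ε) (diagT ε) _) = _
    rw [shiftHom_tgen, AlgHom.commutes]
    conv_lhs => rw [← H.mapT_refl t, ← h0, H.diagT_mapT_oneEmb]
    rfl

theorem restrictFree_twist (H : S.IsIndexed cp) {m n : ℕ} (σ : Fin m ↪o Fin n) (ε : Fin n → S.AugObj k) {u v : Fin n}
    {y : SFAlg (S.R n) (S.T n)} (hy : IsLink S cp u v y) :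
    (u ∈ Set.range σ → v ∈ Set.range σ →
      S.restrictFree k σ (twist ε y) = twist (ε ∘ σ) (S.restrict σ y)) ∧
    ((u ∈ Set.range σ ↔ v ∉ Set.range σ) →
      S.restrictFree k σ (twist ε y) = 0 ∧ S.restrict σ y = 0) := by
  induction hy with
  | zero u v => simp
  | one u => exact ⟨by simp, fun h => absurd h (by tauto)⟩
  | gen a =>
    change (_ → _ → S.restrictFree k σ (shiftHom (diagR ε) (diagT ε) _) =
      shiftHom (diagR _) (diagT _) _) ∧
        (_ → S.restrictFree k σ (shiftHom (diagR ε) (diagT ε) _) = 0 ∧ _)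
    rw [shiftHom_gen, map_add, AlgHom.commutes, restrictFree_of_of]
    constructor
    · intro h1 h2
      obtain ⟨b, rfl⟩ := H.mem_range_mapR σ a h1 h2
      rw [(H.mapR_injective σ).extend_apply, H.restrict_gen, shiftHom_gen, H.diagR_mapR]
    · intro h
      have hne : S.row a ≠ S.col a := fun he => by
        rw [he] at h
        tauto
      have ha : ¬ ∃ b, S.mapR σ b = a := by
        rintro ⟨b, rfl⟩
        rw [H.row_mapR, H.col_mapR] at h
        simp at h
      rw [Function.extend_apply' _ _ _ ha, H.diagR_of_ne ε hne, restrict, SFAlg.lift_gen,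
        Function.extend_apply' _ _ _ ha]
      simp
  | tgen t =>
    refine ⟨fun h _ => ?_, fun h => absurd h (by tauto)⟩
    obtain ⟨b, rfl⟩ := H.mem_range_mapT σ t h
    change S.restrictFree k σ (shiftHom (diagR ε) (diagT ε) _) = shiftHom (diagR _) (diagT _) _
    rw [H.restrict_tgen, shiftHom_tgen, shiftHom_tgen, AlgHom.commutes, H.diagT_mapT]
  | tinv t =>
    refine ⟨fun h _ => ?_, fun h => absurd h (by tauto)⟩
    obtain ⟨b, rfl⟩ := H.mem_range_mapT σ t h
    change S.restrictFree k σ (shiftHom (diagR ε) (diagT ε) _) = shiftHom (diagR _) (diagT _) _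
    rw [SFAlg.map_unit_inv _ _ (H.restrict_tgen σ b), shiftHom_tgen_inv, shiftHom_tgen_inv,
      AlgHom.commutes, H.diagT_mapT]
  | @mul u v w x y _ _ hx hy =>
    rw [map_mul, map_mul, map_mul]
    by_cases hu : u ∈ Set.range σ <;> by_cases hv : v ∈ Set.range σ <;>
      by_cases hw : w ∈ Set.range σ <;> simp only [hu, hv, hw] at hx hy ⊢ <;> simp_all
  | add _ _ hx hy =>
    rw [map_add, map_add, map_add, map_add]
    exact ⟨fun h h' => by rw [hx.1 h h', hy.1 h h'], fun h => by
      rw [(hx.2 h).1, (hx.2 h).2, (hy.2 h).1, (hy.2 h).2]; simp⟩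
  | neg _ hx =>
    rw [map_neg, map_neg, map_neg, map_neg]
    exact ⟨fun h h' => by rw [hx.1 h h'], fun h => by
      rw [(hx.2 h).1, (hx.2 h).2]; simp⟩

end IsIndexed

/-- The words which are composable from `u` to `v`. -/
def IsComposable (S : DGASeq r) {m : ℕ} (v : Fin m) : Fin m → List (S.R m) → Prop
  | u, [] => u = v
  | u, a :: w => S.row a = u ∧ IsComposable S v (S.col a) w

theorem IsComposable.append {m : ℕ} {u v w : Fin m} {x y : List (S.R m)}
    (hx : S.IsComposable v u x) (hy : S.IsComposable w v y) : S.IsComposable w u (x ++ y) := by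
  induction x generalizing u with
  | nil => rwa [show u = v from hx]
  | cons a x ih => exact ⟨hx.1, ih hx.2⟩

theorem IsIndexed.twist_mem {cp : ∀ {m}, S.T m → Fin m} (H : S.IsIndexed cp) {m : ℕ}
    (ε : Fin m → S.AugObj k) {u v : Fin m} {y : SFAlg (S.R m) (S.T m)} (hy : IsLink S cp u v y) :
    twist ε y ∈ wordSpan k (S.IsComposable v u) := by
  have hone : ∀ u, (1 : MonoidAlgebra k (FreeMonoid (S.R m))) ∈ wordSpan k (S.IsComposable u u) := by
    intro u
    rw [← map_one (MonoidAlgebra.of k (FreeMonoid (S.R m)))]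
    exact of_mem_wordSpan rfl
  have hsc : ∀ u c, algebraMap k (MonoidAlgebra k (FreeMonoid (S.R m))) c ∈
      wordSpan k (S.IsComposable u u) := by
    intro u c
    rw [Algebra.algebraMap_eq_smul_one]
    exact Submodule.smul_mem _ _ (hone u)
  change shiftHom (diagR ε) (diagT ε) y ∈ _
  induction hy with
  | zero u v => rw [map_zero]; exact zero_mem _
  | one u => rw [map_one]; exact hone u
  | gen a =>
    rw [shiftHom_gen]
    refine add_mem (of_mem_wordSpan ⟨rfl, rfl⟩) ?_
    by_cases h : S.row a = S.col a
    · rw [h]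
      exact hsc _ _
    · rw [H.diagR_of_ne ε h, map_zero]
      exact zero_mem _
  | tgen t => rw [shiftHom_tgen]; exact hsc _ _
  | tinv t => rw [shiftHom_tgen_inv]; exact hsc _ _
  | mul _ _ hx hy =>
    rw [map_mul]
    exact mul_mem_wordSpan (fun _ _ h h' => h.append h') hx hy
  | add _ _ hx hy => rw [map_add]; exact add_mem hx hy
  | neg _ hx => rw [map_neg]; exact neg_mem hx

end DGASeq

end

noncomputable section

namespace DGASeq

open Classical

variable {r : ℕ} {S S' : DGASeq r} {k : Type u} [CommRing k] {cp : ∀ {m}, S.T m → Fin m}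
  {cp' : ∀ {m}, S'.T m → Fin m} {N : ℕ}

/-- The value of a functional at generators in row `i` and column `l`. -/
def evalAt (S : DGASeq r) (k : Type u) [CommRing k] (i l : Fin N) :
    (S.Mixed → k) →ₗ[k] (S.R N → k) where
  toFun f a := if h : i < l then Function.extend (S.embed h) f 0 a else 0
  map_add' f g := by
    ext a
    simp only [Pi.add_apply, Function.extend_def]
    split_ifs <;> simp
  map_smul' c f := by
    ext a
    simp only [Pi.smul_apply, Function.extend_def, RingHom.id_apply]
    split_ifs <;> simp

/-- The pairing of a sequence of functionals, with labels in `{0, …, N - 1}`, with the algebra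
`A⁽ᴺ⁾`. -/
abbrev pairing (S : DGASeq r) (i : Fin N) (s : List ((S.Mixed → k) × Fin N)) :
    MonoidAlgebra k (FreeMonoid (S.R N)) →ₗ[k] k :=
  pathPair S.deg (S.evalAt k) i s

/-- The operation dual to `G`, computed in `A⁽ᴺ⁾`. -/
def labelledOp (G : ∀ {m}, S'.R m → SFAlg (S.R m) (S.T m)) (ε : Fin N → S.AugObj k) (i : Fin N)
    (s : List ((S.Mixed → k) × Fin N)) (a : S'.Mixed) : k :=
  if h : i < endLabel i s then S.pairing i s (twist ε (G (S'.embed h a))) else 0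

theorem IsIndexed.embed_injective (H : S.IsIndexed cp) {i j : Fin N} (h : i < j) :
    Function.Injective (S.embed h) := fun _ _ h' => Subtype.ext (H.mapR_injective _ h')

theorem IsIndexed.row_embed (H : S.IsIndexed cp) {i j : Fin N} (h : i < j) (a : S.Mixed) :
    S.row (S.embed h a) = i := by
  rw [embed, H.row_mapR, a.2.1]; rfl

theorem IsIndexed.col_embed (H : S.IsIndexed cp) {i j : Fin N} (h : i < j) (a : S.Mixed) :
    S.col (S.embed h a) = j := by
  rw [embed, H.col_mapR, a.2.2]; rfl

theorem IsIndexed.deg_embed (H : S.IsIndexed cp) {i j : Fin N} (h : i < j) (a : S.Mixed) :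
    S.deg (S.embed h a) = S.deg a.1 := H.deg_mapR _ _

theorem IsIndexed.mapR_embed (H : S.IsIndexed cp) {m : ℕ} (σ : Fin m ↪o Fin N) {i j : Fin m}
    (h : i < j) (a : S.Mixed) : S.mapR σ (S.embed h a) = S.embed (σ.strictMono h) a := by
  rw [embed, H.mapR_trans, twoEmb_trans]
  rfl

theorem IsIndexed.exists_embed (H : S.IsIndexed cp) {i j : Fin N} (h : i < j) {a : S.R N}
    (hi : S.row a = i) (hj : S.col a = j) : ∃ b, S.embed h b = a := by
  obtain ⟨b, rfl⟩ := H.mem_range_mapR (twoEmb h) a ⟨0, hi.symm⟩ ⟨1, hj.symm⟩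
  rw [H.row_mapR] at hi
  rw [H.col_mapR] at hj
  exact ⟨⟨b, (twoEmb h).injective hi, (twoEmb h).injective hj⟩, rfl⟩

theorem IsIndexed.evalAt_embed (H : S.IsIndexed cp) {i j : Fin N} (h : i < j) (f : S.Mixed → k)
    (a : S.Mixed) : S.evalAt k i j f (S.embed h a) = f a := by
  simp [evalAt, h, (H.embed_injective h).extend_apply]

theorem IsIndexed.exists_of_evalAt_ne_zero (H : S.IsIndexed cp) {i j : Fin N} {f : S.Mixed → k}
    {a : S.R N} (ha : S.evalAt k i j f a ≠ 0) : ∃ (h : i < j) (b : S.Mixed), S.embed h b = a ∧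
      f b ≠ 0 := by
  by_cases h : i < j
  · refine ⟨h, ?_⟩
    by_cases hb : ∃ b, S.embed h b = a
    · obtain ⟨b, rfl⟩ := hb
      rw [H.evalAt_embed] at ha
      exact ⟨b, rfl, ha⟩
    · simp [evalAt, h, Function.extend_apply' _ _ _ hb] at ha
  · simp [evalAt, h] at ha

theorem IsIndexed.eq_of_listPair_ne_zero (H : S.IsIndexed cp) {i u v : Fin N}
    {s : List ((S.Mixed → k) × Fin N)} (hs : s ≠ []) {w : List (S.R N)}
    (hw : S.IsComposable v u w) (h : listPair (S.evalAt k) i s w.reverse ≠ 0) :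
    u = i ∧ v = endLabel i s := by
  induction s generalizing v w with
  | nil => exact absurd rfl hs
  | cons x s ih =>
    rcases List.eq_nil_or_concat w with rfl | ⟨w', a, rfl⟩
    · exact absurd rfl h
    · rw [List.concat_eq_append] at h hw
      rw [List.reverse_append, List.reverse_singleton, List.singleton_append, listPair] at h
      obtain ⟨hlt, b, rfl, -⟩ := H.exists_of_evalAt_ne_zero (left_ne_zero_of_mul h)
      have hc : S.IsComposable (S.row (S.embed hlt b)) u w' ∧ v = S.col (S.embed hlt b) := by
        clear h ih
        induction w' generalizing u with
        | nil => exact ⟨hw.1.symm, hw.2.symm⟩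
        | cons c w' ih => exact ⟨⟨hw.1, (ih hw.2).1⟩, (ih hw.2).2⟩
      refine ⟨?_, hc.2.trans (H.col_embed _ _)⟩
      by_cases hs' : s = []
      · subst hs'
        have hw' : w' = [] := by
          by_contra hne
          refine right_ne_zero_of_mul h ?_
          cases hw'' : w'.reverse with
          | nil => simp_all
          | cons => rfl
        subst hw'
        exact (hc.1 : u = _).trans (H.row_embed _ _)
      · exact (ih hs' hc.1 (right_ne_zero_of_mul h)).1

theorem IsIndexed.pairing_eq_zero (H : S.IsIndexed cp) {i u v : Fin N}
    {s : List ((S.Mixed → k) × Fin N)} (hs : s ≠ []) (ε : Fin N → S.AugObj k)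
    {y : SFAlg (S.R N) (S.T N)} (hy : IsLink S cp u v y) (h : u ≠ i ∨ v ≠ endLabel i s) :
    S.pairing i s (twist ε y) = 0 := by
  refine map_eq_of_mem_wordSpan (f := S.pairing i s) (g := 0) (fun w hw => ?_) (H.twist_mem ε hy)
  rw [pathPair_of, LinearMap.zero_apply]
  by_contra hne
  obtain ⟨h1, h2⟩ := H.eq_of_listPair_ne_zero hs hw (right_ne_zero_of_mul hne)
  exact h.elim (fun h => h h1) fun h => h h2

theorem IsIndexed.constTerm_eq_zero (H : S.IsIndexed cp) {u v : Fin N} (ε : Fin N → S.AugObj k)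
    {y : SFAlg (S.R N) (S.T N)} (hy : IsLink S cp u v y) (h : u ≠ v) :
    constTerm k _ (twist ε y) = 0 := by
  rw [← constTerm_restrictFree (oneEmb u), ((H.restrictFree_twist (oneEmb u) ε hy).2 ?_).1, map_zero]
  rw [mem_range_oneEmb, mem_range_oneEmb]
  exact iff_of_true rfl (Ne.symm h)

variable {G : ∀ {m}, S'.R m → SFAlg (S.R m) (S.T m)}

theorem IsCompatible.constTerm_eq_zero (hG : IsCompatible S cp S' G) (H : S.IsIndexed cp)
    (ε : Fin N → S.AugObj k) {a : S'.R N} (h : S'.row a ≠ S'.col a) :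
    constTerm k _ (twist ε (G a)) = 0 := H.constTerm_eq_zero ε (hG.link a) h

theorem IsCompatible.constTerm_eq (hG : IsCompatible S cp S' G) (H : S.IsIndexed cp)
    (H' : S'.IsIndexed cp') (ε : Fin N → S.AugObj k) (i : Fin N) (b : S'.R 1) :
    constTerm k _ (twist ε (G (S'.mapR (oneEmb i) b))) = (ε i).1 (G b) := by
  have hl := hG.link (S'.mapR (oneEmb i) b)
  rw [H'.row_mapR, H'.col_mapR] at hl
  rw [← constTerm_restrictFree (oneEmb i), (H.restrictFree_twist (oneEmb i) ε hl).1 ⟨_, rfl⟩ ⟨_, rfl⟩,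
    hG.restrict, H.constTerm_twist]
  rfl

theorem IsCompatible.evalAt_labelledOp (hG : IsCompatible S cp S' G) (H : S.IsIndexed cp)
    (H' : S'.IsIndexed cp') (ε : Fin N → S.AugObj k) {i : Fin N}
    {s : List ((S.Mixed → k) × Fin N)} (hs : IncSteps i s) (hne : s ≠ []) (a : S'.R N) :
    S'.evalAt k i (endLabel i s) (labelledOp G ε i s) a = S.pairing i s (twist ε (G a)) := by
  have hlt := hs.lt hne
  by_cases ha : S'.row a = i ∧ S'.col a = endLabel i s
  · obtain ⟨b, rfl⟩ := H'.exists_embed hlt ha.1 ha.2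
    rw [H'.evalAt_embed, labelledOp, dif_pos hlt]
  · rw [H.pairing_eq_zero hne ε (hG.link a) (by tauto)]
    by_contra hne'
    obtain ⟨_, b, rfl, -⟩ := H'.exists_of_evalAt_ne_zero hne'
    exact ha ⟨H'.row_embed _ _, H'.col_embed _ _⟩

/-! ### Labelled paths -/

/-- `s` is the sequence of functionals of the path `p` with labels of the objects along `p`, of which
the first one is `i`. -/
def IsLabelling {O M : Type u} (ε : Fin N → O) (i : Fin N) {X : O} :
    {Y : O} → HomPath (fun _ _ : O => M) X Y → List (M × Fin N) → Prop
  | _, .nil _, s => s = [] ∧ X = ε i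
  | Z, .cons p f, s => ∃ l s', s = (f, l) :: s' ∧ Z = ε l ∧ IsLabelling ε i p s'

section

variable {O M : Type u} {ε : Fin N → O} {i : Fin N}

theorem IsLabelling.end_eq {X Y : O} {p : HomPath (fun _ _ : O => M) X Y} {s : List (M × Fin N)}
    (h : IsLabelling ε i p s) : Y = ε (endLabel i s) := by
  cases p with
  | nil => obtain ⟨rfl, h⟩ := h; exact h
  | cons p f => obtain ⟨l, s', rfl, h, -⟩ := h; exact h

theorem IsLabelling.cons {X Y Z : O} {p : HomPath (fun _ _ : O => M) X Y} {s : List (M × Fin N)}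
    (h : IsLabelling ε i p s) (f : M) {l : Fin N} (hl : Z = ε l) :
    IsLabelling ε i (p.cons (Z := Z) f) ((f, l) :: s) := ⟨l, s, rfl, hl, h⟩

theorem IsLabelling.comp {X Y Z : O} {p : HomPath (fun _ _ : O => M) X Y} {s t : List (M × Fin N)}
    (h : IsLabelling ε i p s) {q : HomPath (fun _ _ : O => M) Y Z}
    (hq : IsLabelling ε (endLabel i s) q t) : IsLabelling ε i (p.comp q) (t ++ s) := by
  induction q generalizing t with
  | nil => obtain ⟨rfl, -⟩ := hq; exact h
  | cons q f ih =>
    obtain ⟨l, t, rfl, hl, hq⟩ := hq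
    exact ⟨l, t ++ s, rfl, hl, ih hq⟩

theorem IsLabelling.exists_of_comp {X Y Z : O} {p : HomPath (fun _ _ : O => M) X Y}
    {s : List (M × Fin N)} {q : HomPath (fun _ _ : O => M) Y Z}
    (h : IsLabelling ε i (p.comp q) s) : ∃ s₁ s₂, s = s₂ ++ s₁ ∧ IsLabelling ε i p s₁ ∧
      IsLabelling ε (endLabel i s₁) q s₂ := by
  induction q generalizing s with
  | nil => exact ⟨s, [], rfl, h, rfl, h.end_eq⟩
  | cons q f ih =>
    obtain ⟨l, s', rfl, hl, h⟩ := h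
    obtain ⟨s₁, s₂, rfl, h₁, h₂⟩ := ih h
    exact ⟨s₁, (f, l) :: s₂, rfl, h₁, h₂.cons f hl⟩

theorem exists_isLabelling {X Y : O} (p : HomPath (fun _ _ : O => M) X Y)
    (lab : Fin (p.length + 1) → Fin N) (hlab : StrictMono lab) (hε : ∀ j, p.objs j = ε (lab j)) :
    ∃ s, IsLabelling ε (lab 0) p s ∧ IncSteps (lab 0) s ∧
      endLabel (lab 0) s = lab (Fin.last _) ∧ s.length = p.length := by
  induction p with
  | nil => exact ⟨[], ⟨rfl, hε 0⟩, trivial, rfl, rfl⟩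
  | @cons Y Z p f ih =>
    obtain ⟨s, h1, h2, h3, h4⟩ := ih (fun j => lab (Fin.castSucc j))
      (fun a b hab => hlab (Fin.castSucc_lt_castSucc_iff.2 hab))
      fun j => (Fin.snoc_castSucc (α := fun _ => O) Z p.objs j).symm.trans (hε (Fin.castSucc j))
    refine ⟨(f, lab (Fin.last _)) :: s, h1.cons f ?_, ⟨?_, h2⟩, rfl, congrArg (· + 1) h4⟩
    · exact (Fin.snoc_last (α := fun _ => O) Z p.objs).symm.trans (hε (Fin.last _))
    · exact h3.trans_lt (hlab (Fin.castSucc_lt_last _))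

theorem exists_isLabelling_self {X Y : O} (p : HomPath (fun _ _ : O => M) X Y) :
    ∃ s, IsLabelling p.objs 0 p s ∧ IncSteps 0 s ∧
      endLabel 0 s = Fin.last p.length ∧ s.length = p.length :=
  exists_isLabelling (ε := p.objs) p id strictMono_id fun _ => rfl

end

theorem IsLabelling.exists_labels {O : Type u} {ε : Fin N → O} {i : Fin N} {X Y : O}
    {p : HomPath (fun _ _ : O => S.Mixed → k) X Y} {s : List ((S.Mixed → k) × Fin N)}
    (h : IsLabelling ε i p s) (hs : IncSteps i s) :
    ∃ lab : Fin (p.length + 1) → Fin N, StrictMono lab ∧ lab 0 = i ∧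
      lab (Fin.last _) = endLabel i s ∧ (∀ j, p.objs j = ε (lab j)) ∧
      ∀ w : List (S.R N), listPair (S.evalAt k) i s w.reverse =
        if h : w.length = p.length then
          ∏ j, S.evalAt k (lab j.castSucc) (lab j.succ) (p.homs j) (w.get (j.cast h.symm)) else 0 := by
  induction p generalizing s with
  | nil =>
    obtain ⟨rfl, h⟩ := h
    have : Subsingleton (Fin ((HomPath.nil (Hom := fun _ _ : O => S.Mixed → k) X).length + 1)) :=
      inferInstanceAs (Subsingleton (Fin 1))
    have : IsEmpty (Fin (HomPath.nil (Hom := fun _ _ : O => S.Mixed → k) X).length) :=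
      inferInstanceAs (IsEmpty (Fin 0))
    refine ⟨fun _ => i, Subsingleton.strictMono _, rfl, rfl, fun _ => h, fun w => ?_⟩
    cases w with
    | nil => rw [dif_pos (by rfl), Finset.prod_of_isEmpty]; rfl
    | cons a w =>
      rw [dif_neg (by simp [HomPath.length])]
      cases hw : (a :: w).reverse with
      | nil => simp at hw
      | cons => rfl
  | @cons Y Z p f ih =>
    obtain ⟨l, s, rfl, hl, h⟩ := h
    obtain ⟨lab, h1, h2, h3, h4, h5⟩ := ih h hs.2
    obtain ⟨L, hc, hL⟩ : ∃ L : Fin (p.length + 2) → Fin N, (∀ j : Fin (p.length + 1),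
        L j.castSucc = lab j) ∧ L (Fin.last _) = l :=
      ⟨Fin.snoc (α := fun _ => Fin N) lab l, fun j => Fin.snoc_castSucc (α := fun _ => Fin N) l lab j,
        Fin.snoc_last (α := fun _ => Fin N) l lab⟩
    have hmono : StrictMono L := by
      refine Fin.strictMono_iff_lt_succ.2 fun j => ?_
      induction j using Fin.lastCases with
      | last =>
        rw [Fin.succ_last, hc, hL, h3]
        exact hs.1
      | cast j =>
        rw [Fin.succ_castSucc, hc, hc]
        exact h1 Fin.castSucc_lt_succ
    have hobj : ∀ j : Fin (p.length + 1 + 1), (p.cons (Z := Z) f).objs j = ε (L j) := by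
      intro j
      induction j using Fin.lastCases with
      | last => exact (Fin.snoc_last (α := fun _ => O) _ _).trans (hl.trans (by rw [hL]))
      | cast j =>
        exact (Fin.snoc_castSucc (α := fun _ => O) _ _ j).trans ((h4 j).trans (by rw [hc]))
    have hpair : ∀ w : List (S.R N), listPair (S.evalAt k) i ((f, l) :: s) w.reverse =
        if h : w.length = p.length + 1 then ∏ j : Fin (p.length + 1), S.evalAt k (L j.castSucc)
          (L j.succ) ((p.cons (Z := Z) f).homs j) (w.get (j.cast h.symm)) else 0 := by
      intro w
      rcases List.eq_nil_or_concat w with rfl | ⟨w', a, rfl⟩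
      · rw [dif_neg (by simp)]
        rfl
      · rw [List.concat_eq_append, List.reverse_append, List.reverse_singleton,
          List.singleton_append, listPair, h5]
        by_cases hw : w'.length = p.length
        · rw [dif_pos hw, dif_pos (by simp [hw])]
          rw [Fin.prod_univ_castSucc, mul_comm]
          congr 1
          · refine Finset.prod_congr rfl fun j _ => ?_
            have e : (p.cons (Z := Z) f).homs (Fin.castSucc j) = p.homs j :=
              Fin.snoc_castSucc (α := fun _ => S.Mixed → k) f p.homs j
            have : (j : ℕ) < w'.length := j.2.trans_eq hw.symm
            rw [Fin.succ_castSucc, hc, hc, e]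
            simp [List.getElem_append_left this]
          · have e : (p.cons (Z := Z) f).homs (Fin.last p.length) = f :=
              Fin.snoc_last (α := fun _ => S.Mixed → k) f p.homs
            rw [Fin.succ_last, hL, hc, h3, e]
            simp [← hw]
        · rw [dif_neg hw, dif_neg (by simpa using hw), mul_zero]
    exact ⟨L, hmono, (hc 0).trans h2, hL, hobj, hpair⟩

theorem wordSign_eq {m : ℕ} (w : List (S.R m)) : wordSign w = listSign S.deg w := by
  induction w with
  | nil => rfl
  | cons a w ih => rw [wordSign, ih]; rfl

/-- The pairing as a linear map. -/
theorem pairAlg_eq {n : ℕ} (f : Fin n → S.Mixed → k) (y : MonoidAlgebra k (FreeMonoid (S.R (n + 1)))) :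
    pairAlg f y = ((Finsupp.linearCombination k fun w : FreeMonoid (S.R (n + 1)) =>
      pairWord f w.toList).comp (MonoidAlgebra.coeffLinearEquiv k).toLinearMap) y := rfl

theorem IsIndexed.pairAlg_restrictFree (H : S.IsIndexed cp) {n : ℕ} (f : Fin n → S.Mixed → k)
    (σ : Fin (n + 1) ↪o Fin N) (w : FreeMonoid (S.R N)) :
    pairAlg f (S.restrictFree k σ (MonoidAlgebra.of k _ w)) =
      listSign S.deg w.toList * if h : w.toList.length = n then
        ∏ j, S.evalAt k (σ j.castSucc) (σ j.succ) (f j) (w.toList.get (j.cast h.symm)) else 0 := by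
  by_cases hw : ∀ a ∈ w.toList, a ∈ Set.range (S.mapR σ)
  · obtain ⟨v, hv⟩ : w.toList ∈ Set.range (List.map (S.mapR σ)) := by
      rw [Set.range_list_map]; exact hw
    have hQ : S.restrictFree k σ (MonoidAlgebra.of k _ w) =
        MonoidAlgebra.of k _ (FreeMonoid.ofList v) := by
      obtain rfl : w = FreeMonoid.ofList (v.map (S.mapR σ)) := by rw [hv]; rfl
      clear hv hw
      induction v with
      | nil => exact map_one (S.restrictFree k σ)
      | cons a v ih =>
        rw [List.map_cons, FreeMonoid.ofList_cons, FreeMonoid.ofList_cons,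
          map_mul (MonoidAlgebra.of k _), map_mul (MonoidAlgebra.of k _), map_mul, ih,
          restrictFree_of_of, (H.mapR_injective σ).extend_apply]
    have hdeg : ∀ v : List (S.R (n + 1)), listSign S.deg (v.map (S.mapR σ)) = listSign S.deg v := by
      intro v
      induction v with
      | nil => rfl
      | cons a v ih =>
        rw [List.map_cons, listSign, listSign, ih, H.deg_mapR]
        simp [listDeg, Function.comp_def, H.deg_mapR]
    rw [hQ, pairAlg_eq]
    have : (MonoidAlgebra.coeffLinearEquiv k) (MonoidAlgebra.of k _ (FreeMonoid.ofList v)) =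
        Finsupp.single (FreeMonoid.ofList v) 1 := by
      simp [MonoidAlgebra.of, MonoidAlgebra.coeffLinearEquiv]
    rw [LinearMap.comp_apply, LinearEquiv.coe_coe, this, Finsupp.linearCombination_single, one_smul,
      FreeMonoid.toList_ofList, pairWord]
    generalize w.toList = l at hv
    subst hv
    rw [hdeg]
    by_cases hl : v.length = n
    · rw [dif_pos hl, dif_pos (by simpa using hl), wordSign_eq]
      congr 1
      refine Finset.prod_congr rfl fun j _ => ?_
      have hlt : σ j.castSucc < σ j.succ := σ.strictMono Fin.castSucc_lt_succ
      simp only [evalAt, LinearMap.coe_mk, AddHom.coe_mk, dif_pos hlt]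
      have he : S.embed hlt = S.mapR σ ∘ S.embed (Fin.castSucc_lt_succ (i := j)) :=
        funext fun a => (H.mapR_embed σ _ a).symm
      have e : (v.map (S.mapR σ)).get (j.cast (by simpa using hl.symm)) =
          S.mapR σ (v.get (j.cast hl.symm)) := by simp
      rw [he, e, Function.extend_comp_injective (H.mapR_injective σ)]
    · rw [dif_neg hl, dif_neg (by simpa using hl), mul_zero]
  · push Not at hw
    obtain ⟨a, ha, hna⟩ := hw
    have hQ : S.restrictFree k σ (MonoidAlgebra.of k _ w) = 0 := by
      obtain ⟨l, l', h⟩ := List.append_of_mem ha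
      obtain rfl : w = FreeMonoid.ofList l * (FreeMonoid.of a * FreeMonoid.ofList l') := h
      rw [map_mul (MonoidAlgebra.of k _), map_mul (MonoidAlgebra.of k _), map_mul, map_mul,
        restrictFree_of_of, Function.extend_apply' _ _ _ hna]
      simp
    rw [hQ, pairAlg_eq, map_zero]
    split_ifs with h
    · obtain ⟨j, hj⟩ := List.mem_iff_get.1 ha
      rw [Finset.prod_eq_zero (Finset.mem_univ (j.cast h)), mul_zero]
      by_contra hne
      obtain ⟨hlt, b, hb, -⟩ := H.exists_of_evalAt_ne_zero hne
      refine hna ⟨S.embed Fin.castSucc_lt_succ b, (H.mapR_embed σ _ b).trans (hb.trans hj)⟩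
    · rw [mul_zero]

theorem IsCompatible.dualOp_eq (hG : IsCompatible S cp S' G) (H : S.IsIndexed cp)
    (H' : S'.IsIndexed cp') {ε : Fin N → S.AugObj k} {i : Fin N} {X Y : S.AugObj k}
    {p : HomPath (fun _ _ : S.AugObj k => S.Mixed → k) X Y} {s : List ((S.Mixed → k) × Fin N)}
    (h : IsLabelling ε i p s) (hs : IncSteps i s) : dualOp G p = labelledOp G ε i s := by
  obtain ⟨lab, h1, h2, h3, h4, h5⟩ := h.exists_labels hs
  funext a
  let σ : Fin (p.length + 1) ↪o Fin N := OrderEmbedding.ofStrictMono lab h1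
  have hε : p.objs = ε ∘ σ := funext h4
  by_cases hp : 0 < Fin.last p.length
  · have hlt : i < endLabel i s := (h2.symm.trans_lt (h1 hp)).trans_eq h3
    rw [dualOp, labelledOp, dif_pos hp, dif_pos hlt, hε, ← hG.restrict σ]
    have he : S'.mapR σ (S'.embed hp a) = S'.embed hlt a := by
      rw [H'.mapR_embed]
      congr 1
    have hl := hG.link (S'.embed hlt a)
    rw [H'.row_embed, H'.col_embed] at hl
    rw [he, ← (H.restrictFree_twist σ ε hl).1 ⟨0, h2⟩ ⟨Fin.last _, h3⟩]
    obtain ⟨L, hL⟩ : ∃ L : MonoidAlgebra k (FreeMonoid (S.R (p.length + 1))) →ₗ[k] k,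
      ∀ y, pairAlg p.homs y = L y := ⟨_, pairAlg_eq p.homs⟩
    rw [hL]
    refine map_eq_of_mem_wordSpan (f := L.comp (S.restrictFree k σ).toLinearMap)
      (g := S.pairing i s) (fun w _ => ?_) (wordSpan_top (twist ε (G (S'.embed hlt a))))
    rw [pathPair_of, h5, LinearMap.comp_apply, ← hL]
    exact H.pairAlg_restrictFree p.homs σ w
  · have hlen : p.length = 0 := by
      by_contra hne
      exact hp (by rw [Fin.lt_def]; simpa using Nat.pos_of_ne_zero hne)
    have hlt : ¬ i < endLabel i s := by
      have h0 : (0 : Fin (p.length + 1)) = Fin.last _ := by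
        ext; simp [hlen]
      rw [h0] at h2
      rw [← h3, h2]
      exact lt_irrefl _
    rw [dualOp, labelledOp, dif_neg hp, dif_neg hlt]

end DGASeq

end

noncomputable section

/-! ## The laws of augmentation categories -/

namespace AInfData

variable {k : Type u} [CommRing k] {r : ℕ} {C : AInfData k r}

theorem insertSum_nil {A : Type*} [AddCommGroup A] {X : C.Obj} (G : HomPath C.Hom X X → A) :
    insertSum G (.nil X : C.HPath X X) = G ((HomPath.nil X).cons (C.b (.nil X))) := by
  simp [insertSum, HomPath.splits, HPath.forget, HPath.deg, HomPath.comp]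

theorem insertSum_cons {A : Type*} [AddCommGroup A] {X Y Z : C.Obj} (G : HomPath C.Hom X Z → A)
    (p : C.HPath X Y) (f : Σ d, C.gr Y Z d) :
    insertSum G (.cons p f) =
      ((HomPath.splits (.cons p f : C.HPath X Z)).map fun c =>
        G (.cons (HPath.forget c.2.1) (C.b (HPath.forget c.2.2)))).sum +
      sgn (f.1 - 1) • insertSum (fun q => G (q.cons f.2.1)) p := by
  simp only [insertSum, HomPath.splits, List.map_cons, List.sum_cons, List.map_map, HPath.deg,
    HPath.forget, HomPath.comp, Function.comp_def, List.sum_map_add, List.map_nil, List.sum_nil,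
    sgn_zero, one_smul, add_zero, add_assoc, List.smul_sum, sgn_add, mul_smul]
  congr 2
  congr 1
  refine List.map_congr_left fun c _ => ?_
  congr 1
  refine List.map_congr_left fun c' _ => ?_
  exact smul_comm _ _ _

theorem map_insertSum {A A' : Type*} [AddCommGroup A] [AddCommGroup A'] (φ : A →+ A')
    {X Y : C.Obj} (G : HomPath C.Hom X Y → A) (p : C.HPath X Y) :
    φ (insertSum G p) = insertSum (fun q => φ (G q)) p := by
  simp only [insertSum, map_list_sum, List.map_map, Function.comp_def, map_zsmul]

end AInfData

namespace DGASeq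

open Classical AInfData

variable {r : ℕ} {S S' S'' : DGASeq r} {k : Type u} [CommRing k] {cp : ∀ {m}, S.T m → Fin m}
  {cp' : ∀ {m}, S'.T m → Fin m} {cp'' : ∀ {m}, S''.T m → Fin m} {N : ℕ}

/-- The pairing of a sequence from `i` to `l` with the values of `G`. -/
def opTo (G : ∀ {m}, S'.R m → SFAlg (S.R m) (S.T m)) (ε : Fin N → S.AugObj k) (i l : Fin N)
    (s : List ((S.Mixed → k) × Fin N)) (a : S'.Mixed) : k :=
  if h : i < l then S.pairing i s (twist ε (G (S'.embed h a))) else 0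

theorem opTo_add (G : ∀ {m}, S'.R m → SFAlg (S.R m) (S.T m)) (ε : Fin N → S.AugObj k) (i l : Fin N)
    (s t : List ((S.Mixed → k) × Fin N)) (f g : S.Mixed → k) (j : Fin N) :
    opTo G ε i l (t ++ (f + g, j) :: s) =
      opTo G ε i l (t ++ (f, j) :: s) + opTo G ε i l (t ++ (g, j) :: s) := by
  funext a
  rw [Pi.add_apply]
  unfold opTo
  split_ifs
  · rw [pairing, pathPair_add]; rfl
  · rw [add_zero]

theorem opTo_smul (G : ∀ {m}, S'.R m → SFAlg (S.R m) (S.T m)) (ε : Fin N → S.AugObj k)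
    (i l : Fin N) (s t : List ((S.Mixed → k) × Fin N)) (c : k) (f : S.Mixed → k) (j : Fin N) :
    opTo G ε i l (t ++ (c • f, j) :: s) = c • opTo G ε i l (t ++ (f, j) :: s) := by
  funext a
  rw [Pi.smul_apply]
  unfold opTo
  split_ifs
  · rw [pairing, pathPair_smul]; rfl
  · rw [smul_zero]

theorem IsLabelling.exists_homs_eq {O M : Type u} {ε : Fin N → O} {i : Fin N} {X Y : O}
    {p : HomPath (fun _ _ : O => M) X Y} {s : List (M × Fin N)} (h : IsLabelling ε i p s)
    {x : M × Fin N} (hx : x ∈ s) : ∃ j, p.homs j = x.1 := by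
  induction p generalizing s with
  | nil =>
    obtain ⟨rfl, -⟩ := h
    exact absurd hx List.not_mem_nil
  | @cons Y Z p f ih =>
    obtain ⟨l, s', rfl, -, h⟩ := h
    rcases List.mem_cons.1 hx with rfl | hx
    · exact ⟨Fin.last p.length, Fin.snoc_last (α := fun _ => M) f p.homs⟩
    · obtain ⟨j, hj⟩ := ih h hx
      exact ⟨Fin.castSucc j, (Fin.snoc_castSucc (α := fun _ => M) f p.homs j).trans hj⟩

theorem dualOp_eq_zero {G : ∀ {m}, S'.R m → SFAlg (S.R m) (S.T m)} {X Y : S.AugObj k}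
    {p : HomPath (fun _ _ : S.AugObj k => S.Mixed → k) X Y} {j : Fin p.length}
    (h : p.homs j = 0) : dualOp G p = 0 := by
  have key : ∀ w, pairWord p.homs w = 0 := by
    intro w
    rw [pairWord]
    split_ifs with hw
    · rw [Finset.prod_eq_zero (Finset.mem_univ j), mul_zero]
      rw [h, Function.extend_zero]
      rfl
    · rfl
  funext a
  rw [dualOp]
  split_ifs
  · rw [pairAlg]
    simp only [key, mul_zero]
    exact Finsupp.sum_fun_zero _
  · rfl

theorem IsCompatible.dualOp_eq_opTo {G : ∀ {m}, S'.R m → SFAlg (S.R m) (S.T m)}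
    (hG : IsCompatible S cp S' G) (H : S.IsIndexed cp) (H' : S'.IsIndexed cp')
    {ε : Fin N → S.AugObj k} {i l : Fin N} {X Y : S.AugObj k}
    {p : HomPath (fun _ _ : S.AugObj k => S.Mixed → k) X Y} {s : List ((S.Mixed → k) × Fin N)}
    (h : IsLabelling ε i p s) (hl : endLabel i s = l)
    (hs : IncSteps i s ∨ ∃ j, ((0 : S.Mixed → k), j) ∈ s) : dualOp G p = opTo G ε i l s := by
  rcases hs with hs | ⟨j, hj⟩
  · subst hl
    exact hG.dualOp_eq H H' h hs
  · obtain ⟨j', hj'⟩ := h.exists_homs_eq hj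
    rw [dualOp_eq_zero hj']
    obtain ⟨t, s, rfl⟩ := List.append_of_mem hj
    rw [← zero_smul k (0 : S.Mixed → k), opTo_smul, zero_smul]

/-- The operation on functionals by signs. -/
def signOp (S : DGASeq r) (f : S.Mixed → k) : S.Mixed → k := fun a => (sgn (S.deg a.1) : k) * f a

theorem signOp_eq {d : ZMod (2 * r)} {f : S.Mixed → k} (hf : ∀ a, f a ≠ 0 → S.deg a.1 + 1 = d) :
    S.signOp f = (sgn (d - 1) : k) • f := by
  funext a
  by_cases ha : f a = 0
  · simp [signOp, ha]
  · rw [← hf a ha, add_sub_cancel_right]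
    rfl

theorem IsIndexed.evalAt_signOp (H : S.IsIndexed cp) (i l : Fin N) (f : S.Mixed → k) (a : S.R N) :
    S.evalAt k i l (S.signOp f) a = (sgn (S.deg a) : k) * S.evalAt k i l f a := by
  by_cases h : ∃ (h : i < l) (b : S.Mixed), S.embed h b = a
  · obtain ⟨h, b, rfl⟩ := h
    rw [H.evalAt_embed, H.evalAt_embed, H.deg_embed]
    rfl
  · have h0 : ∀ f : S.Mixed → k, S.evalAt k i l f a = 0 := by
      intro f
      by_contra hne
      obtain ⟨hlt, b, hb, -⟩ := H.exists_of_evalAt_ne_zero hne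
      exact h ⟨hlt, b, hb⟩
    rw [h0, h0, mul_zero]

section Sums

variable {A : Type*} [AddCommMonoid A] {ε : Fin N → S.AugObj k} {i : Fin N}

theorem sum_splits {X Z : (S.augPlus k).Obj} {p : (S.augPlus k).HPath X Z}
    {s : List ((S.Mixed → k) × Fin N)}
    (h : IsLabelling (O := S.AugObj k) (M := S.Mixed → k) ε i (HPath.forget p) s)
    {φ : (Σ Y : S.AugObj k, (S.augPlus k).HPath X Y × (S.augPlus k).HPath Y Z) → A}
    {ψ : List ((S.Mixed → k) × Fin N) × List ((S.Mixed → k) × Fin N) → A}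
    (hφ : ∀ Y p₁ p₂ s₁ s₂,
      IsLabelling (O := S.AugObj k) (M := S.Mixed → k) ε i (HPath.forget p₁) s₁ →
      IsLabelling (O := S.AugObj k) (M := S.Mixed → k) ε (endLabel i s₁) (HPath.forget p₂) s₂ →
      s₂ ++ s₁ = s → φ ⟨Y, p₁, p₂⟩ = ψ (s₁, s₂)) :
    (p.splits.map φ).sum = ((lsplits s).map ψ).sum := by
  induction p generalizing s ψ with
  | nil =>
    obtain ⟨rfl, h⟩ := h
    refine Eq.trans (List.sum_singleton (x := φ _)) (Eq.trans ?_ (sum_lsplits_nil ψ).symm)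
    exact hφ _ (.nil _) (.nil _) [] [] ⟨rfl, h⟩ ⟨rfl, h⟩ rfl
  | @cons Y Z p f ih =>
    have h0 := h
    obtain ⟨l, s, rfl, hl, h⟩ := h
    rw [sum_lsplits_cons]
    refine Eq.trans (by exact List.sum_cons) ?_
    refine congrArg₂ (· + ·) ?_ (Eq.trans (congrArg List.sum List.map_map) ?_)
    · exact hφ _ _ (.nil _) _ [] h0 ⟨rfl, hl⟩ rfl
    · refine ih h fun W p₁ p₂ s₁ s₂ h₁ h₂ hs => ?_
      exact hφ W p₁ (p₂.cons f) s₁ ((f.2.1, l) :: s₂) h₁ (h₂.cons _ hl) (by rw [← hs]; rfl)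

end Sums

theorem insertSum_eq (H : S.IsIndexed cp) (hS : IsCompatible S cp S S.diffGen)
    {ε : Fin N → S.AugObj k} {i : Fin N} {X Y : (S.augPlus k).Obj} {p : (S.augPlus k).HPath X Y}
    {s : List ((S.Mixed → k) × Fin N)}
    (h : IsLabelling (O := S.AugObj k) (M := S.Mixed → k) ε i (HPath.forget p) s)
    (hs : IncSteps i s) {G : HomPath (S.augPlus k).Hom X Y → k}
    {ψ : List ((S.Mixed → k) × Fin N) → k}
    (hG : ∀ q t, IsLabelling (O := S.AugObj k) (M := S.Mixed → k) ε i q t →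
      endLabel i t = endLabel i s → (IncSteps i t ∨ ∃ j, ((0 : S.Mixed → k), j) ∈ t) → G q = ψ t)
    (hψ : ∀ t c f j t', ψ (t ++ (c • f, j) :: t') = c * ψ (t ++ (f, j) :: t')) :
    insertSum G p = insertLabelled (labelledOp S.diffGen ε) S.signOp i s ψ := by
  induction p generalizing s ψ with
  | nil =>
    obtain ⟨rfl, h⟩ := h
    have hb : (S.augPlus k).b (.nil X) = labelledOp S.diffGen ε i [] :=
      hS.dualOp_eq H H (p := .nil X) ⟨rfl, h⟩ trivial
    have hb0 : labelledOp S.diffGen ε i [] = 0 := funext fun a => dif_neg (lt_irrefl i)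
    refine Eq.trans (insertSum_nil (C := S.augPlus k) G) ?_
    refine hG _ _ ?_ rfl (Or.inr ⟨i, ?_⟩)
    · exact ⟨i, [], congrArg (fun f => [(f, i)]) hb.symm, h, rfl, h⟩
    · rw [hb0]
      exact List.mem_singleton.2 rfl
  | @cons Y Z p f ih =>
    have h0 := h
    obtain ⟨l, s, rfl, hl, h⟩ := h
    refine Eq.trans (insertSum_cons (C := S.augPlus k) G p f) ?_
    rw [insertLabelled]
    congr 1
    · refine sum_splits h0 fun W p₁ p₂ s₁ s₂ h₁ h₂ hsum => ?_
      have hinc := hs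
      rw [← hsum, incSteps_append] at hinc
      have hb : (S.augPlus k).b (HPath.forget p₂) = labelledOp S.diffGen ε (endLabel i s₁) s₂ :=
        hS.dualOp_eq H H h₂ hinc.2
      refine hG _ _ ⟨l, s₁, congrArg (fun f => (f, l) :: s₁) hb.symm, hl, h₁⟩ rfl ?_
      · by_cases h2 : s₂ = []
        · refine Or.inr ⟨l, ?_⟩
          subst h2
          have hb0 : labelledOp S.diffGen ε (endLabel i s₁) [] = 0 :=
            funext fun a => dif_neg (lt_irrefl _)
          rw [hb0]
          exact List.mem_cons_self
        · refine Or.inl ⟨?_, hinc.1⟩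
          have := hinc.2.lt h2
          rwa [← endLabel_append, hsum] at this
    · have hf := signOp_eq f.2.2
      refine (map_insertSum (C := S.augPlus k) (zsmulAddGroupHom (sgn (f.1 - 1)))
        (fun q => G (q.cons f.2.1)) p).trans ?_
      refine ih h hs.2 (fun q t hq ht hinc => ?_) fun t c g j t' => hψ ((S.signOp f.2.1, l) :: t) c g j t'
      have e := hG (q.cons f.2.1) ((f.2.1, l) :: t) (hq.cons _ hl) rfl (hinc.imp
        (fun h' => ⟨by rw [ht]; exact hs.1, h'⟩) fun ⟨j, hj⟩ => ⟨j, List.mem_cons_of_mem _ hj⟩)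
      have e' := hψ [] (sgn (f.1 - 1) : k) f.2.1 l t
      rw [List.nil_append, List.nil_append] at e'
      refine (congrArg (fun y : k => sgn (f.1 - 1) • y) e).trans ?_
      rw [hf, e', zsmul_eq_mul]

/-- The DGAs of the sequence are consistent in the sense needed for the augmentation category. -/
structure IsConsistent (S : DGASeq r) (cp : ∀ {m}, S.T m → Fin m) : Prop extends S.IsIndexed cp where
  isDGA : ∀ m, IsDGA (SFAlg.grade (T := S.T m) (S.deg (m := m))) (S.diff m)
  compatible : IsCompatible S cp S S.diffGen
  finite_deg : (Set.range (S.deg (m := 2))).Finite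

theorem IsConsistent.diff_diffGen (H : S.IsConsistent cp) {m : ℕ} (a : S.R m) :
    S.diff m (S.diffGen a) = 0 := by
  have := (H.isDGA m).d_d (SFAlg.gen a)
  rwa [diff, SFAlg.derivation_gen] at this

theorem IsConsistent.diffGen_mem (H : S.IsConsistent cp) {m : ℕ} (a : S.R m) :
    S.diffGen a ∈ SFAlg.grade S.deg (S.deg a - 1) := by
  have := (H.isDGA m).d_mem (SFAlg.gen_mem_grade S.deg a)
  rwa [diff, SFAlg.derivation_gen] at this

theorem IsConsistent.constTerm_diffGen (H : S.IsConsistent cp) (ε : Fin N → S.AugObj k)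
    (a : S.R N) : constTerm k _ (twist ε (S.diffGen a)) = 0 := by
  by_cases h : S.row a = S.col a
  · obtain ⟨b, hb⟩ := H.exists_of_row_eq_col h
    rw [← hb, H.compatible.constTerm_eq H.toIsIndexed H.toIsIndexed]
    have := (ε (S.row a)).2.2 (SFAlg.gen b)
    exact (congrArg (ε (S.row a)).1 (SFAlg.derivation_gen S.deg S.diffGen b)).symm.trans this
  · exact H.compatible.constTerm_eq_zero H.toIsIndexed ε h

theorem IsConsistent.insertSum_dualOp (H : S.IsConsistent cp) (H' : S'.IsIndexed cp')
    {G : ∀ {m}, S'.R m → SFAlg (S.R m) (S.T m)} (hG : IsCompatible S cp S' G)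
    {ε : Fin N → S.AugObj k} {i : Fin N} {X Y : (S.augPlus k).Obj} {p : (S.augPlus k).HPath X Y}
    {s : List ((S.Mixed → k) × Fin N)}
    (h : IsLabelling (O := S.AugObj k) (M := S.Mixed → k) ε i (HPath.forget p) s)
    (hs : IncSteps i s) (a : S'.Mixed) :
    insertSum (C := S.augPlus k) (fun q => dualOp G q a) p =
      opTo (fun {m} b => S.diff m (G b)) ε i (endLabel i s) s a := by
  refine Eq.trans (insertSum_eq H.toIsIndexed H.compatible h hs
    (ψ := fun t => opTo G ε i (endLabel i s) t a) (fun q t hq ht hinc =>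
      congrFun (hG.dualOp_eq_opTo H.toIsIndexed H' hq ht hinc) a)
    fun t c f j t' => congrFun (opTo_smul G ε i (endLabel i s) t' t c f j) a) ?_
  unfold opTo
  by_cases hlt : i < endLabel i s
  · simp only [dif_pos hlt]
    refine insertLabelled_pathPair (H.deg_eq_zero_of_diagR_ne_zero ε)
      (fun hx => (H.isDGA N).d_mem hx) H.evalAt_signOp (fun j t ht b => ?_) i hs _
    by_cases hne : t = []
    · subst hne
      change S.evalAt k j j _ b = _
      rw [pathPair_nil]
      refine Eq.trans ?_ (H.constTerm_diffGen ε b).symm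
      by_contra hc
      obtain ⟨hlt, -⟩ := H.exists_of_evalAt_ne_zero hc
      exact lt_irrefl j hlt
    · exact H.compatible.evalAt_labelledOp H.toIsIndexed H.toIsIndexed ε ht hne b
  · simp only [dif_neg hlt]
    have := insertLabelled_mul (B := labelledOp S.diffGen ε) (ν := S.signOp) (i := i) s (0 : k)
      fun _ => 0
    simpa using this

theorem listDeg_eq_of_listPair_ne_zero (H : S.IsIndexed cp) {ε : Fin N → S.AugObj k} {i : Fin N}
    {X Y : (S.augPlus k).Obj} {p : (S.augPlus k).HPath X Y} {s : List ((S.Mixed → k) × Fin N)}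
    (h : IsLabelling (O := S.AugObj k) (M := S.Mixed → k) ε i (HPath.forget p) s)
    {w : List (S.R N)} (hw : listPair (S.evalAt k) i s w ≠ 0) :
    listDeg S.deg w = HPath.deg p := by
  induction p generalizing s w with
  | nil =>
    obtain ⟨rfl, -⟩ := h
    cases w with
    | nil => rfl
    | cons a w => exact absurd rfl hw
  | @cons Y Z p f ih =>
    obtain ⟨l, s, rfl, -, h⟩ := h
    cases w with
    | nil => exact absurd rfl hw
    | cons a w =>
      rw [listPair] at hw
      obtain ⟨hlt, b, rfl, hb⟩ := H.exists_of_evalAt_ne_zero (left_ne_zero_of_mul hw)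
      have h1 := ih h (right_ne_zero_of_mul hw)
      have h2 := f.2.2 b hb
      change _ = HPath.deg p + (f.1 - 1)
      rw [← h1, ← eq_sub_of_add_eq h2, listDeg, List.map_cons, List.sum_cons, H.deg_embed, add_comm]
      rfl

theorem IsCompatible.dualOp_mem {G : ∀ {m}, S'.R m → SFAlg (S.R m) (S.T m)}
    (hG : IsCompatible S cp S' G) (H : S.IsIndexed cp) (H' : S'.IsIndexed cp') {e : ZMod (2 * r)}
    (hdeg : ∀ {m} (a : S'.R m), G a ∈ SFAlg.grade S.deg (S'.deg a + e)) {X Y : S.AugObj k}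
    (p : (S.augPlus k).HPath X Y) (a : S'.Mixed)
    (h : dualOp G (X := X) (Y := Y) (HPath.forget p) a ≠ 0) : S'.deg a.1 + e = HPath.deg p := by
  obtain ⟨s, h1, h2, -, -⟩ := exists_isLabelling_self (O := S.AugObj k) (M := S.Mixed → k)
    (HPath.forget p)
  rw [hG.dualOp_eq H H' h1 h2, labelledOp] at h
  split_ifs at h with hlt
  · have := hdeg (S'.embed hlt a)
    rw [H'.deg_embed] at this
    obtain ⟨w, hw, hne⟩ := pathPair_mem
      (shiftHom_mem (H.deg_eq_zero_of_diagR_ne_zero _) this) h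
    rw [← hw, ← listDeg_eq_of_listPair_ne_zero H h1 hne, listDeg, listDeg, List.map_reverse,
      List.sum_reverse]
  · exact absurd rfl h

theorem IsCompatible.dualOp_add {G : ∀ {m}, S'.R m → SFAlg (S.R m) (S.T m)}
    (hG : IsCompatible S cp S' G) (H : S.IsIndexed cp) (H' : S'.IsIndexed cp')
    {X Y Z W : S.AugObj k} (p : HomPath (fun _ _ : S.AugObj k => S.Mixed → k) X Y)
    (f g : S.Mixed → k) (q : HomPath (fun _ _ : S.AugObj k => S.Mixed → k) Z W) :
    dualOp G ((p.cons (f + g)).comp q) = dualOp G ((p.cons f).comp q) +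
      dualOp G ((p.cons g).comp q) := by
  obtain ⟨s, h1, h2, -, -⟩ := exists_isLabelling_self ((p.cons (f + g)).comp q)
  obtain ⟨s₁, s₂, rfl, h3, h4⟩ := h1.exists_of_comp
  obtain ⟨l, s₁, rfl, hl, h3⟩ := h3
  rw [incSteps_append] at h2
  have key : ∀ f' : S.Mixed → k, dualOp G ((p.cons f').comp q) =
      opTo G ((p.cons (f + g)).comp q).objs 0 (endLabel l s₂) (s₂ ++ (f', l) :: s₁) := fun f' =>
    hG.dualOp_eq_opTo H H' ((h3.cons f' hl).comp h4) (by rw [endLabel_append]; rfl)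
      (Or.inl ((incSteps_append _ _ _).2 h2))
  rw [key, key f, key g, opTo_add]

theorem IsCompatible.dualOp_smul {G : ∀ {m}, S'.R m → SFAlg (S.R m) (S.T m)}
    (hG : IsCompatible S cp S' G) (H : S.IsIndexed cp) (H' : S'.IsIndexed cp')
    {X Y Z W : S.AugObj k} (p : HomPath (fun _ _ : S.AugObj k => S.Mixed → k) X Y) (c : k)
    (f : S.Mixed → k) (q : HomPath (fun _ _ : S.AugObj k => S.Mixed → k) Z W) :
    dualOp G ((p.cons (c • f)).comp q) = c • dualOp G ((p.cons f).comp q) := by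
  obtain ⟨s, h1, h2, -, -⟩ := exists_isLabelling_self ((p.cons (c • f)).comp q)
  obtain ⟨s₁, s₂, rfl, h3, h4⟩ := h1.exists_of_comp
  obtain ⟨l, s₁, rfl, hl, h3⟩ := h3
  rw [incSteps_append] at h2
  have key : ∀ f' : S.Mixed → k, dualOp G ((p.cons f').comp q) =
      opTo G ((p.cons (c • f)).comp q).objs 0 (endLabel l s₂) (s₂ ++ (f', l) :: s₁) := fun f' =>
    hG.dualOp_eq_opTo H H' ((h3.cons f' hl).comp h4) (by rw [endLabel_append]; rfl)
      (Or.inl ((incSteps_append _ _ _).2 h2))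
  rw [key, key f, opTo_smul]

theorem dualOp_nil (G : ∀ {m}, S'.R m → SFAlg (S.R m) (S.T m)) (X : S.AugObj k) :
    dualOp G (.nil X) = 0 := funext fun _ => dif_neg (lt_irrefl _)

theorem isInternal_of_mem_iff (hfin : (Set.range (S.deg (m := 2))).Finite)
    (A : ZMod (2 * r) → Submodule k (S.Mixed → k))
    (hA : ∀ d f, f ∈ A d ↔ ∀ a, f a ≠ 0 → S.deg a.1 + 1 = d) : DirectSum.IsInternal A := by
  rw [DirectSum.isInternal_submodule_iff_iSupIndep_and_iSup_eq_top]
  constructor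
  · intro d
    rw [Submodule.disjoint_def]
    intro f hf hf'
    have hle : ⨆ j ≠ d, A j ≤
        ({ carrier := {f : S.Mixed → k | ∀ a, S.deg a.1 + 1 = d → f a = 0}
           add_mem' := fun {f g} hf hg a ha => by simp [hf a ha, hg a ha]
           zero_mem' := fun a _ => rfl
           smul_mem' := fun c f hf a ha => by simp [hf a ha] } : Submodule k (S.Mixed → k)) := by
      refine iSup₂_le fun j hj g hg a ha => ?_
      by_contra hne
      exact hj (((hA j g).1 hg a hne).symm.trans ha)
    funext a
    by_contra hne
    exact hne (hle hf' a ((hA d f).1 hf a hne))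
  · rw [eq_top_iff]
    intro f _
    have : f = ∑ d ∈ hfin.toFinset, fun a : S.Mixed => if S.deg a.1 = d then f a else (0 : k) := by
      funext a
      rw [Finset.sum_apply, Finset.sum_ite_eq, if_pos]
      rw [Set.Finite.mem_toFinset]
      exact ⟨_, rfl⟩
    rw [this]
    refine Submodule.sum_mem _ fun d _ => Submodule.mem_iSup_of_mem (d + 1) ((hA _ _).2 fun a ha => ?_)
    by_contra hne
    exact ha (if_neg fun h => hne (by rw [h]))

theorem IsConsistent.isAInfCat (H : S.IsConsistent cp) (k : Type u) [CommRing k] :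
    (S.augPlus k).IsAInfCat where
  internal _ _ := isInternal_of_mem_iff H.finite_deg _ fun _ _ => Iff.rfl
  b_nil := dualOp_nil S.diffGen
  b_add := H.compatible.dualOp_add H.toIsIndexed H.toIsIndexed
  b_smul := H.compatible.dualOp_smul H.toIsIndexed H.toIsIndexed
  b_mem p a ha := by
    have := H.compatible.dualOp_mem H.toIsIndexed H.toIsIndexed (e := -1)
      (fun a => by rw [← sub_eq_add_neg]; exact H.diffGen_mem a) p a ha
    rw [← this]
    ring
  b_b {X Y} p := by
    obtain ⟨s, h1, h2, -, -⟩ := exists_isLabelling_self (O := S.AugObj k) (M := S.Mixed → k)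
      (HPath.forget p)
    funext a
    have e := map_insertSum (C := S.augPlus k)
      (Pi.evalAddMonoidHom (fun _ : S.Mixed => k) a) (S.augPlus k).b p
    refine e.trans ((H.insertSum_dualOp H.toIsIndexed H.compatible h1 h2 a).trans ?_)
    rw [opTo]
    split_ifs
    · rw [H.diff_diffGen, map_zero, map_zero]; rfl
    · rfl

end DGASeq

end

noncomputable section

theorem AInfData.Fun.mk_congr {k : Type u} [CommRing k] {r : ℕ} {C D : AInfData k r}
    {obj : C.Obj → D.Obj} {φ ψ : ∀ {X Y}, HomPath C.Hom X Y → D.Hom (obj X) (obj Y)}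
    (h : ∀ {X Y} (p : HomPath C.Hom X Y), φ p = ψ p) :
    (⟨obj, φ⟩ : AInfData.Fun C D) = ⟨obj, ψ⟩ := by
  congr
  funext X Y p
  exact h p

namespace DGASeq

open Classical AInfData

variable {r : ℕ} {S S' S'' : DGASeq r} {k : Type u} [CommRing k] {cp : ∀ {m}, S.T m → Fin m}
  {cp' : ∀ {m}, S'.T m → Fin m} {cp'' : ∀ {m}, S''.T m → Fin m} {N : ℕ}
  {f : ∀ m, SFAlg (S'.R m) (S'.T m) →+* SFAlg (S.R m) (S.T m)}

/-- The homomorphisms `f m` induce an `A∞` functor. -/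
structure IsInducing (S : DGASeq r) (cp : ∀ {m}, S.T m → Fin m) (S' : DGASeq r)
    (f : ∀ m, SFAlg (S'.R m) (S'.T m) →+* SFAlg (S.R m) (S.T m)) : Prop where
  isDGAHom : ∀ m, IsDGAHom (SFAlg.grade S'.deg) (S'.diff m) (SFAlg.grade S.deg) (S.diff m) (f m)
  compatible : IsCompatible S cp S' fun {m} a => f m (SFAlg.gen a)
  exists_tgen : ∃ τ : ∀ m, S'.T m → S.T m,
    (∀ m t, f m (SFAlg.tgen t).1 = (SFAlg.tgen (τ m t)).1) ∧
    ∀ {m n} (σ : Fin m ↪o Fin n) (t : S'.T m), τ n (S'.mapT σ t) = S.mapT σ (τ m t)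

/-- The pullback of diagonal augmentations. -/
def pullbackObjs (hf : IsDGAHom (SFAlg.grade S'.deg) (S'.diff 1) (SFAlg.grade S.deg) (S.diff 1) (f 1))
    (ε : Fin N → S.AugObj k) (j : Fin N) : S'.AugObj k := Aug.pullback hf (ε j)

theorem IsInducing.twist_tgen (hf : IsInducing S cp S' f) (H : S.IsIndexed cp)
    (H' : S'.IsIndexed cp') (ε : Fin N → S.AugObj k) (t : S'.T N) :
    twist ε (f N (SFAlg.tgen t).1) =
      algebraMap k _ (diagT (pullbackObjs (hf.isDGAHom 1) ε) t).1 := by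
  obtain ⟨τ, h1, h2⟩ := hf.exists_tgen
  obtain ⟨b, hb⟩ := H'.exists_mapT t
  rw [h1]
  change shiftHom (diagR ε) (diagT ε) _ = _
  rw [shiftHom_tgen, ← hb, h2, H.diagT_mapT_oneEmb, H'.diagT_mapT_oneEmb]
  change algebraMap k _ ((ε (cp' t)).1 (SFAlg.tgen (τ 1 b)).1) =
    algebraMap k _ ((ε (cp' t)).1 (f 1 (SFAlg.tgen b).1))
  rw [h1]

theorem IsInducing.constTerm (hf : IsInducing S cp S' f) (H : S.IsIndexed cp)
    (H' : S'.IsIndexed cp') (ε : Fin N → S.AugObj k) (a : S'.R N) :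
    constTerm k _ (twist ε (f N (SFAlg.gen a))) = diagR (pullbackObjs (hf.isDGAHom 1) ε) a := by
  by_cases h : S'.row a = S'.col a
  · obtain ⟨b, hb⟩ := H'.exists_of_row_eq_col h
    rw [← hb, H'.diagR_mapR_oneEmb]
    exact hf.compatible.constTerm_eq H H' ε _ b
  · rw [H'.diagR_of_ne _ h]
    exact hf.compatible.constTerm_eq_zero H ε h

theorem IsInducing.sum_blocks (hf : IsInducing S cp S' f) (H : S.IsIndexed cp)
    (H' : S'.IsIndexed cp') {A : Type*} [AddCommMonoid A] {ε : Fin N → S.AugObj k} {i : Fin N}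
    {X Y Z : (S.augPlus k).Obj} {p : HomPath (S.augPlus k).Hom X Y}
    {q : HomPath (S.augPlus k).Hom Y Z} {s t : List ((S.Mixed → k) × Fin N)}
    (hp : IsLabelling (O := S.AugObj k) (M := S.Mixed → k) ε i p s)
    (hq : IsLabelling (O := S.AugObj k) (M := S.Mixed → k) ε (endLabel i s) q t)
    (hs : IncSteps i s) (ht : IncSteps (endLabel i s) t) (hne : t ≠ [])
    {φ : HomPath (S'.augPlus k).Hom (Aug.pullback (hf.isDGAHom 1) X)
      (Aug.pullback (hf.isDGAHom 1) Z) → A} {ψ : List ((S'.Mixed → k) × Fin N) → A}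
    (hφ : ∀ w z, IsLabelling (O := S'.AugObj k) (M := S'.Mixed → k)
      (pullbackObjs (hf.isDGAHom 1) ε) i w z → endLabel i z = endLabel i (t ++ s) →
      IncSteps i z → φ w = ψ z) :
    (((augPlusMap k f (hf.isDGAHom 1)).blocks p q).map φ).sum =
      ((labelledBlocks (labelledOp (fun {m} a => f m (SFAlg.gen a)) ε) i s t).map ψ).sum := by
  have hmap : ∀ {Y Z : (S.augPlus k).Obj} {q : HomPath (S.augPlus k).Hom Y Z}
      {t : List ((S.Mixed → k) × Fin N)} {j : Fin N},
      IsLabelling (O := S.AugObj k) (M := S.Mixed → k) ε j q t → IncSteps j t →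
      (augPlusMap k f (hf.isDGAHom 1)).map q = labelledOp (fun {m} a => f m (SFAlg.gen a)) ε j t :=
    fun h h' => hf.compatible.dualOp_eq H H' h h'
  induction p generalizing Z s t ψ with
  | nil =>
    obtain ⟨rfl, h⟩ := hp
    refine Eq.trans (List.sum_singleton (x := φ _)) (Eq.trans ?_ (List.sum_singleton (x := ψ _)).symm)
    refine hφ _ _ ⟨endLabel i t, [], congrArg (fun f => [(f, endLabel i t)]) (hmap hq ht).symm,
      congrArg _ hq.end_eq, rfl, congrArg _ h⟩ ?_ ⟨ht.lt hne, trivial⟩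
    rw [List.append_nil]
    rfl
  | @cons W Y p g ih =>
    obtain ⟨l, s, rfl, hl, hp⟩ := hp
    have hg : IsLabelling (O := S.AugObj k) (M := S.Mixed → k) ε (endLabel i s)
        ((HomPath.nil W).cons (Z := Y) g) [(g, l)] := ⟨l, [], rfl, hl, rfl, hp.end_eq⟩
    have hgi : IncSteps (endLabel i s) [((g : S.Mixed → k), l)] := ⟨hs.1, trivial⟩
    rw [labelledBlocks, List.map_append, List.sum_append, List.map_map]
    refine Eq.trans (congrArg List.sum List.map_append) (List.sum_append.trans (congrArg₂ (· + ·) ?_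
      (Eq.trans (congrArg List.sum List.map_map) ?_)))
    · refine ih hp (hg.comp hq) hs.2 ((incSteps_append _ _ _).2 ⟨hgi, ht⟩) (by simp) ?_
      intro w z hw hz hz'
      exact hφ w z hw (by rw [hz, List.append_assoc]; rfl) hz'
    · refine ih (q := (HomPath.nil W).cons g) hp hg hs.2 hgi (List.cons_ne_nil _ _) ?_
      intro w z hw hz hz'
      refine hφ _ _ ⟨endLabel l t, z, congrArg (fun f => (f, endLabel l t) :: z) (hmap hq ht).symm,
        congrArg _ hq.end_eq, hw⟩ (by rw [endLabel_append]; rfl) ⟨?_, hz'⟩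
      rw [hz]
      exact ht.lt hne

theorem IsInducing.sum_pieces_dualOp (hf : IsInducing S cp S' f) (H : S.IsConsistent cp)
    (H' : S'.IsIndexed cp') (H'' : S''.IsIndexed cp'')
    {G : ∀ {m}, S''.R m → SFAlg (S'.R m) (S'.T m)} (hG : IsCompatible S' cp' S'' G)
    {ε : Fin N → S.AugObj k} {i : Fin N} {X Y : (S.augPlus k).Obj}
    {p : HomPath (S.augPlus k).Hom X Y} {s : List ((S.Mixed → k) × Fin N)}
    (h : IsLabelling (O := S.AugObj k) (M := S.Mixed → k) ε i p s) (hs : IncSteps i s)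
    (a : S''.Mixed) :
    (((augPlusMap k f (hf.isDGAHom 1)).pieces p).map fun w => dualOp G w a).sum =
      opTo (fun {m} b => f m (G b)) ε i (endLabel i s) s a := by
  have key : (((augPlusMap k f (hf.isDGAHom 1)).pieces p).map fun w => dualOp G w a).sum =
      ((labelledPieces (labelledOp (fun {m} a => f m (SFAlg.gen a)) ε) i s).map fun z =>
        opTo G (pullbackObjs (hf.isDGAHom 1) ε) i (endLabel i s) z a).sum := by
    cases p with
    | nil =>
      obtain ⟨rfl, h⟩ := h
      refine Eq.trans (List.sum_singleton) (Eq.trans ?_ (List.sum_singleton).symm)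
      exact congrFun (hG.dualOp_eq_opTo (ε := pullbackObjs (hf.isDGAHom 1) ε) (i := i) H' H'' (s := [])
        (p := .nil (Aug.pullback (hf.isDGAHom 1) X)) ⟨rfl, congrArg _ h⟩ rfl
        (Or.inl trivial)) a
    | @cons Y Z p g =>
      obtain ⟨l, s, rfl, hl, h⟩ := h
      refine hf.sum_blocks H.toIsIndexed H' h (q := (HomPath.nil Y).cons g) (t := [(g, l)])
        ⟨l, [], rfl, hl, rfl, h.end_eq⟩ hs.2 ⟨hs.1, trivial⟩ (by simp) fun w z hw hz hz' => ?_
      exact congrFun (hG.dualOp_eq_opTo H' H'' hw hz (Or.inl hz')) a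
  rw [key]
  unfold opTo
  by_cases hlt : i < endLabel i s
  · simp only [dif_pos hlt]
    refine sum_labelledPieces_pathPair (c := diagR ε) (ct := diagT ε)
      (H.deg_eq_zero_of_diagR_ne_zero ε) (H'.deg_eq_zero_of_diagR_ne_zero _)
      (hf.isDGAHom N).graded (fun j t ht hne b => ?_) (fun j b => ?_)
      (hf.twist_tgen H.toIsIndexed H' ε) i hs _
    · exact hf.compatible.evalAt_labelledOp H.toIsIndexed H' ε ht hne b
    · rw [pathPair_nil]
      exact hf.constTerm H.toIsIndexed H' ε b
  · simp only [dif_neg hlt]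
    simp

theorem IsInducing.isAInfFunctor (hf : IsInducing S cp S' f) (H : S.IsConsistent cp)
    (H' : S'.IsConsistent cp') (k : Type u) [CommRing k] :
    (augPlusMap k f (hf.isDGAHom 1)).IsAInfFunctor where
  map_nil := dualOp_nil (fun {m} a => f m (SFAlg.gen a))
  map_add := hf.compatible.dualOp_add H.toIsIndexed H'.toIsIndexed
  map_smul := hf.compatible.dualOp_smul H.toIsIndexed H'.toIsIndexed
  map_mem p a ha := by
    have := hf.compatible.dualOp_mem H.toIsIndexed H'.toIsIndexed (e := 0)
      (fun a => by rw [add_zero]; exact (hf.isDGAHom _).graded (SFAlg.gen_mem_grade S'.deg a)) p a ha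
    rw [← this, add_zero]
  map_b {X Y} p := by
    obtain ⟨s, h1, h2, -, -⟩ := exists_isLabelling_self (O := S.AugObj k) (M := S.Mixed → k)
      (HPath.forget p)
    funext a
    refine (map_list_sum (Pi.evalAddMonoidHom (fun _ : S'.Mixed => k) a) _).trans ?_
    refine Eq.trans ?_ (map_insertSum (C := S.augPlus k)
      (Pi.evalAddMonoidHom (fun _ : S'.Mixed => k) a)
      (augPlusMap k f (hf.isDGAHom 1)).map p).symm
    refine Eq.trans (congrArg List.sum List.map_map) ?_
    refine Eq.trans (hf.sum_pieces_dualOp H H'.toIsIndexed H'.toIsIndexed H'.compatible h1 h2 a) ?_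
    refine Eq.trans ?_ (H.insertSum_dualOp H'.toIsIndexed hf.compatible h1 h2 a).symm
    unfold opTo
    split_ifs
    · refine congrArg (fun y => S.pairing 0 s (twist _ y)) (Eq.trans ?_ ((hf.isDGAHom _).comm _))
      exact congrArg (f _) (SFAlg.derivation_gen S'.deg S'.diffGen _).symm
    · rfl

theorem IsInducing.augPlusMap_comp (hf : IsInducing S cp S' f) (H : S.IsConsistent cp)
    (H' : S'.IsIndexed cp') (H'' : S''.IsIndexed cp'')
    {g : ∀ m, SFAlg (S''.R m) (S''.T m) →+* SFAlg (S'.R m) (S'.T m)} (hg : IsInducing S' cp' S'' g)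
    {h : ∀ m, SFAlg (S''.R m) (S''.T m) →+* SFAlg (S.R m) (S.T m)} (hh : IsInducing S cp S'' h)
    (hfg : ∀ m, (f m).comp (g m) = h m) (k : Type u) [CommRing k] :
    (augPlusMap k f (hf.isDGAHom 1)).comp (augPlusMap k g (hg.isDGAHom 1)) =
      augPlusMap k h (hh.isDGAHom 1) := by
  obtain rfl : (fun m => (f m).comp (g m)) = h := funext hfg
  refine AInfData.Fun.mk_congr
    (obj := (augPlusMap k (fun m => (f m).comp (g m)) (hh.isDGAHom 1)).obj) fun {X Y} p => ?_
  obtain ⟨s, h1, h2, -, -⟩ := exists_isLabelling_self (O := S.AugObj k) (M := S.Mixed → k) p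
  funext a
  refine (map_list_sum (Pi.evalAddMonoidHom (fun _ : S''.Mixed => k) a) _).trans ?_
  refine Eq.trans (congrArg List.sum List.map_map) ?_
  refine Eq.trans (hf.sum_pieces_dualOp H H' H'' hg.compatible h1 h2 a) ?_
  exact (congrFun (hh.compatible.dualOp_eq_opTo H.toIsIndexed H'' h1 rfl (Or.inl h2)) a).symm

theorem augPlusMap_eq_id {f : ∀ m, SFAlg (S.R m) (S.T m) →+* SFAlg (S.R m) (S.T m)}
    (hf : IsInducing S cp S f) (H : S.IsIndexed cp) (hid : ∀ m, f m = RingHom.id _) (k : Type u)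
    [CommRing k] : augPlusMap k f (hf.isDGAHom 1) = AInfData.Fun.id (S.augPlus k) := by
  obtain rfl : (fun m => RingHom.id _) = f := funext fun m => (hid m).symm
  refine AInfData.Fun.mk_congr (C := S.augPlus k) (D := S.augPlus k) (obj := fun X => X)
    fun {X Y} p => ?_
  have key : ∀ (q : HomPath (S.augPlus k).Hom X Y) (s : List ((S.Mixed → k) × Fin (q.length + 1)))
      (g : S.Mixed → k) (l : Fin (q.length + 1)),
      IsLabelling (O := S.AugObj k) (M := S.Mixed → k) q.objs 0 q ((g, l) :: s) →
      IncSteps 0 ((g, l) :: s) → dualOp (S := S) (fun {m} a => SFAlg.gen a) q =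
        if s = [] then g else 0 := by
    intro q s g l h1 h2
    funext a
    refine (congrFun (hf.compatible.dualOp_eq_opTo H H h1 rfl (Or.inl h2)) a).trans ?_
    have hlt : (0 : Fin (q.length + 1)) < l := h2.lt (by simp)
    refine (dif_pos hlt).trans ?_
    change pathPair _ _ _ _ (shiftHom (diagR _) (diagT _) (SFAlg.gen _)) = _
    rw [shiftHom_gen, map_add, pathPair_algebraMap, if_neg (by simp), add_zero,
      ← one_mul (MonoidAlgebra.of k _ _), pathPair_cons_mul_of (d := 0) _ _ _ _ one_mem_homogeneous,
      zero_mul, sgn_zero, pathPair_one]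
    by_cases hs : s = []
    · subst hs
      simp [endLabel, H.evalAt_embed hlt]
    · simp [hs]
  obtain ⟨s, h1, h2, -, -⟩ := exists_isLabelling_self (O := S.AugObj k) (M := S.Mixed → k) p
  cases p with
  | nil => exact dualOp_nil _ _
  | cons p g =>
    obtain ⟨l, s, rfl, hl, h3⟩ := id h1
    refine (key _ s g l h1 h2).trans ?_
    cases p with
    | nil =>
      obtain ⟨rfl, -⟩ := h3
      exact if_pos rfl
    | cons p g' =>
      obtain ⟨l', s', rfl, -⟩ := h3
      exact if_neg (by simp)

end DGASeq

end

noncomputable section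

namespace PreferredPlat

open Classical SFAlg

variable {r : ℕ} {Λ : Set (ℝ × ℝ × ℝ)} {P : PreferredPlat r Λ} {m n : ℕ}

/-! ## Restriction of disk sums to fewer copies -/

theorem Cross.map_injective (σ : Fin m ↪o Fin n) :
    Function.Injective (Cross.map σ : P.Cross m → P.Cross n) := by
  intro c c' h
  cases c <;> cases c' <;> simp only [Cross.map, Cross.dbl.injEq, Cross.left.injEq,
    Cross.right.injEq, EmbeddingLike.apply_eq_iff_eq, reduceCtorEq] at h <;> simp [h]

theorem Cross.precedes_map (σ : Fin m ↪o Fin n) {c c' : P.Cross m} :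
    Precedes (c.map σ) (c'.map σ) ↔ Precedes c c' := by
  cases c <;> cases c' <;> simp [Precedes, Cross.map]

theorem Cross.overStrand_map (σ : Fin m ↪o Fin n) (c : P.Cross m) :
    (c.map σ).overStrand = (c.overStrand.1, σ c.overStrand.2) := by
  cases c <;> rfl

theorem Cross.underStrand_map (σ : Fin m ↪o Fin n) (c : P.Cross m) :
    (c.map σ).underStrand = (c.underStrand.1, σ c.underStrand.2) := by
  cases c <;> rfl

theorem Cross.mem_range_map (σ : Fin m ↪o Fin n) {c : P.Cross n}
    (ho : c.overStrand.2 ∈ Set.range σ) (hu : c.underStrand.2 ∈ Set.range σ) :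
    c ∈ Set.range (Cross.map σ : P.Cross m → P.Cross n) := by
  obtain ⟨o, ho⟩ := ho
  obtain ⟨u, hu⟩ := hu
  cases c with
  | dbl c i j =>
    obtain rfl : σ o = i := ho
    obtain rfl : σ u = j := hu
    exact ⟨.dbl c o u, rfl⟩
  | left k i j h =>
    obtain rfl : σ o = i := ho
    obtain rfl : σ u = j := hu
    exact ⟨.left k o u (σ.lt_iff_lt.1 h), rfl⟩
  | right k i j h =>
    obtain rfl : σ o = j := ho
    obtain rfl : σ u = i := hu
    exact ⟨.right k u o (σ.lt_iff_lt.1 h), rfl⟩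

/-- The inclusion of strands. -/
def mapStrand (σ : Fin m ↪o Fin n) (i : P.Strand m) : P.Strand n := (i.1, σ i.2)

theorem mapStrand_injective (σ : Fin m ↪o Fin n) :
    Function.Injective (mapStrand σ : P.Strand m → P.Strand n) := fun i j h => by
  simp only [mapStrand, Prod.mk.injEq, EmbeddingLike.apply_eq_iff_eq] at h
  exact Prod.ext h.1 h.2

/-- The inclusion of base points. -/
def mapBase (σ : Fin m ↪o Fin n) (b : P.base × Fin m) : P.base × Fin n := (b.1, σ b.2)

theorem mapBase_injective (σ : Fin m ↪o Fin n) :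
    Function.Injective (mapBase σ : P.base × Fin m → P.base × Fin n) := fun i j h => by
  simp only [mapBase, Prod.mk.injEq, EmbeddingLike.apply_eq_iff_eq] at h
  exact Prod.ext h.1 h.2

/-- The inverse of the inclusion of events. -/
def eventInv (σ : Fin m ↪o Fin n) : P.Event n → Option (P.Event m)
  | .inl c => (Function.partialInv (Cross.map σ) c).map .inl
  | .inr b => (Function.partialInv (mapBase σ) b).map .inr

section

variable {A B : Type*} [Ring A] [Ring B] (φ : A →+* B) (σ : Fin m ↪o Fin n)
  {x : P.Cross n → A} {t : P.Base n → Aˣ} {x' : P.Cross m → B} {t' : P.Base m → Bˣ}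

/-- The ring homomorphism `φ` restricts from `n` to `m` copies. -/
structure IsRestriction (φ : A →+* B) (σ : Fin m ↪o Fin n) (x : P.Cross n → A) (t : P.Base n → Aˣ)
    (x' : P.Cross m → B) (t' : P.Base m → Bˣ) : Prop where
  cross_map : ∀ c, φ (x (c.map σ)) = x' c
  cross : ∀ c ∉ Set.range (Cross.map σ : P.Cross m → P.Cross n), φ (x c) = 0
  base : ∀ b i, φ (t (b, σ i)).1 = (t' (b, i)).1

variable {φ σ}

theorem IsRestriction.signedBase (H : IsRestriction φ σ x t x' t') (b : P.Base₀) (i : Fin m)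
    (q : Prop) : φ (signedBase t (b, σ i) q) = signedBase t' (b, i) q := by
  unfold PreferredPlat.signedBase
  split_ifs
  · exact H.base b i
  · exact map_unit_inv φ _ (H.base b i)

theorem IsRestriction.invisible (H : IsRestriction φ σ x t x' t') (k : Fin P.n) (i : Fin m) :
    φ (invisible t k (σ i)) = invisible t' k i := by
  unfold PreferredPlat.invisible
  split_ifs
  · exact H.signedBase _ _ _
  · exact map_one φ

theorem IsRestriction.cuspEnd (H : IsRestriction φ σ x t x' t') (p : P.Strand m × P.Strand m) :
    φ (cuspEnd t (p.map (mapStrand σ) (mapStrand σ))) = cuspEnd t' p := by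
  have : p.map (mapStrand σ) (mapStrand σ) =
      (((p.1.1.1, true), σ p.1.2), ((p.1.1.1, false), σ p.1.2)) ↔
      p = (((p.1.1.1, true), p.1.2), ((p.1.1.1, false), p.1.2)) := by
    have := ((mapStrand_injective σ).prodMap (mapStrand_injective (P := P) σ)).eq_iff
      (a := p) (b := (((p.1.1.1, true), p.1.2), ((p.1.1.1, false), p.1.2)))
    exact this
  unfold PreferredPlat.cuspEnd
  change φ (if p.map (mapStrand σ) (mapStrand σ) =
      (((p.1.1.1, true), σ p.1.2), ((p.1.1.1, false), σ p.1.2)) then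
    if h : p.1.1.1 ∈ P.baseL then PreferredPlat.signedBase t (.inr (.inl ⟨p.1.1.1, h⟩), σ p.1.2) _ else 1
    else 0) = _
  simp only [this]
  split_ifs
  · exact H.signedBase _ _ _
  · exact map_one φ
  · exact map_zero φ

theorem IsRestriction.baseUpper (H : IsRestriction φ σ x t x' t') (b : P.base × Fin m)
    (i : P.Strand m) : φ (baseUpper t (mapBase σ b) (mapStrand σ i)) = baseUpper t' b i := by
  unfold PreferredPlat.baseUpper
  have : mapStrand σ i = ((mapBase σ b).1.1.1, (mapBase σ b).2) ↔ i = (b.1.1.1, b.2) :=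
    (mapStrand_injective (P := P) σ).eq_iff (a := i) (b := (b.1.1.1, b.2))
  simp only [this]
  split_ifs
  · exact H.signedBase _ _ _
  · exact map_one φ

theorem IsRestriction.baseLower (H : IsRestriction φ σ x t x' t') (b : P.base × Fin m)
    (i : P.Strand m) : φ (baseLower t (mapBase σ b) (mapStrand σ i)) = baseLower t' b i := by
  unfold PreferredPlat.baseLower
  have : mapStrand σ i = ((mapBase σ b).1.1.1, (mapBase σ b).2) ↔ i = (b.1.1.1, b.2) :=
    (mapStrand_injective (P := P) σ).eq_iff (a := i) (b := (b.1.1.1, b.2))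
  simp only [this]
  split_ifs
  · exact H.signedBase _ _ _
  · exact map_one φ

theorem baseUpper_eq_one (t : P.Base n → Aˣ) {b : P.base × Fin n} (hb : b ∉ Set.range (mapBase σ))
    (i : P.Strand m) : baseUpper t b (mapStrand σ i) = 1 := by
  refine if_neg fun h => hb ⟨(b.1, i.2), Prod.ext rfl ?_⟩
  exact show σ i.2 = b.2 from congrArg Prod.snd h

theorem baseLower_eq_one (t : P.Base n → Aˣ) {b : P.base × Fin n} (hb : b ∉ Set.range (mapBase σ))
    (i : P.Strand m) : baseLower t b (mapStrand σ i) = 1 := by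
  refine if_neg fun h => hb ⟨(b.1, i.2), Prod.ext rfl ?_⟩
  exact show σ i.2 = b.2 from congrArg Prod.snd h

theorem partialInv_eq_none {α β : Type*} {f : α → β} {b : β} (h : b ∉ Set.range f) :
    Function.partialInv f b = none := dif_neg h

theorem IsRestriction.map_diskSum (H : IsRestriction φ σ x t x' t')
    {e : P.Strand n × P.Strand n → A} {e' : P.Strand m × P.Strand m → B}
    (he : ∀ p : P.Strand m × P.Strand m, φ (e (p.map (mapStrand σ) (mapStrand σ))) = e' p)
    (L : List (P.Event n)) (p : P.Strand m × P.Strand m) :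
    φ (diskSum x t e L (p.map (mapStrand σ) (mapStrand σ))) =
      diskSum x' t' e' (L.filterMap (eventInv σ)) p := by
  induction L generalizing p with
  | nil => rw [List.filterMap_nil, diskSum_nil, diskSum_nil, he]
  | cons ev L ih =>
    cases ev with
    | inr b =>
      by_cases hb : b ∈ Set.range (mapBase σ)
      · obtain ⟨b, rfl⟩ := hb
        rw [List.filterMap_cons_some (b := .inr b) (by
          rw [eventInv, Function.partialInv_left (mapBase_injective σ)]; rfl),
          diskSum_base, diskSum_base, map_mul, map_mul, ih]
        exact congrArg₂ _ (congrArg (· * _) (H.baseUpper b p.1)) (H.baseLower b p.2)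
      · rw [List.filterMap_cons_none (by rw [eventInv, partialInv_eq_none hb]; rfl), diskSum_base]
        rw [← ih p]
        change φ (PreferredPlat.baseUpper t b (mapStrand σ p.1) * _ *
          PreferredPlat.baseLower t b (mapStrand σ p.2)) = _
        rw [baseUpper_eq_one t hb, baseLower_eq_one t hb, one_mul, mul_one]
    | inl c =>
      by_cases hc : c ∈ Set.range (Cross.map σ : P.Cross m → P.Cross n)
      · obtain ⟨c, rfl⟩ := hc
        rw [List.filterMap_cons_some (b := .inl c) (by
          rw [eventInv, Function.partialInv_left (Cross.map_injective σ)]; rfl),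
          diskSum_cross, diskSum_cross]
        have ho : (c.map σ).overStrand = mapStrand σ c.overStrand := c.overStrand_map σ
        have hu : (c.map σ).underStrand = mapStrand σ c.underStrand := c.underStrand_map σ
        have h0 : p.map (mapStrand σ) (mapStrand σ) =
            (mapStrand σ c.underStrand, mapStrand σ c.overStrand) ↔
            p = (c.underStrand, c.overStrand) :=
          ((mapStrand_injective σ).prodMap (mapStrand_injective (P := P) σ)).eq_iff
            (a := p) (b := (c.underStrand, c.overStrand))
        have h1 : (p.map (mapStrand σ) (mapStrand (P := P) σ)).1 = mapStrand σ c.overStrand ↔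
            p.1 = c.overStrand := (mapStrand_injective σ).eq_iff
        have h2 : (p.map (mapStrand σ) (mapStrand (P := P) σ)).2 = mapStrand σ c.underStrand ↔
            p.2 = c.underStrand := (mapStrand_injective σ).eq_iff
        have hd : (c.map σ).deg = c.deg := by rw [Cross.deg, ho, hu]; rfl
        rw [ho, hu, hd]
        simp only [h0, h1, h2]
        have e1 := ih (c.underStrand, p.2)
        have e2 := ih (p.1, c.overStrand)
        rw [apply_ite φ, map_zero, map_add, map_add, apply_ite φ, apply_ite φ, map_zero, map_mul,
          map_mul, map_zsmul, H.cross_map, ih, ← e1, ← e2]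
        rfl
      · rw [List.filterMap_cons_none (by rw [eventInv, partialInv_eq_none hc]; rfl), diskSum_cross,
          if_neg, map_add, map_add, apply_ite φ, apply_ite φ, map_zero, map_mul, map_mul, map_zsmul,
          H.cross c hc, ih]
        · simp
        · intro h
          refine hc (Cross.mem_range_map σ ⟨p.2.2, ?_⟩ ⟨p.1.2, ?_⟩)
          · exact congrArg (fun q => q.2.2) h
          · exact congrArg (fun q => q.1.2) h

end

/-! ## The events of several copies -/

variable (P) in
/-- The crossings over `x`. -/
def crossesAt (m : ℕ) (x : ℝ) : List (P.Cross m) :=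
  (if x = P.xL then (List.finRange P.n).flatMap (P.leftList m) else []) ++
    ((Finset.univ.filter fun c : P.Dbl => c.1.2.2 = x).toList.flatMap (P.dblList m)) ++
    (if x = P.xR then (List.finRange P.n).flatMap (P.rightList m) else [])

variable (P) in
/-- The base points in the interior of strands over `x`. -/
def basesAt (m : ℕ) (x : ℝ) : List (P.base × Fin m) :=
  (Finset.univ.filter fun b : P.base × Fin m => b.1.1.2 = x).toList

theorem eventsAt_eq (x : ℝ) :
    P.eventsAt m x = (P.crossesAt m x).map Sum.inl ++ (P.basesAt m x).map Sum.inr := rfl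

theorem mem_basesAt {x : ℝ} {b : P.base × Fin m} : b ∈ P.basesAt m x ↔ b.1.1.2 = x := by
  simp [basesAt]

theorem mem_crossesAt {x : ℝ} {c : P.Cross m} : c ∈ P.crossesAt m x ↔ c.x = x := by
  rw [← show Event.x (.inl c) = c.x from rfl, ← mem_eventsAt, eventsAt_eq]
  simp

theorem nodup_crossesAt (x : ℝ) : (P.crossesAt m x).Nodup := by
  have := nodup_eventsAt (P := P) (m := m) x
  rw [eventsAt_eq, List.nodup_append] at this
  exact List.Nodup.of_map _ this.1

theorem filterMap_eq_of_precedes (σ : Fin m ↪o Fin n) {l : List (P.Cross n)} {l' : List (P.Cross m)}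
    (hl : l.Pairwise Precedes) (hl' : l'.Pairwise Precedes) (h : ∀ c, c.map σ ∈ l ↔ c ∈ l') :
    l.filterMap (Function.partialInv (Cross.map σ)) = l' := by
  have hσ := (Cross.map_injective (P := P) σ).isPartialInv
  have hp : (l.filterMap (Function.partialInv (Cross.map σ))).Pairwise Precedes := by
    refine hl.filterMap _ fun a a' haa' b hb b' hb' => ?_
    rw [← (hσ _ _).1 hb, ← (hσ _ _).1 hb', Cross.precedes_map] at haa'
    exact haa'
  refine List.Perm.eq_of_pairwise (fun a b _ _ h h' => absurd h' (h.asymm _ _)) hp hl' ?_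
  rw [List.perm_ext_iff_of_nodup (nodup_of_precedes hp) (nodup_of_precedes hl')]
  intro c
  rw [List.mem_filterMap, ← h]
  exact ⟨fun ⟨a, ha, hc⟩ => (hσ _ _).1 hc ▸ ha, fun hc => ⟨_, hc, (hσ _ _).2 rfl⟩⟩

theorem filterMap_flatMap_eq {α β γ : Type*} (f : β → Option γ) (g : α → List β) (l : List α) :
    (l.flatMap g).filterMap f = l.flatMap fun a => (g a).filterMap f := by
  induction l with
  | nil => rfl
  | cons a l ih => rw [List.flatMap_cons, List.filterMap_append, ih, List.flatMap_cons]

theorem filterMap_crossesAt (σ : Fin m ↪o Fin n) (x : ℝ) :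
    (P.crossesAt n x).filterMap (Function.partialInv (Cross.map σ)) = P.crossesAt m x := by
  unfold crossesAt
  rw [List.filterMap_append, List.filterMap_append]
  congr 1
  · congr 1
    · split_ifs
      · refine filterMap_eq_of_precedes σ pairwise_leftList pairwise_leftList fun c => ?_
        simp only [List.mem_flatMap, List.mem_finRange, true_and, mem_leftList]
        cases c <;> simp [Cross.map]
      · rfl
    · rw [filterMap_flatMap_eq]
      congr 1
      ext1 d
      refine filterMap_eq_of_precedes σ (pairwise_dblList d) (pairwise_dblList d) fun c => ?_
      simp only [mem_dblList]
      cases c <;> simp [Cross.map]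
  · split_ifs
    · refine filterMap_eq_of_precedes σ pairwise_rightList pairwise_rightList fun c => ?_
      simp only [List.mem_flatMap, List.mem_finRange, true_and, mem_rightList]
      cases c <;> simp [Cross.map]
    · rfl

theorem filterMap_map_inl (σ : Fin m ↪o Fin n) (l : List (P.Cross n)) :
    (l.map Sum.inl : List (P.Event n)).filterMap (eventInv σ) =
      (l.filterMap (Function.partialInv (Cross.map σ))).map Sum.inl := by
  rw [List.filterMap_map, List.map_filterMap]
  rfl

theorem filterMap_map_inr (σ : Fin m ↪o Fin n) (l : List (P.base × Fin n)) :
    (l.map Sum.inr : List (P.Event n)).filterMap (eventInv σ) =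
      (l.filterMap (Function.partialInv (mapBase σ))).map Sum.inr := by
  rw [List.filterMap_map, List.map_filterMap]
  rfl

theorem filterMap_basesAt (σ : Fin m ↪o Fin n) (x : ℝ) :
    ((P.basesAt n x).filterMap (Function.partialInv (mapBase σ))).Perm (P.basesAt m x) := by
  have hσ := (mapBase_injective (P := P) σ).isPartialInv
  refine (List.perm_ext_iff_of_nodup
    ((Finset.nodup_toList _).filterMap fun a a' b hb hb' =>
      ((hσ _ _).1 hb).symm.trans ((hσ _ _).1 hb')) (Finset.nodup_toList _)).2 fun b => ?_
  change _ ↔ b ∈ P.basesAt m x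
  rw [List.mem_filterMap, mem_basesAt]
  exact ⟨fun ⟨a, ha, hb⟩ => by
    rw [← (hσ _ _).1 hb] at ha
    exact (mem_basesAt (b := mapBase σ b)).1 ha, fun hb => ⟨mapBase σ b, mem_basesAt.2 hb, (hσ _ _).2 rfl⟩⟩

section

variable {A : Type*} [Ring A] {x : P.Cross m → A} {t : P.Base m → Aˣ}
  {e : P.Strand m × P.Strand m → A}

theorem eq_or_strand_ne {a : ℝ} {b b' : P.base × Fin m} (hb : b.1.1.2 = a) (hb' : b'.1.1.2 = a) :
    b = b' ∨ ((b.1.1.1, b.2) : P.Strand m) ≠ (b'.1.1.1, b'.2) := by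
  by_cases h : ((b.1.1.1, b.2) : P.Strand m) = (b'.1.1.1, b'.2)
  · rw [Prod.mk.injEq] at h
    exact Or.inl (Prod.ext (Subtype.ext (Prod.ext h.1 (hb.trans hb'.symm))) h.2)
  · exact Or.inr h

theorem diskSum_base_swap {a : ℝ} {b b' : P.base × Fin m} (hb : b.1.1.2 = a) (hb' : b'.1.1.2 = a)
    (L : List (P.Event m)) (p : P.Strand m × P.Strand m) :
    diskSum x t e (.inr b :: .inr b' :: L) p = diskSum x t e (.inr b' :: .inr b :: L) p := by
  rcases eq_or_strand_ne hb hb' with rfl | h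
  · rfl
  have hU : baseUpper t b p.1 * baseUpper t b' p.1 = baseUpper t b' p.1 * baseUpper t b p.1 := by
    unfold baseUpper
    split_ifs with h1 h2
    · exact absurd (h1.symm.trans h2) h
    all_goals simp
  have hL : baseLower t b p.2 * baseLower t b' p.2 = baseLower t b' p.2 * baseLower t b p.2 := by
    unfold baseLower
    split_ifs with h1 h2
    · exact absurd (h1.symm.trans h2) h
    all_goals simp
  simp only [diskSum_base]
  calc _ = (baseUpper t b p.1 * baseUpper t b' p.1) * diskSum x t e L p *
        (baseLower t b' p.2 * baseLower t b p.2) := by noncomm_ring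
    _ = _ := by rw [hU, ← hL]; noncomm_ring

theorem diskSum_perm {a : ℝ} {l l' : List (P.base × Fin m)} (h : l.Perm l')
    (hl : ∀ b ∈ l, b.1.1.2 = a) (L : List (P.Event m)) (p : P.Strand m × P.Strand m) :
    diskSum x t e (l.map .inr ++ L) p = diskSum x t e (l'.map .inr ++ L) p := by
  induction h generalizing p with
  | nil => rfl
  | cons b h ih =>
    rw [List.map_cons, List.cons_append, diskSum_base, List.map_cons, List.cons_append,
      diskSum_base, ih fun b hb => hl b (List.mem_cons_of_mem _ hb)]
  | swap b b' l => exact diskSum_base_swap (hl _ (by simp)) (hl _ (by simp)) _ p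
  | trans h h' ih ih' => rw [ih hl, ih' fun b hb => hl b (h.mem_iff.2 hb)]

theorem diskSum_filterMap_eventsAt (σ : Fin m ↪o Fin n) (y : ℝ) (L : List (P.Event m))
    (p : P.Strand m × P.Strand m) :
    diskSum x t e ((P.eventsAt n y).reverse.filterMap (eventInv σ) ++ L) p =
      diskSum x t e ((P.eventsAt m y).reverse ++ L) p := by
  rw [List.filterMap_reverse, eventsAt_eq, eventsAt_eq, List.filterMap_append, filterMap_map_inl,
    filterMap_map_inr, filterMap_crossesAt, List.reverse_append, List.reverse_append,
    List.append_assoc, List.append_assoc, ← List.map_reverse, ← List.map_reverse,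
    ← List.map_reverse]
  have hp := filterMap_basesAt (P := P) σ y
  exact diskSum_perm (x := x) (t := t) (e := e) (a := y)
    ((List.reverse_perm _).trans (hp.trans (List.reverse_perm _).symm))
    (fun b hb => mem_basesAt.1 (hp.mem_iff.1 (List.mem_reverse.1 hb))) _ p

theorem diskSum_filterMap_eventList (σ : Fin m ↪o Fin n) (S : Set ℝ)
    (p : P.Strand m × P.Strand m) :
    diskSum x t e ((P.eventList n S).filterMap (eventInv σ)) p =
      diskSum x t e (P.eventList m S) p := by
  unfold eventList
  generalize (P.positions.filter fun y => y ∈ S).sort (· ≥ ·) = l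
  induction l generalizing p with
  | nil => rfl
  | cons y l ih =>
    rw [List.flatMap_cons, List.filterMap_append, diskSum_filterMap_eventsAt, diskSum_append,
      List.flatMap_cons, diskSum_append]
    congr 1
    ext q
    exact ih q

theorem sweep_eq_eventsAt_append (m : ℕ) {U : Set ℝ} {y : ℝ} (hU : y ∈ U) :
    P.sweep m U y = (P.eventsAt m y).reverse ++ P.eventList m {z | z < y ∧ Set.Icc z y ⊆ U} := by
  rw [sweep_eq, ← eventList_singleton]
  refine eventList_eq_append (fun z _ => ?_) fun z hz w hw => ?_
  · simp only [Set.mem_ofPred_eq, Set.mem_singleton_iff]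
    constructor
    · rintro ⟨h1, h2⟩
      rcases h1.lt_or_eq with h | h
      · exact Or.inl ⟨h, h2⟩
      · exact Or.inr h
    · rintro (h | rfl)
      · exact ⟨h.1.le, h.2⟩
      · exact ⟨le_rfl, by rwa [Set.Icc_self, Set.singleton_subset_iff]⟩
  · rw [Set.mem_singleton_iff.1 hw]
    exact hz.1

theorem exists_after_sweep (σ : Fin m ↪o Fin n) {U : Set ℝ} {c : P.Cross m} (hU : c.x ∈ U) :
    ∃ (L : List (P.Event n)) (S : Set ℝ),
      P.after (c.map σ) (P.sweep n U (c.map σ).x) = L ++ P.eventList n S ∧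
      P.after c (P.sweep m U c.x) = L.filterMap (eventInv σ) ++ P.eventList m S := by
  obtain ⟨A, B, hAB⟩ := List.append_of_mem
    (List.mem_reverse.2 (mem_crossesAt.2 (rfl : c.x = c.x)))
  have h : (P.crossesAt n c.x).reverse.filterMap (Function.partialInv (Cross.map σ)) =
      A ++ c :: B := by rw [List.filterMap_reverse, filterMap_crossesAt, hAB]
  obtain ⟨A', R', hn, hA', hR'⟩ := List.filterMap_eq_append_iff.1 h
  obtain ⟨N, c', B', rfl, hN, hc', hB'⟩ := List.filterMap_eq_cons_iff.1 hR'
  obtain rfl := ((Cross.map_injective (P := P) σ).isPartialInv _ _).1 hc'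
  have hnd : (A ++ c :: B).Nodup := hAB ▸ List.nodup_reverse.2 (nodup_crossesAt _)
  have hnd' : (A' ++ (N ++ c.map σ :: B')).Nodup := hn ▸ List.nodup_reverse.2 (nodup_crossesAt _)
  have key : ∀ {k : ℕ} {d : P.Cross k} {A B : List (P.Cross k)}, d.x = c.x →
      (P.crossesAt k c.x).reverse = A ++ d :: B → d ∉ A →
      P.after d (P.sweep k U d.x) =
        B.map .inl ++ P.eventList k {z | z < c.x ∧ Set.Icc z c.x ⊆ U} := by
    intro k d A B hd h hA
    rw [hd, sweep_eq_eventsAt_append k hU, eventsAt_eq, List.reverse_append,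
      ← List.map_reverse, ← List.map_reverse, h, List.map_append, List.map_cons]
    rw [← List.append_assoc, List.append_assoc, List.cons_append, after_append_cons]
    simpa using hA
  refine ⟨B'.map .inl, {z | z < c.x ∧ Set.Icc z c.x ⊆ U}, ?_, ?_⟩
  · refine key (A := A' ++ N) (c.map_x σ) (by rw [hn, List.append_assoc]) fun hmem => ?_
    rw [← List.append_assoc, List.nodup_append] at hnd'
    exact hnd'.2.2 _ hmem _ (List.mem_cons_self) rfl
  · rw [filterMap_map_inl, hB']
    refine key rfl hAB fun hmem => ?_
    rw [List.nodup_append] at hnd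
    exact hnd.2.2 _ hmem _ (List.mem_cons_self) rfl

end

section

variable {A B : Type*} [Ring A] [Ring B] {φ : A →+* B} {σ : Fin m ↪o Fin n}
  {x : P.Cross n → A} {t : P.Base n → Aˣ} {x' : P.Cross m → B} {t' : P.Base m → Bˣ}
  {e : P.Strand n × P.Strand n → A} {e' : P.Strand m × P.Strand m → B}

theorem IsRestriction.map_diskSum_sweep (H : IsRestriction φ σ x t x' t')
    (he : ∀ p : P.Strand m × P.Strand m, φ (e (p.map (mapStrand σ) (mapStrand σ))) = e' p)
    (U : Set ℝ) (y : ℝ) (p : P.Strand m × P.Strand m) :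
    φ (diskSum x t e (P.sweep n U y) (p.map (mapStrand σ) (mapStrand σ))) =
      diskSum x' t' e' (P.sweep m U y) p := by
  rw [H.map_diskSum he, sweep_eq, sweep_eq, diskSum_filterMap_eventList]

theorem IsRestriction.map_diskSum_after (H : IsRestriction φ σ x t x' t')
    (he : ∀ p : P.Strand m × P.Strand m, φ (e (p.map (mapStrand σ) (mapStrand σ))) = e' p)
    {U : Set ℝ} {c : P.Cross m} (hU : c.x ∈ U) :
    φ (diskSum x t e (P.after (c.map σ) (P.sweep n U (c.map σ).x))
        ((c.map σ).overStrand, (c.map σ).underStrand)) =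
      diskSum x' t' e' (P.after c (P.sweep m U c.x)) (c.overStrand, c.underStrand) := by
  obtain ⟨L, S, h1, h2⟩ := exists_after_sweep σ hU
  rw [h1, h2, c.overStrand_map, c.underStrand_map, diskSum_append, diskSum_append]
  exact H.map_diskSum (fun p => by rw [H.map_diskSum he, diskSum_filterMap_eventList]) L
    (c.overStrand, c.underStrand)

end

end PreferredPlat

end

noncomputable section

namespace PreferredPlat

open Classical SFAlg DGASeq

variable {r : ℕ} {Λ : Set (ℝ × ℝ × ℝ)} {P : PreferredPlat r Λ} {m n : ℕ}

/-! ## Disk sums and the link grading -/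

theorem isLink_sgn_smul {S : DGASeq r} {cp : ∀ {m}, S.T m → Fin m} {i j : Fin m}
    {y : SFAlg (S.R m) (S.T m)} (h : IsLink S cp i j y) (d : ZMod (2 * r)) :
    IsLink S cp i j (sgn d • y) := by
  unfold sgn
  split_ifs
  · rwa [one_smul]
  · rw [neg_one_smul]
    exact h.neg

theorem isLink_sum {S : DGASeq r} {cp : ∀ {m}, S.T m → Fin m} {i j : Fin m} {ι : Type*}
    (s : Finset ι) {y : ι → SFAlg (S.R m) (S.T m)} (h : ∀ l ∈ s, IsLink S cp i j (y l)) :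
    IsLink S cp i j (∑ l ∈ s, y l) :=
  Finset.sum_induction _ _ (fun _ _ => IsLink.add) (IsLink.zero i j) h

section

variable {S : DGASeq r} {cp : ∀ {m}, S.T m → Fin m} {x : P.Cross m → SFAlg (S.R m) (S.T m)}
  {t : P.Base m → (SFAlg (S.R m) (S.T m))ˣ} {e : P.Strand m × P.Strand m → SFAlg (S.R m) (S.T m)}

theorem isLink_signedBase
    (ht : ∀ b, IsLink S cp b.2 b.2 (t b).1 ∧ IsLink S cp b.2 b.2 (t b)⁻¹.1) (b : P.Base m)
    (q : Prop) : IsLink S cp b.2 b.2 (signedBase t b q) := by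
  unfold signedBase
  split_ifs
  exacts [(ht b).1, (ht b).2]

theorem isLink_cuspEnd
    (ht : ∀ b, IsLink S cp b.2 b.2 (t b).1 ∧ IsLink S cp b.2 b.2 (t b)⁻¹.1)
    (p : P.Strand m × P.Strand m) : IsLink S cp p.1.2 p.2.2 (cuspEnd t p) := by
  unfold cuspEnd
  dsimp only
  split_ifs with h h'
  · rw [show p.2.2 = p.1.2 from congrArg (fun q => q.2.2) h]
    exact isLink_signedBase ht (.inr (.inl ⟨p.1.1.1, h'⟩), p.1.2) _
  · rw [show p.2.2 = p.1.2 from congrArg (fun q => q.2.2) h]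
    exact .one _
  · exact .zero _ _

theorem isLink_invisible
    (ht : ∀ b, IsLink S cp b.2 b.2 (t b).1 ∧ IsLink S cp b.2 b.2 (t b)⁻¹.1)
    (k : Fin P.n) (i : Fin m) : IsLink S cp i i (invisible t k i) := by
  unfold invisible
  split_ifs with h
  · exact isLink_signedBase ht (.inr (.inr ⟨k, h⟩), i) _
  · exact .one _

theorem isLink_diskSum (hx : ∀ c, IsLink S cp c.overStrand.2 c.underStrand.2 (x c))
    (ht : ∀ b, IsLink S cp b.2 b.2 (t b).1 ∧ IsLink S cp b.2 b.2 (t b)⁻¹.1)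
    (he : ∀ q, IsLink S cp q.1.2 q.2.2 (e q)) (L : List (P.Event m)) (p : P.Strand m × P.Strand m) :
    IsLink S cp p.1.2 p.2.2 (diskSum x t e L p) := by
  induction L generalizing p with
  | nil => rw [diskSum_nil]; exact he p
  | cons ev L ih =>
    cases ev with
    | inr b =>
      rw [diskSum_base]
      refine (IsLink.mul ?_ (ih p)).mul ?_
      · unfold baseUpper
        split_ifs with h
        · rw [h]; exact isLink_signedBase ht (.inl b.1, b.2) _
        · exact .one _
      · unfold baseLower
        split_ifs with h
        · rw [h]; exact isLink_signedBase ht (.inl b.1, b.2) _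
        · exact .one _
    | inl c =>
      rw [diskSum_cross]
      refine if h0 : _ then by rw [if_pos h0]; exact .zero _ _ else ?_
      rw [if_neg h0]
      refine ((ih p).add ?_).add ?_
      · split_ifs with h
        · rw [h]; exact (isLink_sgn_smul (hx c) _).mul (ih (c.underStrand, p.2))
        · exact .zero _ _
      · split_ifs with h
        · rw [h]; exact (ih (p.1, c.overStrand)).mul (hx c)
        · exact .zero _ _

end

/-! ## The sequences of the copies -/

theorem Gen.mem_range_map {U : Opens ℝ} (σ : Fin m ↪o Fin n) (a : P.Gen n U)
    (hrow : (P.seq U).row a ∈ Set.range σ) (hcol : (P.seq U).col a ∈ Set.range σ) :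
    a ∈ Set.range (Gen.map σ : P.Gen m U → P.Gen n U) := by
  cases a with
  | cross c h =>
    obtain ⟨c, rfl⟩ := Cross.mem_range_map σ hrow hcol
    exact ⟨.cross c (by rwa [Cross.map_x] at h), rfl⟩
  | cusp k i h =>
    obtain ⟨i, rfl⟩ := hrow
    exact ⟨.cusp k i h, rfl⟩
  | pair a i j ha h =>
    obtain ⟨i, i'⟩ := i
    obtain ⟨j, j'⟩ := j
    obtain ⟨o, rfl⟩ : i' ∈ Set.range σ := hrow
    obtain ⟨u, rfl⟩ : j' ∈ Set.range σ := hcol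
    exact ⟨.pair a (i, o) (j, u) ha (h.imp id fun h => ⟨h.1, σ.lt_iff_lt.1 h.2⟩), rfl⟩

theorem Cross.map_refl (c : P.Cross m) : c.map (RelEmbedding.refl _) = c := by cases c <;> rfl

theorem Cross.map_map {l : ℕ} (σ : Fin l ↪o Fin m) (τ : Fin m ↪o Fin n) (c : P.Cross l) :
    (c.map σ).map τ = c.map (σ.trans τ) := by cases c <;> rfl

theorem Cross.deg_map (σ : Fin m ↪o Fin n) (c : P.Cross m) : (c.map σ).deg = c.deg := by
  rw [Cross.deg, c.overStrand_map, c.underStrand_map]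
  rfl

variable (P) in
theorem isIndexed_seq (U : Opens ℝ) : (P.seq U).IsIndexed fun {_} b => b.1.2 where
  mapR_refl a := by
    cases a with
    | cross c h => simp only [seq, Gen.map, Cross.map_refl]
    | cusp k i h => rfl
    | pair a i j ha h => rfl
  mapR_trans σ τ a := by
    cases a with
    | cross c h => simp only [seq, Gen.map, Cross.map_map]
    | cusp k i h => rfl
    | pair a i j ha h => rfl
  mapR_injective σ a b h := by
    cases a <;> cases b <;> simp only [seq, Gen.map, Gen.cross.injEq, Gen.cusp.injEq, Gen.pair.injEq,
      (Cross.map_injective σ).eq_iff,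
      EmbeddingLike.apply_eq_iff_eq, reduceCtorEq] at h ⊢
    · exact h
    · exact h
    · exact ⟨h.1, mapStrand_injective σ h.2.1, mapStrand_injective σ h.2.2⟩
  row_mapR σ a := by
    cases a with
    | cross c h => exact congrArg Prod.snd (c.overStrand_map σ)
    | cusp k i h => rfl
    | pair a i j ha h => rfl
  col_mapR σ a := by
    cases a with
    | cross c h => exact congrArg Prod.snd (c.underStrand_map σ)
    | cusp k i h => rfl
    | pair a i j ha h => rfl
  deg_mapR σ a := by
    cases a with
    | cross c h => exact c.deg_map σ
    | cusp k i h => rfl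
    | pair a i j ha h => rfl
  mem_range_mapR σ a := Gen.mem_range_map σ a
  mapT_refl _ := rfl
  mapT_trans _ _ _ := rfl
  mapT_injective σ b b' h := by
    have h' := congrArg Subtype.val h
    simp only [seq, Prod.mk.injEq, EmbeddingLike.apply_eq_iff_eq] at h'
    exact Subtype.ext (Prod.ext h'.1 h'.2)
  cp_mapT _ _ := rfl
  mem_range_mapT σ b := by
    obtain ⟨⟨b, i⟩, hb⟩ := b
    rintro ⟨j, rfl⟩
    exact ⟨⟨(b, j), hb⟩, rfl⟩

variable (P) in
theorem isIndexed_ceSeq : P.ceSeq.IsIndexed fun {_} b => b.2 where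
  mapR_refl a := by
    rcases a with c | c
    · exact congrArg Sum.inl c.map_refl
    · rfl
  mapR_trans σ τ a := by
    rcases a with c | c
    · exact congrArg Sum.inl (c.map_map σ τ)
    · rfl
  mapR_injective σ a b h := by
    rcases a with a | a <;> rcases b with b | b <;> simp only [ceSeq, Sum.inl.injEq, Sum.inr.injEq,
      (Cross.map_injective σ).eq_iff, Prod.mk.injEq, EmbeddingLike.apply_eq_iff_eq,
      reduceCtorEq] at h ⊢
    · exact h
    · exact Prod.ext h.1 h.2
  row_mapR σ a := by
    rcases a with c | c
    · exact congrArg Prod.snd (c.overStrand_map σ)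
    · rfl
  col_mapR σ a := by
    rcases a with c | c
    · exact congrArg Prod.snd (c.underStrand_map σ)
    · rfl
  deg_mapR σ a := by
    rcases a with c | c
    · exact c.deg_map σ
    · rfl
  mem_range_mapR σ a := by
    rcases a with c | ⟨k, i⟩
    · intro h h'
      obtain ⟨c, rfl⟩ := Cross.mem_range_map σ h h'
      exact ⟨.inl c, rfl⟩
    · rintro ⟨j, rfl⟩ -
      exact ⟨.inr (k, j), rfl⟩
  mapT_refl _ := rfl
  mapT_trans _ _ _ := rfl
  mapT_injective σ b b' h := by
    simp only [ceSeq, Prod.mk.injEq, EmbeddingLike.apply_eq_iff_eq] at h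
    exact Prod.ext h.1 h.2
  cp_mapT _ _ := rfl
  mem_range_mapT σ b := by
    obtain ⟨b, i⟩ := b
    rintro ⟨j, rfl⟩
    exact ⟨(b, j), rfl⟩

theorem _root_.DGASeq.IsInducing.id {S : DGASeq r} {cp : ∀ {m}, S.T m → Fin m}
    (H : S.IsIndexed cp) : IsInducing S cp S fun _ => RingHom.id _ where
  isDGAHom _ := ⟨fun _ _ h => h, fun _ => rfl⟩
  compatible := ⟨fun a => .gen a, fun σ a => H.restrict_gen σ a⟩
  exists_tgen := ⟨fun _ b => b, fun _ _ => rfl, fun _ _ => rfl⟩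

theorem restrict_gen_eq_zero {S : DGASeq r} {σ : Fin m ↪o Fin n} {a : S.R n}
    (h : a ∉ Set.range (S.mapR σ)) : S.restrict σ (gen a) = 0 := by
  rw [DGASeq.restrict, lift_gen, Function.extend_apply' _ _ _ h, Pi.zero_apply]

/-! ### The bordered front -/

section

variable {U : Opens ℝ}

theorem isLink_crossElt (c : P.Cross m) :
    IsLink (P.seq U) (fun {_} b => b.1.2) c.overStrand.2 c.underStrand.2 (P.crossElt m U c) := by
  unfold crossElt
  split_ifs with h
  · exact IsLink.gen (S := P.seq U) (cp := fun {_} b => b.1.2) (Gen.cross c h)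
  · exact .zero _ _

theorem isLink_baseElt (b : P.Base m) :
    IsLink (P.seq U) (fun {_} b => b.1.2) b.2 b.2 (P.baseElt m U b).1 ∧
      IsLink (P.seq U) (fun {_} b => b.1.2) b.2 b.2 (P.baseElt m U b)⁻¹.1 := by
  unfold baseElt
  split_ifs with h
  · exact ⟨IsLink.tgen (S := P.seq U) (cp := fun {_} b => b.1.2) ⟨b, h⟩,
      IsLink.tinv (S := P.seq U) (cp := fun {_} b => b.1.2) ⟨b, h⟩⟩
  · rw [inv_one]
    exact ⟨.one _, .one _⟩

theorem isLink_endElt (x : ℝ) (p : P.Strand m × P.Strand m) :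
    IsLink (P.seq U) (fun {_} b => b.1.2) p.1.2 p.2.2 (P.endElt m U x p) := by
  unfold endElt
  split_ifs with h
  · exact isLink_cuspEnd isLink_baseElt p
  · unfold pairElt
    split_ifs with h
    · exact IsLink.gen (S := P.seq U) (cp := fun {_} b => b.1.2) (Gen.pair _ p.1 p.2 h.1 h.2)
    · exact .zero _ _

theorem isLink_diskSumOn (x : ℝ) (L : List (P.Event m)) (p : P.Strand m × P.Strand m) :
    IsLink (P.seq U) (fun {_} b => b.1.2) p.1.2 p.2.2 (P.diskSumOn m U x L p) :=
  isLink_diskSum isLink_crossElt isLink_baseElt (isLink_endElt x) L p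

variable (P) in
theorem isRestriction_seq (U : Opens ℝ) (σ : Fin m ↪o Fin n) :
    IsRestriction (P := P) ((P.seq U).restrict σ) σ (P.crossElt n U) (P.baseElt n U)
      (P.crossElt m U) (P.baseElt m U) where
  cross_map c := by
    unfold crossElt
    by_cases h : c.x ∈ U
    · rw [dif_pos h, dif_pos (by rwa [Cross.map_x])]
      exact (P.isIndexed_seq U).restrict_gen σ (Gen.cross c h)
    · rw [dif_neg h, dif_neg (by rwa [Cross.map_x])]
      exact map_zero _
  cross c hc := by
    unfold crossElt
    split_ifs with h
    · refine restrict_gen_eq_zero (S := P.seq U) ?_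
      rintro ⟨a, ha⟩
      cases a with
      | cross d hd => exact hc ⟨d, (Gen.cross.inj ha)⟩
      | cusp k i hk => exact nomatch (show Gen.cusp k (σ i) hk = Gen.cross c h from ha)
      | pair a i j hp hij =>
        exact nomatch (show Gen.pair a (i.1, σ i.2) (j.1, σ j.2) hp (hij.map σ) = Gen.cross c h from ha)
    · exact map_zero _
  base b i := by
    unfold baseElt
    by_cases h : Base.x (P := P) (b, i) ∈ U
    · rw [dif_pos h, dif_pos (show Base.x (P := P) (b, σ i) ∈ U from h)]
      exact (P.isIndexed_seq U).restrict_tgen σ (⟨(b, i), h⟩ : P.BaseOn m U)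
    · rw [dif_neg h, dif_neg (show Base.x (P := P) (b, σ i) ∉ U from h)]
      exact map_one _

theorem Above.of_map {σ : Fin m ↪o Fin n} {a : ℝ} {i j : P.Strand m}
    (h : P.Above a (mapStrand σ i) (mapStrand σ j)) : P.Above a i j :=
  h.imp id fun h => ⟨h.1, σ.lt_iff_lt.1 h.2⟩

theorem restrict_endElt (σ : Fin m ↪o Fin n) (x : ℝ) (p : P.Strand m × P.Strand m) :
    (P.seq U).restrict σ (P.endElt n U x (p.map (mapStrand σ) (mapStrand σ))) =
      P.endElt m U x p := by
  unfold endElt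
  split_ifs with h
  · exact (P.isRestriction_seq U σ).cuspEnd p
  · unfold pairElt
    by_cases h : P.IsLeftEdge U (sSup {y | y ≤ x ∧ y ∉ U}) ∧
        P.Above (sSup {y | y ≤ x ∧ y ∉ U}) p.1 p.2
    · rw [dif_pos h, dif_pos ⟨h.1, h.2.map σ⟩]
      exact (P.isIndexed_seq U).restrict_gen σ (Gen.pair _ p.1 p.2 h.1 h.2)
    · rw [dif_neg h, dif_neg fun h' => h ⟨h'.1, h'.2.of_map⟩]
      exact map_zero _

theorem restrict_diskSumOn_sweep (σ : Fin m ↪o Fin n) (x : ℝ) (p : P.Strand m × P.Strand m) :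
    (P.seq U).restrict σ (P.diskSumOn n U x (P.sweep n U x) (p.map (mapStrand σ) (mapStrand σ))) =
      P.diskSumOn m U x (P.sweep m U x) p :=
  (P.isRestriction_seq U σ).map_diskSum_sweep (restrict_endElt σ x) U x p

theorem restrict_diffGen (σ : Fin m ↪o Fin n) (a : P.Gen m U) :
    (P.seq U).restrict σ (P.diffGen n U (a.map σ)) = P.diffGen m U a := by
  have H := P.isRestriction_seq U σ
  cases a with
  | cross c h =>
    refine H.map_diskSum_after (U := U) (fun p => ?_) h
    rw [Cross.map_x]
    exact restrict_endElt σ c.x p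
  | cusp k i h =>
    refine (map_add ((P.seq U).restrict σ) _ _).trans (congrArg₂ _ (H.invisible k i) ?_)
    exact restrict_diskSumOn_sweep σ P.xR ((P.rup k, i), (P.rlow k, i))
  | pair a i j ha h =>
    rw [Gen.map, diffGen_pair, diffGen_pair]
    refine (map_sum ((P.seq U).restrict σ) _ _).trans ?_
    symm
    refine Finset.sum_of_injOn
      (fun l => ⟨mapStrand σ l.1, l.2.1.map σ, l.2.2.map σ⟩) ?_ (fun _ _ => Finset.mem_univ _) ?_ ?_
    · intro l _ l' _ hl
      exact Subtype.ext (mapStrand_injective σ (congrArg Subtype.val hl))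
    · intro l _ hl
      refine (map_zsmul ((P.seq U).restrict σ) _ _).trans ?_
      refine (congrArg (_ • ·) ((map_mul ((P.seq U).restrict σ) _ _).trans
        ((congrArg (· * _) (restrict_gen_eq_zero (S := P.seq U) ?_)).trans (zero_mul _)))).trans
        (smul_zero _)
      intro ⟨b, hb⟩
      have hr : l.1.2 ∈ Set.range σ := by
        have := congrArg (P.seq U).col hb
        rw [(P.isIndexed_seq U).col_mapR] at this
        exact ⟨_, this⟩
      obtain ⟨s, hs⟩ := hr
      have hs' : l.1 = mapStrand σ (l.1.1, s) := Prod.ext rfl hs.symm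
      refine hl ⟨⟨(l.1.1, s), ?_, ?_⟩, Finset.mem_coe.2 (Finset.mem_univ _), Subtype.ext hs'.symm⟩
      · exact Above.of_map (σ := σ) (hs' ▸ l.2.1)
      · exact Above.of_map (σ := σ) (hs' ▸ l.2.2)
    · intro l _
      symm
      refine (map_zsmul ((P.seq U).restrict σ) _ _).trans ?_
      refine (congrArg (_ • ·) (map_mul ((P.seq U).restrict σ) _ _)).trans ?_
      exact congrArg₂ (fun y z => _ • (y * z))
        ((P.isIndexed_seq U).restrict_gen σ (Gen.pair a i l.1 ha l.2.1))
        ((P.isIndexed_seq U).restrict_gen σ (Gen.pair a l.1 j ha l.2.2))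

theorem isLink_diffGen (a : P.Gen m U) :
    IsLink (P.seq U) (fun {_} b => b.1.2) ((P.seq U).row a) ((P.seq U).col a) (P.diffGen m U a) := by
  cases a with
  | cross c h => exact isLink_diskSumOn c.x _ (c.overStrand, c.underStrand)
  | cusp k i h =>
    exact (isLink_invisible isLink_baseElt k i).add
      (isLink_diskSumOn P.xR _ ((P.rup k, i), (P.rlow k, i)))
  | pair a i j ha h =>
    rw [diffGen_pair]
    exact isLink_sum _ fun l _ => isLink_sgn_smul
      (.mul (.gen (S := P.seq U) (Gen.pair a i l.1 ha l.2.1)) (.gen (S := P.seq U) (Gen.pair a l.1 j ha l.2.2))) _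

theorem isLink_coresGen {V : Opens ℝ} (h : V ≤ U) (a : P.Gen m V) :
    IsLink (P.seq U) (fun {_} b => b.1.2) ((P.seq V).row a) ((P.seq V).col a)
      (P.coresGen m h a) := by
  cases a with
  | cross c hc => exact .gen (S := P.seq U) (Gen.cross c (h hc))
  | cusp k i hk => exact .gen (S := P.seq U) (Gen.cusp k i (h hk))
  | pair a i j ha hij =>
    simp only [coresGen]
    split_ifs with haU
    · exact isLink_diskSumOn a _ (i, j)
    · exact .gen (S := P.seq U) (Gen.pair a i j (ha.mono h haU) hij)

theorem restrict_coresGen {V : Opens ℝ} (h : V ≤ U) (σ : Fin m ↪o Fin n) (a : P.Gen m V) :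
    (P.seq U).restrict σ (P.coresGen n h (a.map σ)) = P.coresGen m h a := by
  cases a with
  | cross c hc => exact (P.isIndexed_seq U).restrict_gen σ (Gen.cross c (h hc))
  | cusp k i hk => exact (P.isIndexed_seq U).restrict_gen σ (Gen.cusp k i (h hk))
  | pair a i j ha hij =>
    rw [Gen.map, coresGen, coresGen]
    split_ifs with haU
    · exact restrict_diskSumOn_sweep σ a (i, j)
    · exact (P.isIndexed_seq U).restrict_gen σ (Gen.pair a i j (ha.mono h haU) hij)

end

theorem finite_range_deg (U : Opens ℝ) : (Set.range (Gen.deg : P.Gen m U → ZMod (2 * r))).Finite := by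
  refine ((Set.finite_range fun p : (Fin P.n × Bool) × (Fin P.n × Bool) =>
    P.μ p.1 - P.μ p.2).union ((Set.finite_singleton 1).union
      (Set.finite_range fun p : (Fin P.n × Bool) × (Fin P.n × Bool) =>
        P.μ p.1 - P.μ p.2 - 1))).subset ?_
  rintro _ ⟨a, rfl⟩
  cases a with
  | cross c h => exact Or.inl ⟨(c.overStrand.1, c.underStrand.1), rfl⟩
  | cusp k i h => exact Or.inr (Or.inl rfl)
  | pair a i j ha h => exact Or.inr (Or.inr ⟨(i.1, j.1), rfl⟩)

variable (P) in
theorem isConsistent_seq (U : Opens ℝ) : (P.seq U).IsConsistent fun {_} b => b.1.2 where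
  toIsIndexed := P.isIndexed_seq U
  isDGA m := P.isDGA m U
  compatible := ⟨isLink_diffGen, restrict_diffGen⟩
  finite_deg := finite_range_deg U

variable (P) in
theorem isInducing_cores {V U : Opens ℝ} (h : V ≤ U) :
    IsInducing (P.seq U) (fun {_} b => b.1.2) (P.seq V) fun m => P.cores m h where
  isDGAHom m := isDGAHom_cores h
  compatible := by
    refine ⟨fun a => ?_, fun σ a => ?_⟩
    · exact cores_gen h a ▸ isLink_coresGen h a
    · exact (congrArg _ (cores_gen h _)).trans ((restrict_coresGen h σ a).trans (cores_gen h a).symm)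
  exists_tgen := ⟨fun m b => ⟨b.1, h b.2⟩, fun m b => cores_tgen h b, fun _ _ => rfl⟩

/-! ### The whole front -/

theorem isLink_ceDiskSum (L : List (P.Event m)) (p : P.Strand m × P.Strand m) :
    IsLink P.ceSeq (fun {_} b => b.2) p.1.2 p.2.2 (P.ceDiskSum L p) := by
  have ht : ∀ b : P.Base m, IsLink P.ceSeq (fun {_} b => b.2) b.2 b.2 (tgen b).1 ∧
      IsLink P.ceSeq (fun {_} b => b.2) b.2 b.2 (tgen b)⁻¹.1 := fun b =>
    ⟨.tgen (S := P.ceSeq) (cp := fun {_} b => b.2) b, .tinv (S := P.ceSeq) (cp := fun {_} b => b.2) b⟩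
  exact isLink_diskSum (fun c => .gen (S := P.ceSeq) (.inl c)) ht (isLink_cuspEnd ht) L p

theorem isLink_ceDiffGen (a : P.CEGen m) :
    IsLink P.ceSeq (fun {_} b => b.2) (P.ceSeq.row a) (P.ceSeq.col a) (P.ceDiffGen a) := by
  rcases a with c | ⟨k, i⟩
  · exact isLink_ceDiskSum _ (c.overStrand, c.underStrand)
  · exact (isLink_invisible (fun b => ⟨.tgen (S := P.ceSeq) (cp := fun {_} b => b.2) b,
      .tinv (S := P.ceSeq) (cp := fun {_} b => b.2) b⟩) k i).add
      (isLink_ceDiskSum _ ((P.rup k, i), (P.rlow k, i)))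

variable (P) in
theorem isRestriction_ceSeq (σ : Fin m ↪o Fin n) :
    IsRestriction (P := P) (P.ceSeq.restrict σ) σ (fun c => gen (.inl c)) tgen
      (fun c => gen (.inl c)) tgen where
  cross_map c := P.isIndexed_ceSeq.restrict_gen σ (.inl c)
  cross c hc := by
    refine restrict_gen_eq_zero (S := P.ceSeq) ?_
    rintro ⟨a, ha⟩
    rcases a with d | d
    · exact hc ⟨d, Sum.inl.inj ha⟩
    · exact absurd ha Sum.inr_ne_inl
  base b i := P.isIndexed_ceSeq.restrict_tgen σ (b, i)

theorem restrict_ceDiffGen (σ : Fin m ↪o Fin n) (a : P.CEGen m) :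
    P.ceSeq.restrict σ (P.ceDiffGen (P.ceSeq.mapR σ a)) = P.ceDiffGen a := by
  have H := P.isRestriction_ceSeq σ
  rcases a with c | ⟨k, i⟩
  · exact H.map_diskSum_after H.cuspEnd (Set.mem_univ c.x)
  · refine (map_add (P.ceSeq.restrict σ) _ _).trans (congrArg₂ _ (H.invisible k i) ?_)
    exact H.map_diskSum_sweep H.cuspEnd Set.univ P.xR ((P.rup k, i), (P.rlow k, i))

variable (P) in
theorem isConsistent_ceSeq : P.ceSeq.IsConsistent fun {_} b => b.2 where
  toIsIndexed := P.isIndexed_ceSeq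
  isDGA m := P.ce_isDGA m
  compatible := ⟨isLink_ceDiffGen, restrict_ceDiffGen⟩
  finite_deg := (finite_range_deg (P := P) (m := 2) ⊤).subset <| by
    rintro _ ⟨a, rfl⟩
    exact ⟨topGen a, topGen_deg a⟩

variable (P) in
theorem isInducing_ceToTop :
    IsInducing (P.seq ⊤) (fun {_} b => b.1.2) P.ceSeq fun m => ceToTop P m where
  isDGAHom m := ceToTop_isDGAHom
  compatible := by
    refine ⟨fun a => ?_, fun σ a => ?_⟩
    · refine (ceToTop_gen a).symm ▸ ?_
      rcases a with c | c
      · exact .gen (S := P.seq ⊤) (topGen (Sum.inl c))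
      · exact .gen (S := P.seq ⊤) (topGen (Sum.inr c))
    · refine (congrArg _ (ceToTop_gen _)).trans (Eq.trans ?_ (ceToTop_gen a).symm)
      rcases a with c | c
      · exact (P.isIndexed_seq ⊤).restrict_gen σ (topGen (Sum.inl c))
      · exact (P.isIndexed_seq ⊤).restrict_gen σ (topGen (Sum.inr c))
  exists_tgen := ⟨fun m b => ⟨b, Opens.mem_top _⟩, fun m b => lift_tgen _ _ b, fun _ _ => rfl⟩

variable (P) in
theorem isInducing_topToCE :
    IsInducing P.ceSeq (fun {_} b => b.2) (P.seq ⊤) fun m => topToCE P m where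
  isDGAHom m := topToCE_isDGAHom
  compatible := by
    refine ⟨fun a => ?_, fun σ a => ?_⟩
    · obtain ⟨a, rfl⟩ := topGen_bijective.2 a
      refine (topToCE_gen a).symm ▸ ?_
      rcases a with c | c
      · exact .gen (S := P.ceSeq) (Sum.inl c)
      · exact .gen (S := P.ceSeq) (Sum.inr c)
    · obtain ⟨a, rfl⟩ := topGen_bijective.2 a
      refine Eq.trans ?_ (topToCE_gen a).symm
      have h : (P.seq ⊤).mapR σ (topGen a) = topGen (P.ceSeq.mapR σ a) := by
        rcases a with c | c <;> rfl
      rw [h]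
      exact (congrArg _ (topToCE_gen _)).trans (P.isIndexed_ceSeq.restrict_gen σ a)
  exists_tgen := ⟨fun m b => b.1, fun m b => lift_tgen _ _ b, fun _ _ => rfl⟩

variable (P) in
/-- The two categories of the whole front are isomorphic. -/
theorem exists_augPlus_iso (k : Type u) [CommRing k] :
    ∃ (F : AInfData.Fun (P.augPlus ⊤ k) (P.ceAugPlus k))
      (G : AInfData.Fun (P.ceAugPlus k) (P.augPlus ⊤ k)),
      F.IsAInfFunctor ∧ G.IsAInfFunctor ∧
        F.comp G = AInfData.Fun.id _ ∧ G.comp F = AInfData.Fun.id _ := by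
  have H := P.isConsistent_seq ⊤
  have H' := P.isConsistent_ceSeq
  have hF := P.isInducing_ceToTop
  have hG := P.isInducing_topToCE
  refine ⟨augPlusMap k _ (hF.isDGAHom 1), augPlusMap k _ (hG.isDGAHom 1),
    hF.isAInfFunctor H H' k, hG.isAInfFunctor H' H k, ?_, ?_⟩
  · exact (hF.augPlusMap_comp H H'.toIsIndexed H.toIsIndexed hG (IsInducing.id H.toIsIndexed)
      (fun m => ceToTop_comp_topToCE) k).trans
      (augPlusMap_eq_id (IsInducing.id H.toIsIndexed) H.toIsIndexed (fun _ => rfl) k)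
  · exact (hG.augPlusMap_comp H' H.toIsIndexed H'.toIsIndexed hF (IsInducing.id H'.toIsIndexed)
      (fun m => topToCE_comp_ceToTop) k).trans
      (augPlusMap_eq_id (IsInducing.id H'.toIsIndexed) H'.toIsIndexed (fun _ => rfl) k)

end PreferredPlat

end

theorem mainTheorem5 (r : ℕ) (Λ : Set (ℝ × ℝ × ℝ)) (P : PreferredPlat r Λ) :
    ∃ (hΛ : IsDGA (P.ceGr 1) (P.ceDiff 1)) (H : ∀ m : ℕ, P.IsDGAPrecosheaf m),
      IsCosheaf (H 1).functor ∧
      IsCosheaf ((H 1).functor ⋙ DGA.toGrRing r) ∧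
      IsConstructibleCosheaf (H 1).functor ∧
      Nonempty ((H 1).functor.obj ⊤ ≅ DGA.mk _ (P.ceGr 1) (P.ceDiff 1) hΛ) ∧
      (∀ U : Opens ℝ, IsSemifreeOn ((H 1).functor.obj U) (P.Gen 1 U) (P.BaseOn 1 U) ∧
        (_root_.IsPreconnected (U : Set ℝ) → Finite (P.Gen 1 U) ∧ Finite (P.BaseOn 1 U))) ∧
      (∀ L R : Opens ℝ,
        IsPushout ((H 1).functor.map (homOfLE (inf_le_left : L ⊓ R ≤ L)))
          ((H 1).functor.map (homOfLE (inf_le_right : L ⊓ R ≤ R)))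
          ((H 1).functor.map (homOfLE (le_sup_left : L ≤ L ⊔ R)))
          ((H 1).functor.map (homOfLE (le_sup_right : R ≤ L ⊔ R)))) ∧
      ∀ (k : Type u) [CommRing k],
        Presheaf.IsSheaf (Opens.grothendieckTopology ℝ) (augPresheaf (H 1).functor k) ∧
        (∀ U : Opens ℝ, (P.augPlus U k).IsAInfCat) ∧
        (∀ (V U : Opens ℝ) (h : V ≤ U), ((H 1).res k h).IsAInfFunctor) ∧
        (∀ U : Opens ℝ, (H 1).res k (le_refl U) = AInfData.Fun.id (P.augPlus U k)) ∧
        (∀ (W V U : Opens ℝ) (h : W ≤ V) (h' : V ≤ U),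
          ((H 1).res k h').comp ((H 1).res k h) = (H 1).res k (h.trans h')) ∧
        ∃ (F : AInfData.Fun (P.augPlus ⊤ k) (P.ceAugPlus k))
          (G : AInfData.Fun (P.ceAugPlus k) (P.augPlus ⊤ k)),
          F.IsAInfFunctor ∧ G.IsAInfFunctor ∧
            F.comp G = AInfData.Fun.id _ ∧ G.comp F = AInfData.Fun.id _ := by
  refine ⟨P.ce_isDGA 1, P.isDGAPrecosheaf, PreferredPlat.isCosheaf _,
    PreferredPlat.isCosheaf_grRing _, PreferredPlat.isConstructibleCosheaf _,
    PreferredPlat.nonempty_iso _ _, fun U => ⟨PreferredPlat.isSemifreeOn _ U,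
      fun hU => ⟨PreferredPlat.finite_gen hU, inferInstance⟩⟩,
    fun L R => PreferredPlat.isPushout _ L R, fun k _ => ⟨PreferredPlat.isSheaf_augPresheaf _ k,
      fun U => (P.isConsistent_seq U).isAInfCat k, fun V U h => ?_, fun U => ?_,
      fun W V U h h' => ?_, P.exists_augPlus_iso k⟩⟩
  · exact (P.isInducing_cores h).isAInfFunctor (P.isConsistent_seq U) (P.isConsistent_seq V) k
  · exact DGASeq.augPlusMap_eq_id (P.isInducing_cores le_rfl) (P.isIndexed_seq U)
      (fun m => PreferredPlat.cores_refl U) k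
  · exact (P.isInducing_cores h').augPlusMap_comp (P.isConsistent_seq U) (P.isIndexed_seq V)
      (P.isIndexed_seq W) (P.isInducing_cores h) (P.isInducing_cores (h.trans h'))
      (fun m => PreferredPlat.cores_comp h h') k
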